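/- \textbf{Setting.} Let $M$ be a smooth (Hausdorff, $\sigma$-compact) manifold of dimension $n$, $[g,a]$ a Weyl class on $M$ (pairs of a smooth metric of signature $(p,q)$ and a smooth one-form, modulo $(g,a)\sim(\mathcal B^{-2}g,\,a-\mathrm d\ln\mathcal B)$, $\mathcal B>0$), and $(g,a)$ a representative. The principal $\mathbb R_+$-bundle $\mathcal P_W$ of the Weyl manifold is trivialized by $g$: a point is $(t,x)$, $t>0$, $x\in M$ (corresponding to $t^2g_x$). On $\mathcal P_W\times\mathbb R\ni(t,x,\rho)$ the dilatations are $\delta_s(t,x,\rho)=(st,x,\rho)$. A \emph{Weyl-ambient space} is a pair $(\tilde M,\tilde g)$ where $\tilde M$ is a dilatation-invariant open neighbourhood of $\mathcal P_W\times\{0\}$ in $\mathcal P_W\times\mathbb R$, $\tilde g$ is a smooth metric on $\tilde M$ of signature $(p+1,q+1)$ with $\delta_s^*\tilde g=s^2\tilde g$ for all $s>0$, the pullback of $\tilde g$ to $\mathcal P_W\times\{0\}$ is the tautological tensor $\mathbf g_0=t^2\pi^*g$, and $\mathrm{Ric}(\tilde g)$ vanishes to infinite order at every point of $\mathcal P_W\times\{0\}$.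 Let $\varphi(x,\rho)=\varphi_i(x,\rho)\,\mathrm dx^i$ be a smooth family of one-forms on $M$, given on an open neighbourhood $O$ of $M\times\{0\}$ in $M\times\mathbb R$. $(\tilde M,\tilde g)$ is in \emph{Weyl-normal form with acceleration} $\mathcal A=t^2\varphi$ if: $\tilde M$ lies over $O$, and for every $p\in\mathcal P_W$ the set of $\rho$ with $(p,\rho)\in\tilde M$ is an open interval containing $0$; the acceleration $\underline{\mathcal A}=\tilde\nabla_{\partial_\rho}\partial_\rho$ of the curves $\rho\mapsto(p,\rho)$ satisfies $\tilde g(t\partial_t,\underline{\mathcal A})=0$, $\tilde g(\partial_\rho,\underline{\mathcal A})=0$ and $\tilde g(\partial_i,\underline{\mathcal A})=t^2\varphi_i(x,\rho)$ on $\tilde M$; and $\tilde g|_{\rho=0}=\mathbf g_0+2t^2(t^{-1}\mathrm dt+a_i\,\mathrm dx^i)\,\mathrm d\rho$. \emph{Formal dimension.} For a real or complex number $d$, the manifold $M$ is given the formal dimension $d$ by regarding it as $M\times\mathbb R^{d-n}$ with metric $g+\delta$, $\delta$ flat, where $a$ and $\varphi$ have no components along $\delta$ (so that every trace $\delta^i{}_i$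 equals $d$). A \emph{Weyl-ambient space of formal dimension $d+2$} is $(\tilde M,\tilde g+f^2\delta)$ with $\tilde M$ as above, $\tilde g$ a smooth nondegenerate symmetric field of bilinear forms and $f$ a smooth nowhere zero function on $\tilde M$ (with values in $\mathbb R$ or $\mathbb C$, as $d$), $\delta_s^*\tilde g=s^2\tilde g$, $\delta_s^*f=sf$, $\tilde g$ pulling back to $\mathbf g_0$ on $\mathcal P_W\times\{0\}$ and $f|_{\rho=0}=t$, whose Ricci tensor vanishes to infinite order at every point of $\mathcal P_W\times\{0\}$, that is, both $$\mathrm{Ric}(\tilde g)-(d-n)f^{-1}\tilde\nabla^2f\qquad\text{and}\qquad f\,\tilde\Delta f+(d-n-1)\,|\tilde\nabla f|^2$$ do so. Weyl-normal form refers to $\tilde g$ as before. \textbf{Theorem.} Let $(g,a)$ and $\varphi$ be as above. (1) Suppose that $n$ is odd and $n\ge3$. (A) There is a Weyl-ambient space $(\tilde M,\tilde g)$ for $(M,[g,a])$ that is in Weyl-normal form with acceleration $\mathcal A=t^2\varphi$. (B) If $(\tilde M_1,\tilde g_1)$ and $(\tilde M_2,\tilde g_2)$ are two such spaces, with the same $\mathcal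 A$, then $\tilde g_1-\tilde g_2$ vanishes to infinite order at every point of $\mathcal P_W\times\{0\}$. (2) Let $n$ be arbitrary and let $d$ be a real or complex number with $d\ne1$ and $d\notin\{0,2,4,6,\dots\}$. (A) There is a Weyl-ambient space of formal dimension $d+2$ that is in Weyl-normal form with acceleration $\mathcal A=t^2\varphi$. (B) For two such spaces $(\tilde M_1,\tilde g_1+f_1^2\delta)$ and $(\tilde M_2,\tilde g_2+f_2^2\delta)$, with the same $\mathcal A$, both $\tilde g_1-\tilde g_2$ and $f_1-f_2$ vanish to infinite order at every point of $\mathcal P_W\times\{0\}$. -/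

import Mathlib

open scoped Manifold ContDiff

noncomputable section

namespace WeylAmbient

/-! ### Tensor calculus in ambient coordinates `(t, x, ρ)` -/

/-- The model space of an `n`-dimensional manifold. -/
abbrev Model (n : ℕ) : Type := EuclideanSpace ℝ (Fin n)

/-- Ambient indices `0, i, ∞`: the `t`-component, the components along `M`, the `ρ`-component. -/
abbrev Idx (n : ℕ) : Type := Unit ⊕ Fin n ⊕ Unit

/-- The index `0` of the coordinate `t`. -/
abbrev idx0 (n : ℕ) : Idx n := Sum.inl ()

/-- The index `i` of the coordinate `xⁱ`. -/
abbrev idxM {n : ℕ} (i : Fin n) : Idx n := Sum.inr (Sum.inl i)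

/-- The index `∞` of the coordinate `ρ`. -/
abbrev idxInf (n : ℕ) : Idx n := Sum.inr (Sum.inr ())

/-- Ambient coordinates `(t, x, ρ)`. -/
abbrev Coord (n : ℕ) : Type := ℝ × Model n × ℝ

/-- The coordinate vectors of `ℝ × ℝⁿ × ℝ`. -/
def basisVec {n : ℕ} : Idx n → Coord n
  | Sum.inl _ => (1, 0, 0)
  | Sum.inr (Sum.inl i) => (0, EuclideanSpace.single i 1, 0)
  | Sum.inr (Sum.inr _) => (0, 0, 1)

section Calculus

variable {n : ℕ} {𝕜 : Type*} [RCLike 𝕜]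

/-- The partial derivative `∂_I F`. -/
def pd (I : Idx n) (F : Coord n → 𝕜) (z : Coord n) : 𝕜 := fderiv ℝ F z (basisVec I)

/-- The Christoffel symbol `Γ^K_{IJ}` of the metric with components `G`. -/
def christoffel (G : Coord n → Matrix (Idx n) (Idx n) 𝕜) (K I J : Idx n) (z : Coord n) : 𝕜 :=
  (1 / 2) * ∑ L, (G z)⁻¹ K L *
    (pd I (fun w => G w J L) z + pd J (fun w => G w I L) z - pd L (fun w => G w I J) z)

/-- The Ricci tensor
`R_{IJ} = ∂_K Γ^K_{IJ} - ∂_J Γ^K_{IK} + Γ^K_{KL} Γ^L_{IJ} - Γ^K_{JL} Γ^L_{IK}`. -/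
def ricci (G : Coord n → Matrix (Idx n) (Idx n) 𝕜) (I J : Idx n) (z : Coord n) : 𝕜 :=
  (∑ K, pd K (christoffel G K I J) z) - (∑ K, pd J (christoffel G K I K) z)
    + (∑ K, ∑ L, christoffel G K K L z * christoffel G L I J z)
    - (∑ K, ∑ L, christoffel G K J L z * christoffel G L I K z)

/-- The covariant Hessian `∇_I ∇_J f`. -/
def hess (G : Coord n → Matrix (Idx n) (Idx n) 𝕜) (f : Coord n → 𝕜) (I J : Idx n)
    (z : Coord n) : 𝕜 :=
  pd I (pd J f) z - ∑ K, christoffel G K I J z * pd K f z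

/-- The Laplacian `g^{IJ} ∇_I ∇_J f`. -/
def laplacian (G : Coord n → Matrix (Idx n) (Idx n) 𝕜) (f : Coord n → 𝕜) (z : Coord n) : 𝕜 :=
  ∑ I, ∑ J, (G z)⁻¹ I J * hess G f I J z

/-- The squared gradient `g^{IJ} ∂_I f ∂_J f`. -/
def gradSq (G : Coord n → Matrix (Idx n) (Idx n) 𝕜) (f : Coord n → 𝕜) (z : Coord n) : 𝕜 :=
  ∑ I, ∑ J, (G z)⁻¹ I J * (pd I f z * pd J f z)

/-- The components `𝒜^K` of the acceleration `𝒜 = ∇_𝒰 𝒰` of the curves `ρ ↦ (t, x, ρ)`, whose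
tangent vector is `𝒰 = ∂_ρ`. -/
def accel (G : Coord n → Matrix (Idx n) (Idx n) 𝕜) (K : Idx n) (z : Coord n) : 𝕜 :=
  christoffel G K (idxInf n) (idxInf n) z

/-- The components `𝒜_I = g(∂_I, 𝒜)` of the acceleration covector. -/
def accelLow (G : Coord n → Matrix (Idx n) (Idx n) 𝕜) (I : Idx n) (z : Coord n) : 𝕜 :=
  ∑ K, G z I K * accel G K z

/-- All derivatives of `F`, of all orders (including `0`), vanish at `z`. -/
def VanishesToInfiniteOrder (F : Coord n → 𝕜) (z : Coord n) : Prop :=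
  ∀ k : ℕ, iteratedFDeriv ℝ k F z = 0

/-- A metric `g̃ + f² δ` of formal dimension `d + 2`, where `g̃` lives in the `n + 2` ambient
coordinates, `δ` is the flat metric of formal dimension `d - n` and `f` depends on the ambient
coordinates only. This is its Ricci tensor in the ambient directions. -/
def formalRicci (d : 𝕜) (G : Coord n → Matrix (Idx n) (Idx n) 𝕜) (f : Coord n → 𝕜)
    (I J : Idx n) (z : Coord n) : 𝕜 :=
  ricci G I J z - (d - n) * (f z)⁻¹ * hess G f I J z

/-- The Ricci tensor of `g̃ + f² δ` in the flat directions is this multiple of `δ`. -/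
def formalRicciFlat (d : 𝕜) (G : Coord n → Matrix (Idx n) (Idx n) 𝕜) (f : Coord n → 𝕜)
    (z : Coord n) : 𝕜 :=
  -(f z * laplacian G f z + (d - n - 1) * gradSq G f z)

end Calculus

/-! ### Weyl manifolds -/

/-- A symmetric bilinear form of signature `(p, q)`; in particular it is nondegenerate. -/
structure HasSignature {V : Type*} [AddCommGroup V] [Module ℝ V] (B : V →ₗ[ℝ] V →ₗ[ℝ] ℝ)
    (p q : ℕ) : Prop where
  symm : ∀ v w, B v w = B w v
  finrank_eq : Module.finrank ℝ V = p + q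
  pos : sigPos (LinearMap.BilinMap.toQuadraticMap B) = p
  neg : sigNeg (LinearMap.BilinMap.toQuadraticMap B) = q

/-- The tangent space `T_x M`. -/
abbrev Tan (n : ℕ) {M : Type*} [TopologicalSpace M] [ChartedSpace (Model n) M] (x : M) : Type :=
  TangentSpace 𝓘(ℝ, Model n) x

section Manifold

variable {n : ℕ} {M : Type*} [TopologicalSpace M] [ChartedSpace (Model n) M]

/-- The smooth charts of `M`. -/
def charts (n : ℕ) (M : Type*) [TopologicalSpace M] [ChartedSpace (Model n) M] :
    Set (OpenPartialHomeomorph M (Model n)) :=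
  IsManifold.maximalAtlas 𝓘(ℝ, Model n) ∞ M

/-- The coordinate vector `∂_i` of the chart `φ` at the point with coordinates `y`. -/
def coordVec (φ : OpenPartialHomeomorph M (Model n)) (y : Model n) (i : Fin n) :
    Tan n (φ.symm y) :=
  mfderiv 𝓘(ℝ, Model n) 𝓘(ℝ, Model n) φ.symm y (EuclideanSpace.single i 1 : Model n)

end Manifold

/-- A representative `(g, a)` of a Weyl class on `M`: a smooth metric `g` of signature `(p, q)` and
a smooth one-form `a`. Its Weyl class consists of the pairs `(B⁻² g, a - d ln B)` with `B` a
positive smooth function. -/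
structure WeylRep (n : ℕ) (M : Type*) [TopologicalSpace M] [ChartedSpace (Model n) M]
    (p q : ℕ) where
  /-- the metric -/
  g : ∀ x : M, Tan n x →ₗ[ℝ] Tan n x →ₗ[ℝ] ℝ
  /-- the Weyl connection -/
  a : ∀ x : M, Tan n x →ₗ[ℝ] ℝ
  signature : ∀ x, HasSignature (g x) p q
  smooth_g : ∀ φ ∈ charts n M, ∀ i j : Fin n,
    ContDiffOn ℝ ∞ (fun y => g (φ.symm y) (coordVec φ y i) (coordVec φ y j)) φ.target
  smooth_a : ∀ φ ∈ charts n M, ∀ i : Fin n,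
    ContDiffOn ℝ ∞ (fun y => a (φ.symm y) (coordVec φ y i)) φ.target

/-- A prescribed acceleration: a smooth family `ρ ↦ ϕ(x, ρ)` of one-forms on `M`, given on an open
neighbourhood of `M × {0}` in `M × ℝ`. The acceleration covector that it prescribes
is `𝒜 = t² ϕ_i(x, ρ) dxⁱ`. -/
structure Acceleration (n : ℕ) (M : Type*) [TopologicalSpace M] [ChartedSpace (Model n) M] where
  /-- where the family is given -/
  dom : Set (M × ℝ)
  isOpen_dom : IsOpen dom
  zero_mem : ∀ x, (x, 0) ∈ dom
  /-- the family of one-forms -/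
  form : ∀ x : M, ℝ → Tan n x →ₗ[ℝ] ℝ
  smooth : ∀ φ ∈ charts n M, ∀ i : Fin n,
    ContDiffOn ℝ ∞ (fun w : Model n × ℝ => form (φ.symm w.1) w.2 (coordVec φ w.1 i))
      {w | w.1 ∈ φ.target ∧ (φ.symm w.1, w.2) ∈ dom}

/-! ### Ambient spaces

The representative `g` trivializes the principal `ℝ₊`-bundle `𝒫` of the Weyl manifold (the point
`t² g_x` of the metric bundle is identified with `(t, x)`), so that `𝒫 × ℝ` is the set of all
`(t, x, ρ) ∈ ℝ × M × ℝ` with `t > 0`, and the dilatations are `δ_s (t, x, ρ) = (s t, x, ρ)`. -/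

section Ambient

variable {n : ℕ} {M : Type*} [TopologicalSpace M] [ChartedSpace (Model n) M]

/-- The tangent space of `ℝ × M × ℝ`. -/
abbrev AmbTan (n : ℕ) {M : Type*} [TopologicalSpace M] [ChartedSpace (Model n) M]
    (z : ℝ × M × ℝ) : Type :=
  ℝ × Tan n z.2.1 × ℝ

/-- Fields of bilinear forms on `ℝ × M × ℝ` (only their values on the ambient domain matter). -/
abbrev AmbForm (𝕜 : Type*) [RCLike 𝕜] (n : ℕ) (M : Type*) [TopologicalSpace M]
    [ChartedSpace (Model n) M] : Type _ :=
  ∀ z : ℝ × M × ℝ, AmbTan n z →ₗ[ℝ] AmbTan n z →ₗ[ℝ] 𝕜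

/-- Dilatation-invariant open neighbourhoods of `𝒫 × {0}` in `𝒫 × ℝ`. -/
structure IsAmbientDomain (D : Set (ℝ × M × ℝ)) : Prop where
  isOpen : IsOpen D
  pos : ∀ z ∈ D, 0 < z.1
  zero_mem : ∀ t : ℝ, 0 < t → ∀ x : M, (t, x, 0) ∈ D
  dilatation : ∀ s : ℝ, 0 < s → ∀ z ∈ D, (s * z.1, z.2) ∈ D

/-- The point of `ℝ × M × ℝ` with ambient coordinates `z` with respect to the chart `φ`. -/
def ambPoint (φ : OpenPartialHomeomorph M (Model n)) (z : Coord n) : ℝ × M × ℝ :=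
  (z.1, φ.symm z.2.1, z.2.2)

/-- The coordinate vectors `∂_t, ∂_i, ∂_ρ`. -/
def ambVec (φ : OpenPartialHomeomorph M (Model n)) (z : Coord n) :
    Idx n → AmbTan n (ambPoint φ z)
  | Sum.inl _ => (1, 0, 0)
  | Sum.inr (Sum.inl i) => (0, coordVec φ z.2.1 i, 0)
  | Sum.inr (Sum.inr _) => (0, 0, 1)

/-- The ambient coordinates of the points of `D` over the domain of the chart `φ`. -/
def chartDomain (φ : OpenPartialHomeomorph M (Model n)) (D : Set (ℝ × M × ℝ)) :
    Set (Coord n) :=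
  {z | z.2.1 ∈ φ.target ∧ ambPoint φ z ∈ D}

variable {𝕜 : Type*} [RCLike 𝕜]

/-- The components `G_{IJ}` in the ambient coordinates of the chart `φ`. -/
def comps (φ : OpenPartialHomeomorph M (Model n)) (G : AmbForm 𝕜 n M) (z : Coord n) :
    Matrix (Idx n) (Idx n) 𝕜 :=
  Matrix.of fun I J => G (ambPoint φ z) (ambVec φ z I) (ambVec φ z J)

/-- Smoothness on `D`. -/
def SmoothOn (D : Set (ℝ × M × ℝ)) (G : AmbForm 𝕜 n M) : Prop :=
  ∀ φ ∈ charts n M, ∀ I J, ContDiffOn ℝ ∞ (fun z => comps φ G z I J) (chartDomain φ D)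

/-- Homogeneity of degree `2` on `D`, that is, `δ_s^* G = s² G` for all `s > 0`. -/
def HomogeneousOn (D : Set (ℝ × M × ℝ)) (G : AmbForm 𝕜 n M) : Prop :=
  ∀ s : ℝ, 0 < s → ∀ (t : ℝ) (x : M) (ρ : ℝ), (t, x, ρ) ∈ D →
    ∀ (τ τ' σ σ' : ℝ) (v v' : Tan n x),
      G (s * t, x, ρ) (s * τ, v, σ) (s * τ', v', σ') =
        (s : 𝕜) ^ 2 * G (t, x, ρ) (τ, v, σ) (τ', v', σ')

variable {p q : ℕ}

/-- The pullback of `G` to `𝒫 × {0}` is the tautological tensor `t² π^* g`. -/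
def RestrictsToTautological (r : WeylRep n M p q) (G : AmbForm 𝕜 n M) : Prop :=
  ∀ t : ℝ, 0 < t → ∀ (x : M) (τ τ' : ℝ) (v v' : Tan n x),
    G (t, x, 0) (τ, v, 0) (τ', v', 0) = ((t ^ 2 * r.g x v v' : ℝ) : 𝕜)

/-- `(D, G)` is a Weyl pre-ambient space. -/
structure IsWeylPreAmbient (r : WeylRep n M p q) (D : Set (ℝ × M × ℝ)) (G : AmbForm ℝ n M) :
    Prop where
  domain : IsAmbientDomain D
  tautological : RestrictsToTautological r G
  smooth : SmoothOn D G
  signature : ∀ z ∈ D, HasSignature (G z) (p + 1) (q + 1)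
  homogeneous : HomogeneousOn D G

/-- `(D, G)` is a Weyl-ambient space: a Weyl pre-ambient space whose Ricci tensor vanishes to
infinite order at every point of `𝒫 × {0}`. -/
structure IsWeylAmbient (r : WeylRep n M p q) (D : Set (ℝ × M × ℝ)) (G : AmbForm ℝ n M) : Prop
    extends IsWeylPreAmbient r D G where
  ricciFlat : ∀ φ ∈ charts n M, ∀ t : ℝ, 0 < t → ∀ y ∈ φ.target, ∀ I J,
    VanishesToInfiniteOrder (ricci (comps φ G) I J) (t, y, 0)

/-- `(D, G)` is in Weyl-normal form, relative to the representative `(g, a)`, with the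
acceleration prescribed by `A`. -/
structure IsWeylNormal (r : WeylRep n M p q) (A : Acceleration n M) (D : Set (ℝ × M × ℝ))
    (G : AmbForm 𝕜 n M) : Prop where
  interval : ∀ t : ℝ, 0 < t → ∀ x : M, {ρ : ℝ | (t, x, ρ) ∈ D}.OrdConnected
  domain_subset : ∀ z ∈ D, z.2 ∈ A.dom
  /-- `𝒜` is orthogonal to the generator `𝒯 = t ∂_t` of the dilatations. -/
  accel_T : ∀ φ ∈ charts n M, ∀ z ∈ chartDomain φ D,
    (z.1 : 𝕜) * accelLow (comps φ G) (idx0 n) z = 0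
  /-- `𝒜` is orthogonal to `𝒰 = ∂_ρ`. -/
  accel_U : ∀ φ ∈ charts n M, ∀ z ∈ chartDomain φ D,
    accelLow (comps φ G) (idxInf n) z = 0
  /-- The remaining components of `𝒜` are `t² ϕ_i(x, ρ)`. -/
  accel_M : ∀ φ ∈ charts n M, ∀ z ∈ chartDomain φ D, ∀ i : Fin n,
    accelLow (comps φ G) (idxM i) z =
      ((z.1 ^ 2 * A.form (φ.symm z.2.1) z.2.2 (coordVec φ z.2.1 i) : ℝ) : 𝕜)
  /-- At `ρ = 0` the metric is `t² g + 2 t² (t⁻¹ dt + a) dρ`. -/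
  initial : ∀ t : ℝ, 0 < t → ∀ (x : M) (τ τ' σ σ' : ℝ) (v v' : Tan n x),
    G (t, x, 0) (τ, v, σ) (τ', v', σ') =
      ((t ^ 2 * r.g x v v' +
        t ^ 2 * ((t⁻¹ * τ + r.a x v) * σ' + (t⁻¹ * τ' + r.a x v') * σ) : ℝ) : 𝕜)

/-- The difference of `G₁` and `G₂` vanishes to infinite order at every point of `𝒫 × {0}`. -/
def AgreeToInfiniteOrder (G₁ G₂ : AmbForm 𝕜 n M) : Prop :=
  ∀ φ ∈ charts n M, ∀ t : ℝ, 0 < t → ∀ y ∈ φ.target, ∀ I J,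
    VanishesToInfiniteOrder (fun z => comps φ G₁ z I J - comps φ G₂ z I J) (t, y, 0)

/-! ### Formal dimension

For a scalar `d`, the manifold `M` is given the formal dimension `d` by regarding it as `M × ℝ^{d-n}`
with metric `g + δ`, where `δ` is flat and the one-forms `a` and `ϕ(·, ρ)` have no components along
`δ`; thus every trace `δ^i_i` takes the value `d`. An ambient metric then is `G + f² δ` with `G`
and `f` independent of the flat directions. When `d - n` is a positive integer, these are the usual
notions for metrics of this kind on the manifold `M × ℝ^{d-n}`; in general `d` enters only as
a coefficient in the Ricci tensor. The metric takes values in `ℝ` or `ℂ`, as `d` does. -/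

/-- `(D, G + f² δ)` is a Weyl-ambient space of formal dimension `d + 2`. -/
structure IsFormalWeylAmbient (r : WeylRep n M p q) (d : 𝕜) (D : Set (ℝ × M × ℝ))
    (G : AmbForm 𝕜 n M) (f : ℝ × M × ℝ → 𝕜) : Prop where
  domain : IsAmbientDomain D
  tautological : RestrictsToTautological r G
  tautological_flat : ∀ t : ℝ, 0 < t → ∀ x : M, f (t, x, 0) = (t : 𝕜)
  smooth : SmoothOn D G
  smooth_flat : ∀ φ ∈ charts n M, ContDiffOn ℝ ∞ (fun z => f (ambPoint φ z)) (chartDomain φ D)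
  symm : ∀ z ∈ D, ∀ v w, G z v w = G z w v
  nondegenerate : ∀ φ ∈ charts n M, ∀ z ∈ chartDomain φ D, (comps φ G z).det ≠ 0
  nondegenerate_flat : ∀ z ∈ D, f z ≠ 0
  homogeneous : HomogeneousOn D G
  homogeneous_flat : ∀ s : ℝ, 0 < s → ∀ z ∈ D, f (s * z.1, z.2) = (s : 𝕜) * f z
  ricciFlat : ∀ φ ∈ charts n M, ∀ t : ℝ, 0 < t → ∀ y ∈ φ.target, ∀ I J,
    VanishesToInfiniteOrder
      (formalRicci d (comps φ G) (fun z => f (ambPoint φ z)) I J) (t, y, 0)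
  ricciFlat_flat : ∀ φ ∈ charts n M, ∀ t : ℝ, 0 < t → ∀ y ∈ φ.target,
    VanishesToInfiniteOrder
      (formalRicciFlat d (comps φ G) (fun z => f (ambPoint φ z))) (t, y, 0)

/-- The difference of `f₁` and `f₂` vanishes to infinite order at every point of `𝒫 × {0}`. -/
def AgreeToInfiniteOrderFlat (f₁ f₂ : ℝ × M × ℝ → 𝕜) : Prop :=
  ∀ φ ∈ charts n M, ∀ t : ℝ, 0 < t → ∀ y ∈ φ.target,
    VanishesToInfiniteOrder (fun z => f₁ (ambPoint φ z) - f₂ (ambPoint φ z)) (t, y, 0)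

end Ambient

end WeylAmbient

end

open scoped Manifold ContDiff

noncomputable section

namespace WeylAmbient

set_option linter.unusedSectionVars false

open PowerSeries TopologicalSpace

open Finset (sum_congr mul_sum sum_comm sum_mul sum_const_zero sum_add_distrib sum_sub_distrib
  sum_neg_distrib sum_eq_zero dvd_sum)

section

/-- Square matrices with ambient indices. -/
abbrev AmbMat (n : ℕ) (R : Type*) : Type _ := Matrix (Idx n) (Idx n) R

/-- Square matrices with indices along `M`. -/
abbrev BaseMat (n : ℕ) (R : Type*) : Type _ := Matrix (Fin n) (Fin n) R

/-- Charts of `M`. -/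
abbrev Chart (n : ℕ) (M : Type*) [TopologicalSpace M] : Type _ := OpenPartialHomeomorph M (Model n)

lemma sum_congr₂ {ι κ R : Type*} [AddCommMonoid R] {s : Finset ι} {t : Finset κ} {f g : ι → κ → R}
    (h : ∀ i j, f i j = g i j) : ∑ i ∈ s, ∑ j ∈ t, f i j = ∑ i ∈ s, ∑ j ∈ t, g i j :=
  sum_congr rfl fun i _ => sum_congr rfl fun j _ => h i j

lemma sum_swap {ι κ R : Type*} [AddCommMonoid R] {s : Finset ι} {t : Finset κ} {f : ι → κ → R}
    {g : κ → ι → R} (h : ∀ j i, f i j = g j i) : ∑ i ∈ s, ∑ j ∈ t, f i j = ∑ j ∈ t, ∑ i ∈ s, g j i :=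
  sum_comm.trans (sum_congr₂ h)

/-! ### Levi-Civita symbols with respect to commuting derivations -/

section LeviCivita

variable {𝕜 R ι : Type*} [CommRing 𝕜] [CommRing R] [Algebra 𝕜 R] [Fintype ι]

/-- `Γ I K J` is the Levi-Civita symbol `Γ^K_{IJ}` of the metric `G` in the frame `D`. -/
structure IsLC (D : ι → Derivation 𝕜 R R) (G : Matrix ι ι R) (Γ : ι → Matrix ι ι R) : Prop where
  symm : ∀ I J, G I J = G J I
  torsion : ∀ I K J, Γ I K J = Γ J K I
  compat : ∀ M I J, D M (G I J) = ∑ L, (Γ M L I * G L J + Γ M L J * G L I)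

/-- The frame `D` commutes. -/
def Commutes (D : ι → Derivation 𝕜 R R) : Prop := ∀ I J x, D I (D J x) = D J (D I x)

/-- The curvature `R^K_{L I J}`, as the matrix in `(K, L)`. -/
def curv (D : ι → Derivation 𝕜 R R) (Γ : ι → Matrix ι ι R) (I J : ι) : Matrix ι ι R :=
  (Γ J).map (D I) - (Γ I).map (D J) + Γ I * Γ J - Γ J * Γ I

/-- The Ricci tensor of the symbols `Γ`. -/
def ric (D : ι → Derivation 𝕜 R R) (Γ : ι → Matrix ι ι R) (I J : ι) : R :=
  (∑ K, D K (Γ I K J)) - (∑ K, D J (Γ I K K)) + (∑ K, ∑ L, Γ K K L * Γ I L J)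
    - ∑ K, ∑ L, Γ J K L * Γ I L K

/-- The covariant Hessian. -/
def hes (D : ι → Derivation 𝕜 R R) (Γ : ι → Matrix ι ι R) (f : R) (I J : ι) : R :=
  D I (D J f) - ∑ K, Γ I K J * D K f

/-- The covariant derivative `∇_M T_{IJ}`. -/
def cov (D : ι → Derivation 𝕜 R R) (Γ : ι → Matrix ι ι R) (T : ι → ι → R) (M I J : ι) : R :=
  D M (T I J) - ∑ L, Γ M L I * T L J - ∑ L, Γ M L J * T I L

/-- The squared gradient. -/
def grad2 (D : ι → Derivation 𝕜 R R) (Gi : Matrix ι ι R) (f : R) : R :=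
  ∑ I, ∑ J, Gi I J * (D I f * D J f)

/-- The trace of a bilinear form. -/
def trc (Gi : Matrix ι ι R) (T : ι → ι → R) : R := ∑ I, ∑ J, Gi I J * T I J

variable {D : ι → Derivation 𝕜 R R} {G Gi : Matrix ι ι R} {Γ : ι → Matrix ι ι R}

lemma map_derivation_mul (d : Derivation 𝕜 R R) (X Y : Matrix ι ι R) :
    (X * Y).map d = X.map d * Y + X * Y.map d := by
  ext i j
  simp only [Matrix.map_apply, Matrix.mul_apply, map_sum, Derivation.leibniz, smul_eq_mul,
    Matrix.add_apply, ← sum_add_distrib]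
  exact sum_congr rfl fun _ _ => by ring

lemma map_derivation_add (d : Derivation 𝕜 R R) (X Y : Matrix ι ι R) :
    (X + Y).map d = X.map d + Y.map d := by ext i j; simp

lemma map_derivation_sub (d : Derivation 𝕜 R R) (X Y : Matrix ι ι R) :
    (X - Y).map d = X.map d - Y.map d := by ext i j; simp

lemma map_derivation_comm (hD : Commutes D) (I J : ι) (X : Matrix ι ι R) :
    (X.map (D J)).map (D I) = (X.map (D I)).map (D J) := by
  ext i j; simp [hD I J]

lemma map_derivation_one [DecidableEq ι] (d : Derivation 𝕜 R R) :
    (1 : Matrix ι ι R).map d = 0 := by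
  ext i j; by_cases h : i = j <;> simp [h]

lemma IsLC.compat_matrix (h : IsLC D G Γ) (M : ι) :
    G.map (D M) = (Γ M).transpose * G + G * Γ M := by
  ext I J
  simp only [Matrix.map_apply, h.compat, sum_add_distrib, Matrix.add_apply,
    Matrix.mul_apply, Matrix.transpose_apply]
  congr 1
  exact sum_congr rfl fun L _ => by rw [h.symm L I]; ring

lemma IsLC.transpose_G (h : IsLC D G Γ) : G.transpose = G := by
  ext I J; exact h.symm J I

section Inverse
variable [DecidableEq ι]

lemma IsLC.symm_inv (h : IsLC D G Γ) (hG : G * Gi = 1) : Gi.transpose = Gi := by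
  have h1 : Gi.transpose * G = 1 := by
    rw [← h.transpose_G, ← Matrix.transpose_mul, hG, Matrix.transpose_one]
  calc Gi.transpose = Gi.transpose * (G * Gi) := by rw [hG, mul_one]
    _ = Gi := by rw [← mul_assoc, h1, one_mul]

lemma IsLC.compat_inv (h : IsLC D G Γ) (hG : G * Gi = 1) (M : ι) :
    Gi.map (D M) = -(Γ M * Gi) - Gi * (Γ M).transpose := by
  have hG' : Gi * G = 1 := mul_eq_one_comm.mp hG
  have e : G.map (D M) * Gi + G * Gi.map (D M) = 0 := by
    rw [← map_derivation_mul, hG, map_derivation_one]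
  rw [h.compat_matrix] at e
  have e2 : Gi * (((Γ M).transpose * G + G * Γ M) * Gi + G * Gi.map (D M)) = 0 := by
    rw [e, mul_zero]
  have e3 : Gi * (Γ M).transpose * (G * Gi) + (Gi * G) * (Γ M * Gi) + (Gi * G) * Gi.map (D M)
      = 0 := by
    rw [← e2]; noncomm_ring
  rw [hG, hG', mul_one, one_mul, one_mul] at e3
  rw [← sub_eq_zero, ← e3]; abel

lemma IsLC.inv_apply (h : IsLC D G Γ) (hG : G * Gi = 1) (I J : ι) : Gi I J = Gi J I := by
  have := congrFun (congrFun (h.symm_inv hG) J) I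
  simpa using this

lemma curv_antisymm_G (h : IsLC D G Γ) (hD : Commutes D) (I J : ι) :
    (curv D Γ I J).transpose * G + G * curv D Γ I J = 0 := by
  have e := map_derivation_comm hD I J G
  rw [h.compat_matrix, h.compat_matrix] at e
  simp only [map_derivation_add, map_derivation_mul, h.compat_matrix,
    Matrix.transpose_map] at e
  simp only [curv, Matrix.transpose_add, Matrix.transpose_sub, Matrix.transpose_mul,
    ← Matrix.transpose_map]
  rw [← sub_eq_zero] at e
  rw [← e]; simp only [Matrix.transpose_map]; noncomm_ring

lemma curv_inv_antisymm (h : IsLC D G Γ) (hG : G * Gi = 1) (hD : Commutes D) (I J : ι) :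
    (curv D Γ I J * Gi).transpose = -(curv D Γ I J * Gi) := by
  have hG' : Gi * G = 1 := mul_eq_one_comm.mp hG
  have e := congrArg (fun X => Gi * X * Gi) (curv_antisymm_G h hD I J)
  simp only [mul_zero, zero_mul] at e
  rw [Matrix.transpose_mul, h.symm_inv hG]
  have e3 : Gi * (curv D Γ I J).transpose * (G * Gi) + (Gi * G) * (curv D Γ I J * Gi) = 0 := by
    rw [← e]; noncomm_ring
  rw [hG, hG', mul_one, one_mul] at e3
  exact eq_neg_of_add_eq_zero_left e3

lemma bianchi_matrix (hD : Commutes D) (M I J : ι) :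
    ((curv D Γ I J).map (D M) + Γ M * curv D Γ I J - curv D Γ I J * Γ M)
    + ((curv D Γ J M).map (D I) + Γ I * curv D Γ J M - curv D Γ J M * Γ I)
    + ((curv D Γ M I).map (D J) + Γ J * curv D Γ M I - curv D Γ M I * Γ J) = 0 := by
  simp only [curv, map_derivation_add, map_derivation_sub, map_derivation_mul,
    map_derivation_comm hD I M, map_derivation_comm hD J M, map_derivation_comm hD J I]
  noncomm_ring

end Inverse

end LeviCivita

end

section

section Bianchi

variable {𝕜 R ι : Type*} [CommRing 𝕜] [CommRing R] [Algebra 𝕜 R] [Fintype ι] [DecidableEq ι]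
variable {D : ι → Derivation 𝕜 R R} {G Gi : Matrix ι ι R} {Γ : ι → Matrix ι ι R}

lemma curv_swap (I J : ι) : curv D Γ J I = -curv D Γ I J := by
  simp only [curv]; abel

lemma ric_eq_curv (ht : ∀ I K J, Γ I K J = Γ J K I) (I J : ι) :
    ric D Γ I J = ∑ K, curv D Γ K J K I := by
  simp only [ric, curv, Matrix.sub_apply, Matrix.add_apply, Matrix.map_apply, Matrix.mul_apply,
    sum_add_distrib, sum_sub_distrib]
  simp only [ht I]

/-- The covariant derivative `∇_M R^K_{LIJ}`, as the matrix in `(K, L)`. -/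
def covCurv (D : ι → Derivation 𝕜 R R) (Γ : ι → Matrix ι ι R) (M I J : ι) : Matrix ι ι R :=
  (curv D Γ I J).map (D M) + Γ M * curv D Γ I J - curv D Γ I J * Γ M
    - ∑ P, Γ M P I • curv D Γ P J - ∑ P, Γ M P J • curv D Γ I P

lemma sum_smul_curv_swap (c : ι → R) (I : ι) :
    ∑ P, c P • curv D Γ P I = -∑ P, c P • curv D Γ I P := by
  rw [← sum_neg_distrib]
  exact sum_congr rfl fun P _ => by rw [curv_swap I P, smul_neg]

lemma covCurv_swap (M I J : ι) : covCurv D Γ M J I = -covCurv D Γ M I J := by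
  have e : (-curv D Γ I J).map (D M) = -(curv D Γ I J).map (D M) := by ext; simp
  rw [covCurv, covCurv, sum_smul_curv_swap _ I, sum_smul_curv_swap _ J, curv_swap I J, e]
  noncomm_ring

lemma second_bianchi (ht : ∀ I K J, Γ I K J = Γ J K I) (hD : Commutes D) (M I J : ι) :
    covCurv D Γ M I J + covCurv D Γ I J M + covCurv D Γ J M I = 0 := by
  rw [← bianchi_matrix (Γ := Γ) hD M I J]
  rw [covCurv, covCurv, covCurv, sum_smul_curv_swap _ I, sum_smul_curv_swap _ J,
    sum_smul_curv_swap _ M]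
  simp only [fun P => ht M P I, fun P => ht M P J, fun P => ht I P J]
  abel

lemma covCurv_inv_antisymm (h : IsLC D G Γ) (hG : G * Gi = 1) (hD : Commutes D) (M I J : ι) :
    (covCurv D Γ M I J * Gi).transpose = -(covCurv D Γ M I J * Gi) := by
  have e : covCurv D Γ M I J * Gi = (curv D Γ I J * Gi).map (D M) + Γ M * (curv D Γ I J * Gi)
      + (curv D Γ I J * Gi) * (Γ M).transpose
      - ∑ P, Γ M P I • (curv D Γ P J * Gi) - ∑ P, Γ M P J • (curv D Γ I P * Gi) := by
    rw [map_derivation_mul, h.compat_inv hG]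
    simp only [covCurv, sub_mul, add_mul, sum_mul, Matrix.smul_mul]
    noncomm_ring
  rw [e]
  simp only [Matrix.transpose_add, Matrix.transpose_sub, Matrix.transpose_mul (Γ M),
    Matrix.transpose_mul _ (Γ M).transpose, Matrix.transpose_transpose, Matrix.transpose_sum,
    Matrix.transpose_smul, curv_inv_antisymm h hG hD, smul_neg, sum_neg_distrib,
    ← Matrix.transpose_map]
  have e : ∀ X : Matrix ι ι R, (-X).map (D M) = -X.map (D M) := fun X => by ext; simp
  rw [e]
  noncomm_ring

lemma cov_ric (ht : ∀ I K J, Γ I K J = Γ J K I) (M L J : ι) :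
    cov D Γ (ric D Γ) M L J = ∑ K, covCurv D Γ M K J K L := by
  simp only [cov, covCurv, ric_eq_curv ht, Matrix.sub_apply, Matrix.add_apply, Matrix.map_apply,
    Matrix.mul_apply, sum_add_distrib, sum_sub_distrib, Matrix.sum_apply,
    Matrix.smul_apply, smul_eq_mul, map_sum, mul_sum]
  have e1 : ∑ x, ∑ i, Γ M x i * curv D Γ x J i L = ∑ x, ∑ i, Γ M i x * curv D Γ i J x L :=
    sum_comm
  have e2 : ∑ x, ∑ i, Γ M x L * curv D Γ i J i x = ∑ x, ∑ i, curv D Γ x J x i * Γ M i L := by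
    exact sum_swap fun _ _ => mul_comm _ _
  have e3 : ∑ x, ∑ i, Γ M x J * curv D Γ i x i L = ∑ x, ∑ i, Γ M i J * curv D Γ x i x L :=
    sum_comm
  rw [e1, e2, e3]; ring

/-- The contracted second Bianchi identity. -/
theorem contracted_bianchi (h : IsLC D G Γ) (hG : G * Gi = 1) (hD : Commutes D) (M : ι) :
    ∑ L, ∑ J, Gi L J * cov D Γ (ric D Γ) M L J
      = 2 * ∑ L, ∑ J, Gi L J * cov D Γ (ric D Γ) J L M := by
  have b : ∀ L J, cov D Γ (ric D Γ) M L J + ∑ K, covCurv D Γ K J M K L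
      - cov D Γ (ric D Γ) J L M = 0 := by
    intro L J
    rw [cov_ric h.torsion, cov_ric h.torsion, ← sum_add_distrib,
      ← sum_sub_distrib]
    refine sum_eq_zero fun K _ => ?_
    have e := congrFun (congrFun (second_bianchi (Γ := Γ) h.torsion hD M K J) K) L
    rw [covCurv_swap J K M] at e
    simpa [sub_eq_add_neg] using e
  have a : ∑ L, ∑ J, Gi L J * ∑ K, covCurv D Γ K J M K L
      = -∑ L, ∑ J, Gi L J * cov D Γ (ric D Γ) J L M := by
    have e : ∀ K J, (covCurv D Γ K J M * Gi) K J = -(covCurv D Γ K J M * Gi) J K := by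
      intro K J
      have := congrFun (congrFun (covCurv_inv_antisymm h hG hD K J M) J) K
      simpa using this
    have l : ∑ L, ∑ J, Gi L J * ∑ K, covCurv D Γ K J M K L
        = ∑ K, ∑ J, (covCurv D Γ K J M * Gi) K J := by
      simp only [Matrix.mul_apply, mul_sum]
      rw [Finset.sum_comm' (t' := Finset.univ) (s' := fun _ => Finset.univ) (by simp),
        sum_congr rfl fun J _ => sum_comm, sum_comm]
      exact sum_congr₂ fun _ _ =>
        sum_congr rfl fun _ _ => mul_comm _ _
    have r : ∑ L, ∑ J, Gi L J * cov D Γ (ric D Γ) J L M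
        = ∑ K, ∑ J, (covCurv D Γ K J M * Gi) J K := by
      simp only [cov_ric h.torsion, Matrix.mul_apply, mul_sum]
      rw [sum_comm]
      refine sum_congr rfl fun _ _ => ?_
      exact sum_swap fun _ _ => mul_comm _ _
    rw [l, r, ← sum_neg_distrib]
    refine sum_congr rfl fun _ _ => ?_
    rw [← sum_neg_distrib]
    exact sum_congr rfl fun _ _ => e _ _
  have z : ∑ L, ∑ J, Gi L J * (cov D Γ (ric D Γ) M L J + ∑ K, covCurv D Γ K J M K L
      - cov D Γ (ric D Γ) J L M) = 0 :=
    sum_eq_zero fun L _ => sum_eq_zero fun J _ => by rw [b, mul_zero]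
  simp only [mul_sub, mul_add, sum_sub_distrib, sum_add_distrib, a] at z
  linear_combination z

lemma trace_curv (h : IsLC D G Γ) (hG : G * Gi = 1) (hD : Commutes D) (I J : ι) :
    2 * ∑ K, curv D Γ I J K K = 0 := by
  have hG' : Gi * G = 1 := mul_eq_one_comm.mp hG
  have e : curv D Γ I J = -(Gi * (curv D Γ I J).transpose * G) := by
    have e := congrArg (fun X => Gi * X) (curv_antisymm_G h hD I J)
    simp only [mul_zero, mul_add, ← mul_assoc, hG', one_mul] at e
    exact eq_neg_of_add_eq_zero_right e
  have t := congrArg Matrix.trace e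
  rw [Matrix.trace_neg, mul_assoc, Matrix.trace_mul_comm, mul_assoc, hG, mul_one,
    Matrix.trace_transpose] at t
  simp only [Matrix.trace, Matrix.diag] at t
  linear_combination t

lemma ric_symm (h : IsLC D G Γ) (hG : G * Gi = 1) (hD : Commutes D) (I J : ι) :
    2 * ric D Γ I J = 2 * ric D Γ J I := by
  have t := trace_curv h hG hD I J
  have e : ∑ K, (curv D Γ K J K I - curv D Γ K I K J + curv D Γ J I K K) = 0 := by
    refine sum_eq_zero fun K _ => ?_
    simp only [curv, Matrix.sub_apply, Matrix.add_apply, Matrix.map_apply, Matrix.mul_apply,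
      h.torsion J K I]
    rw [h.torsion K K I, h.torsion K K J]
    have s1 : ∀ A B : ι, ∑ x, Γ A K x * Γ K x B = ∑ x, Γ A K x * Γ B x K := fun A B =>
      sum_congr rfl fun x _ => by rw [h.torsion K x B]
    have s2 : ∑ x, Γ K K x * Γ J x I = ∑ x, Γ K K x * Γ I x J :=
      sum_congr rfl fun x _ => by rw [h.torsion J x I]
    rw [s1, s1, s2]
    ring
  rw [curv_swap I J] at e
  simp only [sum_add_distrib, sum_sub_distrib, Matrix.neg_apply,
    sum_neg_distrib] at e
  rw [ric_eq_curv h.torsion, ric_eq_curv h.torsion]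
  linear_combination 2 * e + t

lemma hes_symm (ht : ∀ I K J, Γ I K J = Γ J K I) (hD : Commutes D) (f : R) (I J : ι) :
    hes D Γ f I J = hes D Γ f J I := by
  simp only [hes, hD I J, ht I]

/-- The Ricci identity for the third covariant derivatives of a function. -/
lemma cov_hes (ht : ∀ I K J, Γ I K J = Γ J K I) (hD : Commutes D) (f : R) (M I J : ι) :
    cov D Γ (hes D Γ f) M I J - cov D Γ (hes D Γ f) I M J
      = -∑ K, curv D Γ M I K J * D K f := by
  let P : Matrix ι ι R := Matrix.of fun _ K => D K f
  have hes' : ∀ I, Matrix.of (fun _ J => hes D Γ f I J) = P.map (D I) - P * Γ I := by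
    intro I; ext a b
    simp only [hes, P, Matrix.of_apply, Matrix.sub_apply, Matrix.map_apply, Matrix.mul_apply]
    congr 1
    exact sum_congr rfl fun _ _ => mul_comm _ _
  have e : ((P.map (D I) - P * Γ I).map (D M) - (P.map (D I) - P * Γ I) * Γ M)
      - ((P.map (D M) - P * Γ M).map (D I) - (P.map (D M) - P * Γ M) * Γ I)
      = -(P * curv D Γ M I) := by
    simp only [curv, map_derivation_sub, map_derivation_mul, map_derivation_comm hD I M]
    noncomm_ring
  rw [← hes', ← hes'] at e
  have e' := congrFun (congrFun e J) J
  simp only [Matrix.sub_apply, Matrix.map_apply, Matrix.mul_apply, Matrix.of_apply, P,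
    Matrix.neg_apply] at e'
  have c : ∀ M I, ∑ L, Γ M L J * hes D Γ f I L = ∑ L, hes D Γ f I L * Γ M L J := fun M I =>
    sum_congr rfl fun _ _ => mul_comm _ _
  have c' : ∑ K, curv D Γ M I K J * D K f = ∑ K, D K f * curv D Γ M I K J :=
    sum_congr rfl fun _ _ => mul_comm _ _
  have c2 : ∑ L, Γ M L I * hes D Γ f L J = ∑ L, Γ I L M * hes D Γ f L J :=
    sum_congr rfl fun L _ => by rw [ht M L I]
  simp only [cov, c, c', c2]
  linear_combination e'

end Bianchi

end

section

section Warped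

variable {𝕜 R ι : Type*} [CommRing 𝕜] [CommRing R] [Algebra 𝕜 R] [Fintype ι] [DecidableEq ι]
variable {D : ι → Derivation 𝕜 R R} {G Gi : Matrix ι ι R} {Γ : ι → Matrix ι ι R}

/-- The Ricci tensor of the warped metric `G + f² δ`, `δ` flat of dimension `κ`, in the directions
of `G`; here `v = f⁻¹`. -/
def warpedRic (D : ι → Derivation 𝕜 R R) (Γ : ι → Matrix ι ι R) (κ v f : R) (I J : ι) : R :=
  ric D Γ I J - κ * v * hes D Γ f I J

/-- Up to sign, the Ricci tensor of the warped metric `G + f² δ` in the directions of `δ`. -/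
def warpedFlat (D : ι → Derivation 𝕜 R R) (Gi : Matrix ι ι R) (Γ : ι → Matrix ι ι R) (κ f : R) :
    R :=
  f * trc Gi (hes D Γ f) + (κ - 1) * grad2 D Gi f

lemma derivation_trc (h : IsLC D G Γ) (hG : G * Gi = 1) (T : ι → ι → R) (J : ι) :
    D J (trc Gi T) = ∑ I, ∑ M, Gi I M * cov D Γ T J I M := by
  have e : ∀ I M, D J (Gi I M) = -(∑ L, Γ J I L * Gi L M) - ∑ L, Gi I L * Γ J M L := by
    intro I M
    have := congrFun (congrFun (h.compat_inv hG J) I) M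
    simpa [Matrix.mul_apply] using this
  have a1 : ∑ I, ∑ M, (∑ L, Γ J I L * Gi L M) * T I M
      = ∑ I, ∑ M, Gi I M * ∑ L, Γ J L I * T L M := by
    simp only [sum_mul, mul_sum]
    rw [sum_congr rfl fun I _ => sum_comm, sum_comm]
    refine sum_congr rfl fun _ _ => ?_
    exact sum_swap fun _ _ => by ring
  have a2 : ∑ I, ∑ M, (∑ L, Gi I L * Γ J M L) * T I M
      = ∑ I, ∑ M, Gi I M * ∑ L, Γ J L M * T I L := by
    simp only [sum_mul, mul_sum]
    refine sum_congr rfl fun _ _ => ?_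
    exact sum_swap fun _ _ => by ring
  have l : D J (trc Gi T) = ∑ I, ∑ M, (Gi I M * D J (T I M)) - ∑ I, ∑ M, (∑ L, Γ J I L * Gi L M) * T I M
      - ∑ I, ∑ M, (∑ L, Gi I L * Γ J M L) * T I M := by
    simp only [trc, map_sum, Derivation.leibniz, smul_eq_mul, e, ← sum_sub_distrib]
    exact sum_congr₂ fun _ _ => by ring
  rw [l, a1, a2]
  simp only [cov, mul_sub, sum_sub_distrib]

lemma div_hes (h : IsLC D G Γ) (hG : G * Gi = 1) (hD : Commutes D) (f : R) (J : ι) :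
    ∑ I, ∑ M, Gi I M * cov D Γ (hes D Γ f) M I J
      = D J (trc Gi (hes D Γ f)) + ∑ I, ∑ M, Gi I M * D M f * ric D Γ I J := by
  have s : ∀ M I, cov D Γ (hes D Γ f) M I J
      = cov D Γ (hes D Γ f) J M I - ∑ K, curv D Γ M J K I * D K f := by
    intro M I
    have e := cov_hes (Γ := Γ) h.torsion hD f M J I
    have e2 : cov D Γ (hes D Γ f) M I J = cov D Γ (hes D Γ f) M J I := by
      simp only [cov, hes_symm h.torsion hD f I, hes_symm h.torsion hD f _ J]
      ring
    rw [e2]; linear_combination e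
  have c : ∑ I, ∑ M, Gi I M * ∑ K, curv D Γ M J K I * D K f
      = -∑ I, ∑ M, Gi I M * D M f * ric D Γ I J := by
    have l : ∑ I, ∑ M, Gi I M * ∑ K, curv D Γ M J K I * D K f
        = ∑ M, ∑ K, (curv D Γ M J * Gi) K M * D K f := by
      simp only [Matrix.mul_apply, mul_sum, sum_mul]
      rw [sum_comm]
      refine sum_congr rfl fun _ _ => ?_
      exact sum_swap fun _ _ => by ring
    have r : ∑ I, ∑ M, Gi I M * D M f * ric D Γ I J
        = ∑ M, ∑ K, (curv D Γ M J * Gi) M K * D K f := by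
      simp only [Matrix.mul_apply, mul_sum, sum_mul, ric_eq_curv h.torsion]
      rw [sum_congr rfl fun I _ => sum_comm, sum_comm]
      refine sum_congr rfl fun _ _ => ?_
      exact sum_swap fun _ _ => by ring
    rw [l, r, ← sum_neg_distrib]
    refine sum_congr rfl fun M _ => ?_
    rw [← sum_neg_distrib]
    refine sum_congr rfl fun K _ => ?_
    have := congrFun (congrFun (curv_inv_antisymm h hG hD M J) M) K
    simp only [Matrix.transpose_apply, Matrix.neg_apply] at this
    rw [this]; ring
  have t : ∑ I, ∑ M, Gi I M * cov D Γ (hes D Γ f) J M I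
      = ∑ I, ∑ M, Gi I M * cov D Γ (hes D Γ f) J I M := by
    exact sum_swap fun _ _ => by
      rw [h.inv_apply hG]
  simp only [s, mul_sub, sum_sub_distrib, c, t, derivation_trc h hG]
  ring

lemma derivation_grad2 (h : IsLC D G Γ) (hG : G * Gi = 1) (hD : Commutes D) (f : R) (J : ι) :
    D J (grad2 D Gi f) = 2 * ∑ I, ∑ M, Gi I M * D M f * hes D Γ f I J := by
  have e : grad2 D Gi f = trc Gi fun I M => D I f * D M f := rfl
  have c : ∀ I M, cov D Γ (fun I M => D I f * D M f) J I M
      = hes D Γ f I J * D M f + hes D Γ f M J * D I f := by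
    intro I M
    rw [hes_symm h.torsion hD f I, hes_symm h.torsion hD f M]
    have e1 : ∑ L, Γ J L I * (D L f * D M f) = (∑ L, Γ J L I * D L f) * D M f := by
      rw [sum_mul]; exact sum_congr rfl fun _ _ => by ring
    have e2 : ∑ L, Γ J L M * (D I f * D L f) = (∑ L, Γ J L M * D L f) * D I f := by
      rw [sum_mul]; exact sum_congr rfl fun _ _ => by ring
    simp only [cov, hes, Derivation.leibniz, smul_eq_mul, e1, e2]; ring
  have s : ∑ I, ∑ M, Gi I M * (hes D Γ f M J * D I f)
      = ∑ I, ∑ M, Gi I M * D M f * hes D Γ f I J := by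
    exact sum_swap fun _ _ => by
      rw [h.inv_apply hG]; ring
  rw [e, derivation_trc h hG]
  simp only [c, mul_add, sum_add_distrib, s]
  rw [two_mul]
  congr 1
  exact sum_congr₂ fun _ _ => by ring

/-- The contracted Bianchi identity of a warped metric. -/
theorem warped_bianchi (h : IsLC D G Γ) (hG : G * Gi = 1) (hD : Commutes D) {κ v f : R}
    (hκ : ∀ I, D I κ = 0) (hv : f * v = 1) (J : ι) :
    2 * (∑ I, ∑ M, Gi I M * cov D Γ (warpedRic D Γ κ v f) M I J)
      + 2 * κ * v * (∑ I, ∑ M, Gi I M * D M f * warpedRic D Γ κ v f I J)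
      + 2 * κ * v ^ 3 * D J f * warpedFlat D Gi Γ κ f
    = D J (trc Gi (warpedRic D Γ κ v f) - κ * v ^ 2 * warpedFlat D Gi Γ κ f) := by
  have dv : ∀ I, D I v = -v ^ 2 * D I f := by
    intro I
    have := congrArg (D I) hv
    simp only [Derivation.leibniz, smul_eq_mul, Derivation.map_one_eq_zero] at this
    linear_combination v * this - (D I v) * hv
  set H := hes D Γ f with hH
  have c : ∀ M I J, cov D Γ (warpedRic D Γ κ v f) M I J = cov D Γ (ric D Γ) M I J
      - κ * v * cov D Γ H M I J + κ * v ^ 2 * (D M f * H I J) := by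
    intro M I J
    have e1 : ∀ (T : ι → R) , ∑ L, T L * (κ * v * H L J) = κ * v * ∑ L, T L * H L J := fun T => by
      rw [mul_sum]; exact sum_congr rfl fun _ _ => by ring
    have e2 : ∀ (T : ι → R) , ∑ L, T L * (κ * v * H I L) = κ * v * ∑ L, T L * H I L := fun T => by
      rw [mul_sum]; exact sum_congr rfl fun _ _ => by ring
    simp only [cov, warpedRic, ← hH, mul_sub, sum_sub_distrib, e1, e2, map_sub,
      Derivation.leibniz, smul_eq_mul, hκ, dv]
    ring
  have d1 : ∑ I, ∑ M, Gi I M * cov D Γ (warpedRic D Γ κ v f) M I J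
      = (∑ I, ∑ M, Gi I M * cov D Γ (ric D Γ) M I J)
        - κ * v * (∑ I, ∑ M, Gi I M * cov D Γ H M I J)
        + κ * v ^ 2 * (∑ I, ∑ M, Gi I M * D M f * H I J) := by
    simp only [c, mul_sum, ← sum_sub_distrib, ← sum_add_distrib]
    exact sum_congr₂ fun _ _ => by ring
  have d2 : ∑ I, ∑ M, Gi I M * D M f * warpedRic D Γ κ v f I J
      = (∑ I, ∑ M, Gi I M * D M f * ric D Γ I J)
        - κ * v * (∑ I, ∑ M, Gi I M * D M f * H I J) := by
    simp only [warpedRic, ← hH, mul_sum, ← sum_sub_distrib]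
    exact sum_congr₂ fun _ _ => by ring
  have d3 : trc Gi (warpedRic D Γ κ v f) = trc Gi (ric D Γ) - κ * v * trc Gi H := by
    simp only [trc, warpedRic, ← hH, mul_sum, ← sum_sub_distrib]
    exact sum_congr₂ fun _ _ => by ring
  have b := contracted_bianchi h hG hD J
  rw [← derivation_trc h hG] at b
  have dh := div_hes h hG hD f J
  have dg := derivation_grad2 h hG hD f J
  rw [← hH] at dh dg
  rw [d1, d2, d3, dh]
  simp only [warpedFlat, ← hH, map_sub, map_add, Derivation.leibniz, smul_eq_mul, hκ, dv,
    Derivation.leibniz_pow, Derivation.map_one_eq_zero, b, dg, nsmul_eq_mul]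
  push_cast
  linear_combination (κ * v * D J (trc Gi H)) * hv

/-! ### Homothetic vector fields -/

/-- The covariant derivative `∇_I T^K` of a vector field. -/
def covVec (D : ι → Derivation 𝕜 R R) (Γ : ι → Matrix ι ι R) (T : ι → R) (I K : ι) : R :=
  D I (T K) + ∑ L, Γ I K L * T L

/-- The exterior derivative `∂_I T_J - ∂_J T_I` of the one-form dual to a vector field. -/
def curl (D : ι → Derivation 𝕜 R R) (G : Matrix ι ι R) (T : ι → R) (I J : ι) : R :=
  D I (∑ K, G J K * T K) - D J (∑ K, G I K * T K)

/-- The exterior derivative of the dual one-form with the second index raised. -/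
def curlUp (D : ι → Derivation 𝕜 R R) (G Gi : Matrix ι ι R) (T : ι → R) (I K : ι) : R :=
  ∑ L, Gi K L * curl D G T I L

/-- The vector field `T` is homothetic: `ℒ_T G = 2 G`. -/
def IsHomothetic (D : ι → Derivation 𝕜 R R) (G : Matrix ι ι R) (T : ι → R) : Prop :=
  ∀ I J, ∑ K, (T K * D K (G I J) + D I (T K) * G K J + D J (T K) * G I K) = 2 * G I J

lemma lower_covVec (h : IsLC D G Γ) (T : ι → R) (I J : ι) :
    D I (∑ K, G J K * T K) = ∑ K, G J K * covVec D Γ T I K + ∑ K, ∑ L, Γ I L J * G L K * T K := by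
  simp only [map_sum, Derivation.leibniz, smul_eq_mul, h.compat, covVec, mul_add,
    sum_add_distrib, mul_sum]
  have : ∑ x, ∑ i, T x * (Γ I i x * G i J) = ∑ x, ∑ i, G J x * (Γ I x i * T i) := by
    exact sum_swap fun i j => by
      rw [h.symm i J]; ring
  rw [this]
  have : ∑ x, ∑ i, T x * (Γ I i J * G i x) = ∑ x, ∑ i, Γ I i J * G i x * T x :=
    sum_congr₂ fun i j => by ring
  rw [this]; ring

lemma two_covVec (h : IsLC D G Γ) (hG : G * Gi = 1) {T : ι → R} (hT : IsHomothetic D G T)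
    (I K : ι) :
    2 * covVec D Γ T I K = 2 * (1 : Matrix ι ι R) K I + curlUp D G Gi T I K := by
  have hG' : Gi * G = 1 := mul_eq_one_comm.mp hG
  have low : ∀ I J, ∑ K, G J K * covVec D Γ T I K + ∑ K, G I K * covVec D Γ T J K
      = 2 * G I J := by
    intro I J
    rw [← hT I J]
    simp only [covVec, mul_add, sum_add_distrib, h.compat, mul_sum]
    have e1 : ∑ x, ∑ i, G J x * (Γ I x i * T i) = ∑ x, ∑ i, T x * (Γ x i I * G i J) := by
      exact sum_swap fun i j => by
        rw [h.symm J j, h.torsion I]; ring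
    have e2 : ∑ x, ∑ i, G I x * (Γ J x i * T i) = ∑ x, ∑ i, T x * (Γ x i J * G i I) := by
      exact sum_swap fun i j => by
        rw [h.symm I j, h.torsion J]; ring
    have e3 : ∑ x, G J x * D I (T x) = ∑ x, D I (T x) * G x J :=
      sum_congr rfl fun i _ => by rw [h.symm J]; ring
    have e4 : ∑ x, G I x * D J (T x) = ∑ x, D J (T x) * G I x :=
      sum_congr rfl fun i _ => by ring
    rw [e1, e2, e3, e4]; ring
  have cur : ∀ I J, curl D G T I J = ∑ K, G J K * covVec D Γ T I K
      - ∑ K, G I K * covVec D Γ T J K := by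
    intro I J
    rw [curl, lower_covVec h, lower_covVec h]
    have : ∑ K, ∑ L, Γ I L J * G L K * T K = ∑ K, ∑ L, Γ J L I * G L K * T K :=
      sum_congr₂ fun i j => by rw [h.torsion I]
    rw [this]; ring
  have two : ∀ L, 2 * ∑ K, G L K * covVec D Γ T I K = 2 * G I L + curl D G T I L := by
    intro L
    rw [cur]; linear_combination low I L
  have inv : ∀ w : ι → R, ∑ L, Gi K L * ∑ P, G L P * w P = w K := by
    intro w
    have : ∑ L, Gi K L * ∑ P, G L P * w P = ∑ P, (Gi * G) K P * w P := by
      simp only [Matrix.mul_apply, mul_sum, sum_mul]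
      exact sum_swap fun i j => by ring
    rw [this, hG']; simp [Matrix.one_apply]
  rw [← inv (fun P => covVec D Γ T I P), mul_sum]
  have e : ∀ L, 2 * (Gi K L * ∑ P, G L P * covVec D Γ T I P)
      = 2 * (Gi K L * G L I) + Gi K L * curl D G T I L := by
    intro L
    rw [h.symm L I]; linear_combination Gi K L * two L
  simp only [e, sum_add_distrib, ← mul_sum, curlUp]
  rw [← hG', Matrix.mul_apply]

lemma trace_curlUp (h : IsLC D G Γ) (hG : G * Gi = 1) (T : ι → R) :
    2 * ∑ K, curlUp D G Gi T K K = 0 := by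
  have e : ∑ K, curlUp D G Gi T K K = -∑ K, curlUp D G Gi T K K := by
    simp only [curlUp]
    conv_lhs => rw [sum_comm]
    rw [← sum_neg_distrib]
    refine sum_congr rfl fun i _ => ?_
    rw [← sum_neg_distrib]
    refine sum_congr rfl fun j _ => ?_
    rw [h.inv_apply hG, curl, curl]; ring
  linear_combination e

/-- The Ricci identity for a vector field, contracted. -/
lemma ric_vec (h : IsLC D G Γ) (hD : Commutes D) (T : ι → R) (J : ι) :
    ∑ L, ric D Γ L J * T L = ∑ K, (D K (covVec D Γ T J K)
      + ∑ P, Γ K K P * covVec D Γ T J P - D J (covVec D Γ T K K)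
      - ∑ P, Γ J K P * covVec D Γ T K P) := by
  let Q : Matrix ι ι R := Matrix.of fun K _ => T K
  have cv : ∀ I, Matrix.of (fun K _ => covVec D Γ T I K) = Q.map (D I) + Γ I * Q := by
    intro I; ext a b
    simp [covVec, Q, Matrix.mul_apply]
  have e : ∀ I J, ((Q.map (D J) + Γ J * Q).map (D I) + Γ I * (Q.map (D J) + Γ J * Q))
      - ((Q.map (D I) + Γ I * Q).map (D J) + Γ J * (Q.map (D I) + Γ I * Q))
      = curv D Γ I J * Q := by
    intro I J
    simp only [curv, map_derivation_add, map_derivation_mul, map_derivation_comm hD J I]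
    noncomm_ring
  simp only [ric_eq_curv h.torsion, sum_mul]
  rw [sum_comm]
  refine sum_congr rfl fun K _ => ?_
  have e' := congrFun (congrFun (e K J) K) K
  rw [← cv, ← cv] at e'
  simp only [Matrix.sub_apply, Matrix.add_apply, Matrix.map_apply, Matrix.mul_apply,
    Matrix.of_apply, Q] at e'
  linear_combination -e'

lemma hes_vec (ht : ∀ I K J, Γ I K J = Γ J K I) (hD : Commutes D) {T : ι → R} {f : R}
    (hf : ∑ K, T K * D K f = f) (J : ι) :
    ∑ L, hes D Γ f L J * T L = D J f - ∑ K, covVec D Γ T J K * D K f := by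
  have l : ∑ L, hes D Γ f L J * T L
      = ∑ L, T L * D J (D L f) - ∑ L, ∑ K, Γ J K L * D K f * T L := by
    rw [← sum_sub_distrib]
    refine sum_congr rfl fun L _ => ?_
    rw [hes_symm ht hD, hes, sub_mul, sum_mul]; ring
  have r : ∑ K, covVec D Γ T J K * D K f
      = ∑ K, D J (T K) * D K f + ∑ L, ∑ K, Γ J K L * D K f * T L := by
    simp only [covVec, add_mul, sum_add_distrib, sum_mul]
    congr 1
    exact sum_swap fun i j => by ring
  have m : D J f = ∑ K, T K * D J (D K f) + ∑ K, D J (T K) * D K f := by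
    conv_lhs => rw [← hf]
    simp only [map_sum, Derivation.leibniz, smul_eq_mul, ← sum_add_distrib]
    exact sum_congr rfl fun i _ => by ring
  rw [l, r, m]; ring

/-- For a homothetic vector field `T`, the contraction of the Ricci tensor of a warped metric with
`T` is a divergence of the exterior derivative of the dual one-form. -/
theorem warpedRic_homothetic (h : IsLC D G Γ) (hG : G * Gi = 1) (hD : Commutes D)
    (h2 : IsUnit (2 : R)) {T : ι → R} (hT : IsHomothetic D G T) {κ v f : R}
    (hf : ∑ K, T K * D K f = f) (J : ι) :
    2 * ∑ L, warpedRic D Γ κ v f L J * T L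
      = (∑ K, (D K (curlUp D G Gi T J K) + ∑ P, Γ K K P * curlUp D G Gi T J P
        - ∑ P, Γ J K P * curlUp D G Gi T K P))
        + κ * v * ∑ K, curlUp D G Gi T J K * D K f := by
  have tr : ∑ K, curlUp D G Gi T K K = 0 := by
    have := trace_curlUp h hG T
    exact h2.mul_left_cancel (by rw [this, mul_zero])
  have c2 := two_covVec h hG hT
  have hess := hes_vec h.torsion hD hf J
  have hess2 : 2 * ∑ L, hes D Γ f L J * T L = -∑ K, curlUp D G Gi T J K * D K f := by
    have e : ∑ K, 2 * covVec D Γ T J K * D K f = 2 * D J f + ∑ K, curlUp D G Gi T J K * D K f := by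
      simp only [c2, add_mul, sum_add_distrib]
      congr 1
      simp [Matrix.one_apply]
    have e2 : ∑ K, 2 * covVec D Γ T J K * D K f = 2 * ∑ K, covVec D Γ T J K * D K f := by
      rw [mul_sum]; exact sum_congr rfl fun i _ => by ring
    rw [hess]; linear_combination e2 - e
  have ricc : 2 * ∑ L, ric D Γ L J * T L
      = ∑ K, (D K (curlUp D G Gi T J K) + ∑ P, Γ K K P * curlUp D G Gi T J P
        - ∑ P, Γ J K P * curlUp D G Gi T K P) := by
    have d : ∀ M I K, 2 * D M (covVec D Γ T I K) = D M (curlUp D G Gi T I K) := by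
      intro M I K
      have := congrArg (D M) (c2 I K)
      have z : D M ((1 : Matrix ι ι R) K I) = 0 := by
        by_cases hh : K = I <;> simp [Matrix.one_apply, hh]
      have z2 : D M (2 : R) = 0 := by
        have : (2 : R) = ((2 : ℕ) : R) := by norm_num
        rw [this]; exact Derivation.map_natCast _ _
      simp only [Derivation.leibniz, smul_eq_mul, map_add, z, z2] at this
      linear_combination this
    have s : ∀ (A : ι → R) (I : ι), 2 * ∑ P, A P * covVec D Γ T I P
        = 2 * A I + ∑ P, A P * curlUp D G Gi T I P := by
      intro A I
      have : 2 * ∑ P, A P * covVec D Γ T I P = ∑ P, A P * (2 * covVec D Γ T I P) := by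
        rw [mul_sum]; exact sum_congr rfl fun i _ => by ring
      rw [this]
      simp only [c2, mul_add, sum_add_distrib]
      congr 1
      simp [Matrix.one_apply, mul_comm]
    rw [ric_vec h hD, mul_sum]
    have tot : ∀ K, 2 * (D K (covVec D Γ T J K)
      + ∑ P, Γ K K P * covVec D Γ T J P - D J (covVec D Γ T K K)
      - ∑ P, Γ J K P * covVec D Γ T K P) = (D K (curlUp D G Gi T J K)
        + ∑ P, Γ K K P * curlUp D G Gi T J P
        - ∑ P, Γ J K P * curlUp D G Gi T K P) - D J (curlUp D G Gi T K K) := by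
      intro K
      have := h.torsion J K K
      linear_combination d K J K + s (Γ K K) J - d J K K - s (Γ J K) K - 2 * this
    rw [sum_congr rfl fun K _ => tot K, sum_sub_distrib, ← map_sum, tr, map_zero,
      sub_zero]
  have fin : ∑ L, warpedRic D Γ κ v f L J * T L
      = ∑ L, ric D Γ L J * T L - κ * v * ∑ L, hes D Γ f L J * T L := by
    rw [mul_sum, ← sum_sub_distrib]
    exact sum_congr rfl fun i _ => by rw [warpedRic]; ring
  rw [fin]
  linear_combination ricc - κ * v * hess2

end Warped

end

section

section Naturality

variable {𝕜 R ι : Type*} [CommRing 𝕜] [CommRing R] [Algebra 𝕜 R] [Fintype ι] [DecidableEq ι]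
variable {D : ι → Derivation 𝕜 R R} {G Gi : Matrix ι ι R} {Γ : ι → Matrix ι ι R}

/-- The first Christoffel symbols. -/
lemma IsLC.lower (h : IsLC D G Γ) (L I J : ι) :
    2 * ∑ K, G L K * Γ I K J = D I (G J L) + D J (G I L) - D L (G I J) := by
  simp only [h.compat, mul_sum, ← sum_add_distrib, ← sum_sub_distrib]
  refine sum_congr rfl fun K _ => ?_
  rw [h.torsion L K I, h.torsion L K J, h.torsion J K I, h.symm L K]
  ring

lemma IsLC.upper (h : IsLC D G Γ) (hG : G * Gi = 1) (K I J : ι) :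
    2 * Γ I K J = ∑ L, Gi K L * (D I (G J L) + D J (G I L) - D L (G I J)) := by
  have hG' : Gi * G = 1 := mul_eq_one_comm.mp hG
  have e : ∑ L, Gi K L * (2 * ∑ P, G L P * Γ I P J) = 2 * ∑ P, (Gi * G) K P * Γ I P J := by
    simp only [Matrix.mul_apply, sum_mul, mul_sum]
    exact sum_swap fun i j => by ring
  simp only [← h.lower]
  rw [e, hG']; simp [Matrix.one_apply]

lemma IsLC.unique (h2 : IsUnit (2 : R)) (hG : G * Gi = 1) {Γ' : ι → Matrix ι ι R}
    (h : IsLC D G Γ) (h' : IsLC D G Γ') : Γ = Γ' := by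
  funext I; ext K J
  exact h2.mul_left_cancel (by rw [h.upper hG, h'.upper hG])

/-- The Levi-Civita symbols are given by the usual formula. -/
lemma isLC_of_upper (h2 : IsUnit (2 : R)) (hs : ∀ I J, G I J = G J I) (hG : G * Gi = 1)
    (hΓ : ∀ K I J, 2 * Γ I K J = ∑ L, Gi K L * (D I (G J L) + D J (G I L) - D L (G I J))) :
    IsLC D G Γ := by
  have low : ∀ P I J, 2 * ∑ K, Γ I K J * G K P = D I (G J P) + D J (G I P) - D P (G I J) := by
    intro P I J
    have : 2 * ∑ K, Γ I K J * G K P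
        = ∑ L, (G * Gi) P L * (D I (G J L) + D J (G I L) - D L (G I J)) := by
      rw [mul_sum, sum_congr rfl fun K _ => show 2 * (Γ I K J * G K P)
        = (∑ L, Gi K L * (D I (G J L) + D J (G I L) - D L (G I J))) * G K P by rw [← hΓ]; ring]
      simp only [Matrix.mul_apply, sum_mul]
      exact sum_swap fun i j => by
        rw [hs P]; ring
    rw [this, hG]; simp [Matrix.one_apply]
  refine ⟨hs, fun I K J => h2.mul_left_cancel ?_, fun M I J => h2.mul_left_cancel ?_⟩
  · rw [hΓ, hΓ]
    exact sum_congr rfl fun L _ => by rw [hs I J]; ring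
  · rw [sum_add_distrib, mul_add, low, low, hs J I, hs M I, hs M J]; ring

section Hom

variable {R' : Type*} [CommRing R'] [Algebra 𝕜 R'] {D' : ι → Derivation 𝕜 R' R'} {σ : R →+* R'}

lemma IsLC.map (h : IsLC D G Γ) (hσ : ∀ I x, D' I (σ x) = σ (D I x)) :
    IsLC D' (G.map σ) (fun I => (Γ I).map σ) where
  symm I J := by simp [h.symm I J]
  torsion I K J := by simp [h.torsion I K J]
  compat M I J := by simp [hσ, h.compat M I J]

lemma ric_map (hσ : ∀ I x, D' I (σ x) = σ (D I x)) (I J : ι) :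
    ric D' (fun I => (Γ I).map σ) I J = σ (ric D Γ I J) := by
  simp [ric, hσ]

lemma hes_map (hσ : ∀ I x, D' I (σ x) = σ (D I x)) (f : R) (I J : ι) :
    hes D' (fun I => (Γ I).map σ) (σ f) I J = σ (hes D Γ f I J) := by
  simp [hes, hσ]

lemma trc_map (T : ι → ι → R) : trc (Gi.map σ) (fun I J => σ (T I J)) = σ (trc Gi T) := by
  simp [trc]

lemma grad2_map (hσ : ∀ I x, D' I (σ x) = σ (D I x)) (f : R) :
    grad2 D' (Gi.map σ) (σ f) = σ (grad2 D Gi f) := by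
  simp [grad2, hσ]

lemma warpedRic_map (hσ : ∀ I x, D' I (σ x) = σ (D I x)) (κ v f : R) (I J : ι) :
    warpedRic D' (fun I => (Γ I).map σ) (σ κ) (σ v) (σ f) I J = σ (warpedRic D Γ κ v f I J) := by
  simp [warpedRic, ric_map hσ, hes_map hσ]

lemma warpedFlat_map (hσ : ∀ I x, D' I (σ x) = σ (D I x)) (κ f : R) :
    warpedFlat D' (Gi.map σ) (fun I => (Γ I).map σ) (σ κ) (σ f)
      = σ (warpedFlat D Gi Γ κ f) := by
  have : hes D' (fun I => (Γ I).map σ) (σ f) = fun I J => σ (hes D Γ f I J) := by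
    funext I J; exact hes_map hσ f I J
  simp [warpedFlat, this, trc_map, grad2_map hσ]

end Hom

section Frame

variable {e : ι → Derivation 𝕜 R R} {J Ji : Matrix ι ι R}

/-- The connection one-forms in the frame `D`, before the change of basis. -/
def pullConn (J : Matrix ι ι R) (Γ : ι → Matrix ι ι R) (I : ι) : Matrix ι ι R :=
  ∑ A, J A I • Γ A

/-- The Levi-Civita symbols in the frame `D I = ∑ A, J A I • e A`. -/
def frameLC (D : ι → Derivation 𝕜 R R) (J Ji : Matrix ι ι R) (Γ : ι → Matrix ι ι R) (I : ι) :
    Matrix ι ι R :=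
  Ji * (J.map (D I) + pullConn J Γ I * J)

lemma mul_frameLC (hJ : J * Ji = 1) (I : ι) :
    J * frameLC D J Ji Γ I = J.map (D I) + pullConn J Γ I * J := by
  rw [frameLC, ← mul_assoc, hJ, one_mul]

lemma pullConn_mul_apply (I A K : ι) :
    (pullConn J Γ I * J) A K = ∑ B, ∑ C, J B I * J C K * Γ B A C := by
  simp only [pullConn, sum_mul, Matrix.sum_apply, Matrix.smul_apply,
    Matrix.mul_apply, smul_eq_mul]
  exact sum_swap fun i j => by ring

lemma isLC_frame (hJ : J * Ji = 1) (hD : ∀ I x, D I x = ∑ A, J A I * e A x)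
    (hdJ : ∀ I A K, D I (J A K) = D K (J A I)) (h : IsLC e G Γ) :
    IsLC D (J.transpose * G * J) (frameLC D J Ji Γ) := by
  have hJ' : Ji * J = 1 := mul_eq_one_comm.mp hJ
  have dG : ∀ I, G.map (D I) = (pullConn J Γ I).transpose * G + G * pullConn J Γ I := by
    intro I
    have : G.map (D I) = ∑ A, J A I • G.map (e A) := by
      ext a b; simp [hD, Matrix.sum_apply]
    rw [this]
    simp only [h.compat_matrix, pullConn, Matrix.transpose_sum, Matrix.transpose_smul,
      sum_mul, mul_sum, Matrix.smul_mul, Matrix.mul_smul, smul_add,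
      sum_add_distrib]
  have hs : (J.transpose * G * J).transpose = J.transpose * G * J := by
    simp only [Matrix.transpose_mul, Matrix.transpose_transpose, h.transpose_G, mul_assoc]
  refine ⟨fun I K => ?_, fun I L K => ?_, fun M I K => ?_⟩
  · exact (congrFun (congrFun hs K) I)
  · have t : ∀ A, (J.map (D I) + pullConn J Γ I * J) A K = (J.map (D K) + pullConn J Γ K * J) A I := by
      intro A
      simp only [Matrix.add_apply, Matrix.map_apply, hdJ I A K, pullConn_mul_apply]
      congr 1
      exact sum_swap fun i j => by
        rw [h.torsion j A i]; ring
    simp only [frameLC, Matrix.mul_apply (M := Ji), t]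
  · have m : (J.transpose * G * J).map (D M)
        = (J * frameLC D J Ji Γ M).transpose * G * J + J.transpose * G * (J * frameLC D J Ji Γ M)
        := by
      rw [mul_frameLC hJ, map_derivation_mul, map_derivation_mul, dG, Matrix.transpose_add,
        Matrix.transpose_mul, Matrix.transpose_map]
      noncomm_ring
    have m' : (J.transpose * G * J).map (D M)
        = (frameLC D J Ji Γ M).transpose * (J.transpose * G * J)
          + (J.transpose * G * J) * (frameLC D J Ji Γ M) := by
      rw [m, Matrix.transpose_mul]; noncomm_ring
    have := congrFun (congrFun m' I) K
    rw [Matrix.map_apply] at this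
    rw [this, Matrix.add_apply, Matrix.mul_apply, Matrix.mul_apply, sum_add_distrib]
    congr 1
    refine sum_congr rfl fun L _ => ?_
    have s := congrFun (congrFun hs L) I
    rw [Matrix.transpose_apply] at s
    rw [s]; ring

lemma curv_frame (hJ : J * Ji = 1) (hD : ∀ I x, D I x = ∑ A, J A I * e A x)
    (hdJ : ∀ I A K, D I (J A K) = D K (J A I)) (hc : Commutes D) (I K : ι) :
    curv D (frameLC D J Ji Γ) I K = Ji * (∑ A, ∑ B, (J A I * J B K) • curv e Γ A B) * J := by
  have hJ' : Ji * J = 1 := mul_eq_one_comm.mp hJ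
  set W := pullConn J Γ with hW
  have dJi : ∀ I, Ji.map (D I) = -(Ji * J.map (D I) * Ji) := by
    intro I
    have z : Ji.map (D I) * J + Ji * J.map (D I) = 0 := by
      rw [← map_derivation_mul, hJ', map_derivation_one]
    have : Ji.map (D I) * (J * Ji) = -(Ji * J.map (D I) * Ji) := by
      rw [← mul_assoc, eq_neg_of_add_eq_zero_left z, neg_mul]
    rwa [hJ, mul_one] at this
  have step : curv D (frameLC D J Ji Γ) I K
      = Ji * ((W K).map (D I) - (W I).map (D K) + W I * W K - W K * W I) * J := by
    have sum1 : ∀ I K, Ji * (J.map (D I) + W I * J) * (Ji * (J.map (D K) + W K * J))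
        = Ji * J.map (D I) * Ji * J.map (D K) + Ji * J.map (D I) * Ji * W K * J
          + Ji * W I * J.map (D K) + Ji * W I * W K * J := by
      intro I K
      calc _ = Ji * J.map (D I) * Ji * J.map (D K) + Ji * J.map (D I) * Ji * W K * J
          + Ji * W I * (J * Ji) * J.map (D K) + Ji * W I * (J * Ji) * W K * J := by noncomm_ring
        _ = _ := by rw [hJ]; noncomm_ring
    simp only [curv, frameLC, ← hW, map_derivation_mul, map_derivation_add, dJi, sum1,
      map_derivation_comm hc K I]
    noncomm_ring
  rw [step]
  congr 2
  have dW : ∀ I K, (W K).map (D I) = ∑ B, D I (J B K) • Γ B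
      + ∑ A, ∑ B, (J A I * J B K) • (Γ B).map (e A) := by
    intro I K
    ext a b
    simp only [hW, pullConn, Matrix.map_apply, Matrix.sum_apply, Matrix.smul_apply, smul_eq_mul,
      map_sum, Derivation.leibniz, Matrix.add_apply, sum_add_distrib]
    rw [add_comm]
    congr 1
    · exact sum_congr rfl fun i _ => by ring
    · rw [sum_comm]
      refine sum_congr rfl fun i _ => ?_
      rw [hD, mul_sum]
      exact sum_congr rfl fun j _ => by ring
  have WW : ∀ I K, W I * W K = ∑ A, ∑ B, (J A I * J B K) • (Γ A * Γ B) := by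
    intro I K
    simp only [hW, pullConn, sum_mul, mul_sum, Matrix.smul_mul, Matrix.mul_smul,
      smul_smul]
    exact sum_swap fun i j => by rw [mul_comm (J j K)]
  have sw : ∀ X : ι → ι → Matrix ι ι R, ∑ A, ∑ B, (J A K * J B I) • X A B
      = ∑ A, ∑ B, (J A I * J B K) • X B A := by
    intro X
    exact sum_swap fun i j => by rw [mul_comm]
  rw [dW, dW, WW, WW, sw, sw]
  simp only [curv, smul_add, smul_sub, sum_add_distrib, sum_sub_distrib,
    hdJ K _ I]
  abel

lemma ric_frame (hJ : J * Ji = 1) (hD : ∀ I x, D I x = ∑ A, J A I * e A x)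
    (hdJ : ∀ I A K, D I (J A K) = D K (J A I)) (hc : Commutes D) (h : IsLC e G Γ) (I K : ι) :
    ric D (frameLC D J Ji Γ) I K = ∑ A, ∑ B, J A I * J B K * ric e Γ A B := by
  rw [ric_eq_curv (isLC_frame hJ hD hdJ h).torsion]
  simp only [curv_frame hJ hD hdJ hc, ric_eq_curv h.torsion]
  have t : ∀ L, (Ji * (∑ A, ∑ B, (J A L * J B K) • curv e Γ A B) * J) L I
      = ∑ A, ∑ B, ∑ P, ∑ Q, Ji L P * J A L * (J B K * J Q I * curv e Γ A B P Q) := by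
    intro L
    simp only [mul_sum, sum_mul, Matrix.sum_apply, Matrix.mul_smul,
      Matrix.smul_apply, smul_eq_mul, Matrix.mul_apply]
    rw [sum_comm]
    refine sum_congr rfl fun _ _ => ?_
    rw [sum_comm]
    refine sum_congr rfl fun _ _ => ?_
    exact sum_swap fun _ _ => by ring
  simp only [t]
  have hj : ∀ A P, ∑ L, Ji L P * J A L = (1 : Matrix ι ι R) A P := by
    intro A P
    rw [← hJ, Matrix.mul_apply]
    exact sum_congr rfl fun _ _ => mul_comm _ _
  calc ∑ L, ∑ A, ∑ B, ∑ P, ∑ Q, Ji L P * J A L * (J B K * J Q I * curv e Γ A B P Q)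
      = ∑ A, ∑ B, ∑ P, ∑ Q, ∑ L, Ji L P * J A L * (J B K * J Q I * curv e Γ A B P Q) := by
        rw [sum_comm]
        refine sum_congr rfl fun _ _ => ?_
        rw [sum_comm]
        refine sum_congr rfl fun _ _ => ?_
        rw [sum_comm]
        exact sum_congr rfl fun _ _ => sum_comm
    _ = ∑ A, ∑ B, ∑ Q, J B K * J Q I * curv e Γ A B A Q := by
        simp only [← sum_mul, hj]
        refine sum_congr₂ fun _ _ => ?_
        rw [sum_comm]
        refine sum_congr rfl fun _ _ => ?_
        simp [Matrix.one_apply]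
    _ = _ := by
        simp only [mul_sum]
        rw [sum_congr rfl fun A _ => sum_comm, sum_comm]
        refine sum_congr rfl fun _ _ => ?_
        exact sum_swap fun _ _ => by ring

lemma hes_frame (hJ : J * Ji = 1) (hD : ∀ I x, D I x = ∑ A, J A I * e A x) (f : R) (I K : ι) :
    hes D (frameLC D J Ji Γ) f I K = ∑ A, ∑ B, J A I * J B K * hes e Γ f A B := by
  have s : ∑ L, frameLC D J Ji Γ I L K * D L f
      = ∑ A, (J.map (D I) + pullConn J Γ I * J) A K * e A f := by
    rw [← mul_frameLC hJ]
    simp only [hD _ f, Matrix.mul_apply, sum_mul, mul_sum]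
    exact sum_swap fun _ _ => by ring
  have d : D I (D K f) = ∑ B, D I (J B K) * e B f
      + ∑ A, ∑ B, J A I * J B K * e A (e B f) := by
    rw [hD K f]
    simp only [map_sum, Derivation.leibniz, smul_eq_mul, sum_add_distrib]
    rw [add_comm]
    congr 1
    · exact sum_congr rfl fun i _ => by ring
    · rw [sum_comm]
      refine sum_congr rfl fun i _ => ?_
      rw [hD, mul_sum]
      exact sum_congr rfl fun j _ => by ring
  have w : ∑ A, (pullConn J Γ I * J) A K * e A f
      = ∑ A, ∑ B, J A I * J B K * ∑ C, Γ A C B * e C f := by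
    simp only [pullConn_mul_apply, sum_mul, mul_sum]
    rw [sum_comm]
    refine sum_congr rfl fun _ _ => ?_
    exact sum_swap fun _ _ => by ring
  rw [hes, s, d]
  simp only [Matrix.add_apply, Matrix.map_apply, add_mul, sum_add_distrib, w, hes, mul_sub,
    sum_sub_distrib]
  ring

lemma trc_frame (hJ : J * Ji = 1) (T : ι → ι → R) :
    trc (Ji * Gi * Ji.transpose) (fun I K => ∑ A, ∑ B, J A I * J B K * T A B) = trc Gi T := by
  have m : ∀ (X : Matrix ι ι R) (T : ι → ι → R), trc X T
      = Matrix.trace (X * (Matrix.of T).transpose) := by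
    intro X T
    simp [trc, Matrix.trace, Matrix.mul_apply]
  have hT : Matrix.of (fun I K => ∑ A, ∑ B, J A I * J B K * T A B)
      = J.transpose * Matrix.of T * J := by
    ext I K
    simp only [Matrix.mul_apply, Matrix.of_apply, Matrix.transpose_apply, sum_mul]
    exact sum_swap fun _ _ => by ring
  rw [m, m, hT]
  have t : Ji.transpose * J.transpose = 1 := by
    rw [← Matrix.transpose_mul, hJ, Matrix.transpose_one]
  simp only [Matrix.transpose_mul, Matrix.transpose_transpose]
  calc Matrix.trace (Ji * Gi * Ji.transpose * (J.transpose * ((Matrix.of T).transpose * J)))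
      = Matrix.trace (Ji * (Gi * (Ji.transpose * J.transpose) * (Matrix.of T).transpose * J)) := by
        congr 1; noncomm_ring
    _ = _ := by rw [t, mul_one, Matrix.trace_mul_comm, mul_assoc, hJ, mul_one]

end Frame

section Pull

variable {R' : Type*} [CommRing R'] [Algebra 𝕜 R'] {D' : ι → Derivation 𝕜 R' R'} {σ : R →+* R'}
  {J Ji : Matrix ι ι R'}

/-- Naturality of the Ricci tensor of warped metrics under a change of coordinates `σ` with Jacobian
matrix `J`. -/
theorem warped_natural (hJ : J * Ji = 1) (hσ : ∀ I x, D' I (σ x) = ∑ A, J A I * σ (D A x))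
    (hdJ : ∀ I A K, D' I (J A K) = D' K (J A I)) (hc : Commutes D') (h : IsLC D G Γ)
    (hG : G * Gi = 1) :
    ∃ (Gi' : Matrix ι ι R') (Γ' : ι → Matrix ι ι R'),
      J.transpose * G.map σ * J * Gi' = 1 ∧ IsLC D' (J.transpose * G.map σ * J) Γ' ∧
      (∀ κ v f I K, warpedRic D' Γ' (σ κ) (σ v) (σ f) I K
        = ∑ A, ∑ B, J A I * J B K * σ (warpedRic D Γ κ v f A B)) ∧
      (∀ κ f, warpedFlat D' Gi' Γ' (σ κ) (σ f) = σ (warpedFlat D Gi Γ κ f)) := by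
  have hJ' : Ji * J = 1 := mul_eq_one_comm.mp hJ
  let e : ι → Derivation 𝕜 R' R' := fun A => ∑ I, Ji I A • D' I
  have he : ∀ A x, e A x = ∑ I, Ji I A * D' I x := by
    intro A x
    have : (∑ I, Ji I A • D' I) x = ∑ I, (Ji I A • D' I) x := by
      have := congrFun (map_sum Derivation.coeFnAddMonoidHom (fun I => Ji I A • D' I)
        Finset.univ) x
      rwa [Finset.sum_apply] at this
    simp only [e, this, Derivation.smul_apply, smul_eq_mul]
  have hD : ∀ I x, D' I x = ∑ A, J A I * e A x := by
    intro I x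
    simp only [he, mul_sum]
    rw [sum_comm]
    have : ∀ K, ∑ A, J A I * (Ji K A * D' K x) = (1 : Matrix ι ι R') K I * D' K x := by
      intro K
      rw [← hJ', Matrix.mul_apply, sum_mul]
      exact sum_congr rfl fun _ _ => by ring
    simp [this, Matrix.one_apply]
  have hs : ∀ A x, e A (σ x) = σ (D A x) := by
    intro A x
    simp only [he, hσ, mul_sum]
    rw [sum_comm]
    have : ∀ B, ∑ I, Ji I A * (J B I * σ (D B x)) = (1 : Matrix ι ι R') B A * σ (D B x) := by
      intro K
      rw [← hJ, Matrix.mul_apply, sum_mul]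
      exact sum_congr rfl fun _ _ => by ring
    simp [this, Matrix.one_apply]
  have hm := h.map hs
  have hGs : G.map σ * Gi.map σ = 1 := by
    rw [← Matrix.map_mul, hG]; ext i j; by_cases hh : i = j <;> simp [Matrix.one_apply, hh]
  have ht : J.transpose * Ji.transpose = 1 := by
    rw [← Matrix.transpose_mul, hJ', Matrix.transpose_one]
  refine ⟨Ji * Gi.map σ * Ji.transpose, frameLC D' J Ji fun I => (Γ I).map σ, ?_,
    isLC_frame hJ hD hdJ hm, ?_, ?_⟩
  · calc J.transpose * G.map σ * J * (Ji * Gi.map σ * Ji.transpose)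
        = J.transpose * (G.map σ * (J * Ji) * Gi.map σ) * Ji.transpose := by noncomm_ring
      _ = 1 := by rw [hJ, mul_one, hGs, mul_one, ht]
  · intro κ v f I K
    rw [warpedRic, ric_frame hJ hD hdJ hc hm, hes_frame hJ hD]
    simp only [ric_map hs, hes_map hs, mul_sum, ← sum_sub_distrib, warpedRic, map_sub,
      map_mul]
    exact sum_congr₂ fun _ _ => by ring
  · intro κ f
    have e1 : hes D' (frameLC D' J Ji fun I => (Γ I).map σ) (σ f)
        = fun I K => ∑ A, ∑ B, J A I * J B K * σ (hes D Γ f A B) := by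
      funext I K; rw [hes_frame hJ hD]; simp only [hes_map hs]
    have e2 : grad2 D' (Ji * Gi.map σ * Ji.transpose) (σ f) = σ (grad2 D Gi f) := by
      rw [← grad2_map hs]
      change trc _ _ = trc _ _
      rw [← trc_frame (Gi := Gi.map σ) hJ]
      congr 1; funext I K
      rw [hD I, hD K, Finset.sum_mul_sum]
      exact sum_congr₂ fun _ _ => by ring
    rw [warpedFlat, e1, trc_frame hJ, e2, trc_map, warpedFlat]
    simp

end Pull

end Naturality

end

section

section Series

variable {A : Type*} [CommRing A]

lemma coeff_mul_of_dvd {s : ℕ} (P : A⟦X⟧) {Q : A⟦X⟧} (h : X ^ s ∣ Q) :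
    coeff s (P * Q) = constantCoeff P * coeff s Q := by
  obtain ⟨w, rfl⟩ := h
  rw [mul_left_comm, coeff_X_pow_mul', coeff_X_pow_mul']
  simp

lemma coeff_mul_of_dvd' {s : ℕ} {P : A⟦X⟧} (Q : A⟦X⟧) (h : X ^ s ∣ P) :
    coeff s (P * Q) = coeff s P * constantCoeff Q := by
  rw [mul_comm, coeff_mul_of_dvd Q h, mul_comm]

lemma coeff_of_dvd_succ {s : ℕ} {P : A⟦X⟧} (h : X ^ (s + 1) ∣ P) : coeff s P = 0 :=
  X_pow_dvd_iff.mp h s (Nat.lt_succ_self s)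

lemma dvd_succ_of_coeff {s : ℕ} {P : A⟦X⟧} (h : X ^ s ∣ P) (h0 : coeff s P = 0) :
    X ^ (s + 1) ∣ P := by
  rw [X_pow_dvd_iff] at h ⊢
  intro m hm
  rcases Nat.lt_succ_iff_lt_or_eq.mp hm with hm | rfl
  · exact h m hm
  · exact h0

lemma X_mul_dvd_of_dvd {s : ℕ} {P : A⟦X⟧} (h : X ^ s ∣ P) : X ^ (s + 1) ∣ X * P := by
  rw [pow_succ']; exact mul_dvd_mul_left _ h

lemma eq_of_forall_dvd {P Q : A⟦X⟧} (h : ∀ s, X ^ s ∣ P - Q) : P = Q := by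
  ext s
  have := coeff_of_dvd_succ (h (s + 1))
  rw [map_sub] at this
  exact sub_eq_zero.mp this

lemma coeff_X_mul_derivative (s : ℕ) (P : A⟦X⟧) :
    coeff s (X * derivative A P) = s * coeff s P := by
  cases s with
  | zero => simp
  | succ s => rw [coeff_succ_X_mul, coeff_derivative]; push_cast; ring

variable {𝕜 : Type*} [CommRing 𝕜] [Algebra 𝕜 A]

/-- A derivation of the coefficients, extended to power series. -/
def liftD (δ : Derivation 𝕜 A A) : Derivation 𝕜 A⟦X⟧ A⟦X⟧ :=
  Derivation.mk'
    { toFun := fun P => PowerSeries.mk fun m => δ (coeff m P)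
      map_add' := fun P Q => by ext; simp
      map_smul' := fun c P => by
        ext m
        have : ∀ Q : A⟦X⟧, coeff m (c • Q) = c • coeff m Q := fun Q => rfl
        simp [this] }
    (fun P Q => by
      ext m
      simp only [LinearMap.coe_mk, AddHom.coe_mk, coeff_mk, coeff_mul, map_sum,
        Derivation.leibniz, smul_eq_mul, map_add, sum_add_distrib]
      congr 1
      rw [← Finset.Nat.sum_antidiagonal_swap]
      simp only [Prod.fst_swap, Prod.snd_swap])

@[simp] lemma coeff_liftD (δ : Derivation 𝕜 A A) (m : ℕ) (P : A⟦X⟧) :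
    coeff m (liftD δ P) = δ (coeff m P) := by
  simp [liftD]

@[simp] lemma constantCoeff_liftD (δ : Derivation 𝕜 A A) (P : A⟦X⟧) :
    constantCoeff (liftD δ P) = δ (constantCoeff P) := by
  rw [← coeff_zero_eq_constantCoeff_apply, coeff_liftD, coeff_zero_eq_constantCoeff_apply]

lemma liftD_C (δ : Derivation 𝕜 A A) (a : A) : liftD δ (C a) = C (δ a) := by
  ext m; rw [coeff_liftD, coeff_C, coeff_C]; split_ifs <;> simp

lemma liftD_X (δ : Derivation 𝕜 A A) : liftD δ (X : A⟦X⟧) = 0 := by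
  ext m; rw [coeff_liftD, coeff_X]; split_ifs <;> simp

/-- The formal derivative, as a derivation over the scalars. -/
def derivX (𝕜 A : Type*) [CommRing A] [CommRing 𝕜] [Algebra 𝕜 A] :
    Derivation 𝕜 A⟦X⟧ A⟦X⟧ :=
  (derivative A).restrictScalars 𝕜

lemma derivX_apply (P : A⟦X⟧) : derivX 𝕜 A P = derivative A P := rfl

@[simp] lemma coeff_derivX (m : ℕ) (P : A⟦X⟧) :
    coeff m (derivX 𝕜 A P) = coeff (m + 1) P * (m + 1) := by
  rw [derivX_apply, coeff_derivative]

@[simp] lemma constantCoeff_derivX (P : A⟦X⟧) :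
    constantCoeff (derivX 𝕜 A P) = coeff 1 P := by
  rw [← coeff_zero_eq_constantCoeff_apply, coeff_derivX]; simp

lemma derivX_C (a : A) : derivX 𝕜 A (C a) = 0 := by
  ext m; simp

lemma derivX_X : derivX 𝕜 A (X : A⟦X⟧) = 1 := by
  ext m; rw [coeff_derivX, coeff_X, coeff_one]; by_cases h : m = 0 <;> simp [h]

lemma liftD_derivX (δ : Derivation 𝕜 A A) (P : A⟦X⟧) :
    liftD δ (derivX 𝕜 A P) = derivX 𝕜 A (liftD δ P) := by
  ext m
  have : δ ((m : A) + 1) = 0 := by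
    have : ((m : A) + 1) = ((m + 1 : ℕ) : A) := by push_cast; ring
    rw [this]; exact Derivation.map_natCast _ _
  simp only [coeff_liftD, coeff_derivX, Derivation.leibniz, smul_eq_mul, this]; ring

lemma dvd_liftD {s : ℕ} (δ : Derivation 𝕜 A A) {P : A⟦X⟧} (h : X ^ s ∣ P) :
    X ^ s ∣ liftD δ P := by
  rw [X_pow_dvd_iff] at h ⊢
  intro m hm; rw [coeff_liftD, h m hm, map_zero]

lemma dvd_derivX {s : ℕ} {P : A⟦X⟧} (h : X ^ (s + 1) ∣ P) : X ^ s ∣ derivX 𝕜 A P := by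
  rw [X_pow_dvd_iff] at h ⊢
  intro m hm; rw [coeff_derivX, h (m + 1) (by omega), zero_mul]

end Series

/-! ### The formal ambient space -/

/-- Functions on the base with coordinates `(t, x)`: a ring with derivations `∂_t`, `∂_i` and the
coordinate `t`, which is invertible. -/
structure AmbBase (𝕜 A : Type*) [CommRing 𝕜] [CommRing A] [Algebra 𝕜 A] (n : ℕ) where
  /-- the derivation `∂_t` -/
  d0 : Derivation 𝕜 A A
  /-- the derivations `∂_i` -/
  d : Fin n → Derivation 𝕜 A A
  d0_d : ∀ i x, d0 (d i x) = d i (d0 x)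
  d_d : ∀ i j x, d i (d j x) = d j (d i x)
  /-- the coordinate `t` -/
  t : A
  /-- its inverse -/
  ti : A
  t_mul : t * ti = 1
  d0_t : d0 t = 1
  d_t : ∀ i, d i t = 0

lemma sum_idx {R : Type*} [AddCommMonoid R] {n : ℕ} (F : Idx n → R) :
    ∑ I, F I = F (idx0 n) + (∑ i, F (idxM i) + F (idxInf n)) := by
  simp [Fintype.sum_sum_type]

lemma idx_cases {n : ℕ} {P : Idx n → Prop} (h0 : P (idx0 n)) (hM : ∀ i, P (idxM i))
    (hInf : P (idxInf n)) : ∀ I, P I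
  | Sum.inl () => h0
  | Sum.inr (Sum.inl i) => hM i
  | Sum.inr (Sum.inr ()) => hInf

namespace AmbBase

variable {𝕜 A : Type*} [CommRing 𝕜] [CommRing A] [Algebra 𝕜 A] {n : ℕ} (b : AmbBase 𝕜 A n)

/-- The coordinate derivations of the formal ambient space. -/
def D : Idx n → Derivation 𝕜 A⟦X⟧ A⟦X⟧
  | Sum.inl _ => liftD b.d0
  | Sum.inr (Sum.inl i) => liftD (b.d i)
  | Sum.inr (Sum.inr _) => derivX 𝕜 A

@[simp] lemma D_zero : b.D (idx0 n) = liftD b.d0 := rfl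
@[simp] lemma D_M (i : Fin n) : b.D (idxM i) = liftD (b.d i) := rfl
@[simp] lemma D_inf : b.D (idxInf n) = derivX 𝕜 A := rfl

lemma commutes : Commutes b.D := by
  have h0 : ∀ i x, liftD b.d0 (liftD (b.d i) x) = liftD (b.d i) (liftD b.d0 x) := fun i x => by
    ext; simp [b.d0_d]
  intro I J x
  rcases I with _ | i | _ <;> rcases J with _ | j | _
  · rfl
  · exact h0 j x
  · exact liftD_derivX _ _
  · exact (h0 i x).symm
  · change liftD (b.d i) (liftD (b.d j) x) = liftD (b.d j) (liftD (b.d i) x)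
    ext; simp [b.d_d i j]
  · exact liftD_derivX _ _
  · exact (liftD_derivX _ _).symm
  · exact (liftD_derivX _ _).symm
  · rfl

/-- The coordinate `t`. -/
def τ : A⟦X⟧ := C b.t

/-- The inverse of the coordinate `t`. -/
def τi : A⟦X⟧ := C b.ti

lemma τ_mul : b.τ * b.τi = 1 := by rw [τ, τi, ← map_mul, b.t_mul, map_one]

lemma τ_cancel {x y : A⟦X⟧} (h : b.τ * x = b.τ * y) : x = y := by
  linear_combination b.τi * h + (y - x) * b.τ_mul

lemma t_cancel {x y : A} (h : b.t * x = b.t * y) : x = y := by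
  linear_combination b.ti * h + (y - x) * b.t_mul

@[simp] lemma constantCoeff_τ : constantCoeff b.τ = b.t := by simp [τ]
@[simp] lemma constantCoeff_τi : constantCoeff b.τi = b.ti := by simp [τi]

@[simp] lemma d0_τ : liftD b.d0 b.τ = 1 := by rw [τ, liftD_C, b.d0_t, map_one]
@[simp] lemma d_τ (i : Fin n) : liftD (b.d i) b.τ = 0 := by rw [τ, liftD_C, b.d_t, map_zero]
@[simp] lemma derivX_τ : derivX 𝕜 A b.τ = 0 := derivX_C _

lemma d0_τ_mul {x : A⟦X⟧} (hx : liftD b.d0 x = 0) : liftD b.d0 (b.τ * x) = x := by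
  simp [hx]

lemma d0_τ_sq_mul {x : A⟦X⟧} (hx : liftD b.d0 x = 0) :
    liftD b.d0 (b.τ ^ 2 * x) = 2 * b.τ * x := by
  simp [hx, Derivation.leibniz_pow]; ring

lemma d_τ_mul (i : Fin n) (x : A⟦X⟧) : liftD (b.d i) (b.τ * x) = b.τ * liftD (b.d i) x := by
  simp

lemma d_τ_sq_mul (i : Fin n) (x : A⟦X⟧) :
    liftD (b.d i) (b.τ ^ 2 * x) = b.τ ^ 2 * liftD (b.d i) x := by
  simp [Derivation.leibniz_pow]

lemma derivX_τ_mul (x : A⟦X⟧) : derivX 𝕜 A (b.τ * x) = b.τ * derivX 𝕜 A x := by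
  simp

lemma derivX_τ_sq_mul (x : A⟦X⟧) : derivX 𝕜 A (b.τ ^ 2 * x) = b.τ ^ 2 * derivX 𝕜 A x := by
  simp [Derivation.leibniz_pow]

/-- The generator `t ∂_t` of the dilatations. -/
def T : Idx n → A⟦X⟧
  | Sum.inl _ => b.τ
  | Sum.inr _ => 0

@[simp] lemma T_zero : b.T (idx0 n) = b.τ := rfl
@[simp] lemma T_inr (i) : b.T (Sum.inr i) = 0 := rfl

lemma sum_mul_T (F : Idx n → A⟦X⟧) : ∑ K, F K * b.T K = F (idx0 n) * b.τ := by
  rw [sum_idx]; simp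

/-- A homogeneous metric in Weyl-normal form. -/
def normalG (h0 : A⟦X⟧) (h1 : Fin n → A⟦X⟧) (q : BaseMat n A⟦X⟧)
    (α : Fin n → A⟦X⟧) : AmbMat n A⟦X⟧ :=
  Matrix.of fun I J => match I, J with
  | Sum.inl _, Sum.inl _ => h0
  | Sum.inl _, Sum.inr (Sum.inl j) => b.τ * h1 j
  | Sum.inl _, Sum.inr (Sum.inr _) => b.τ
  | Sum.inr (Sum.inl i), Sum.inl _ => b.τ * h1 i
  | Sum.inr (Sum.inl i), Sum.inr (Sum.inl j) => b.τ ^ 2 * q i j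
  | Sum.inr (Sum.inl i), Sum.inr (Sum.inr _) => b.τ ^ 2 * α i
  | Sum.inr (Sum.inr _), Sum.inl _ => b.τ
  | Sum.inr (Sum.inr _), Sum.inr (Sum.inl j) => b.τ ^ 2 * α j
  | Sum.inr (Sum.inr _), Sum.inr (Sum.inr _) => 0

section Entries

variable (h0 : A⟦X⟧) (h1 : Fin n → A⟦X⟧) (q : BaseMat n A⟦X⟧) (α : Fin n → A⟦X⟧)
  (i j : Fin n)

@[simp] lemma normalG_00 : b.normalG h0 h1 q α (idx0 n) (idx0 n) = h0 := rfl
@[simp] lemma normalG_0M : b.normalG h0 h1 q α (idx0 n) (idxM j) = b.τ * h1 j := rfl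
@[simp] lemma normalG_0inf : b.normalG h0 h1 q α (idx0 n) (idxInf n) = b.τ := rfl
@[simp] lemma normalG_M0 : b.normalG h0 h1 q α (idxM i) (idx0 n) = b.τ * h1 i := rfl
@[simp] lemma normalG_MM : b.normalG h0 h1 q α (idxM i) (idxM j) = b.τ ^ 2 * q i j := rfl
@[simp] lemma normalG_Minf : b.normalG h0 h1 q α (idxM i) (idxInf n) = b.τ ^ 2 * α i := rfl
@[simp] lemma normalG_inf0 : b.normalG h0 h1 q α (idxInf n) (idx0 n) = b.τ := rfl
@[simp] lemma normalG_infM : b.normalG h0 h1 q α (idxInf n) (idxM j) = b.τ ^ 2 * α j := rfl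
@[simp] lemma normalG_infinf : b.normalG h0 h1 q α (idxInf n) (idxInf n) = 0 := rfl

end Entries

variable {h0 : A⟦X⟧} {h1 : Fin n → A⟦X⟧} {q : BaseMat n A⟦X⟧} {α : Fin n → A⟦X⟧}

lemma isHomothetic (hh0 : liftD b.d0 h0 = 0) (hh1 : ∀ i, liftD b.d0 (h1 i) = 0)
    (hq : ∀ i j, liftD b.d0 (q i j) = 0) (hα : ∀ i, liftD b.d0 (α i) = 0) :
    IsHomothetic b.D (b.normalG h0 h1 q α) b.T := by
  intro I J
  induction I using idx_cases <;> induction J using idx_cases <;>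
    simp [hh0, hh1, hq, hα, Derivation.leibniz, Derivation.leibniz_pow] <;> ring

end AmbBase

end

section

lemma isUnit_two_of_field (𝕜 : Type*) {R : Type*} [Field 𝕜] [CharZero 𝕜] [CommRing R]
    [Algebra 𝕜 R] : IsUnit (2 : R) := by
  have := (IsUnit.mk0 (2 : 𝕜) two_ne_zero).map (algebraMap 𝕜 R)
  rwa [map_ofNat] at this

variable {𝕜 A : Type*} [Field 𝕜] [CharZero 𝕜] [CommRing A] [Algebra 𝕜 A] {n : ℕ}

/-- `Γ` and `Gi` are the Levi-Civita symbols and the inverse of the homogeneous metric in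
Weyl-normal form with coefficients `h0, h1, q, α`, which extends `g`. -/
structure IsNormalData (b : AmbBase 𝕜 A n) (g gi : BaseMat n A) (h0 : A⟦X⟧)
    (h1 : Fin n → A⟦X⟧) (q : BaseMat n A⟦X⟧) (α : Fin n → A⟦X⟧)
    (Gi : AmbMat n A⟦X⟧) (Γ : Idx n → AmbMat n A⟦X⟧) : Prop where
  lc : IsLC b.D (b.normalG h0 h1 q α) Γ
  inv : b.normalG h0 h1 q α * Gi = 1
  g_inv : g * gi = 1
  cc_h0 : constantCoeff h0 = 0
  cc_h1 : ∀ i, constantCoeff (h1 i) = 0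
  cc_q : ∀ i j, constantCoeff (q i j) = g i j
  d0_h0 : liftD b.d0 h0 = 0
  d0_h1 : ∀ i, liftD b.d0 (h1 i) = 0
  d0_q : ∀ i j, liftD b.d0 (q i j) = 0
  d0_α : ∀ i, liftD b.d0 (α i) = 0

namespace IsNormalData

variable {b : AmbBase 𝕜 A n} {g gi : BaseMat n A} {h0 : A⟦X⟧}
  {h1 : Fin n → A⟦X⟧} {q : BaseMat n A⟦X⟧} {α : Fin n → A⟦X⟧}
  {Gi : AmbMat n A⟦X⟧} {Γ : Idx n → AmbMat n A⟦X⟧}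
  (h : IsNormalData b g gi h0 h1 q α Gi Γ)
include h

lemma inv' : Gi * b.normalG h0 h1 q α = 1 := mul_eq_one_comm.mp h.inv

lemma homothetic : IsHomothetic b.D (b.normalG h0 h1 q α) b.T :=
  b.isHomothetic h.d0_h0 h.d0_h1 h.d0_q h.d0_α

lemma Gi_symm (I J : Idx n) : Gi I J = Gi J I := h.lc.inv_apply h.inv I J

lemma row_zero (K : Idx n) :
    Gi K (idx0 n) * h0 + (∑ i, Gi K (idxM i) * (b.τ * h1 i) + Gi K (idxInf n) * b.τ)
      = (1 : AmbMat n A⟦X⟧) K (idx0 n) := by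
  rw [← h.inv', Matrix.mul_apply, sum_idx]; rfl

lemma row_M (K : Idx n) (j : Fin n) :
    Gi K (idx0 n) * (b.τ * h1 j) + (∑ i, Gi K (idxM i) * (b.τ ^ 2 * q i j)
      + Gi K (idxInf n) * (b.τ ^ 2 * α j))
      = (1 : AmbMat n A⟦X⟧) K (idxM j) := by
  rw [← h.inv', Matrix.mul_apply, sum_idx]; rfl

lemma cc_Gi_inf (K : Idx n) :
    constantCoeff (Gi K (idxInf n)) = if K = idx0 n then b.ti else 0 := by
  have e := congrArg constantCoeff (h.row_zero K)
  simp only [map_add, map_mul, map_sum, h.cc_h0, h.cc_h1, mul_zero, sum_const_zero, zero_add,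
    b.constantCoeff_τ, Matrix.one_apply] at e
  apply b.t_cancel
  rw [mul_comm, e]
  split_ifs
  · rw [b.t_mul, map_one]
  · simp

@[simp] lemma cc_Gi_0inf : constantCoeff (Gi (idx0 n) (idxInf n)) = b.ti := by
  rw [h.cc_Gi_inf]; simp

@[simp] lemma cc_Gi_Minf (i : Fin n) : constantCoeff (Gi (idxM i) (idxInf n)) = 0 := by
  rw [h.cc_Gi_inf]; simp

@[simp] lemma cc_Gi_infinf : constantCoeff (Gi (idxInf n) (idxInf n)) = 0 := by
  rw [h.cc_Gi_inf]; simp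

@[simp] lemma cc_Gi_inf0 : constantCoeff (Gi (idxInf n) (idx0 n)) = b.ti := by
  rw [h.Gi_symm]; exact h.cc_Gi_0inf

@[simp] lemma cc_Gi_infM (i : Fin n) : constantCoeff (Gi (idxInf n) (idxM i)) = 0 := by
  rw [h.Gi_symm]; exact h.cc_Gi_Minf i

lemma gi_inv : gi * g = 1 := mul_eq_one_comm.mp h.g_inv

lemma g_symm (i j : Fin n) : g i j = g j i := by
  have e := congrArg constantCoeff (h.lc.symm (idxM i) (idxM j))
  simp only [b.normalG_MM, map_mul, map_pow, b.constantCoeff_τ, h.cc_q] at e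
  exact b.t_cancel (b.t_cancel (by linear_combination e))

@[simp] lemma cc_Gi_MM (i j : Fin n) :
    constantCoeff (Gi (idxM i) (idxM j)) = b.ti ^ 2 * gi i j := by
  have e : ∀ j, ∑ l, constantCoeff (Gi (idxM i) (idxM l)) * g l j * b.t ^ 2
      = (1 : BaseMat n A) i j := by
    intro j
    have e := congrArg constantCoeff (h.row_M (idxM i) j)
    simp only [map_add, map_mul, map_sum, h.cc_h1, mul_zero, zero_add, map_pow, h.cc_Gi_Minf,
      zero_mul, add_zero, b.constantCoeff_τ, h.cc_q] at e
    have r : constantCoeff ((1 : AmbMat n A⟦X⟧) (idxM i) (idxM j))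
        = (1 : BaseMat n A) i j := by
      by_cases hij : i = j <;> simp [Matrix.one_apply, hij]
    rw [← r, ← e]
    exact sum_congr rfl fun _ _ => by ring
  have e2 : ∑ k, (∑ l, constantCoeff (Gi (idxM i) (idxM l)) * g l k * b.t ^ 2) * gi k j = gi i j := by
    simp [e, Matrix.one_apply]
  have e3 : ∑ k, (∑ l, constantCoeff (Gi (idxM i) (idxM l)) * g l k * b.t ^ 2) * gi k j
      = b.t ^ 2 * ∑ l, constantCoeff (Gi (idxM i) (idxM l)) * (g * gi) l j := by
    simp only [sum_mul, Matrix.mul_apply, mul_sum]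
    exact sum_swap fun _ _ => by ring
  rw [e3, h.g_inv] at e2
  simp only [Matrix.one_apply, mul_ite, mul_one, mul_zero, Finset.sum_ite_eq', Finset.mem_univ, if_true] at e2
  rw [← e2]
  linear_combination (-(1 + b.t * b.ti) * constantCoeff (Gi (idxM i) (idxM j))) * b.t_mul

lemma two_tau_mul_Γ (P K : Idx n) :
    2 * (b.D P (b.T K) + b.τ * Γ P K (idx0 n))
      = 2 * (1 : AmbMat n A⟦X⟧) K P
        + curlUp b.D (b.normalG h0 h1 q α) Gi b.T P K := by
  rw [← two_covVec h.lc h.inv h.homothetic, covVec, b.sum_mul_T]; ring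

lemma trace_curl : ∑ K, curlUp b.D (b.normalG h0 h1 q α) Gi b.T K K = 0 :=
  (isUnit_two_of_field 𝕜).mul_left_cancel (by rw [trace_curlUp h.lc h.inv, mul_zero])

/-- The trace of the Levi-Civita symbols in the direction `t`. -/
lemma trace_Γ : b.τ * ∑ K, Γ K K (idx0 n) = n + 1 := by
  have e : ∑ K, 2 * (b.D K (b.T K) + b.τ * Γ K K (idx0 n)) = 2 * (n + 2) := by
    simp only [h.two_tau_mul_Γ, sum_add_distrib, h.trace_curl, ← mul_sum]
    simp; ring
  rw [← mul_sum, sum_add_distrib] at e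
  have e' := (isUnit_two_of_field 𝕜).mul_left_cancel e
  have e2 : ∑ K, b.D K (b.T K) = 1 := by rw [sum_idx]; simp
  rw [e2, ← mul_sum] at e'
  linear_combination e'

lemma cc_Γ_inf (i j : Fin n) : constantCoeff (Γ (idxM i) (idxInf n) (idxM j)) = -g i j := by
  have e := h.lc.upper h.inv (idxInf n) (idxM i) (idxM j)
  rw [sum_idx, b.D_zero, b.normalG_MM, b.d0_τ_sq_mul (h.d0_q i j)] at e
  have e := congrArg constantCoeff e
  simp only [map_add, map_mul, map_sum, map_sub, h.cc_Gi_inf0, h.cc_Gi_infM, h.cc_Gi_infinf,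
    zero_mul, sum_const_zero, add_zero, b.D_M, constantCoeff_liftD, b.normalG_M0,
    h.cc_h1, mul_zero, map_zero, b.constantCoeff_τ, h.cc_q, zero_sub, map_ofNat] at e
  refine (isUnit_two_of_field 𝕜).mul_left_cancel ?_
  linear_combination e - 2 * g i j * b.t_mul

/-! The leading coefficients of the exterior derivative of the one-form dual to `t ∂_t`. -/

section Curl

variable {s : ℕ} {a : A⟦X⟧} {β : Fin n → A⟦X⟧}
  (e0 : h0 = 2 * X + X ^ (s + 1) * a) (e1 : ∀ i, h1 i = X ^ (s + 1) * β i)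
include e0 e1

lemma curl_0inf : curl b.D (b.normalG h0 h1 q α) b.T (idx0 n) (idxInf n)
    = -(b.τ * derivX 𝕜 A (X ^ (s + 1) * a)) := by
  rw [curl, b.sum_mul_T, b.sum_mul_T, b.normalG_inf0, b.normalG_00, b.D_zero, b.D_inf, e0]
  have : derivX 𝕜 A (2 * X : A⟦X⟧) = 2 := by
    rw [two_mul, map_add, derivX_X]; norm_num
  rw [mul_comm (2 * X + X ^ (s + 1) * a) b.τ, b.derivX_τ_mul, map_add, this, Derivation.leibniz, b.d0_τ]
  simp; ring

lemma curl_Minf (i : Fin n) : curl b.D (b.normalG h0 h1 q α) b.T (idxM i) (idxInf n)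
    = -(b.τ ^ 2 * derivX 𝕜 A (X ^ (s + 1) * β i)) := by
  rw [curl, b.sum_mul_T, b.sum_mul_T, b.normalG_inf0, b.normalG_M0, b.D_M, b.D_inf, e1,
    show b.τ * (X ^ (s + 1) * β i) * b.τ = b.τ ^ 2 * (X ^ (s + 1) * β i) by ring,
    b.derivX_τ_sq_mul, b.d_τ_mul, b.d_τ]
  ring

lemma curl_0M (i : Fin n) : curl b.D (b.normalG h0 h1 q α) b.T (idx0 n) (idxM i)
    = X ^ (s + 1) * (b.τ * (2 * β i - liftD (b.d i) a)) := by
  have hX : ∀ δ : Derivation 𝕜 A A, liftD δ (X ^ (s + 1) : A⟦X⟧) = 0 := fun δ => by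
    rw [Derivation.leibniz_pow, liftD_X]; simp
  have h2 : ∀ δ : Derivation 𝕜 A A, liftD δ (2 * X : A⟦X⟧) = 0 := fun δ => by
    rw [two_mul, map_add, liftD_X, add_zero]
  have hd := h.d0_h1 i
  rw [e1] at hd
  rw [curl, b.sum_mul_T, b.sum_mul_T, b.normalG_00, b.normalG_M0, b.D_M, b.D_zero, e0, e1,
    show b.τ * (X ^ (s + 1) * β i) * b.τ = b.τ ^ 2 * (X ^ (s + 1) * β i) by ring,
    b.d0_τ_sq_mul hd, mul_comm (2 * X + X ^ (s + 1) * a) b.τ, b.d_τ_mul, map_add, h2, Derivation.leibniz, hX]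
  simp only [smul_eq_mul]; ring

lemma dvd_curl_MM (i j : Fin n) :
    X ^ (s + 1) ∣ curl b.D (b.normalG h0 h1 q α) b.T (idxM i) (idxM j) := by
  rw [curl, b.sum_mul_T, b.sum_mul_T, b.normalG_M0, b.normalG_M0, b.D_M, b.D_M, e1, e1]
  refine dvd_sub (dvd_liftD _ ?_) (dvd_liftD _ ?_)
  · exact ⟨b.τ * β j * b.τ, by ring⟩
  · exact ⟨b.τ * β i * b.τ, by ring⟩

end Curl

end IsNormalData

end

section

variable {𝕜 A : Type*} [Field 𝕜] [CharZero 𝕜] [CommRing A] [Algebra 𝕜 A] {n : ℕ}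

lemma curl_swap {R ι : Type*} [CommRing R] [Algebra 𝕜 R] [Fintype ι] (D : ι → Derivation 𝕜 R R)
    (G : Matrix ι ι R) (T : ι → R) (I J : ι) : curl D G T J I = -curl D G T I J := by
  rw [curl, curl]; ring

lemma curl_self {R ι : Type*} [CommRing R] [Algebra 𝕜 R] [Fintype ι] (D : ι → Derivation 𝕜 R R)
    (G : Matrix ι ι R) (T : ι → R) (I : ι) : curl D G T I I = 0 := by
  rw [curl]; ring

namespace IsNormalData

variable {b : AmbBase 𝕜 A n} {g gi : BaseMat n A} {h0 : A⟦X⟧}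
  {h1 : Fin n → A⟦X⟧} {q : BaseMat n A⟦X⟧} {α : Fin n → A⟦X⟧}
  {Gi : AmbMat n A⟦X⟧} {Γ : Idx n → AmbMat n A⟦X⟧}
  (h : IsNormalData b g gi h0 h1 q α Gi Γ)
include h

lemma cc_curlUp (J K : Idx n) :
    constantCoeff (curlUp b.D (b.normalG h0 h1 q α) Gi b.T J K)
      = ∑ L, constantCoeff (Gi K L)
        * constantCoeff (curl b.D (b.normalG h0 h1 q α) b.T J L) := by
  simp [curlUp]

/-- The leading coefficient of the divergence equation for the exterior derivative of the one-form
dual to `t ∂_t`. -/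
lemma coeff_divergence {s : ℕ}
    (hdvd : ∀ J K, X ^ s ∣ curlUp b.D (b.normalG h0 h1 q α) Gi b.T J K)
    {κ₀ : A} {u v : A⟦X⟧} (hu : liftD b.d0 u = 0) (hu1 : constantCoeff u = 1)
    (hv : b.τ * u * v = 1) (J : Idx n)
    (hE : warpedRic b.D Γ (C κ₀) v (b.τ * u) (idx0 n) J = 0)
    (hM : ∀ i, coeff s (curlUp b.D (b.normalG h0 h1 q α) Gi b.T J (idxM i)) = 0)
    (hI : coeff s (curlUp b.D (b.normalG h0 h1 q α) Gi b.T J (idxInf n)) = 0) :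
    b.t * b.d0 (coeff s (curlUp b.D (b.normalG h0 h1 q α) Gi b.T J (idx0 n)))
      + b.t * (coeff (s + 1) (curlUp b.D (b.normalG h0 h1 q α) Gi b.T J (idxInf n)) * (s + 1))
      + (n + 1 + κ₀) * coeff s (curlUp b.D (b.normalG h0 h1 q α) Gi b.T J (idx0 n))
      - b.t * ∑ K, ∑ P, constantCoeff (Γ J K P)
          * coeff s (curlUp b.D (b.normalG h0 h1 q α) Gi b.T K P) = 0 := by
  set F := curlUp b.D (b.normalG h0 h1 q α) Gi b.T with hF
  have hf : ∑ K, b.T K * b.D K (b.τ * u) = b.τ * u := by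
    simp only [mul_comm (b.T _)]
    rw [b.sum_mul_T, b.D_zero, b.d0_τ_mul hu]; ring
  have w := warpedRic_homothetic h.lc h.inv b.commutes (isUnit_two_of_field 𝕜) h.homothetic
    (κ := C κ₀) (v := v) hf J
  rw [b.sum_mul_T, hE, zero_mul, mul_zero, ← hF] at w
  have w' := congrArg (coeff s) w
  simp only [sum_add_distrib, sum_sub_distrib, map_add, map_sub, map_sum, map_zero,
    fun K P => coeff_mul_of_dvd (Γ K K P) (hdvd J P),
    fun K P => coeff_mul_of_dvd (Γ J K P) (hdvd K P)] at w'
  have e1 : ∑ K, coeff s (b.D K (F J K)) = b.d0 (coeff s (F J (idx0 n)))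
      + coeff (s + 1) (F J (idxInf n)) * (s + 1) := by
    rw [sum_idx]
    simp [hM]
  have e2 : b.t * ∑ K, ∑ P, constantCoeff (Γ K K P) * coeff s (F J P)
      = (n + 1) * coeff s (F J (idx0 n)) := by
    rw [sum_comm, sum_idx]
    simp only [hM, hI, mul_zero, sum_const_zero, add_zero, ← sum_mul]
    have := congrArg constantCoeff h.trace_Γ
    simp only [map_mul, map_sum, b.constantCoeff_τ, map_add, map_natCast, map_one] at this
    rw [← mul_assoc, this]
  have e3 : b.t * coeff s (C κ₀ * v * ∑ K, F J K * b.D K (b.τ * u))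
      = κ₀ * coeff s (F J (idx0 n)) := by
    have cv : b.t * constantCoeff v = 1 := by
      have := congrArg constantCoeff hv
      simpa [hu1] using this
    rw [coeff_mul_of_dvd _ (dvd_sum fun K _ => (hdvd J K).mul_right _), map_sum, sum_idx,
      coeff_mul_of_dvd' _ (hdvd J _), coeff_mul_of_dvd' _ (hdvd J _), hI,
      sum_eq_zero fun i _ => by rw [coeff_mul_of_dvd' _ (hdvd J _), hM, zero_mul],
      b.D_zero, b.d0_τ_mul hu, hu1, map_mul, constantCoeff_C]
    linear_combination κ₀ * coeff s (F J (idx0 n)) * cv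
  rw [e1] at w'
  linear_combination -b.t * w' - e2 - e3

section Curl

variable {s : ℕ} {a : A⟦X⟧} {β : Fin n → A⟦X⟧}
  (e0 : h0 = 2 * X + X ^ (s + 1) * a) (e1 : ∀ i, h1 i = X ^ (s + 1) * β i)
include e0 e1

lemma dvd_curl (I J : Idx n) : X ^ s ∣ curl b.D (b.normalG h0 h1 q α) b.T I J := by
  have hs : (X : A⟦X⟧) ^ s ∣ X ^ (s + 1) := pow_dvd_pow _ (Nat.le_succ s)
  have a1 : X ^ s ∣ curl b.D (b.normalG h0 h1 q α) b.T (idx0 n) (idxInf n) := by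
    rw [h.curl_0inf e0 e1]
    exact ((dvd_derivX (Dvd.intro _ rfl)).mul_left _).neg_right
  have a2 : ∀ i, X ^ s ∣ curl b.D (b.normalG h0 h1 q α) b.T (idxM i) (idxInf n) := fun i => by
    rw [h.curl_Minf e0 e1]
    exact ((dvd_derivX (Dvd.intro _ rfl)).mul_left _).neg_right
  have a3 : ∀ i, X ^ s ∣ curl b.D (b.normalG h0 h1 q α) b.T (idx0 n) (idxM i) := fun i => by
    rw [h.curl_0M e0 e1]; exact hs.mul_right _
  have a4 : ∀ i j, X ^ s ∣ curl b.D (b.normalG h0 h1 q α) b.T (idxM i) (idxM j) := fun i j =>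
    hs.trans (h.dvd_curl_MM e0 e1 i j)
  induction I using idx_cases <;> induction J using idx_cases
  · rw [curl_self]; exact dvd_zero _
  · exact a3 _
  · exact a1
  · rw [curl_swap]; exact (a3 _).neg_right
  · exact a4 _ _
  · exact a2 _
  · rw [curl_swap]; exact a1.neg_right
  · rw [curl_swap]; exact (a2 _).neg_right
  · rw [curl_self]; exact dvd_zero _

lemma dvd_curlUp (J K : Idx n) : X ^ s ∣ curlUp b.D (b.normalG h0 h1 q α) Gi b.T J K :=
  dvd_sum fun L _ => (h.dvd_curl e0 e1 J L).mul_left _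

lemma coeff_curlUp (J K : Idx n) :
    coeff s (curlUp b.D (b.normalG h0 h1 q α) Gi b.T J K)
      = ∑ L, constantCoeff (Gi K L) * coeff s (curl b.D (b.normalG h0 h1 q α) b.T J L) := by
  rw [curlUp, map_sum]
  exact sum_congr rfl fun L _ => coeff_mul_of_dvd _ (h.dvd_curl e0 e1 J L)

lemma coeff_curl_0inf : coeff s (curl b.D (b.normalG h0 h1 q α) b.T (idx0 n) (idxInf n))
    = -(b.t * ((s + 1) * constantCoeff a)) := by
  rw [h.curl_0inf e0 e1, map_neg, AmbBase.τ, coeff_C_mul, coeff_derivX, coeff_X_pow_mul']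
  simp; ring

lemma coeff_curl_Minf (i : Fin n) :
    coeff s (curl b.D (b.normalG h0 h1 q α) b.T (idxM i) (idxInf n))
      = -(b.t ^ 2 * ((s + 1) * constantCoeff (β i))) := by
  rw [h.curl_Minf e0 e1, map_neg, AmbBase.τ, ← map_pow, coeff_C_mul, coeff_derivX,
    coeff_X_pow_mul']
  simp; ring

lemma coeff_curl_0M (i : Fin n) :
    coeff s (curl b.D (b.normalG h0 h1 q α) b.T (idx0 n) (idxM i)) = 0 := by
  rw [h.curl_0M e0 e1]; exact coeff_of_dvd_succ (Dvd.intro _ rfl)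

lemma coeff_curl_MM (i j : Fin n) :
    coeff s (curl b.D (b.normalG h0 h1 q α) b.T (idxM i) (idxM j)) = 0 :=
  coeff_of_dvd_succ (h.dvd_curl_MM e0 e1 i j)

lemma cc_curl_0inf : constantCoeff (curl b.D (b.normalG h0 h1 q α) b.T (idx0 n) (idxInf n))
    = -(b.t * constantCoeff (X ^ s * a)) := by
  rw [h.curl_0inf e0 e1, map_neg, map_mul, constantCoeff_derivX, b.constantCoeff_τ, pow_succ',
    mul_assoc, coeff_succ_X_mul, coeff_zero_eq_constantCoeff_apply]

lemma cc_curl_0M (i : Fin n) :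
    constantCoeff (curl b.D (b.normalG h0 h1 q α) b.T (idx0 n) (idxM i)) = 0 := by
  rw [h.curl_0M e0 e1]; simp

lemma cc_curl_MM (i j : Fin n) :
    constantCoeff (curl b.D (b.normalG h0 h1 q α) b.T (idxM i) (idxM j)) = 0 :=
  X_dvd_iff.mp ((dvd_pow_self X (Nat.succ_ne_zero s)).trans (h.dvd_curl_MM e0 e1 i j))

/-- The component `Gi ∞ ∞` to first order. -/
lemma Gi_infinf_eq : ∃ y, Gi (idxInf n) (idxInf n) = X * y ∧
    constantCoeff y = -(b.ti ^ 2 * (2 + constantCoeff (X ^ s * a))) := by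
  refine ⟨-(b.τi * (Gi (idxInf n) (idx0 n) * (2 + X ^ s * a)
    + ∑ i, Gi (idxInf n) (idxM i) * (b.τ * (X ^ s * β i)))), ?_, ?_⟩
  · have r := h.row_zero (idxInf n)
    rw [e0] at r
    have e : ∑ i, Gi (idxInf n) (idxM i) * (b.τ * h1 i)
        = X * ∑ i, Gi (idxInf n) (idxM i) * (b.τ * (X ^ s * β i)) := by
      rw [mul_sum]; exact sum_congr rfl fun i _ => by rw [e1]; ring
    rw [e] at r
    apply b.τ_cancel
    have z : (1 : AmbMat n A⟦X⟧) (idxInf n) (idx0 n) = 0 := by simp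
    rw [z] at r
    linear_combination r + (-X * (Gi (idxInf n) (idx0 n) * (2 + X ^ s * a)
      + ∑ i, Gi (idxInf n) (idxM i) * (b.τ * (X ^ s * β i)))) * (-b.τ_mul)
  · simp only [map_neg, map_mul, map_add, map_sum, h.cc_Gi_infM, zero_mul,
      sum_const_zero, add_zero, h.cc_Gi_inf0, b.constantCoeff_τi, map_ofNat]
    ring

lemma coeff_curlUp_0M (i : Fin n) :
    coeff s (curlUp b.D (b.normalG h0 h1 q α) Gi b.T (idx0 n) (idxM i)) = 0 := by
  rw [h.coeff_curlUp e0 e1, sum_idx]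
  simp [curl_self, h.coeff_curl_0M e0 e1, h.cc_Gi_Minf]

lemma coeff_curlUp_0inf :
    coeff s (curlUp b.D (b.normalG h0 h1 q α) Gi b.T (idx0 n) (idxInf n)) = 0 := by
  rw [h.coeff_curlUp e0 e1, sum_idx]
  simp [curl_self, h.coeff_curl_0M e0 e1, h.cc_Gi_infinf]

lemma coeff_curlUp_00 :
    coeff s (curlUp b.D (b.normalG h0 h1 q α) Gi b.T (idx0 n) (idx0 n))
      = -((s + 1) * constantCoeff a) := by
  rw [h.coeff_curlUp e0 e1, sum_idx, h.coeff_curl_0inf e0 e1, h.cc_Gi_0inf]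
  simp only [curl_self, h.coeff_curl_0M e0 e1, map_zero, mul_zero, sum_const_zero]
  linear_combination (-((s + 1) * constantCoeff a)) * b.t_mul

lemma coeff_curlUp_M0 (i : Fin n) :
    coeff s (curlUp b.D (b.normalG h0 h1 q α) Gi b.T (idxM i) (idx0 n))
      = -(b.t * ((s + 1) * constantCoeff (β i))) := by
  rw [h.coeff_curlUp e0 e1, sum_idx, h.coeff_curl_Minf e0 e1, h.cc_Gi_0inf, curl_swap, map_neg]
  simp only [h.coeff_curl_0M e0 e1, h.coeff_curl_MM e0 e1, mul_zero, sum_const_zero]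
  linear_combination (-(b.t * ((s + 1) * constantCoeff (β i)))) * b.t_mul

lemma coeff_curlUp_MM (i j : Fin n) :
    coeff s (curlUp b.D (b.normalG h0 h1 q α) Gi b.T (idxM i) (idxM j)) = 0 := by
  rw [h.coeff_curlUp e0 e1, sum_idx, h.cc_Gi_Minf, curl_swap, map_neg]
  simp [h.coeff_curl_0M e0 e1, h.coeff_curl_MM e0 e1]

lemma coeff_curlUp_Minf (i : Fin n) :
    coeff s (curlUp b.D (b.normalG h0 h1 q α) Gi b.T (idxM i) (idxInf n)) = 0 := by
  rw [h.coeff_curlUp e0 e1, sum_idx, h.cc_Gi_infinf, curl_swap, map_neg]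
  simp [h.coeff_curl_0M e0 e1, h.coeff_curl_MM e0 e1]

lemma coeff_curlUp_infinf :
    coeff s (curlUp b.D (b.normalG h0 h1 q α) Gi b.T (idxInf n) (idxInf n))
      = (s + 1) * constantCoeff a := by
  rw [h.coeff_curlUp e0 e1, sum_idx, h.cc_Gi_infinf, h.cc_Gi_inf0, curl_swap, map_neg,
    h.coeff_curl_0inf e0 e1]
  simp only [h.cc_Gi_infM, zero_mul, sum_const_zero]
  linear_combination ((s + 1) * constantCoeff a) * b.t_mul

lemma cc_curlUp_0M (i : Fin n) :
    constantCoeff (curlUp b.D (b.normalG h0 h1 q α) Gi b.T (idx0 n) (idxM i)) = 0 := by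
  rw [h.cc_curlUp, sum_idx]
  simp [curl_self, h.cc_curl_0M e0 e1, h.cc_Gi_Minf]

lemma cc_curlUp_0inf :
    constantCoeff (curlUp b.D (b.normalG h0 h1 q α) Gi b.T (idx0 n) (idxInf n)) = 0 := by
  rw [h.cc_curlUp, sum_idx]
  simp [curl_self, h.cc_curl_0M e0 e1, h.cc_Gi_infinf]

lemma cc_curlUp_00 :
    constantCoeff (curlUp b.D (b.normalG h0 h1 q α) Gi b.T (idx0 n) (idx0 n))
      = -constantCoeff (X ^ s * a) := by
  rw [h.cc_curlUp, sum_idx, h.cc_curl_0inf e0 e1, h.cc_Gi_0inf]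
  simp only [curl_self, h.cc_curl_0M e0 e1, map_zero, mul_zero, sum_const_zero]
  linear_combination (-constantCoeff (X ^ s * a)) * b.t_mul

lemma cc_curlUp_MM (i j : Fin n) :
    constantCoeff (curlUp b.D (b.normalG h0 h1 q α) Gi b.T (idxM i) (idxM j)) = 0 := by
  rw [h.cc_curlUp, sum_idx, h.cc_Gi_Minf, curl_swap, map_neg]
  simp [h.cc_curl_0M e0 e1, h.cc_curl_MM e0 e1]

lemma cc_curlUp_Minf (i : Fin n) :
    constantCoeff (curlUp b.D (b.normalG h0 h1 q α) Gi b.T (idxM i) (idxInf n)) = 0 := by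
  rw [h.cc_curlUp, sum_idx, h.cc_Gi_infinf, curl_swap, map_neg]
  simp [h.cc_curl_0M e0 e1, h.cc_curl_MM e0 e1]

lemma cc_curlUp_infinf :
    constantCoeff (curlUp b.D (b.normalG h0 h1 q α) Gi b.T (idxInf n) (idxInf n))
      = constantCoeff (X ^ s * a) := by
  rw [h.cc_curlUp, sum_idx, h.cc_Gi_infinf, h.cc_Gi_inf0, curl_swap, map_neg,
    h.cc_curl_0inf e0 e1]
  simp only [h.cc_Gi_infM, zero_mul, sum_const_zero]
  linear_combination (constantCoeff (X ^ s * a)) * b.t_mul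

/-- The recursion for the component `G 0 0`. -/
theorem leading_h0 {κ₀ : A} {u v : A⟦X⟧} (hu : liftD b.d0 u = 0) (hu1 : constantCoeff u = 1)
    (hv : b.τ * u * v = 1) (ha : liftD b.d0 a = 0)
    (hE : warpedRic b.D Γ (C κ₀) v (b.τ * u) (idx0 n) (idx0 n) = 0) :
    (s + 1) * (2 * s - n - κ₀) * constantCoeff a = 0 := by
  have m := h.coeff_divergence (h.dvd_curlUp e0 e1) hu hu1 hv (idx0 n) hE
    (h.coeff_curlUp_0M e0 e1) (h.coeff_curlUp_0inf e0 e1)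
  obtain ⟨y, hy, hy0⟩ := h.Gi_infinf_eq e0 e1
  have top : coeff (s + 1) (curlUp b.D (b.normalG h0 h1 q α) Gi b.T (idx0 n) (idxInf n))
      = b.ti * (2 + constantCoeff (X ^ s * a)) * ((s + 1) * constantCoeff a) := by
    rw [curlUp, sum_idx, hy, curl_self, mul_zero, zero_add, map_add, map_sum,
      sum_eq_zero fun i _ => by
        rw [h.curl_0M e0 e1, coeff_mul_of_dvd _ (Dvd.intro _ rfl), h.cc_Gi_infM, zero_mul],
      zero_add, mul_assoc, coeff_succ_X_mul, coeff_mul_of_dvd _ (h.dvd_curl e0 e1 _ _), hy0,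
      h.coeff_curl_0inf e0 e1]
    linear_combination (b.ti * (2 + constantCoeff (X ^ s * a)) * ((s + 1) * constantCoeff a))
      * b.t_mul
  have quad : 2 * (b.t * ∑ K, ∑ P, constantCoeff (Γ (idx0 n) K P)
      * coeff s (curlUp b.D (b.normalG h0 h1 q α) Gi b.T K P))
      = 2 * ((s + 1) * constantCoeff a) * (1 + constantCoeff (X ^ s * a)) := by
    set F := curlUp b.D (b.normalG h0 h1 q α) Gi b.T with hF
    have hΓ : ∀ K P, 2 * (b.t * constantCoeff (Γ (idx0 n) K P))
        = 2 * (1 : AmbMat n A) K P - 2 * constantCoeff (b.D P (b.T K))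
          + constantCoeff (F P K) := by
      intro K P
      have e := congrArg constantCoeff (h.two_tau_mul_Γ P K)
      have o : constantCoeff ((1 : AmbMat n A⟦X⟧) K P)
          = (1 : AmbMat n A) K P := by
        by_cases hh : K = P <;> simp [Matrix.one_apply, hh]
      simp only [map_mul, map_add, map_ofNat, b.constantCoeff_τ, o, ← hF] at e
      rw [h.lc.torsion (idx0 n)]; linear_combination e
    have step : 2 * (b.t * ∑ K, ∑ P, constantCoeff (Γ (idx0 n) K P) * coeff s (F K P))
        = ∑ K, ∑ P, (2 * (1 : AmbMat n A) K P - 2 * constantCoeff (b.D P (b.T K))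
          + constantCoeff (F P K)) * coeff s (F K P) := by
      simp only [← hΓ, mul_sum]
      exact sum_congr₂ fun _ _ => by ring
    have tr : ∑ K, coeff s (F K K) = 0 := by
      rw [← map_sum, h.trace_curl, map_zero]
    have t1 : ∑ K, ∑ P, 2 * (1 : AmbMat n A) K P * coeff s (F K P) = 0 := by
      simp only [Matrix.one_apply, mul_ite, mul_one, mul_zero, ite_mul, zero_mul,
        Finset.sum_ite_eq, Finset.mem_univ, if_true, ← mul_sum, tr]
    have t2 : ∑ K, ∑ P, 2 * constantCoeff (b.D P (b.T K)) * coeff s (F K P)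
        = 2 * coeff s (F (idx0 n) (idx0 n)) := by
      rw [sum_idx, sum_idx]
      simp
    have t3 : ∑ K, ∑ P, constantCoeff (F P K) * coeff s (F K P)
        = 2 * ((s + 1) * constantCoeff a) * constantCoeff (X ^ s * a) := by
      simp only [sum_idx, hF,
        h.coeff_curlUp_0M e0 e1, h.coeff_curlUp_0inf e0 e1, h.coeff_curlUp_MM e0 e1,
        h.coeff_curlUp_Minf e0 e1, h.cc_curlUp_0M e0 e1, h.cc_curlUp_0inf e0 e1,
        h.cc_curlUp_Minf e0 e1, mul_zero, zero_mul, sum_const_zero, add_zero, zero_add,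
        h.cc_curlUp_00 e0 e1, h.coeff_curlUp_00 e0 e1, h.cc_curlUp_infinf e0 e1,
        h.coeff_curlUp_infinf e0 e1]
      ring
    rw [step]
    simp only [add_mul, sub_mul, sum_add_distrib, sum_sub_distrib, t1, t2, t3]
    rw [hF, h.coeff_curlUp_00 e0 e1]
    ring
  have sε : (s : A) * constantCoeff (X ^ s * a) = 0 := by
    cases s with
    | zero => simp
    | succ s => simp
  have da : b.d0 (constantCoeff a) = 0 := by
    have := congrArg constantCoeff ha
    simpa using this
  rw [top, h.coeff_curlUp_00 e0 e1] at m
  have d0z : b.d0 (-(((s : A) + 1) * constantCoeff a)) = 0 := by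
    have : ((s : A) + 1) = ((s + 1 : ℕ) : A) := by push_cast; ring
    rw [map_neg, Derivation.leibniz, da, this, Derivation.map_natCast]; simp
  rw [d0z] at m
  refine (isUnit_two_of_field 𝕜).mul_left_cancel ?_
  linear_combination 2 * m + quad - 2 * (s + 1) * constantCoeff a * sε
    - 2 * ((2 + constantCoeff (X ^ s * a)) * ((s + 1) * constantCoeff a)) * (s + 1) * b.t_mul

/-- The recursion for the components `G 0 i`. -/
theorem leading_h1 {κ₀ : A} {u v : A⟦X⟧} (hu : liftD b.d0 u = 0) (hu1 : constantCoeff u = 1)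
    (hv : b.τ * u * v = 1) (ha : constantCoeff a = 0) (j : Fin n) (hβ : liftD b.d0 (β j) = 0)
    (hE : warpedRic b.D Γ (C κ₀) v (b.τ * u) (idx0 n) (idxM j) = 0) :
    (s + 1) * (2 * s - n - κ₀) * constantCoeff (β j) = 0 := by
  have m := h.coeff_divergence (h.dvd_curlUp e0 e1) hu hu1 hv (idxM j) hE
    (h.coeff_curlUp_MM e0 e1 j) (h.coeff_curlUp_Minf e0 e1 j)
  obtain ⟨y, hy, hy0⟩ := h.Gi_infinf_eq e0 e1
  have ε0 : constantCoeff (X ^ s * a) = 0 := by rw [map_mul, ha, mul_zero]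
  rw [ε0, add_zero] at hy0
  have top : coeff (s + 1) (curlUp b.D (b.normalG h0 h1 q α) Gi b.T (idxM j) (idxInf n))
      = 2 * s * constantCoeff (β j) := by
    have c0 : coeff (s + 1) (Gi (idxInf n) (idx0 n)
        * curl b.D (b.normalG h0 h1 q α) b.T (idxM j) (idx0 n))
        = -(2 * constantCoeff (β j)) := by
      rw [curl_swap, h.curl_0M e0 e1, ← mul_neg, coeff_mul_of_dvd _ (Dvd.intro _ rfl),
        coeff_X_pow_mul', h.cc_Gi_inf0]
      simp only [le_refl, if_true, Nat.sub_self, coeff_zero_eq_constantCoeff_apply, map_neg,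
        map_mul, map_sub, b.constantCoeff_τ, constantCoeff_liftD, ha, map_zero, map_ofNat]
      linear_combination (-(2 * constantCoeff (β j))) * b.t_mul
    rw [curlUp, sum_idx, hy, map_add, c0, map_add, map_sum,
      sum_eq_zero fun i _ => by
        rw [coeff_mul_of_dvd _ (h.dvd_curl_MM e0 e1 j i), h.cc_Gi_infM, zero_mul],
      zero_add, mul_assoc, coeff_succ_X_mul, coeff_mul_of_dvd _ (h.dvd_curl e0 e1 _ _), hy0,
      h.coeff_curl_Minf e0 e1]
    linear_combination (2 * (s + 1) * constantCoeff (β j)) * (b.t * b.ti + 1) * b.t_mul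
  have cΓ : ∀ K, 2 * (b.t * constantCoeff (Γ (idxM j) K (idx0 n)))
        = 2 * (1 : AmbMat n A) K (idxM j)
          + constantCoeff (curlUp b.D (b.normalG h0 h1 q α) Gi b.T (idxM j) K) := by
    intro K
    have e := congrArg constantCoeff (h.two_tau_mul_Γ (idxM j) K)
    have o : constantCoeff ((1 : AmbMat n A⟦X⟧) K (idxM j))
        = (1 : AmbMat n A) K (idxM j) := by
      by_cases hh : K = idxM j <;> simp [Matrix.one_apply, hh]
    have z : b.D (idxM j) (b.T K) = 0 := by
      induction K using idx_cases <;> simp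
    simpa only [map_mul, map_add, map_ofNat, b.constantCoeff_τ, o, z, map_zero, zero_add] using e
  have cM : ∀ i, b.t * constantCoeff (Γ (idxM j) (idxM i) (idx0 n))
      = (1 : BaseMat n A) i j := by
    intro i
    have e := cΓ (idxM i)
    rw [h.cc_curlUp_MM e0 e1, add_zero] at e
    rw [(isUnit_two_of_field 𝕜).mul_left_cancel e]
    simp [Matrix.one_apply]
  have cI : b.t * constantCoeff (Γ (idxM j) (idxInf n) (idx0 n)) = 0 := by
    have e := cΓ (idxInf n)
    rw [h.cc_curlUp_Minf e0 e1, add_zero] at e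
    rw [(isUnit_two_of_field 𝕜).mul_left_cancel e]
    simp
  have cIM : ∀ i, coeff s (curlUp b.D (b.normalG h0 h1 q α) Gi b.T (idxInf n) (idxM i))
      = (s + 1) * ∑ l, gi i l * constantCoeff (β l) := by
    intro i
    rw [h.coeff_curlUp e0 e1, sum_idx, curl_self, curl_swap, map_neg, h.coeff_curl_0inf e0 e1, ha]
    simp only [curl_swap b.D _ b.T (idxM _) (idxInf n), h.coeff_curl_Minf e0 e1, map_neg, map_zero,
      h.cc_Gi_MM, mul_zero, neg_zero, zero_add, add_zero, neg_neg, mul_sum]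
    refine sum_congr rfl fun l _ => ?_
    linear_combination ((s + 1) * gi i l * constantCoeff (β l)) * (b.t * b.ti + 1) * b.t_mul
  have quad : b.t * ∑ K, ∑ P, constantCoeff (Γ (idxM j) K P)
      * coeff s (curlUp b.D (b.normalG h0 h1 q α) Gi b.T K P)
      = -(2 * (b.t * ((s + 1) * constantCoeff (β j)))) := by
    simp only [sum_idx,
        h.coeff_curlUp_0M e0 e1, h.coeff_curlUp_0inf e0 e1, h.coeff_curlUp_MM e0 e1,
        h.coeff_curlUp_Minf e0 e1, mul_zero, sum_const_zero, add_zero, zero_add,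
        h.coeff_curlUp_00 e0 e1, h.coeff_curlUp_infinf e0 e1, ha, neg_zero,
        h.coeff_curlUp_M0 e0 e1, cIM, h.cc_Γ_inf]
    have s1 : b.t * ∑ i, constantCoeff (Γ (idxM j) (idxM i) (idx0 n))
        * -(b.t * ((s + 1) * constantCoeff (β i))) = -(b.t * ((s + 1) * constantCoeff (β j))) := by
      rw [mul_sum, sum_congr rfl fun i _ => show b.t * (constantCoeff (Γ (idxM j)
        (idxM i) (idx0 n)) * -(b.t * ((s + 1) * constantCoeff (β i))))
        = (1 : BaseMat n A) i j * -(b.t * ((s + 1) * constantCoeff (β i))) by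
          rw [← cM]; ring]
      simp [Matrix.one_apply]
    have s2 : ∑ i, -g j i * ((s + 1) * ∑ l, gi i l * constantCoeff (β l))
        = -((s + 1) * constantCoeff (β j)) := by
      have : ∑ i, -g j i * (((s : A) + 1) * ∑ l, gi i l * constantCoeff (β l))
          = -((s + 1) * ∑ l, (g * gi) j l * constantCoeff (β l)) := by
        simp only [Matrix.mul_apply, mul_sum, sum_mul, ← sum_neg_distrib]
        exact sum_swap fun _ _ => by ring
      rw [this, h.g_inv]
      simp [Matrix.one_apply]
    rw [mul_add, s1, s2]
    linear_combination coeff s (curlUp b.D (b.normalG h0 h1 q α) Gi b.T (idxInf n) (idx0 n)) * cI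
  have da : b.d0 (constantCoeff (β j)) = 0 := by
    have := congrArg constantCoeff hβ
    simpa using this
  have d0z : b.d0 (-(b.t * (((s : A) + 1) * constantCoeff (β j))))
      = -((s + 1) * constantCoeff (β j)) := by
    have : ((s : A) + 1) = ((s + 1 : ℕ) : A) := by push_cast; ring
    rw [map_neg, Derivation.leibniz, Derivation.leibniz, da, this, Derivation.map_natCast, b.d0_t]
    simp
  rw [quad, top, h.coeff_curlUp_M0 e0 e1, d0z] at m
  refine b.t_cancel ?_
  linear_combination m

end Curl

end IsNormalData

end

section

variable {𝕜 A : Type*} [Field 𝕜] [CharZero 𝕜] [CommRing A] [Algebra 𝕜 A] {n : ℕ}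

lemma algebraMap_cancel {c : 𝕜} (hc : c ≠ 0) {x y : A}
    (h : algebraMap 𝕜 A c * x = algebraMap 𝕜 A c * y) : x = y :=
  ((IsUnit.mk0 c hc).map (algebraMap 𝕜 A)).mul_left_cancel h

lemma liftD_of_X_pow_mul {δ : Derivation 𝕜 A A} {s : ℕ} {x : A⟦X⟧}
    (h : liftD δ (X ^ s * x) = 0) : liftD δ x = 0 := by
  ext m
  have := congrArg (coeff (m + s)) h
  rwa [coeff_liftD, coeff_X_pow_mul, ← coeff_liftD, map_zero] at this

/-- A Ricci-flat metric in Weyl-normal form is straight. -/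
theorem IsNormalData.straight {b : AmbBase 𝕜 A n} {g gi : BaseMat n A} {h0 : A⟦X⟧}
    {h1 : Fin n → A⟦X⟧} {q : BaseMat n A⟦X⟧} {α : Fin n → A⟦X⟧}
    {Gi : AmbMat n A⟦X⟧} {Γ : Idx n → AmbMat n A⟦X⟧}
    (h : IsNormalData b g gi h0 h1 q α Gi Γ) {d : 𝕜} (hd : ∀ m : ℕ, d ≠ 2 * m)
    {u v : A⟦X⟧} (hu : liftD b.d0 u = 0) (hu1 : constantCoeff u = 1) (hv : b.τ * u * v = 1)
    (hE : ∀ J, warpedRic b.D Γ (C (algebraMap 𝕜 A (d - n))) v (b.τ * u) (idx0 n) J = 0) :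
    h0 = 2 * X ∧ h1 = 0 := by
  have key : ∀ s : ℕ, X ^ (s + 1) ∣ h0 - 2 * X ∧ ∀ i, X ^ (s + 1) ∣ h1 i := by
    intro s
    induction s with
    | zero =>
      refine ⟨?_, fun i => ?_⟩
      · rw [zero_add, pow_one, X_dvd_iff]; simp [h.cc_h0]
      · rw [zero_add, pow_one, X_dvd_iff, h.cc_h1]
    | succ s ih =>
      obtain ⟨⟨a, ha⟩, ih1⟩ := ih
      choose β hβ using ih1
      have e0 : h0 = 2 * X + X ^ (s + 1) * a := by rw [← ha]; ring
      have nz : ((s + 1 : ℕ) : 𝕜) * (2 * s - d) ≠ 0 :=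
        mul_ne_zero (Nat.cast_ne_zero.mpr (Nat.succ_ne_zero s))
          (sub_ne_zero.mpr (hd s).symm)
      have cst : ∀ x : A, ((s : A) + 1) * (2 * s - n - algebraMap 𝕜 A (d - n)) * x = 0 → x = 0 := by
        intro x hx
        refine algebraMap_cancel nz ?_
        rw [mul_zero, ← hx]
        simp only [map_mul, map_sub, map_natCast, map_ofNat]
        push_cast; ring
      have d2 : liftD b.d0 (2 * X : A⟦X⟧) = 0 := by rw [two_mul, map_add, liftD_X, add_zero]
      have da : liftD b.d0 a = 0 := by
        refine liftD_of_X_pow_mul (s := s + 1) ?_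
        rw [← ha, map_sub, h.d0_h0, d2, sub_zero]
      have a0 := cst _ (h.leading_h0 e0 hβ hu hu1 hv da (hE _))
      refine ⟨?_, fun j => ?_⟩
      · rw [ha, pow_succ (X : A⟦X⟧) (s + 1)]
        exact mul_dvd_mul_left _ (X_dvd_iff.mpr a0)
      · have db : liftD b.d0 (β j) = 0 :=
          liftD_of_X_pow_mul (s := s + 1) (by rw [← hβ, h.d0_h1])
        have b0 := cst _ (h.leading_h1 e0 hβ hu hu1 hv a0 j db (hE _))
        rw [hβ, pow_succ (X : A⟦X⟧) (s + 1)]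
        exact mul_dvd_mul_left _ (X_dvd_iff.mpr b0)
  have drop : ∀ {s : ℕ} {P : A⟦X⟧}, X ^ (s + 1) ∣ P → X ^ s ∣ P := fun h =>
    (pow_dvd_pow _ (Nat.le_succ _)).trans h
  refine ⟨eq_of_forall_dvd fun s => drop (key s).1, ?_⟩
  funext i
  exact eq_of_forall_dvd fun s => by simpa using drop ((key s).2 i)

/-! ### Homogeneity -/

namespace AmbBase

variable (b : AmbBase 𝕜 A n)

/-- `x` is homogeneous of degree `a` with respect to dilatations. -/
def Hom (a : ℤ) (x : A⟦X⟧) : Prop := b.τ * liftD b.d0 x = a * x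

variable {b} {a c : ℤ} {x y : A⟦X⟧}

lemma Hom.of_eq (h : b.Hom a x) (e : a = c) : b.Hom c x := e ▸ h

lemma Hom.add (hx : b.Hom a x) (hy : b.Hom a y) : b.Hom a (x + y) := by
  simp only [Hom, map_add] at *; linear_combination hx + hy

lemma Hom.sub (hx : b.Hom a x) (hy : b.Hom a y) : b.Hom a (x - y) := by
  simp only [Hom, map_sub] at *; linear_combination hx - hy

lemma Hom.mul (hx : b.Hom a x) (hy : b.Hom c y) : b.Hom (a + c) (x * y) := by
  simp only [Hom, Derivation.leibniz, smul_eq_mul] at *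
  push_cast
  linear_combination y * hx + x * hy

lemma Hom.sum {ι : Type*} {s : Finset ι} {f : ι → A⟦X⟧} (h : ∀ i ∈ s, b.Hom a (f i)) :
    b.Hom a (∑ i ∈ s, f i) := by
  simp only [Hom, map_sum, mul_sum] at *
  exact sum_congr rfl h

lemma hom_zero_iff : b.Hom 0 x ↔ liftD b.d0 x = 0 := by
  simp only [Hom, Int.cast_zero, zero_mul]
  exact ⟨fun h => b.τ_cancel (by rw [h, mul_zero]), fun h => by rw [h, mul_zero]⟩

lemma hom_τ : b.Hom 1 b.τ := by simp [Hom]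

/-- The weight of an index. -/
def wt : Idx n → ℤ
  | Sum.inl _ => 0
  | Sum.inr _ => 1

lemma Hom.D (hx : b.Hom a x) (I : Idx n) : b.Hom (a + wt I - 1) (b.D I x) := by
  have c := b.commutes (idx0 n) I x
  have e := congrArg (b.D I) hx
  have z : b.D I (a : A⟦X⟧) = 0 := Derivation.map_intCast _ _
  simp only [Derivation.leibniz, smul_eq_mul, z, mul_zero, add_zero] at e
  rw [b.D_zero] at c
  rw [Hom, c]
  push_cast
  induction I using idx_cases with
  | h0 =>
    simp only [b.D_zero, b.d0_τ] at e ⊢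
    simp only [wt, Int.cast_zero]
    linear_combination e
  | hM i =>
    simp only [b.D_M, b.d_τ] at e ⊢
    simp only [wt, Int.cast_one]
    linear_combination e
  | hInf =>
    simp only [b.D_inf, b.derivX_τ] at e ⊢
    simp only [wt, Int.cast_one]
    linear_combination e

end AmbBase

namespace IsNormalData

variable {b : AmbBase 𝕜 A n} {g gi : BaseMat n A}
  {q : BaseMat n A⟦X⟧} {α : Fin n → A⟦X⟧}
  {Gi : AmbMat n A⟦X⟧} {Γ : Idx n → AmbMat n A⟦X⟧}
  (h : IsNormalData b g gi (2 * X) 0 q α Gi Γ)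
include h

lemma curl_eq_zero (I J : Idx n) : curl b.D (b.normalG (2 * X) 0 q α) b.T I J = 0 := by
  have e0 : (2 * X : A⟦X⟧) = 2 * X + X ^ (0 + 1) * 0 := by ring
  have e1 : ∀ i : Fin n, (0 : Fin n → A⟦X⟧) i = X ^ (0 + 1) * (0 : Fin n → A⟦X⟧) i := by simp
  have a1 := h.curl_0inf e0 e1
  have a2 := h.curl_Minf e0 e1
  have a3 := h.curl_0M e0 e1
  have a4 : ∀ i j : Fin n, curl b.D (b.normalG (2 * X) 0 q α) b.T (idxM i) (idxM j) = 0 := by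
    intro i j; simp [curl, b.sum_mul_T]
  simp only [mul_zero, map_zero, neg_zero, Pi.zero_apply, sub_zero] at a1 a2 a3
  induction I using idx_cases <;> induction J using idx_cases
  · exact curl_self _ _ _ _
  · exact a3 _
  · exact a1
  · rw [curl_swap, a3, neg_zero]
  · exact a4 _ _
  · exact a2 _
  · rw [curl_swap, a1, neg_zero]
  · rw [curl_swap, a2, neg_zero]
  · exact curl_self _ _ _ _

lemma curlUp_eq_zero (I J : Idx n) : curlUp b.D (b.normalG (2 * X) 0 q α) Gi b.T I J = 0 := by
  simp [curlUp, h.curl_eq_zero]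

lemma covVec_eq (P K : Idx n) : covVec b.D Γ b.T P K = (1 : AmbMat n A⟦X⟧) K P := by
  refine (isUnit_two_of_field 𝕜).mul_left_cancel ?_
  rw [two_covVec h.lc h.inv h.homothetic, h.curlUp_eq_zero, add_zero]

lemma τ_mul_Γ (P K : Idx n) : b.τ * Γ P K (idx0 n)
    = (AmbBase.wt K : A⟦X⟧) * (1 : AmbMat n A⟦X⟧) K P := by
  have e := h.covVec_eq P K
  rw [covVec, b.sum_mul_T] at e
  induction P using idx_cases <;> induction K using idx_cases <;>
    simp [AmbBase.wt, Matrix.one_apply] at e ⊢ <;> linear_combination e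

lemma Γ_0 (P K : Idx n) : Γ P K (idx0 n)
    = b.τi * ((AmbBase.wt K : A⟦X⟧) * (1 : AmbMat n A⟦X⟧) K P) := by
  refine b.τ_cancel ?_
  rw [h.τ_mul_Γ, ← mul_assoc, b.τ_mul, one_mul]

lemma hom_G (I J : Idx n) : b.Hom (AmbBase.wt I + AmbBase.wt J) (b.normalG (2 * X) 0 q α I J) := by
  have d2 : liftD b.d0 (2 * X : A⟦X⟧) = 0 := by rw [two_mul, map_add, liftD_X, add_zero]
  have z : ∀ x, liftD b.d0 x = 0 → b.Hom 2 (b.τ ^ 2 * x) := fun x hx => by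
    rw [AmbBase.Hom, b.d0_τ_sq_mul hx]; push_cast; ring
  induction I using idx_cases <;> induction J using idx_cases
  · exact (AmbBase.hom_zero_iff.mpr d2)
  · simp [AmbBase.Hom]
  · exact AmbBase.hom_τ
  · simp [AmbBase.Hom]
  · exact z _ (h.d0_q _ _)
  · exact z _ (h.d0_α _)
  · exact AmbBase.hom_τ
  · exact z _ (h.d0_α _)
  · simp [AmbBase.Hom]

lemma hom_Gi (K L : Idx n) : b.Hom (-AmbBase.wt K - AmbBase.wt L) (Gi K L) := by
  have e := congrFun (congrFun (h.lc.compat_inv h.inv (idx0 n)) K) L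
  simp only [Matrix.map_apply, Matrix.sub_apply, Matrix.neg_apply, Matrix.mul_apply,
    Matrix.transpose_apply, h.lc.torsion (idx0 n), h.Γ_0, b.D_zero] at e
  rw [AmbBase.Hom, e]
  simp only [Matrix.one_apply, mul_ite, mul_one, mul_zero, ite_mul, zero_mul, Finset.sum_ite_eq,
    Finset.mem_univ, if_true]
  push_cast
  linear_combination (-(AmbBase.wt K : A⟦X⟧) * Gi K L - Gi K L * (AmbBase.wt L : A⟦X⟧)) * b.τ_mul

lemma hom_Γ (I K J : Idx n) :
    b.Hom (AmbBase.wt I + AmbBase.wt J - AmbBase.wt K - 1) (Γ I K J) := by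
  have e : b.Hom (AmbBase.wt I + AmbBase.wt J - AmbBase.wt K - 1) (2 * Γ I K J) := by
    rw [h.lc.upper h.inv]
    refine AmbBase.Hom.sum fun L _ => ?_
    refine ((h.hom_Gi K L).mul (c := AmbBase.wt I + AmbBase.wt J + AmbBase.wt L - 1)
      ((AmbBase.Hom.add ?_ ?_).sub ?_)).of_eq (by ring)
    · exact ((h.hom_G J L).D I).of_eq (by ring)
    · exact ((h.hom_G I L).D J).of_eq (by ring)
    · exact ((h.hom_G I J).D L).of_eq (by ring)
  refine (isUnit_two_of_field 𝕜).mul_left_cancel ?_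
  rw [AmbBase.Hom, two_mul, map_add] at e
  linear_combination e

lemma hom_ric (I J : Idx n) : b.Hom (AmbBase.wt I + AmbBase.wt J - 2) (ric b.D Γ I J) := by
  refine AmbBase.Hom.sub (AmbBase.Hom.add (AmbBase.Hom.sub ?_ ?_) ?_) ?_
  · exact AmbBase.Hom.sum fun K _ => ((h.hom_Γ I K J).D K).of_eq (by ring)
  · exact AmbBase.Hom.sum fun K _ => ((h.hom_Γ I K K).D J).of_eq (by ring)
  · exact AmbBase.Hom.sum fun K _ => AmbBase.Hom.sum fun L _ =>
      ((h.hom_Γ K K L).mul (h.hom_Γ I L J)).of_eq (by ring)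
  · exact AmbBase.Hom.sum fun K _ => AmbBase.Hom.sum fun L _ =>
      ((h.hom_Γ J K L).mul (h.hom_Γ I L K)).of_eq (by ring)

variable {u v : A⟦X⟧} (hu : liftD b.d0 u = 0)
include hu

lemma hom_f : b.Hom 1 (b.τ * u) := by
  rw [AmbBase.Hom, b.d0_τ_mul hu]; simp

lemma hom_hes (I J : Idx n) :
    b.Hom (AmbBase.wt I + AmbBase.wt J - 1) (hes b.D Γ (b.τ * u) I J) := by
  refine AmbBase.Hom.sub ((((h.hom_f hu).D J).D I).of_eq (by ring)) ?_
  exact AmbBase.Hom.sum fun K _ => ((h.hom_Γ I K J).mul ((h.hom_f hu).D K)).of_eq (by ring)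

variable {d : 𝕜}

lemma d0_algebraMap : liftD b.d0 (C (algebraMap 𝕜 A d)) = 0 := by
  rw [liftD_C, Derivation.map_algebraMap, map_zero]

lemma hom_v (hv : b.τ * u * v = 1) : b.Hom (-1) v := by
  have e := congrArg (liftD b.d0) hv
  simp only [Derivation.leibniz, smul_eq_mul, Derivation.map_one_eq_zero, hu, b.d0_τ] at e
  rw [AmbBase.Hom]
  push_cast
  linear_combination b.τ * v * e - b.τ * (liftD b.d0 v) * hv - v * hv

lemma hom_warpedRic (hv : b.τ * u * v = 1) (I J : Idx n) :
    b.Hom (AmbBase.wt I + AmbBase.wt J - 2)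
      (warpedRic b.D Γ (C (algebraMap 𝕜 A d)) v (b.τ * u) I J) := by
  refine (h.hom_ric I J).sub ?_
  have k : b.Hom 0 (C (algebraMap 𝕜 A d)) := AmbBase.hom_zero_iff.mpr (h.d0_algebraMap hu)
  exact ((k.mul (h.hom_v hu hv)).mul (h.hom_hes hu I J)).of_eq (by ring)

lemma d0_warpedRic (hv : b.τ * u * v = 1) (I J : Fin n ⊕ Unit) :
    liftD b.d0 (warpedRic b.D Γ (C (algebraMap 𝕜 A d)) v (b.τ * u) (Sum.inr I) (Sum.inr J)) = 0 :=
  AmbBase.hom_zero_iff.mp ((h.hom_warpedRic hu hv (Sum.inr I) (Sum.inr J)).of_eq (by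
    simp [AmbBase.wt]))

lemma d0_warpedFlat :
    liftD b.d0 (warpedFlat b.D Gi Γ (C (algebraMap 𝕜 A d)) (b.τ * u)) = 0 := by
  have k : b.Hom 0 (C (algebraMap 𝕜 A d) - 1) :=
    AmbBase.hom_zero_iff.mpr (by
      rw [map_sub, h.d0_algebraMap hu, Derivation.map_one_eq_zero, sub_zero])
  refine AmbBase.hom_zero_iff.mp (AmbBase.Hom.add ?_ ?_)
  · refine ((h.hom_f hu).mul (c := -1) ?_).of_eq (by ring)
    exact AmbBase.Hom.sum fun I _ => AmbBase.Hom.sum fun J _ =>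
      ((h.hom_Gi I J).mul (h.hom_hes hu I J)).of_eq (by ring)
  · refine (k.mul (c := 0) ?_).of_eq (by ring)
    exact AmbBase.Hom.sum fun I _ => AmbBase.Hom.sum fun J _ =>
      ((h.hom_Gi I J).mul (((h.hom_f hu).D I).mul ((h.hom_f hu).D J))).of_eq (by ring)

lemma T_f : ∑ K, b.T K * b.D K (b.τ * u) = b.τ * u := by
  simp only [mul_comm (b.T _)]
  rw [b.sum_mul_T, b.D_zero, b.d0_τ_mul hu]; ring

lemma hes_zero (J : Idx n) : hes b.D Γ (b.τ * u) (idx0 n) J = 0 := by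
  have e := hes_vec h.lc.torsion b.commutes (h.T_f hu) J
  rw [b.sum_mul_T] at e
  simp only [h.covVec_eq, Matrix.one_apply, ite_mul, one_mul, zero_mul, Finset.sum_ite_eq',
    Finset.mem_univ, if_true, sub_self] at e
  refine b.τ_cancel ?_
  rw [mul_comm, e, mul_zero]

lemma warpedRic_zero (κ v : A⟦X⟧) (J : Idx n) :
    warpedRic b.D Γ κ v (b.τ * u) (idx0 n) J = 0 := by
  have w := warpedRic_homothetic h.lc h.inv b.commutes (isUnit_two_of_field 𝕜) h.homothetic
    (κ := κ) (v := v) (h.T_f hu) J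
  simp only [b.sum_mul_T, h.curlUp_eq_zero, map_zero, mul_zero, zero_mul, sum_const_zero,
    add_zero, sub_zero] at w
  have := (isUnit_two_of_field 𝕜).mul_left_cancel (w.trans (mul_zero _).symm)
  refine b.τ_cancel ?_
  rw [mul_comm, this, mul_zero]

end IsNormalData

lemma warpedRic_symm {R ι : Type*} [CommRing R] [Algebra 𝕜 R] [Fintype ι] [DecidableEq ι]
    {D : ι → Derivation 𝕜 R R} {G Gi : Matrix ι ι R} {Γ : ι → Matrix ι ι R}
    (h : IsLC D G Γ) (hG : G * Gi = 1) (hD : Commutes D) (κ v f : R) (I J : ι) :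
    warpedRic D Γ κ v f I J = warpedRic D Γ κ v f J I := by
  rw [warpedRic, warpedRic, hes_symm h.torsion hD f I J,
    (isUnit_two_of_field 𝕜).mul_left_cancel (ric_symm h hG hD I J)]

end

section

/-! ### Leading coefficients -/

/-- `P = c X^s + O(X^{s+1})`. -/
structure Lead {A : Type*} [CommRing A] (s : ℕ) (P : A⟦X⟧) (c : A) : Prop where
  dvd : X ^ s ∣ P
  coeff_eq : coeff s P = c

namespace Lead

variable {A : Type*} [CommRing A] {s : ℕ} {P Q : A⟦X⟧} {c e : A}

lemma self (h : X ^ s ∣ P) : Lead s P (coeff s P) := ⟨h, rfl⟩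

lemma congr (h : Lead s P c) (e1 : P = Q) (e2 : c = e) : Lead s Q e := e1 ▸ e2 ▸ h

lemma of_dvd_succ (h : X ^ (s + 1) ∣ P) : Lead s P 0 :=
  ⟨(pow_dvd_pow _ (Nat.le_succ s)).trans h, coeff_of_dvd_succ h⟩

lemma dvd_succ (h : Lead s P 0) : X ^ (s + 1) ∣ P := dvd_succ_of_coeff h.dvd h.coeff_eq

lemma zero : Lead s (0 : A⟦X⟧) 0 := ⟨dvd_zero _, map_zero _⟩

lemma add (h : Lead s P c) (h' : Lead s Q e) : Lead s (P + Q) (c + e) :=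
  ⟨dvd_add h.dvd h'.dvd, by rw [map_add, h.coeff_eq, h'.coeff_eq]⟩

lemma sub (h : Lead s P c) (h' : Lead s Q e) : Lead s (P - Q) (c - e) :=
  ⟨dvd_sub h.dvd h'.dvd, by rw [map_sub, h.coeff_eq, h'.coeff_eq]⟩

lemma neg (h : Lead s P c) : Lead s (-P) (-c) :=
  ⟨(dvd_neg).mpr h.dvd, by rw [map_neg, h.coeff_eq]⟩

lemma sum {ι : Type*} {σ : Finset ι} {F : ι → A⟦X⟧} {f : ι → A} (h : ∀ i ∈ σ, Lead s (F i) (f i)) :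
    Lead s (∑ i ∈ σ, F i) (∑ i ∈ σ, f i) :=
  ⟨dvd_sum fun i hi => (h i hi).dvd, by
    rw [map_sum]; exact sum_congr rfl fun i hi => (h i hi).coeff_eq⟩

lemma mul (Q : A⟦X⟧) (h : Lead s P c) : Lead s (Q * P) (constantCoeff Q * c) :=
  ⟨h.dvd.mul_left _, by rw [coeff_mul_of_dvd _ h.dvd, h.coeff_eq]⟩

lemma mul' (h : Lead s P c) (Q : A⟦X⟧) : Lead s (P * Q) (c * constantCoeff Q) :=
  ⟨h.dvd.mul_right _, by rw [coeff_mul_of_dvd' _ h.dvd, h.coeff_eq]⟩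

lemma X_mul (h : Lead s P c) : Lead (s + 1) (X * P) c :=
  ⟨X_mul_dvd_of_dvd h.dvd, by rw [coeff_succ_X_mul, h.coeff_eq]⟩

lemma X_pow_mul (s : ℕ) (P : A⟦X⟧) : Lead s (X ^ s * P) (constantCoeff P) :=
  ⟨Dvd.intro _ rfl, by simp [coeff_X_pow_mul']⟩

variable {𝕜 : Type*} [CommRing 𝕜] [Algebra 𝕜 A]

lemma liftD (δ : Derivation 𝕜 A A) (h : Lead s P c) : Lead s (liftD δ P) (δ c) :=
  ⟨dvd_liftD δ h.dvd, by rw [coeff_liftD, h.coeff_eq]⟩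

lemma derivX (h : Lead (s + 1) P c) : Lead s (derivX 𝕜 A P) ((s + 1) * c) :=
  ⟨dvd_derivX h.dvd, by rw [coeff_derivX, h.coeff_eq, mul_comm]⟩

lemma X_mul_derivX (h : Lead s P c) : Lead s (X * WeylAmbient.derivX 𝕜 A P) (s * c) := by
  refine ⟨?_, by rw [derivX_apply, coeff_X_mul_derivative, h.coeff_eq]⟩
  rw [X_pow_dvd_iff]
  intro m hm
  rw [derivX_apply, coeff_X_mul_derivative, X_pow_dvd_iff.mp h.dvd m hm, mul_zero]

end Lead

/-- The difference of the Levi-Civita symbols of two metrics. -/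
lemma IsLC.sub_eq {𝕜 R ι : Type*} [CommRing 𝕜] [CommRing R] [Algebra 𝕜 R] [Fintype ι]
    [DecidableEq ι] {D : ι → Derivation 𝕜 R R} {G G' Gi' p : Matrix ι ι R}
    {Γ Γ' : ι → Matrix ι ι R} (h : IsLC D G Γ) (h' : IsLC D G' Γ') (hG' : G' * Gi' = 1)
    (h2 : IsUnit (2 : R)) (hp : ∀ I J, G' I J = G I J + 2 * p I J) (I K J : ι) :
    Γ' I K J - Γ I K J = ∑ L, Gi' K L * (D I (p J L) + D J (p I L) - D L (p I J)
      - 2 * ∑ P, p L P * Γ I P J) := by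
  refine h2.mul_left_cancel ?_
  have a : ∑ L, Gi' K L * ∑ P, G' L P * Γ I P J = Γ I K J := by
    have e : ∑ L, Gi' K L * ∑ P, G' L P * Γ I P J = ∑ P, (Gi' * G') K P * Γ I P J := by
      simp only [Matrix.mul_apply, sum_mul, mul_sum]
      exact sum_swap fun _ _ => by ring
    rw [e, mul_eq_one_comm.mp hG']; simp [Matrix.one_apply]
  rw [mul_sub, h'.upper hG', ← a, mul_sum, mul_sum, ← sum_sub_distrib]
  refine sum_congr rfl fun L _ => ?_
  have e := h.lower L I J
  have z : ∀ M, D M (2 : R) = 0 := fun M => by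
    rw [← Nat.cast_ofNat (n := 2)]; exact Derivation.map_natCast _ _
  simp only [hp, map_add, Derivation.leibniz, smul_eq_mul, z, mul_zero, add_zero, add_mul,
    sum_add_distrib, mul_assoc, ← mul_sum]
  linear_combination -Gi' K L * e

variable {𝕜 A : Type*} [Field 𝕜] [CharZero 𝕜] [CommRing A] [Algebra 𝕜 A] {n : ℕ}

/-- A change of the components of the metric along `M`. -/
def AmbBase.pert (b : AmbBase 𝕜 A n) (Φ : BaseMat n A⟦X⟧) :
    AmbMat n A⟦X⟧ :=
  Matrix.of fun I J => match I, J with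
  | Sum.inr (Sum.inl i), Sum.inr (Sum.inl j) => b.τ ^ 2 * Φ i j
  | _, _ => 0

section Pert

variable (b : AmbBase 𝕜 A n) (Φ : BaseMat n A⟦X⟧) (I : Idx n)

@[simp] lemma AmbBase.pert_0 : b.pert Φ (idx0 n) I = 0 := rfl
@[simp] lemma AmbBase.pert_inf : b.pert Φ (idxInf n) I = 0 := rfl
@[simp] lemma AmbBase.pert_MM (i j : Fin n) : b.pert Φ (idxM i) (idxM j) = b.τ ^ 2 * Φ i j := rfl
@[simp] lemma AmbBase.pert_0' : b.pert Φ I (idx0 n) = 0 := by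
  induction I using idx_cases <;> rfl
@[simp] lemma AmbBase.pert_inf' : b.pert Φ I (idxInf n) = 0 := by
  induction I using idx_cases <;> rfl

end Pert

/-- Two straight metrics, given by `(q, Gi, Γ)` and `(q', Gi', Γ')`, whose components along `M`
differ by `2 X^{s+1} Φ`. -/
structure IsPert (b : AmbBase 𝕜 A n) (g gi : BaseMat n A)
    (q : BaseMat n A⟦X⟧) (α : Fin n → A⟦X⟧)
    (Gi : AmbMat n A⟦X⟧) (Γ : Idx n → AmbMat n A⟦X⟧)
    (q' : BaseMat n A⟦X⟧)
    (Gi' : AmbMat n A⟦X⟧) (Γ' : Idx n → AmbMat n A⟦X⟧)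
    (s : ℕ) (Φ : BaseMat n A⟦X⟧) : Prop where
  left : IsNormalData b g gi (2 * X) 0 q α Gi Γ
  right : IsNormalData b g gi (2 * X) 0 q' α Gi' Γ'
  eq : ∀ i j, q' i j = q i j + 2 * (X ^ (s + 1) * Φ i j)

namespace IsNormalData

variable {b : AmbBase 𝕜 A n} {g gi : BaseMat n A}
    {q : BaseMat n A⟦X⟧} {α : Fin n → A⟦X⟧}
    {Gi : AmbMat n A⟦X⟧} {Γ : Idx n → AmbMat n A⟦X⟧}
    (h : IsNormalData b g gi (2 * X) 0 q α Gi Γ)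
include h

lemma Gi_Minf (k : Fin n) : Gi (idxM k) (idxInf n) = X * (-2 * b.τi * Gi (idxM k) (idx0 n)) := by
  have e := h.row_zero (idxM k)
  simp only [Pi.zero_apply, mul_zero, sum_const_zero, zero_add] at e
  refine b.τ_cancel ?_
  have z : (1 : AmbMat n A⟦X⟧) (idxM k) (idx0 n) = 0 := by simp
  rw [z] at e
  linear_combination e + 2 * X * Gi (idxM k) (idx0 n) * b.τ_mul

lemma Gi_infinf : Gi (idxInf n) (idxInf n) = X * (-2 * b.τi * Gi (idxInf n) (idx0 n)) := by
  have e := h.row_zero (idxInf n)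
  simp only [Pi.zero_apply, mul_zero, sum_const_zero, zero_add] at e
  refine b.τ_cancel ?_
  have z : (1 : AmbMat n A⟦X⟧) (idxInf n) (idx0 n) = 0 := by simp
  rw [z] at e
  linear_combination e + 2 * X * Gi (idxInf n) (idx0 n) * b.τ_mul

@[simp] lemma cc_Γ_0 (P K : Idx n) : constantCoeff (Γ P K (idx0 n))
    = b.ti * ((AmbBase.wt K : A) * (1 : AmbMat n A) K P) := by
  rw [h.Γ_0]
  by_cases hh : K = P <;> simp [hh, Matrix.one_apply]

end IsNormalData

namespace IsPert

variable {b : AmbBase 𝕜 A n} {g gi : BaseMat n A}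
    {q : BaseMat n A⟦X⟧} {α : Fin n → A⟦X⟧}
    {Gi : AmbMat n A⟦X⟧} {Γ : Idx n → AmbMat n A⟦X⟧}
    {q' : BaseMat n A⟦X⟧}
    {Gi' : AmbMat n A⟦X⟧} {Γ' : Idx n → AmbMat n A⟦X⟧}
    {s : ℕ} {Φ : BaseMat n A⟦X⟧}
    (h : IsPert b g gi q α Gi Γ q' Gi' Γ' s Φ)
include h

lemma G_eq (I J : Idx n) : b.normalG (2 * X) 0 q' α I J
    = b.normalG (2 * X) 0 q α I J + 2 * b.pert (Matrix.of fun i j => X ^ (s + 1) * Φ i j) I J := by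
  induction I using idx_cases <;> induction J using idx_cases <;> simp [h.eq]; ring

lemma d0_Φ (i j : Fin n) : liftD b.d0 (Φ i j) = 0 := by
  refine liftD_of_X_pow_mul (s := s + 1) ?_
  have e := h.right.d0_q i j
  rw [h.eq, map_add, h.left.d0_q, zero_add, two_mul, map_add, ← two_mul] at e
  exact (isUnit_two_of_field 𝕜).mul_left_cancel (e.trans (mul_zero _).symm)

lemma Φ_symm (i j : Fin n) : Φ i j = Φ j i := by
  have e := h.right.lc.symm (idxM i) (idxM j)
  have e' := h.left.lc.symm (idxM i) (idxM j)
  simp only [b.normalG_MM, h.eq] at e e'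
  have e2 : (2 : A⟦X⟧) * (X ^ (s + 1) * Φ i j) = 2 * (X ^ (s + 1) * Φ j i) :=
    b.τ_cancel (b.τ_cancel (by linear_combination e - e'))
  have e3 := (isUnit_two_of_field 𝕜).mul_left_cancel e2
  ext m
  have := congrArg (coeff (m + (s + 1))) e3
  rwa [coeff_X_pow_mul, coeff_X_pow_mul] at this

/-- The difference of the Levi-Civita symbols, with the index `K` lowered. -/
lemma sub_eq (I K J : Idx n) : Γ' I K J - Γ I K J = ∑ L, Gi' K L *
    (b.D I (b.pert (Matrix.of fun i j => X ^ (s + 1) * Φ i j) J L)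
      + b.D J (b.pert (Matrix.of fun i j => X ^ (s + 1) * Φ i j) I L)
      - b.D L (b.pert (Matrix.of fun i j => X ^ (s + 1) * Φ i j) I J)
      - 2 * ∑ P, b.pert (Matrix.of fun i j => X ^ (s + 1) * Φ i j) L P * Γ I P J) :=
  h.left.lc.sub_eq h.right.lc h.right.inv (isUnit_two_of_field 𝕜) h.G_eq I K J

lemma lead_Φ (i j : Fin n) : Lead (s + 1) (X ^ (s + 1) * Φ i j) (constantCoeff (Φ i j)) :=
  Lead.X_pow_mul _ _

lemma lead_deriv (i j : Fin n) : Lead s (derivX 𝕜 A (b.τ ^ 2 * (X ^ (s + 1) * Φ i j)))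
    (b.t ^ 2 * ((s + 1) * constantCoeff (Φ i j))) := by
  rw [b.derivX_τ_sq_mul]
  exact ((h.lead_Φ i j).derivX.mul _).congr rfl (by simp)

lemma sum_pert (l : Fin n) (I J : Idx n) :
    ∑ P, b.pert (Matrix.of fun i j => X ^ (s + 1) * Φ i j) (idxM l) P * Γ I P J
      = X ^ (s + 1) * ∑ k, b.τ ^ 2 * Φ l k * Γ I (idxM k) J := by
  rw [sum_idx, mul_sum]
  simp only [b.pert_0', b.pert_inf', b.pert_MM, Matrix.of_apply, zero_mul, zero_add, add_zero]
  exact sum_congr rfl fun k _ => by ring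

lemma sub_MM (i j : Fin n) (K : Idx n) : Γ' (idxM i) K (idxM j) - Γ (idxM i) K (idxM j)
    = Gi' K (idx0 n) * (-(2 * b.τ * (X ^ (s + 1) * Φ i j)))
      + (∑ l, Gi' K (idxM l) * (X ^ (s + 1) * (b.τ ^ 2 * (liftD (b.d i) (Φ j l)
        + liftD (b.d j) (Φ i l) - liftD (b.d l) (Φ i j))
        - 2 * ∑ k, b.τ ^ 2 * Φ l k * Γ (idxM i) (idxM k) (idxM j)))
      + Gi' K (idxInf n) * (-(derivX 𝕜 A (b.τ ^ 2 * (X ^ (s + 1) * Φ i j))))) := by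
  have hX : ∀ (δ : Derivation 𝕜 A A) (x : A⟦X⟧),
      liftD δ (X ^ (s + 1) * x) = X ^ (s + 1) * liftD δ x := fun δ x => by
    rw [Derivation.leibniz, Derivation.leibniz_pow, liftD_X]; simp
  rw [h.sub_eq, sum_idx]
  simp only [h.sum_pert]
  simp only [b.pert_0', b.pert_inf', b.pert_0, b.pert_inf, b.pert_MM, Matrix.of_apply, zero_mul, map_zero,
    sum_const_zero, mul_zero, sub_zero, add_zero, zero_sub, b.D_zero, b.D_M, b.D_inf]
  rw [b.d0_τ_sq_mul (by rw [hX, h.d0_Φ, mul_zero])]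
  congr 2
  refine sum_congr rfl fun l _ => ?_
  rw [b.d_τ_sq_mul, b.d_τ_sq_mul, b.d_τ_sq_mul, hX, hX, hX]; ring

lemma sub_Minf (i : Fin n) (K : Idx n) : Γ' (idxM i) K (idxInf n) - Γ (idxM i) K (idxInf n)
    = ∑ l, Gi' K (idxM l) * (derivX 𝕜 A (b.τ ^ 2 * (X ^ (s + 1) * Φ i l))
        - 2 * (X ^ (s + 1) * ∑ k, b.τ ^ 2 * Φ l k * Γ (idxM i) (idxM k) (idxInf n))) := by
  rw [h.sub_eq, sum_idx]
  simp only [h.sum_pert]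
  simp

lemma sub_infinf (K : Idx n) : Γ' (idxInf n) K (idxInf n) - Γ (idxInf n) K (idxInf n)
    = ∑ l, Gi' K (idxM l) * (-
        (2 * (X ^ (s + 1) * ∑ k, b.τ ^ 2 * Φ l k * Γ (idxInf n) (idxM k) (idxInf n)))) := by
  rw [h.sub_eq, sum_idx]
  simp only [h.sum_pert]
  simp

lemma sub_zero_right (I K : Idx n) : Γ' I K (idx0 n) - Γ I K (idx0 n) = 0 := by
  rw [h.left.Γ_0, h.right.Γ_0, sub_self]

lemma dvd_sub_MM_inf (i j : Fin n) :
    Lead (s + 1) (Γ' (idxM i) (idxInf n) (idxM j) - Γ (idxM i) (idxInf n) (idxM j))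
      (2 * s * constantCoeff (Φ i j)) := by
  rw [h.sub_MM, h.right.Gi_infinf]
  have e1 := (((h.lead_Φ i j).mul (2 * b.τ)).neg.mul (Gi' (idxInf n) (idx0 n)))
  have e2 : Lead (s + 1) (∑ l, Gi' (idxInf n) (idxM l) * (X ^ (s + 1) * (b.τ ^ 2 *
      (liftD (b.d i) (Φ j l) + liftD (b.d j) (Φ i l) - liftD (b.d l) (Φ i j))
        - 2 * ∑ k, b.τ ^ 2 * Φ l k * Γ (idxM i) (idxM k) (idxM j)))) (∑ _l : Fin n, 0) :=
    Lead.sum fun l _ => ((Lead.X_pow_mul _ _).mul _).congr rfl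
      (by rw [h.right.cc_Gi_infM, zero_mul])
  have e3 := (((h.lead_deriv i j).neg.X_mul).mul (-2 * b.τi * Gi' (idxInf n) (idx0 n)))
  refine (e1.add (e2.add e3)).congr (by ring) ?_
  simp only [map_mul, map_neg, map_ofNat, b.constantCoeff_τ, b.constantCoeff_τi,
    h.right.cc_Gi_inf0, sum_const_zero]
  linear_combination (2 * constantCoeff (Φ i j) * ((b.ti * b.t + 1) * (s + 1) - 1)) * b.t_mul

lemma dvd_sub_MM_M (i j k : Fin n) :
    X ^ (s + 1) ∣ Γ' (idxM i) (idxM k) (idxM j) - Γ (idxM i) (idxM k) (idxM j) := by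
  rw [h.sub_MM, h.right.Gi_Minf]
  refine dvd_add (Dvd.dvd.mul_left ?_ _) (dvd_add (dvd_sum fun l _ => ?_) ?_)
  · exact (dvd_neg).mpr (Dvd.dvd.mul_left (Dvd.intro _ rfl) _)
  · exact Dvd.dvd.mul_left (Dvd.intro _ rfl) _
  · rw [mul_right_comm]
    exact Dvd.dvd.mul_right (X_mul_dvd_of_dvd ((h.lead_deriv i j).neg.dvd)) _

lemma lead_sub_MM_0 (i j : Fin n) :
    Lead s (Γ' (idxM i) (idx0 n) (idxM j) - Γ (idxM i) (idx0 n) (idxM j))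
      (-(b.t * ((s + 1) * constantCoeff (Φ i j)))) := by
  rw [h.sub_MM]
  refine ((((Lead.of_dvd_succ ((h.lead_Φ i j).mul (2 * b.τ)).neg.dvd).mul _).add
    ((Lead.sum (f := fun _ => 0) fun l _ => ?_).add
      (((h.lead_deriv i j).neg).mul _))).congr rfl ?_)
  · exact ((Lead.of_dvd_succ (Lead.X_pow_mul _ _).dvd).mul _).congr rfl (by simp)
  · rw [h.right.cc_Gi_0inf]; simp only [sum_const_zero]
    linear_combination (-b.t * (s + 1) * constantCoeff (Φ i j)) * b.t_mul

lemma lead_sub_Minf (i : Fin n) (K : Idx n) :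
    Lead s (Γ' (idxM i) K (idxInf n) - Γ (idxM i) K (idxInf n))
      (∑ l, constantCoeff (Gi' K (idxM l)) * (b.t ^ 2 * ((s + 1) * constantCoeff (Φ i l)))) := by
  rw [h.sub_Minf]
  refine Lead.sum fun l _ => Lead.mul _ ?_
  exact ((h.lead_deriv i l).sub ((Lead.of_dvd_succ (Lead.X_pow_mul _ _).dvd).mul _)).congr rfl
    (by simp)

lemma lead_sub_Minf_M (i k : Fin n) :
    Lead s (Γ' (idxM i) (idxM k) (idxInf n) - Γ (idxM i) (idxM k) (idxInf n))
      ((s + 1) * ∑ l, gi k l * constantCoeff (Φ i l)) := by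
  refine (h.lead_sub_Minf i (idxM k)).congr rfl ?_
  rw [mul_sum]
  refine sum_congr rfl fun l _ => ?_
  rw [h.right.cc_Gi_MM]
  linear_combination ((s + 1) * gi k l * constantCoeff (Φ i l)) * (1 + b.t * b.ti) * b.t_mul

lemma dvd_sub_Minf_inf (i : Fin n) :
    X ^ (s + 1) ∣ Γ' (idxM i) (idxInf n) (idxInf n) - Γ (idxM i) (idxInf n) (idxInf n) :=
  ((h.lead_sub_Minf i (idxInf n)).congr rfl (by simp [h.right.cc_Gi_infM])).dvd_succ

lemma dvd_sub_infinf (K : Idx n) :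
    X ^ (s + 1) ∣ Γ' (idxInf n) K (idxInf n) - Γ (idxInf n) K (idxInf n) := by
  rw [h.sub_infinf]
  refine dvd_sum fun l _ => Dvd.dvd.mul_left ?_ _
  exact (dvd_neg).mpr (Dvd.dvd.mul_left (Dvd.intro _ rfl) _)

/-- The leading coefficients of the difference of the Levi-Civita symbols. -/
def symb (b : AmbBase 𝕜 A n) (gi : BaseMat n A) (s : ℕ)
    (φ : BaseMat n A) (e : Fin n → A) : Idx n → Idx n → Idx n → A
  | Sum.inr (Sum.inl i), Sum.inl _, Sum.inr (Sum.inl j) => -(b.t * ((s + 1) * φ i j))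
  | Sum.inr (Sum.inl i), Sum.inl _, Sum.inr (Sum.inr _) => e i
  | Sum.inr (Sum.inr _), Sum.inl _, Sum.inr (Sum.inl i) => e i
  | Sum.inr (Sum.inl i), Sum.inr (Sum.inl k), Sum.inr (Sum.inr _) => (s + 1) * ∑ l, gi k l * φ i l
  | Sum.inr (Sum.inr _), Sum.inr (Sum.inl k), Sum.inr (Sum.inl i) => (s + 1) * ∑ l, gi k l * φ i l
  | _, _, _ => 0

lemma lead_sub : ∃ e : Fin n → A, ∀ I K J, Lead s (Γ' I K J - Γ I K J)
    (symb b gi s (fun i j => constantCoeff (Φ i j)) e I K J) := by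
  refine ⟨fun i => ∑ l, constantCoeff (Gi' (idx0 n) (idxM l))
    * (b.t ^ 2 * ((s + 1) * constantCoeff (Φ i l))), fun I K J => ?_⟩
  have t : ∀ I K J, Γ' I K J - Γ I K J = Γ' J K I - Γ J K I := fun I K J => by
    rw [h.right.lc.torsion, h.left.lc.torsion]
  induction I using idx_cases with
  | h0 => rw [t, h.sub_zero_right]; exact Lead.zero
  | hM i =>
    induction J using idx_cases with
    | h0 =>
      rw [h.sub_zero_right]
      induction K using idx_cases <;> exact Lead.zero
    | hM j =>
      induction K using idx_cases with
      | h0 => exact h.lead_sub_MM_0 i j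
      | hM k => exact Lead.of_dvd_succ (h.dvd_sub_MM_M i j k)
      | hInf => exact Lead.of_dvd_succ (h.dvd_sub_MM_inf i j).dvd
    | hInf =>
      induction K using idx_cases with
      | h0 => exact h.lead_sub_Minf i (idx0 n)
      | hM k => exact h.lead_sub_Minf_M i k
      | hInf => exact Lead.of_dvd_succ (h.dvd_sub_Minf_inf i)
  | hInf =>
    induction J using idx_cases with
    | h0 =>
      rw [h.sub_zero_right]
      induction K using idx_cases <;> exact Lead.zero
    | hM j =>
      rw [t]
      induction K using idx_cases with
      | h0 => exact h.lead_sub_Minf j (idx0 n)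
      | hM k => exact h.lead_sub_Minf_M j k
      | hInf => exact Lead.of_dvd_succ (h.dvd_sub_Minf_inf j)
    | hInf =>
      induction K using idx_cases <;> exact Lead.of_dvd_succ (h.dvd_sub_infinf _)

end IsPert

end

section

section Differences

variable {𝕜 R ι : Type*} [CommRing 𝕜] [CommRing R] [Algebra 𝕜 R] [Fintype ι]
  {D : ι → Derivation 𝕜 R R} {Γ Γ' : ι → Matrix ι ι R} {Gi Gi' : Matrix ι ι R}

lemma ric_sub (I J : ι) : ric D Γ' I J - ric D Γ I J
    = (∑ K, D K (Γ' I K J - Γ I K J)) - (∑ K, D J (Γ' I K K - Γ I K K))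
      + (∑ K, ∑ L, (Γ' K K L * (Γ' I L J - Γ I L J) + (Γ' K K L - Γ K K L) * Γ I L J))
      - ∑ K, ∑ L, (Γ' J K L * (Γ' I L K - Γ I L K) + (Γ' J K L - Γ J K L) * Γ I L K) := by
  have e : ∀ a b c d : R, a * (b - c) + (a - d) * c = a * b - d * c := fun a b c d => by ring
  simp only [ric, e, map_sub, sum_sub_distrib]
  ring

lemma hes_sub (f p : R) (I J : ι) : hes D Γ' (f + p) I J - hes D Γ f I J
    = D I (D J p) - ∑ K, (Γ' I K J - Γ I K J) * D K f - ∑ K, Γ' I K J * D K p := by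
  have e : ∀ K, (Γ' I K J - Γ I K J) * D K f = Γ' I K J * D K f - Γ I K J * D K f :=
    fun K => by ring
  simp only [hes, map_add, mul_add, e, sum_add_distrib, sum_sub_distrib]
  ring

lemma trc_sub (T T' : ι → ι → R) : trc Gi' T' - trc Gi T
    = ∑ I, ∑ J, Gi' I J * (T' I J - T I J) + ∑ I, ∑ J, (Gi' I J - Gi I J) * T I J := by
  simp only [trc, ← sum_sub_distrib, ← sum_add_distrib]
  exact sum_congr₂ fun _ _ => by ring

lemma grad2_sub (f p : R) : grad2 D Gi' (f + p) - grad2 D Gi f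
    = ∑ I, ∑ J, (Gi' I J * (D I (f + p) * D J p) + Gi' I J * (D J f * D I p))
      + ∑ I, ∑ J, (Gi' I J - Gi I J) * (D I f * D J f) := by
  simp only [grad2, ← sum_sub_distrib, ← sum_add_distrib, map_add]
  exact sum_congr₂ fun _ _ => by ring

end Differences

variable {𝕜 A : Type*} [Field 𝕜] [CharZero 𝕜] [CommRing A] [Algebra 𝕜 A] {n : ℕ}

lemma AmbBase.cc_v {b : AmbBase 𝕜 A n} {u v : A⟦X⟧} (hu1 : constantCoeff u = 1)
    (hv : b.τ * u * v = 1) : constantCoeff v = b.ti := by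
  have e := congrArg constantCoeff hv
  rw [map_mul, map_mul, hu1, b.constantCoeff_τ, map_one, mul_one] at e
  exact b.t_cancel (by rw [e, b.t_mul])

lemma AmbBase.f_add {b : AmbBase 𝕜 A n} {s : ℕ} {u u' ψ : A⟦X⟧}
    (hu' : u' = u + 2 * (X ^ (s + 1) * ψ)) :
    b.τ * u' = b.τ * u + X ^ (s + 1) * (2 * b.τ * ψ) := by rw [hu']; ring

/-- Leading coefficients of the derivatives of `2 t X^{s+1} ψ`. -/
def fluct (b : AmbBase 𝕜 A n) (s : ℕ) (ψ : A⟦X⟧) : Idx n → A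
  | Sum.inr (Sum.inr _) => (s + 1) * (2 * b.t * constantCoeff ψ)
  | _ => 0

lemma lead_fluct (b : AmbBase 𝕜 A n) (s : ℕ) (ψ : A⟦X⟧) (I : Idx n) :
    Lead s (b.D I (X ^ (s + 1) * (2 * b.τ * ψ))) (fluct b s ψ I) := by
  have a := Lead.X_pow_mul (s + 1) (2 * b.τ * ψ)
  induction I using idx_cases with
  | h0 => exact Lead.of_dvd_succ (a.liftD b.d0).dvd
  | hM i => exact Lead.of_dvd_succ (a.liftD (b.d i)).dvd
  | hInf => exact a.derivX.congr rfl (by simp [fluct, map_ofNat])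

namespace IsPert

variable {b : AmbBase 𝕜 A n} {g gi : BaseMat n A}
    {q : BaseMat n A⟦X⟧} {α : Fin n → A⟦X⟧}
    {Gi : AmbMat n A⟦X⟧} {Γ : Idx n → AmbMat n A⟦X⟧}
    {q' : BaseMat n A⟦X⟧}
    {Gi' : AmbMat n A⟦X⟧} {Γ' : Idx n → AmbMat n A⟦X⟧}
    {s : ℕ} {Φ : BaseMat n A⟦X⟧}
    (h : IsPert b g gi q α Gi Γ q' Gi' Γ' s Φ)
include h

lemma φ_symm (i j : Fin n) : constantCoeff (Φ i j) = constantCoeff (Φ j i) := by rw [h.Φ_symm]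

lemma d0_φ (i j : Fin n) : b.d0 (constantCoeff (Φ i j)) = 0 := by
  rw [← constantCoeff_liftD, h.d0_Φ, map_zero]

lemma g_gi_φ (i j : Fin n) : ∑ k, g j k * ∑ l, gi k l * constantCoeff (Φ i l)
    = constantCoeff (Φ i j) := by
  have e : ∑ k, g j k * ∑ l, gi k l * constantCoeff (Φ i l)
      = ∑ l, (g * gi) j l * constantCoeff (Φ i l) := by
    simp only [Matrix.mul_apply, sum_mul, mul_sum]
    exact sum_swap fun _ _ => by ring
  rw [e, h.left.g_inv]
  simp [Matrix.one_apply]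

lemma lead_ric_MM (i j : Fin n) :
    Lead s (ric b.D Γ' (idxM i) (idxM j) - ric b.D Γ (idxM i) (idxM j))
      ((s + 1) * ((2 * s + 2 - n) * constantCoeff (Φ i j)
        - (∑ k, ∑ l, gi k l * constantCoeff (Φ k l)) * g i j)) := by
  obtain ⟨e, he⟩ := h.lead_sub
  rw [ric_sub]
  have e1 : Lead s (∑ K, b.D K (Γ' (idxM i) K (idxM j) - Γ (idxM i) K (idxM j)))
      ((s + 1) * (2 * s - 1) * constantCoeff (Φ i j)) := by
    rw [sum_idx]
    have a1 := (h.lead_sub_MM_0 i j).liftD b.d0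
    have a2 : Lead s (∑ k, b.D (idxM k) (Γ' (idxM i) (idxM k) (idxM j)
        - Γ (idxM i) (idxM k) (idxM j))) (∑ _k : Fin n, 0) :=
      Lead.sum fun k _ => Lead.of_dvd_succ (dvd_liftD _ (h.dvd_sub_MM_M i j k))
    have a3 := (h.dvd_sub_MM_inf i j).derivX (𝕜 := 𝕜)
    refine (a1.add (a2.add a3)).congr rfl ?_
    have z : b.d0 ((s : A) + 1) = 0 := by
      rw [show (s : A) + 1 = ((s + 1 : ℕ) : A) by push_cast; ring]
      exact Derivation.map_natCast _ _
    simp only [map_neg, Derivation.leibniz, smul_eq_mul, z, h.d0_φ, b.d0_t,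
      sum_const_zero]
    ring
  have e2 : Lead s (∑ K, b.D (idxM j) (Γ' (idxM i) K K - Γ (idxM i) K K))
      (∑ K, b.d j (symb b gi s (fun i j => constantCoeff (Φ i j)) e (idxM i) K K)) :=
    Lead.sum fun K _ => (he _ _ _).liftD _
  have e3 : Lead s _ _ := Lead.sum (σ := Finset.univ) fun K _ => Lead.sum (σ := Finset.univ)
    fun L _ => ((he (idxM i) L (idxM j)).mul (Γ' K K L)).add
      ((he K K L).mul' (Γ (idxM i) L (idxM j)))
  have e4 : Lead s _ _ := Lead.sum (σ := Finset.univ) fun K _ => Lead.sum (σ := Finset.univ)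
    fun L _ => ((he (idxM i) L K).mul (Γ' (idxM j) K L)).add
      ((he (idxM j) K L).mul' (Γ (idxM i) L K))
  refine (((e1.sub e2).add e3).sub e4).congr rfl ?_
  simp only [sum_idx, symb, map_zero, mul_zero, zero_mul, add_zero, zero_add, sub_zero,
    sum_const_zero, h.left.cc_Γ_0, h.right.cc_Γ_0, h.left.cc_Γ_inf, h.right.cc_Γ_inf]
  simp only [AmbBase.wt, Matrix.one_apply, reduceCtorEq, if_false, if_true, Int.cast_zero,
    Int.cast_one, mul_zero, zero_mul, add_zero, zero_add, mul_one, Sum.inr.injEq,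
    Sum.inl.injEq, sum_add_distrib, Finset.sum_const,
    Finset.card_univ, Fintype.card_fin, nsmul_eq_mul, mul_ite, ite_mul, Finset.sum_ite_eq,
    Finset.sum_ite_eq', Finset.mem_univ]
  have r1 := h.g_gi_φ i j
  have r2 := h.g_gi_φ j i
  have s1 : ∑ x, ((s + 1) * ∑ l, gi x l * constantCoeff (Φ x l)) * -g i j
      = -((s + 1) * (∑ k, ∑ l, gi k l * constantCoeff (Φ k l)) * g i j) := by
    rw [← sum_mul, ← mul_sum]; ring
  have s2 : ∑ x, ((s + 1) * ∑ l, gi x l * constantCoeff (Φ j l)) * -g i x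
      = -((s + 1) * constantCoeff (Φ j i)) := by
    rw [← r2, mul_sum, ← sum_neg_distrib]
    exact sum_congr rfl fun _ _ => by ring
  have s3 : ∑ x, -g j x * ((s + 1) * ∑ l, gi x l * constantCoeff (Φ i l))
      = -((s + 1) * constantCoeff (Φ i j)) := by
    rw [← r1, mul_sum, ← sum_neg_distrib]
    exact sum_congr rfl fun _ _ => by ring
  rw [s1, s2, s3, h.φ_symm j i]
  linear_combination (-(n - 1) * (s + 1) * constantCoeff (Φ i j)) * b.t_mul

lemma lead_X_ric_inf :
    Lead s (X * (ric b.D Γ' (idxInf n) (idxInf n) - ric b.D Γ (idxInf n) (idxInf n)))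
      (-(s * ((s + 1) * ∑ k, ∑ l, gi k l * constantCoeff (Φ k l)))) := by
  obtain ⟨e, he⟩ := h.lead_sub
  have zX : ∀ {P : A⟦X⟧} {c : A}, Lead s P c → Lead s (X * P) 0 := fun hP =>
    (hP.mul X).congr rfl (by simp)
  have e1 : Lead s (X * ∑ K, b.D K (Γ' (idxInf n) K (idxInf n) - Γ (idxInf n) K (idxInf n))) 0 := by
    rw [sum_idx, mul_add, mul_add, mul_sum]
    have a1 := zX ((Lead.of_dvd_succ (h.dvd_sub_infinf (idx0 n))).liftD b.d0)
    have a2 : Lead s (∑ k, X * b.D (idxM k) (Γ' (idxInf n) (idxM k) (idxInf n)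
        - Γ (idxInf n) (idxM k) (idxInf n))) (∑ _k : Fin n, 0) :=
      Lead.sum fun k _ => zX ((Lead.of_dvd_succ (h.dvd_sub_infinf (idxM k))).liftD (b.d k))
    have a3 := (Lead.of_dvd_succ (h.dvd_sub_infinf (idxInf n))).X_mul_derivX (𝕜 := 𝕜)
    exact (a1.add (a2.add a3)).congr rfl (by simp)
  have e2 : Lead s (X * ∑ K, b.D (idxInf n) (Γ' (idxInf n) K K - Γ (idxInf n) K K))
      (∑ K, s * (symb b gi s (fun i j => constantCoeff (Φ i j)) e (idxInf n) K K)) := by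
    rw [mul_sum]
    exact Lead.sum fun K _ => (he _ _ _).X_mul_derivX
  have e3 := zX (Lead.sum (σ := Finset.univ) fun K _ => Lead.sum (σ := Finset.univ)
    fun L _ => ((he (idxInf n) L (idxInf n)).mul (Γ' K K L)).add
      ((he K K L).mul' (Γ (idxInf n) L (idxInf n))))
  have e4 := zX (Lead.sum (σ := Finset.univ) fun K _ => Lead.sum (σ := Finset.univ)
    fun L _ => ((he (idxInf n) L K).mul (Γ' (idxInf n) K L)).add
      ((he (idxInf n) K L).mul' (Γ (idxInf n) L K)))
  refine (((e1.sub e2).add e3).sub e4).congr ?_ ?_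
  · rw [ric_sub]; ring
  · simp only [sum_idx, symb, mul_zero, zero_add, add_zero, sub_zero, zero_sub, mul_sum]

lemma dvd_Gi_sub (K L : Idx n) : X ^ (s + 1) ∣ Gi' K L - Gi K L := by
  have e : Gi' - Gi = -(Gi' * (b.normalG (2 * X) 0 q' α - b.normalG (2 * X) 0 q α) * Gi) := by
    rw [mul_sub, h.right.inv', sub_mul, one_mul, mul_assoc, h.left.inv, mul_one]; abel
  rw [← Matrix.sub_apply, e, Matrix.neg_apply, Matrix.mul_apply]
  refine (dvd_neg).mpr (dvd_sum fun J _ => Dvd.dvd.mul_right ?_ _)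
  rw [Matrix.mul_apply]
  refine dvd_sum fun I _ => Dvd.dvd.mul_left ?_ _
  rw [Matrix.sub_apply, h.G_eq, add_sub_cancel_left]
  refine Dvd.dvd.mul_left ?_ _
  induction I using idx_cases <;> induction J using idx_cases <;> simp
  exact Dvd.dvd.mul_left (Dvd.intro _ rfl) _

/-! ### Warped metrics -/

section Warped

variable {u u' ψ v v' : A⟦X⟧}

lemma lead_hes_MM (hu : liftD b.d0 u = 0) (hu1 : constantCoeff u = 1)
    (hu' : u' = u + 2 * (X ^ (s + 1) * ψ)) (i j : Fin n) :
    Lead s (hes b.D Γ' (b.τ * u') (idxM i) (idxM j) - hes b.D Γ (b.τ * u) (idxM i) (idxM j))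
      (b.t * ((s + 1) * (constantCoeff (Φ i j) + 2 * constantCoeff ψ * g i j))) := by
  obtain ⟨e, he⟩ := h.lead_sub
  rw [AmbBase.f_add hu', hes_sub]
  have e1 := (lead_fluct b s ψ (idxM j)).liftD (b.d i)
  have e2 := Lead.sum (σ := Finset.univ) fun K _ =>
    (he (idxM i) K (idxM j)).mul' (b.D K (b.τ * u))
  have e3 := Lead.sum (σ := Finset.univ) fun K _ =>
    (lead_fluct b s ψ K).mul (Γ' (idxM i) K (idxM j))
  refine ((e1.sub e2).sub e3).congr rfl ?_
  simp only [sum_idx, symb, fluct, b.D_zero, b.d0_τ_mul hu, hu1, h.right.cc_Γ_inf, map_zero,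
    mul_zero, zero_mul, sum_const_zero]
  ring

lemma dvd_hes_sub_Minf (hu' : u' = u + 2 * (X ^ (s + 1) * ψ)) (i : Fin n) :
    X ^ s ∣ hes b.D Γ' (b.τ * u') (idxM i) (idxInf n)
      - hes b.D Γ (b.τ * u) (idxM i) (idxInf n) := by
  obtain ⟨e, he⟩ := h.lead_sub
  rw [AmbBase.f_add hu', hes_sub]
  exact (((lead_fluct b s ψ (idxInf n)).liftD (b.d i)).sub (Lead.sum fun K _ =>
    (he (idxM i) K (idxInf n)).mul' (b.D K (b.τ * u)))).sub (Lead.sum fun K _ =>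
    (lead_fluct b s ψ K).mul (Γ' (idxM i) K (idxInf n))) |>.dvd

lemma lead_X_hes_inf (hu' : u' = u + 2 * (X ^ (s + 1) * ψ)) :
    Lead s (X * (hes b.D Γ' (b.τ * u') (idxInf n) (idxInf n)
      - hes b.D Γ (b.τ * u) (idxInf n) (idxInf n)))
      (s * ((s + 1) * (2 * b.t * constantCoeff ψ))) := by
  obtain ⟨e, he⟩ := h.lead_sub
  rw [AmbBase.f_add hu', hes_sub]
  have e1 := (lead_fluct b s ψ (idxInf n)).X_mul_derivX (𝕜 := 𝕜)
  have e2 := (Lead.sum (σ := Finset.univ) fun K _ =>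
    (he (idxInf n) K (idxInf n)).mul' (b.D K (b.τ * u))).mul X
  have e3 := (Lead.sum (σ := Finset.univ) fun K _ =>
    (lead_fluct b s ψ K).mul (Γ' (idxInf n) K (idxInf n))).mul X
  refine ((e1.sub e2).sub e3).congr ?_ ?_
  · rw [mul_sub, mul_sub]; rfl
  · simp [fluct]

lemma dvd_v_sub (hv : b.τ * u * v = 1) (hu' : u' = u + 2 * (X ^ (s + 1) * ψ))
    (hv' : b.τ * u' * v' = 1) : X ^ (s + 1) ∣ v' - v := by
  refine ⟨-(2 * b.τ * ψ * v * v'), ?_⟩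
  rw [hu'] at hv'
  linear_combination -v' * hv + v * hv'

lemma lead_warpedRic_MM (hu : liftD b.d0 u = 0) (hu1 : constantCoeff u = 1)
    (hv : b.τ * u * v = 1) (hu' : u' = u + 2 * (X ^ (s + 1) * ψ)) (hv' : b.τ * u' * v' = 1)
    (κ : A) (i j : Fin n) :
    Lead s (warpedRic b.D Γ' (C κ) v' (b.τ * u') (idxM i) (idxM j)
        - warpedRic b.D Γ (C κ) v (b.τ * u) (idxM i) (idxM j))
      ((s + 1) * ((2 * s + 2 - n - κ) * constantCoeff (Φ i j)
        - ((∑ k, ∑ l, gi k l * constantCoeff (Φ k l)) + 2 * κ * constantCoeff ψ) * g i j)) := by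
  have hu1' : constantCoeff u' = 1 := by rw [hu']; simp [hu1]
  have e1 := h.lead_ric_MM i j
  have e2 := (h.lead_hes_MM hu hu1 hu' i j).mul (C κ * v')
  have e3 := (Lead.of_dvd_succ (h.dvd_v_sub hv hu' hv')).mul'
    (C κ * hes b.D Γ (b.τ * u) (idxM i) (idxM j))
  refine (e1.sub (e2.add e3)).congr ?_ ?_
  · simp only [warpedRic]; ring
  · rw [map_mul, constantCoeff_C, AmbBase.cc_v hu1' hv']
    linear_combination (-κ * ((s + 1) * (constantCoeff (Φ i j) + 2 * constantCoeff ψ * g i j)))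
      * b.t_mul

lemma lead_X_warpedRic_inf (hu1 : constantCoeff u = 1)
    (hv : b.τ * u * v = 1) (hu' : u' = u + 2 * (X ^ (s + 1) * ψ)) (hv' : b.τ * u' * v' = 1)
    (κ : A) :
    Lead s (X * (warpedRic b.D Γ' (C κ) v' (b.τ * u') (idxInf n) (idxInf n)
        - warpedRic b.D Γ (C κ) v (b.τ * u) (idxInf n) (idxInf n)))
      (-(s * ((s + 1) * ((∑ k, ∑ l, gi k l * constantCoeff (Φ k l))
        + 2 * κ * constantCoeff ψ)))) := by
  have hu1' : constantCoeff u' = 1 := by rw [hu']; simp [hu1]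
  have e1 := h.lead_X_ric_inf
  have e2 := (h.lead_X_hes_inf (u := u) hu').mul (C κ * v')
  have e3 := (Lead.of_dvd_succ (h.dvd_v_sub hv hu' hv')).mul'
    (X * (C κ * hes b.D Γ (b.τ * u) (idxInf n) (idxInf n)))
  refine (e1.sub (e2.add e3)).congr ?_ ?_
  · simp only [warpedRic]; ring
  · rw [map_mul, constantCoeff_C, AmbBase.cc_v hu1' hv']
    linear_combination (-κ * (s * ((s + 1) * (2 * constantCoeff ψ)))) * b.t_mul

lemma sum_gi_g : ∑ i, ∑ j, gi i j * g i j = n := by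
  have e : ∀ i, ∑ j, gi i j * g i j = 1 := fun i => by
    have := congrFun (congrFun h.left.gi_inv i) i
    rw [Matrix.mul_apply, Matrix.one_apply_eq] at this
    rw [← this]
    exact sum_congr rfl fun j _ => by rw [h.left.g_symm]
  simp [e]

lemma lead_warpedFlat (hu : liftD b.d0 u = 0) (hu1 : constantCoeff u = 1)
    (hψ : liftD b.d0 ψ = 0) (hu' : u' = u + 2 * (X ^ (s + 1) * ψ)) (κ : A) :
    Lead s (warpedFlat b.D Gi' Γ' (C κ) (b.τ * u') - warpedFlat b.D Gi Γ (C κ) (b.τ * u))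
      ((s + 1) * (((∑ k, ∑ l, gi k l * constantCoeff (Φ k l)) + 2 * κ * constantCoeff ψ)
        + 2 * (n + κ - 2 * s - 2) * constantCoeff ψ)) := by
  have hu1' : constantCoeff u' = 1 := by rw [hu']; simp [hu1]
  have hd' : liftD b.d0 u' = 0 := by
    rw [hu', map_add, hu, two_mul, map_add, Derivation.leibniz, Derivation.leibniz_pow, liftD_X,
      hψ]; simp
  have t1 : Lead s (∑ I, ∑ J, Gi' I J
      * (hes b.D Γ' (b.τ * u') I J - hes b.D Γ (b.τ * u) I J))
      (b.ti * ((s + 1) * ((∑ k, ∑ l, gi k l * constantCoeff (Φ k l))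
        + 2 * constantCoeff ψ * n - 4 * s * constantCoeff ψ))) := by
    have z : ∀ J, hes b.D Γ' (b.τ * u') (idx0 n) J - hes b.D Γ (b.τ * u) (idx0 n) J = 0 :=
      fun J => by rw [h.left.hes_zero hu, h.right.hes_zero hd', sub_zero]
    have z' : ∀ I, hes b.D Γ' (b.τ * u') I (idx0 n) - hes b.D Γ (b.τ * u) I (idx0 n) = 0 :=
      fun I => by
        rw [hes_symm h.left.lc.torsion b.commutes, hes_symm h.right.lc.torsion b.commutes, z]
    have w : ∀ i : Fin n, hes b.D Γ' (b.τ * u') (idxInf n) (idxM i)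
        - hes b.D Γ (b.τ * u) (idxInf n) (idxM i)
        = hes b.D Γ' (b.τ * u') (idxM i) (idxInf n)
        - hes b.D Γ (b.τ * u) (idxM i) (idxInf n) := fun i => by
      rw [hes_symm h.left.lc.torsion b.commutes, hes_symm h.right.lc.torsion b.commutes]
    simp only [sum_idx, z, z', w, mul_zero, sum_const_zero, zero_add]
    have a1 : Lead s _ _ := Lead.sum (σ := Finset.univ) fun i _ =>
      (Lead.sum (σ := Finset.univ) fun j _ => (h.lead_hes_MM hu hu1 hu' i j).mul
        (Gi' (idxM i) (idxM j))).add
      ((Lead.self (h.dvd_hes_sub_Minf (u := u) hu' i)).mul (Gi' (idxM i) (idxInf n)))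
    have a2 : Lead s _ _ := Lead.sum (σ := Finset.univ) fun i _ =>
      (Lead.self (h.dvd_hes_sub_Minf (u := u) hu' i)).mul (Gi' (idxInf n) (idxM i))
    have a3 := (h.lead_X_hes_inf (u := u) hu').mul (-2 * b.τi * Gi' (idxInf n) (idx0 n))
    refine (a1.add (a2.add a3)).congr ?_ ?_
    · rw [h.right.Gi_infinf]; congr 2; ring
    · simp only [h.right.cc_Gi_Minf, h.right.cc_Gi_infM, zero_mul, add_zero, zero_add,
        sum_const_zero, map_mul, map_neg, map_ofNat, b.constantCoeff_τi,
        h.right.cc_Gi_inf0, h.right.cc_Gi_MM]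
      have r := h.sum_gi_g
      have m : ∑ i, ∑ j, b.ti ^ 2 * gi i j * (b.t * ((s + 1)
          * (constantCoeff (Φ i j) + 2 * constantCoeff ψ * g i j)))
          = b.ti ^ 2 * b.t * (s + 1) * ((∑ k, ∑ l, gi k l * constantCoeff (Φ k l))
            + 2 * constantCoeff ψ * ∑ i, ∑ j, gi i j * g i j) := by
        simp only [mul_sum, ← sum_add_distrib]
        exact sum_congr₂ fun _ _ => by ring
      rw [m, r]
      linear_combination (b.ti * ((s + 1) * ((∑ k, ∑ l, gi k l * constantCoeff (Φ k l))
        + 2 * constantCoeff ψ * n - 4 * s * constantCoeff ψ))) * b.t_mul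
  have t2 : Lead s (∑ I, ∑ J, (Gi' I J - Gi I J) * hes b.D Γ (b.τ * u) I J) 0 :=
    Lead.of_dvd_succ (dvd_sum fun I _ => dvd_sum fun J _ =>
      (h.dvd_Gi_sub I J).mul_right _)
  have t3 := (Lead.sum (σ := Finset.univ) fun I _ => Lead.sum (σ := Finset.univ) fun J _ =>
    (((lead_fluct b s ψ J).mul (b.D I (b.τ * u'))).mul (Gi' I J)).add
      (((lead_fluct b s ψ I).mul (b.D J (b.τ * u))).mul (Gi' I J)))
  have t4 : Lead s (∑ I, ∑ J, (Gi' I J - Gi I J) * (b.D I (b.τ * u) * b.D J (b.τ * u))) 0 :=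
    Lead.of_dvd_succ (dvd_sum fun I _ => dvd_sum fun J _ =>
      (h.dvd_Gi_sub I J).mul_right _)
  have t5 := (Lead.of_dvd_succ (Lead.X_pow_mul (s + 1) (2 * b.τ * ψ)).dvd).mul'
    (trc Gi (hes b.D Γ (b.τ * u)))
  refine ((((t1.add t2).mul (b.τ * u')).add t5).add ((t3.add t4).mul (C κ - 1))).congr ?_ ?_
  · have c1 := trc_sub (Gi := Gi) (Gi' := Gi') (hes b.D Γ (b.τ * u)) (hes b.D Γ' (b.τ * u'))
    have c2 := grad2_sub (D := b.D) (Gi := Gi) (Gi' := Gi') (b.τ * u)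
      (X ^ (s + 1) * (2 * b.τ * ψ))
    rw [← AmbBase.f_add hu'] at c2
    rw [← c1, ← c2]
    simp only [warpedFlat]
    linear_combination (-trc Gi (hes b.D Γ (b.τ * u))) * AmbBase.f_add (b := b) hu'
  · simp only [sum_idx, fluct, mul_zero, zero_mul, add_zero, zero_add, sum_const_zero,
      h.right.cc_Gi_Minf, h.right.cc_Gi_infM, h.right.cc_Gi_infinf, h.right.cc_Gi_inf0,
      h.right.cc_Gi_0inf, b.D_zero, b.d0_τ_mul hd', b.d0_τ_mul hu, hu1, hu1', map_mul, map_sub,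
      map_one, constantCoeff_C, b.constantCoeff_τ, mul_one, one_mul]
    linear_combination ((s + 1) * ((∑ k, ∑ l, gi k l * constantCoeff (Φ k l))
        + 2 * constantCoeff ψ * n - 4 * s * constantCoeff ψ)
        + (κ - 1) * 4 * (s + 1) * constantCoeff ψ) * b.t_mul

end Warped

end IsPert

end

section

variable {𝕜 A : Type*} [Field 𝕜] [CharZero 𝕜] [CommRing A] [Algebra 𝕜 A] {n : ℕ}

namespace IsNormalData

variable {b : AmbBase 𝕜 A n} {g gi : BaseMat n A}
    {q : BaseMat n A⟦X⟧} {α : Fin n → A⟦X⟧}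
    {Gi : AmbMat n A⟦X⟧} {Γ : Idx n → AmbMat n A⟦X⟧}
    (h : IsNormalData b g gi (2 * X) 0 q α Gi Γ)
include h

lemma sum_gi_g : ∑ i, ∑ j, gi i j * g i j = n := by
  have e : ∀ i, ∑ j, gi i j * g i j = 1 := fun i => by
    have := congrFun (congrFun h.gi_inv i) i
    rw [Matrix.mul_apply, Matrix.one_apply_eq] at this
    rw [← this]
    exact sum_congr rfl fun j _ => by rw [h.g_symm]
  simp [e]

lemma sum_gi_g_mul (ε : Fin n → A) (i : Fin n) : ∑ j, ∑ k, gi j k * (g k i * ε j) = ε i := by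
  have e : ∀ j, ∑ k, gi j k * (g k i * ε j) = (gi * g) j i * ε j := fun j => by
    rw [Matrix.mul_apply, sum_mul]; exact sum_congr rfl fun _ _ => by ring
  simp only [e, h.gi_inv]
  simp [Matrix.one_apply]

lemma cc_Γ_0' (P K : Idx n) : constantCoeff (Γ (idx0 n) K P)
    = b.ti * ((AmbBase.wt K : A) * (1 : AmbMat n A) K P) := by
  rw [h.lc.torsion, h.cc_Γ_0]

variable {T : Idx n → Idx n → A⟦X⟧} {s : ℕ}

lemma lead_div_M (hT0 : ∀ J, T (idx0 n) J = 0) (hT0' : ∀ I, T I (idx0 n) = 0)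
    (hTd : ∀ I J, liftD b.d0 (T I J) = 0) (hsymm : ∀ I J, T I J = T J I)
    (hMM : ∀ j k, X ^ (s + 1) ∣ T (idxM j) (idxM k)) (hMi : ∀ j, X ^ s ∣ T (idxM j) (idxInf n))
    (hii : X ^ s ∣ T (idxInf n) (idxInf n)) (i : Fin n) :
    Lead s (∑ I, ∑ M, Gi I M * cov b.D Γ T M I (idxM i))
      (b.ti ^ 2 * (n - 2 - 2 * s) * coeff s (T (idxM i) (idxInf n))) := by
  have hd : ∀ I J, X ^ s ∣ T I J := by
    intro I J
    induction I using idx_cases with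
    | h0 => rw [hT0]; exact dvd_zero _
    | hM i =>
      induction J using idx_cases with
      | h0 => rw [hT0']; exact dvd_zero _
      | hM j => exact (Lead.of_dvd_succ (hMM i j)).dvd
      | hInf => exact hMi i
    | hInf =>
      induction J using idx_cases with
      | h0 => rw [hT0']; exact dvd_zero _
      | hM j => rw [hsymm]; exact hMi j
      | hInf => exact hii
  have z : ∀ j k, coeff s (T (idxM j) (idxM k)) = 0 := fun j k => coeff_of_dvd_succ (hMM j k)
  have e1 : Lead s (∑ I, ∑ M, Gi I M * b.D M (T I (idxM i)))
      (-2 * b.ti ^ 2 * s * coeff s (T (idxM i) (idxInf n))) := by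
    simp only [sum_idx, hT0, map_zero, mul_zero, sum_const_zero, zero_add, b.D_zero, hTd]
    have a1 : Lead s _ _ := Lead.sum (σ := Finset.univ) fun j _ =>
      (Lead.sum (σ := Finset.univ) fun k _ => ((Lead.of_dvd_succ (hMM j i)).liftD (b.d k)).mul
        (Gi (idxM j) (idxM k))).add
      ((Lead.self (dvd_derivX (𝕜 := 𝕜) (hMM j i))).mul (Gi (idxM j) (idxInf n)))
    have a2 : Lead s _ _ := Lead.sum (σ := Finset.univ) fun k _ =>
      ((Lead.self (hd (idxInf n) (idxM i))).liftD (b.d k)).mul (Gi (idxInf n) (idxM k))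
    have a3 := ((Lead.self (hd (idxInf n) (idxM i))).X_mul_derivX (𝕜 := 𝕜)).mul
      (-2 * b.τi * Gi (idxInf n) (idx0 n))
    refine (a1.add (a2.add a3)).congr ?_ ?_
    · rw [h.Gi_infinf, b.D_inf]; congr 2; ring
    · simp only [map_zero, mul_zero, sum_const_zero, h.cc_Gi_Minf, h.cc_Gi_infM, zero_mul,
        add_zero, zero_add, map_mul, map_neg, map_ofNat, b.constantCoeff_τi, h.cc_Gi_inf0]
      rw [hsymm (idxInf n)]; ring
  have e2 := Lead.sum (σ := Finset.univ) fun I _ => Lead.sum (σ := Finset.univ) fun M _ =>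
    (Lead.sum (σ := Finset.univ) fun L _ =>
      (Lead.self (hd L (idxM i))).mul (Γ M L I)).mul (Gi I M)
  have e3 := Lead.sum (σ := Finset.univ) fun I _ => Lead.sum (σ := Finset.univ) fun M _ =>
    (Lead.sum (σ := Finset.univ) fun L _ =>
      (Lead.self (hd I L)).mul (Γ M L (idxM i))).mul (Gi I M)
  refine ((e1.sub e2).sub e3).congr ?_ ?_
  · simp only [cov, mul_sub, sum_sub_distrib]
  · simp only [sum_idx, hT0, hT0', z, map_zero, mul_zero, sum_const_zero, zero_add, add_zero,
      h.cc_Gi_Minf, h.cc_Gi_infM, h.cc_Gi_infinf, h.cc_Gi_0inf, h.cc_Gi_inf0, h.cc_Gi_MM, zero_mul,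
      h.cc_Γ_0, h.cc_Γ_0', h.cc_Γ_inf]
    simp only [AmbBase.wt, Matrix.one_apply, reduceCtorEq, if_false, if_true, Int.cast_zero,
      Int.cast_one, mul_zero, zero_mul, add_zero, zero_add, mul_one, Sum.inr.injEq,
      Sum.inl.injEq, sum_const_zero, mul_ite, ite_mul, Finset.sum_ite_eq,
      Finset.sum_ite_eq', Finset.mem_univ]
    have r1 : ∀ c : A, ∑ x, ∑ y, b.ti ^ 2 * gi x y * (-g y x * c) = -(b.ti ^ 2 * n * c) :=
      fun c => by
        rw [← h.sum_gi_g, mul_sum, sum_mul, ← sum_neg_distrib]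
        refine sum_congr rfl fun x _ => ?_
        rw [mul_sum, sum_mul, ← sum_neg_distrib]
        exact sum_congr rfl fun y _ => by rw [h.g_symm x y]; ring
    have r2 : ∑ x, ∑ y, b.ti ^ 2 * gi x y * (-g y i * coeff s (T (idxM x) (idxInf n)))
        = -(b.ti ^ 2 * coeff s (T (idxM i) (idxInf n))) := by
      have e := h.sum_gi_g_mul (fun j => coeff s (T (idxM j) (idxInf n))) i
      rw [← e, mul_sum, ← sum_neg_distrib]
      refine sum_congr rfl fun x _ => ?_
      rw [mul_sum, ← sum_neg_distrib]
      exact sum_congr rfl fun y _ => by ring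
    rw [r1, r2, hsymm (idxInf n)]
    ring

lemma lead_div_inf (hT0 : ∀ J, T (idx0 n) J = 0) (hT0' : ∀ I, T I (idx0 n) = 0)
    (hTd : ∀ I J, liftD b.d0 (T I J) = 0) (hsymm : ∀ I J, T I J = T J I)
    (hMM : ∀ j k, X ^ s ∣ T (idxM j) (idxM k)) (hMi : ∀ j, X ^ s ∣ T (idxM j) (idxInf n))
    (hii : X ^ s ∣ X * T (idxInf n) (idxInf n)) :
    Lead s (X * ∑ I, ∑ M, Gi I M * cov b.D Γ T M I (idxInf n))
      (b.ti ^ 2 * (n - 1 - 2 * s) * coeff s (X * T (idxInf n) (idxInf n))) := by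
  have hX : ∀ I J, X ^ s ∣ T I J → Lead s (X * T I J) 0 := fun I J hI =>
    ((Lead.self hI).mul X).congr rfl (by simp)
  have hd : ∀ I J, X ^ s ∣ X * T I J := by
    intro I J
    induction I using idx_cases with
    | h0 => rw [hT0, mul_zero]; exact dvd_zero _
    | hM i =>
      induction J using idx_cases with
      | h0 => rw [hT0', mul_zero]; exact dvd_zero _
      | hM j => exact (hMM i j).mul_left _
      | hInf => exact (hMi i).mul_left _
    | hInf =>
      induction J using idx_cases with
      | h0 => rw [hT0', mul_zero]; exact dvd_zero _
      | hM j => rw [hsymm]; exact (hMi j).mul_left _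
      | hInf => exact hii
  have z : ∀ j k, coeff s (X * T (idxM j) (idxM k)) = 0 := fun j k => (hX _ _ (hMM j k)).coeff_eq
  have z1 : ∀ j, coeff s (X * T (idxM j) (idxInf n)) = 0 := fun j => (hX _ _ (hMi j)).coeff_eq
  have z2 : ∀ j, coeff s (X * T (idxInf n) (idxM j)) = 0 := fun j => by rw [hsymm, z1]
  have e1 : Lead s (X * ∑ I, ∑ M, Gi I M * b.D M (T I (idxInf n)))
      (-2 * b.ti ^ 2 * (s - 1) * coeff s (X * T (idxInf n) (idxInf n))) := by
    simp only [sum_idx, hT0, map_zero, mul_zero, sum_const_zero, zero_add, b.D_zero, hTd]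
    have a1 : Lead s _ _ := Lead.sum (σ := Finset.univ) fun j _ =>
      (((Lead.sum (σ := Finset.univ) fun k _ => ((Lead.self (hMi j)).liftD (b.d k)).mul
        (Gi (idxM j) (idxM k)))).mul X).add
      (((Lead.self (hMi j)).X_mul_derivX (𝕜 := 𝕜)).mul (Gi (idxM j) (idxInf n)))
    have a2 : Lead s _ _ := Lead.sum (σ := Finset.univ) fun k _ =>
      ((Lead.self hii).liftD (b.d k)).mul (Gi (idxInf n) (idxM k))
    have a3 := (((Lead.self hii).X_mul_derivX (𝕜 := 𝕜)).sub (Lead.self hii)).mul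
      (-2 * b.τi * Gi (idxInf n) (idx0 n))
    refine (a1.add (a2.add a3)).congr ?_ ?_
    · have x1 : ∀ k, liftD (b.d k) (X * T (idxInf n) (idxInf n))
          = X * liftD (b.d k) (T (idxInf n) (idxInf n)) := fun k => by
        rw [Derivation.leibniz, liftD_X]; simp
      have x2 : derivX 𝕜 A (X * T (idxInf n) (idxInf n))
          = T (idxInf n) (idxInf n) + X * derivX 𝕜 A (T (idxInf n) (idxInf n)) := by
        rw [Derivation.leibniz, derivX_X]; simp; ring
      rw [h.Gi_infinf, x2]
      simp only [x1, b.D_inf, b.D_M, mul_add, mul_sum, sum_add_distrib]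
      congr 1
      · congr 1
        exact sum_congr rfl fun _ _ => by ring
      · congr 1
        · exact sum_congr rfl fun _ _ => by ring
        · ring
    · simp only [h.cc_Gi_Minf, h.cc_Gi_infM, zero_mul, constantCoeff_X, sum_const_zero,
        add_zero, zero_add, map_mul, map_neg, map_ofNat, b.constantCoeff_τi, h.cc_Gi_inf0]
      ring
  have e2 := Lead.sum (σ := Finset.univ) fun I _ => Lead.sum (σ := Finset.univ) fun M _ =>
    (Lead.sum (σ := Finset.univ) fun L _ =>
      (Lead.self (hd L (idxInf n))).mul (Γ M L I)).mul (Gi I M)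
  have e3 := Lead.sum (σ := Finset.univ) fun I _ => Lead.sum (σ := Finset.univ) fun M _ =>
    (Lead.sum (σ := Finset.univ) fun L _ =>
      (Lead.self (hd I L)).mul (Γ M L (idxInf n))).mul (Gi I M)
  refine ((e1.sub e2).sub e3).congr ?_ ?_
  · simp only [cov, mul_sub, sum_sub_distrib, mul_sum]
    refine congrArg₂ _ (congrArg₂ _ rfl ?_) ?_ <;>
    exact sum_congr₂ fun _ _ =>
        sum_congr rfl fun _ _ => by ring
  · simp only [sum_idx, hT0, hT0', z, z1, z2, map_zero, mul_zero, sum_const_zero, zero_add,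
      add_zero, h.cc_Gi_Minf, h.cc_Gi_infM, h.cc_Gi_infinf, h.cc_Gi_0inf, h.cc_Gi_inf0,
      h.cc_Gi_MM, zero_mul, h.cc_Γ_0, h.cc_Γ_0', h.cc_Γ_inf]
    simp only [AmbBase.wt, Matrix.one_apply, reduceCtorEq, if_false, if_true, Int.cast_zero,
      Int.cast_one, mul_zero, zero_mul, add_zero, zero_add, mul_one, Sum.inr.injEq,
      Sum.inl.injEq, sum_const_zero, mul_ite, ite_mul, Finset.sum_ite_eq,
      Finset.sum_ite_eq', Finset.mem_univ]
    have r1 : ∀ c : A, ∑ x, ∑ y, b.ti ^ 2 * gi x y * (-g y x * c) = -(b.ti ^ 2 * n * c) :=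
      fun c => by
        rw [← h.sum_gi_g, mul_sum, sum_mul, ← sum_neg_distrib]
        refine sum_congr rfl fun x _ => ?_
        rw [mul_sum, sum_mul, ← sum_neg_distrib]
        exact sum_congr rfl fun y _ => by rw [h.g_symm x y]; ring
    rw [r1]
    ring

lemma lead_trc (hT0 : ∀ J, T (idx0 n) J = 0) (hT0' : ∀ I, T I (idx0 n) = 0)
    (hsymm : ∀ I J, T I J = T J I)
    (hMM : ∀ j k, X ^ s ∣ T (idxM j) (idxM k)) (hMi : ∀ j, X ^ s ∣ T (idxM j) (idxInf n))
    (hii : X ^ s ∣ X * T (idxInf n) (idxInf n)) :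
    Lead s (trc Gi T) (b.ti ^ 2 * ((∑ j, ∑ k, gi j k * coeff s (T (idxM j) (idxM k)))
      - 2 * coeff s (X * T (idxInf n) (idxInf n)))) := by
  simp only [trc, sum_idx, hT0, hT0', hsymm (idxInf n) (idxM _), mul_zero, sum_const_zero,
    zero_add]
  have a1 : Lead s _ _ := Lead.sum (σ := Finset.univ) fun j _ =>
    (Lead.sum (σ := Finset.univ) fun k _ => (Lead.self (hMM j k)).mul (Gi (idxM j) (idxM k))).add
      ((Lead.self (hMi j)).mul (Gi (idxM j) (idxInf n)))
  have a2 : Lead s _ _ := Lead.sum (σ := Finset.univ) fun k _ =>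
    (Lead.self (hMi k)).mul (Gi (idxInf n) (idxM k))
  have a3 := (Lead.self hii).mul (-2 * b.τi * Gi (idxInf n) (idx0 n))
  refine (a1.add (a2.add a3)).congr ?_ ?_
  · rw [h.Gi_infinf]; congr 2; ring
  · simp only [h.cc_Gi_Minf, h.cc_Gi_infM, zero_mul, sum_const_zero, h.cc_Gi_MM,
      add_zero, zero_add, map_mul, map_neg, map_ofNat, b.constantCoeff_τi, h.cc_Gi_inf0, mul_sub,
      mul_sum, mul_assoc]
    ring

section Bianchi

variable {u v : A⟦X⟧} (hu : liftD b.d0 u = 0) (hu1 : constantCoeff u = 1)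
  (hv : b.τ * u * v = 1) {d : 𝕜}
include hu hu1 hv

lemma ti_sq_cancel {x : A} (hx : b.ti ^ 2 * x = 0) : x = 0 := by
  linear_combination b.t ^ 2 * hx - x * (b.t * b.ti + 1) * b.t_mul

/-- The consequences of the vanishing of the Ricci tensor along `M` for its mixed components. -/
theorem coeff_warpedRic_Minf
    (hMM : ∀ j k, X ^ (s + 1) ∣
      warpedRic b.D Γ (C (algebraMap 𝕜 A d)) v (b.τ * u) (idxM j) (idxM k))
    (hMi : ∀ j, X ^ s ∣ warpedRic b.D Γ (C (algebraMap 𝕜 A d)) v (b.τ * u) (idxM j) (idxInf n))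
    (hii : X ^ s ∣ warpedRic b.D Γ (C (algebraMap 𝕜 A d)) v (b.τ * u) (idxInf n) (idxInf n))
    (hS : X ^ (s + 1) ∣ warpedFlat b.D Gi Γ (C (algebraMap 𝕜 A d)) (b.τ * u)) (i : Fin n) :
    (n + algebraMap 𝕜 A d - 2 - 2 * s)
      * coeff s (warpedRic b.D Γ (C (algebraMap 𝕜 A d)) v (b.τ * u) (idxM i) (idxInf n)) = 0 := by
  have B := warped_bianchi h.lc h.inv b.commutes (κ := C (algebraMap 𝕜 A d)) (v := v)
    (f := b.τ * u) (fun I => by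
      induction I using idx_cases <;> simp [liftD_C, derivX_C]) hv (idxM i)
  set E := warpedRic b.D Γ (C (algebraMap 𝕜 A d)) v (b.τ * u) with hE
  set S := warpedFlat b.D Gi Γ (C (algebraMap 𝕜 A d)) (b.τ * u) with hS'
  have E0 : ∀ J, E (idx0 n) J = 0 := h.warpedRic_zero hu _ _
  have Es : ∀ I J, E I J = E J I := warpedRic_symm h.lc h.inv b.commutes _ _ _
  have E0' : ∀ J, E J (idx0 n) = 0 := fun J => by rw [Es, E0]
  have Ed : ∀ I J, liftD b.d0 (E I J) = 0 := by
    intro I J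
    rcases I with I | I
    · exact (congrArg _ (E0 J)).trans (map_zero _)
    · rcases J with J | J
      · exact (congrArg _ (E0' _)).trans (map_zero _)
      · exact h.d0_warpedRic hu hv I J
  have l1 := h.lead_div_M E0 E0' Ed Es hMM hMi hii i
  have hX : X ^ (s + 1) ∣ X * E (idxInf n) (idxInf n) := X_mul_dvd_of_dvd hii
  have l2 := h.lead_trc E0 E0' Es (fun j k => (Lead.of_dvd_succ (hMM j k)).dvd) hMi
    (Lead.of_dvd_succ hX).dvd
  have l3 := Lead.sum (σ := Finset.univ) fun I _ => Lead.sum (σ := Finset.univ) fun M _ =>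
    (show Lead s (Gi I M * b.D M (b.τ * u) * E I (idxM i)) _ from (by
      have hd : X ^ s ∣ E I (idxM i) := by
        induction I using idx_cases with
        | h0 => rw [E0]; exact dvd_zero _
        | hM j => exact (Lead.of_dvd_succ (hMM j i)).dvd
        | hInf => rw [Es]; exact hMi i
      exact (Lead.self hd).mul _))
  have lS := Lead.of_dvd_succ hS
  have L := ((l1.mul 2).add (l3.mul (2 * C (algebraMap 𝕜 A d) * v))).add
    (lS.mul (2 * C (algebraMap 𝕜 A d) * v ^ 3 * b.D (idxM i) (b.τ * u)))
  have R := (l2.sub (lS.mul (C (algebraMap 𝕜 A d) * v ^ 2))).liftD (b.d i)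
  rw [← b.D_M, ← B] at R
  have K := L.coeff_eq.symm.trans R.coeff_eq
  have z : ∀ j k, coeff s (E (idxM j) (idxM k)) = 0 := fun j k => coeff_of_dvd_succ (hMM j k)
  have z0 : coeff s (X * E (idxInf n) (idxInf n)) = 0 := coeff_of_dvd_succ hX
  simp only [sum_idx, E0, z, z0, map_zero, mul_zero, sum_const_zero, map_mul, map_ofNat,
    constantCoeff_C, AmbBase.cc_v hu1 hv, h.cc_Gi_infM, h.cc_Gi_infinf, h.cc_Gi_inf0, zero_mul,
    add_zero, zero_add, sub_zero, b.D_zero, b.d0_τ_mul hu, hu1, mul_one, Es (idxInf n) (idxM _)] at K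
  refine (isUnit_two_of_field 𝕜).mul_left_cancel (h.ti_sq_cancel hu hu1 hv ?_ |>.trans (mul_zero _).symm)
  linear_combination K

/-- The consequences of the vanishing of the Ricci tensor along `M` for its normal component. -/
theorem coeff_X_warpedRic_inf
    (hMM : ∀ j k, X ^ s ∣
      warpedRic b.D Γ (C (algebraMap 𝕜 A d)) v (b.τ * u) (idxM j) (idxM k))
    (hMi : ∀ j, X ^ s ∣ warpedRic b.D Γ (C (algebraMap 𝕜 A d)) v (b.τ * u) (idxM j) (idxInf n))
    (hii : X ^ s ∣ X * warpedRic b.D Γ (C (algebraMap 𝕜 A d)) v (b.τ * u) (idxInf n) (idxInf n))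
    (hS : X ^ s ∣ warpedFlat b.D Gi Γ (C (algebraMap 𝕜 A d)) (b.τ * u)) :
    2 * (n + algebraMap 𝕜 A d - s - 1) * coeff s
        (X * warpedRic b.D Γ (C (algebraMap 𝕜 A d)) v (b.τ * u) (idxInf n) (idxInf n))
      = s * ((∑ j, ∑ k, gi j k * coeff s
          (warpedRic b.D Γ (C (algebraMap 𝕜 A d)) v (b.τ * u) (idxM j) (idxM k)))
        - algebraMap 𝕜 A d * coeff s (warpedFlat b.D Gi Γ (C (algebraMap 𝕜 A d)) (b.τ * u))) := by
  have B := warped_bianchi h.lc h.inv b.commutes (κ := C (algebraMap 𝕜 A d)) (v := v)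
    (f := b.τ * u) (fun I => by
      induction I using idx_cases <;> simp [liftD_C, derivX_C]) hv (idxInf n)
  set E := warpedRic b.D Γ (C (algebraMap 𝕜 A d)) v (b.τ * u) with hE
  set S := warpedFlat b.D Gi Γ (C (algebraMap 𝕜 A d)) (b.τ * u) with hS'
  have E0 : ∀ J, E (idx0 n) J = 0 := h.warpedRic_zero hu _ _
  have Es : ∀ I J, E I J = E J I := warpedRic_symm h.lc h.inv b.commutes _ _ _
  have E0' : ∀ J, E J (idx0 n) = 0 := fun J => by rw [Es, E0]
  have Ed : ∀ I J, liftD b.d0 (E I J) = 0 := by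
    intro I J
    rcases I with I | I
    · exact (congrArg _ (E0 J)).trans (map_zero _)
    · rcases J with J | J
      · exact (congrArg _ (E0' _)).trans (map_zero _)
      · exact h.d0_warpedRic hu hv I J
  have l1 := h.lead_div_inf E0 E0' Ed Es hMM hMi hii
  have l2 := h.lead_trc E0 E0' Es hMM hMi hii
  have l3 := Lead.sum (σ := Finset.univ) fun I _ => Lead.sum (σ := Finset.univ) fun M _ =>
    (show Lead s (Gi I M * b.D M (b.τ * u) * (X * E I (idxInf n))) _ from (by
      have hd : X ^ s ∣ X * E I (idxInf n) := by
        induction I using idx_cases with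
        | h0 => rw [E0, mul_zero]; exact dvd_zero _
        | hM j => exact (hMi j).mul_left _
        | hInf => exact hii
      exact (Lead.self hd).mul _))
  have lS := Lead.self hS
  have L := ((l1.mul 2).add (l3.mul (2 * C (algebraMap 𝕜 A d) * v))).add
    (lS.mul (2 * C (algebraMap 𝕜 A d) * v ^ 3 * b.D (idxInf n) (b.τ * u) * X))
  have R := (l2.sub (lS.mul (C (algebraMap 𝕜 A d) * v ^ 2))).X_mul_derivX (𝕜 := 𝕜)
  rw [← b.D_inf, ← B] at R
  have Z : ∑ I, ∑ M, Gi I M * b.D M (b.τ * u) * (X * E I (idxInf n))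
      = X * ∑ I, ∑ M, Gi I M * b.D M (b.τ * u) * E I (idxInf n) := by
    simp only [mul_sum]
    exact sum_congr₂ fun _ _ => by ring
  rw [Z] at L
  have K := (L.congr (by ring) rfl).coeff_eq.symm.trans R.coeff_eq
  have z1 : ∀ j, coeff s (X * E (idxM j) (idxInf n)) = 0 := fun j => by
    rw [coeff_mul_of_dvd _ (hMi j)]; simp
  simp only [sum_idx, E0, z1, map_zero, mul_zero, sum_const_zero, map_mul, map_ofNat,
    constantCoeff_C, AmbBase.cc_v hu1 hv, h.cc_Gi_infM, h.cc_Gi_infinf, h.cc_Gi_inf0, zero_mul,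
    add_zero, zero_add, b.D_zero, b.d0_τ_mul hu, hu1, mul_one, constantCoeff_X, map_pow] at K
  refine sub_eq_zero.mp (h.ti_sq_cancel hu hu1 hv ?_)
  linear_combination K

end Bianchi

end IsNormalData

end

section

variable {𝕜 A : Type*} [Field 𝕜] [CharZero 𝕜] [CommRing A] [Algebra 𝕜 A] {n : ℕ}

/-! ### Existence of the Levi-Civita symbols -/

lemma exists_inverse_of_constantCoeff {ι : Type*} [Fintype ι] [DecidableEq ι]
    {G : Matrix ι ι A⟦X⟧} {N : Matrix ι ι A} (hN : G.map constantCoeff * N = 1) :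
    ∃ Gi, G * Gi = 1 := by
  refine ⟨G⁻¹, Matrix.mul_nonsing_inv _ ?_⟩
  rw [PowerSeries.isUnit_iff_constantCoeff, RingHom.map_det]
  exact Matrix.isUnit_det_of_right_inverse hN

lemma exists_isLC {R ι : Type*} [CommRing R] [Algebra 𝕜 R] [Fintype ι] [DecidableEq ι]
    (D : ι → Derivation 𝕜 R R) {G Gi : Matrix ι ι R} (hs : ∀ I J, G I J = G J I)
    (hG : G * Gi = 1) : ∃ Γ, IsLC D G Γ := by
  refine ⟨fun I => Matrix.of fun K J => algebraMap 𝕜 R (1 / 2)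
    * ∑ L, Gi K L * (D I (G J L) + D J (G I L) - D L (G I J)),
    isLC_of_upper (isUnit_two_of_field 𝕜) hs hG fun K I J => ?_⟩
  rw [Matrix.of_apply, ← mul_assoc, ← map_ofNat (algebraMap 𝕜 R) 2, ← map_mul]
  norm_num

/-- The inverse of the metric at `X = 0`. -/
def AmbBase.inverseAtZero (b : AmbBase 𝕜 A n) (gi : BaseMat n A) (a : Fin n → A) :
    AmbMat n A :=
  Matrix.of fun I J => match I, J with
  | Sum.inl _, Sum.inl _ => ∑ j, a j * ∑ k, gi j k * a k
  | Sum.inl _, Sum.inr (Sum.inl j) => -(b.ti * ∑ k, a k * gi k j)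
  | Sum.inl _, Sum.inr (Sum.inr _) => b.ti
  | Sum.inr (Sum.inl i), Sum.inl _ => -(b.ti * ∑ k, gi i k * a k)
  | Sum.inr (Sum.inl i), Sum.inr (Sum.inl j) => b.ti ^ 2 * gi i j
  | Sum.inr (Sum.inl _), Sum.inr (Sum.inr _) => 0
  | Sum.inr (Sum.inr _), Sum.inl _ => b.ti
  | Sum.inr (Sum.inr _), Sum.inr (Sum.inl _) => 0
  | Sum.inr (Sum.inr _), Sum.inr (Sum.inr _) => 0

lemma AmbBase.mul_inverseAtZero (b : AmbBase 𝕜 A n) {g gi : BaseMat n A}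
    (hg : g * gi = 1) {q : BaseMat n A⟦X⟧} (hq : ∀ i j, constantCoeff (q i j) = g i j)
    (α : Fin n → A⟦X⟧) :
    (b.normalG (2 * X) 0 q α).map constantCoeff
      * b.inverseAtZero gi (fun i => constantCoeff (α i)) = 1 := by
  have r : ∀ i, ∑ j, g i j * ∑ k, gi j k * constantCoeff (α k) = constantCoeff (α i) := by
    intro i
    have e : ∑ j, g i j * ∑ k, gi j k * constantCoeff (α k)
        = ∑ k, (g * gi) i k * constantCoeff (α k) := by
      simp only [Matrix.mul_apply, sum_mul, mul_sum]
      exact sum_swap fun _ _ => by ring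
    rw [e, hg]; simp [Matrix.one_apply]
  have r' : ∀ i j, ∑ k, g i k * gi k j = (1 : BaseMat n A) i j := fun i j => by
    rw [← hg, Matrix.mul_apply]
  ext I J
  rw [Matrix.mul_apply, sum_idx]
  induction I using idx_cases with
  | h0 =>
    induction J using idx_cases <;> simp [inverseAtZero, b.t_mul]
  | hM i =>
    induction J using idx_cases with
    | h0 =>
      have e : ∑ x, b.t ^ 2 * g i x * -(b.ti * ∑ k, gi x k * constantCoeff (α k))
          = -(b.t ^ 2 * b.ti * constantCoeff (α i)) := by
        rw [← r i, mul_sum, ← sum_neg_distrib]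
        exact sum_congr rfl fun _ _ => by ring
      simp only [Matrix.map_apply, b.normalG_M0, b.normalG_MM, b.normalG_Minf, map_mul, map_pow,
        b.constantCoeff_τ, Pi.zero_apply, map_zero, mul_zero, zero_mul, inverseAtZero,
        Matrix.of_apply, hq, e]
      simp; ring
    | hM j =>
      have e : ∑ x, b.t ^ 2 * g i x * (b.ti ^ 2 * gi x j)
          = (b.t * b.ti) ^ 2 * (1 : BaseMat n A) i j := by
        rw [← r' i j, mul_sum]
        exact sum_congr rfl fun _ _ => by ring
      simp only [Matrix.map_apply, b.normalG_M0, b.normalG_MM, b.normalG_Minf, map_mul, map_pow,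
        b.constantCoeff_τ, Pi.zero_apply, map_zero, mul_zero, zero_mul, inverseAtZero,
        Matrix.of_apply, hq, e, b.t_mul]
      by_cases hij : i = j <;> simp [Matrix.one_apply, hij]
    | hInf => simp [inverseAtZero]
  | hInf =>
    induction J using idx_cases with
    | h0 =>
      have e : ∑ x, b.t ^ 2 * constantCoeff (α x) * -(b.ti * ∑ k, gi x k * constantCoeff (α k))
          = -(b.t ^ 2 * b.ti * ∑ j, constantCoeff (α j) * ∑ k, gi j k * constantCoeff (α k)) := by
        rw [mul_sum, ← sum_neg_distrib]
        exact sum_congr rfl fun _ _ => by ring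
      simp only [Matrix.map_apply, b.normalG_inf0, b.normalG_infM, b.normalG_infinf, map_mul,
        map_pow, b.constantCoeff_τ, map_zero, zero_mul, inverseAtZero, Matrix.of_apply, e]
      simp
      linear_combination (-b.t * ∑ j, constantCoeff (α j) * ∑ k, gi j k * constantCoeff (α k))
        * b.t_mul
    | hM j =>
      have e : ∑ x, b.t ^ 2 * constantCoeff (α x) * (b.ti ^ 2 * gi x j)
          = b.t ^ 2 * b.ti ^ 2 * ∑ k, constantCoeff (α k) * gi k j := by
        rw [mul_sum]
        exact sum_congr rfl fun _ _ => by ring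
      simp only [Matrix.map_apply, b.normalG_inf0, b.normalG_infM, b.normalG_infinf, map_mul,
        map_pow, b.constantCoeff_τ, map_zero, zero_mul, inverseAtZero, Matrix.of_apply, e]
      simp
      linear_combination (b.t * b.ti * ∑ k, constantCoeff (α k) * gi k j) * b.t_mul
    | hInf => simp [inverseAtZero, b.t_mul]

/-- Coefficients of a straight metric in Weyl-normal form, and of the function `f = t u`. -/
structure IsSeed (b : AmbBase 𝕜 A n) (g : BaseMat n A)
    (q : BaseMat n A⟦X⟧) (u : A⟦X⟧) : Prop where
  symm : ∀ i j, q i j = q j i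
  cc : ∀ i j, constantCoeff (q i j) = g i j
  d0 : ∀ i j, liftD b.d0 (q i j) = 0
  cc_u : constantCoeff u = 1
  d0_u : liftD b.d0 u = 0

lemma IsSeed.exists_data {b : AmbBase 𝕜 A n} {g gi : BaseMat n A}
    {q : BaseMat n A⟦X⟧} {u : A⟦X⟧} {α : Fin n → A⟦X⟧} (h : IsSeed b g q u)
    (hg : g * gi = 1) (hα : ∀ i, liftD b.d0 (α i) = 0) :
    ∃ Gi Γ v, IsNormalData b g gi (2 * X) 0 q α Gi Γ ∧ b.τ * u * v = 1 := by
  obtain ⟨Gi, hGi⟩ := exists_inverse_of_constantCoeff (b.mul_inverseAtZero hg h.cc α)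
  have hs : ∀ I J, b.normalG (2 * X) 0 q α I J = b.normalG (2 * X) 0 q α J I := by
    intro I J
    induction I using idx_cases <;> induction J using idx_cases <;> simp
    rw [h.symm]
  obtain ⟨Γ, hΓ⟩ := exists_isLC b.D hs hGi
  have hunit : IsUnit u := PowerSeries.isUnit_iff_constantCoeff.mpr (by rw [h.cc_u]; exact isUnit_one)
  obtain ⟨w, hw⟩ := hunit.exists_right_inv
  refine ⟨Gi, Γ, b.τi * w, ⟨hΓ, hGi, hg, by simp, by simp, h.cc, ?_, by simp, h.d0, hα⟩, ?_⟩
  · rw [two_mul, map_add, liftD_X, add_zero]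
  · linear_combination b.τ * b.τi * hw + b.τ_mul

/-! ### Uniqueness -/

lemma exists_eq_two_mul (𝕜 : Type*) {A : Type*} [Field 𝕜] [CharZero 𝕜] [CommRing A] [Algebra 𝕜 A]
    {P Q : A⟦X⟧} {m : ℕ} (h : X ^ m ∣ Q - P) :
    ∃ Φ, Q = P + 2 * (X ^ m * Φ) := by
  obtain ⟨Ψ, hΨ⟩ := h
  obtain ⟨c, hc⟩ := (isUnit_two_of_field 𝕜 (R := A⟦X⟧)).exists_right_inv
  exact ⟨c * Ψ, by linear_combination hΨ - X ^ m * Ψ * hc⟩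

theorem normalData_unique {b : AmbBase 𝕜 A n} {g gi : BaseMat n A}
    {q q' : BaseMat n A⟦X⟧} {α : Fin n → A⟦X⟧}
    {Gi Gi' : AmbMat n A⟦X⟧} {Γ Γ' : Idx n → AmbMat n A⟦X⟧}
    (h : IsNormalData b g gi (2 * X) 0 q α Gi Γ) (h' : IsNormalData b g gi (2 * X) 0 q' α Gi' Γ')
    {d : 𝕜} (hd1 : d ≠ 1) (hd : ∀ m : ℕ, d ≠ 2 * m) {u v u' v' : A⟦X⟧}
    (hu : liftD b.d0 u = 0) (hu1 : constantCoeff u = 1) (hv : b.τ * u * v = 1)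
    (hu' : liftD b.d0 u' = 0) (hu1' : constantCoeff u' = 1) (hv' : b.τ * u' * v' = 1)
    (hE : ∀ I J, warpedRic b.D Γ (C (algebraMap 𝕜 A (d - n))) v (b.τ * u) I J = 0)
    (hE' : ∀ I J, warpedRic b.D Γ' (C (algebraMap 𝕜 A (d - n))) v' (b.τ * u') I J = 0)
    (hS : (warpedFlat b.D Gi Γ (C (algebraMap 𝕜 A (d - n))) (b.τ * u) = 0 ∧
      warpedFlat b.D Gi' Γ' (C (algebraMap 𝕜 A (d - n))) (b.τ * u') = 0) ∨ (d = n ∧ u' = u)) :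
    q' = q ∧ u' = u := by
  have key : ∀ s : ℕ, (∀ i j, X ^ (s + 1) ∣ q' i j - q i j) ∧ X ^ (s + 1) ∣ u' - u := by
    intro s
    induction s with
    | zero =>
      refine ⟨fun i j => ?_, ?_⟩
      · rw [zero_add, pow_one, X_dvd_iff, map_sub, h.cc_q, h'.cc_q, sub_self]
      · rw [zero_add, pow_one, X_dvd_iff, map_sub, hu1, hu1', sub_self]
    | succ s ih =>
      obtain ⟨ihq, ihu⟩ := ih
      choose Φ hΦ using fun i j => exists_eq_two_mul 𝕜 (ihq i j)
      obtain ⟨ψ, hψ, hψu⟩ : ∃ ψ, u' = u + 2 * (X ^ (s + 1) * ψ) ∧ (u' = u → ψ = 0) := by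
        by_cases huu : u' = u
        · exact ⟨0, by rw [huu]; ring, fun _ => rfl⟩
        · obtain ⟨ψ, hψ⟩ := exists_eq_two_mul 𝕜 ihu
          exact ⟨ψ, hψ, fun e => absurd e huu⟩
      have dψ : liftD b.d0 ψ = 0 := by
        refine liftD_of_X_pow_mul (s := s + 1) ?_
        have e := hu'
        rw [hψ, map_add, hu, zero_add, two_mul, map_add, ← two_mul] at e
        exact (isUnit_two_of_field 𝕜).mul_left_cancel (e.trans (mul_zero _).symm)
      have hP : IsPert b g gi q α Gi Γ q' Gi' Γ' s (Matrix.of Φ) := ⟨h, h', hΦ⟩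
      set κ := algebraMap 𝕜 A (d - n) with hκ
      have hκd : (n : A) + κ = algebraMap 𝕜 A d := by
        rw [hκ, map_sub, map_natCast]; ring
      set φ : Fin n → Fin n → A := fun i j => constantCoeff (Φ i j) with hφ
      set ψ0 := constantCoeff ψ with hψ0
      set θ := (∑ k, ∑ l, gi k l * φ k l) + 2 * κ * ψ0 with hθ
      have s1 : (algebraMap 𝕜 A (s + 1)) = s + 1 := by simp
      have s1' : (s : 𝕜) + 1 ≠ 0 := Nat.cast_add_one_ne_zero s
      have nD : (2 * s + 2 - d : 𝕜) ≠ 0 := by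
        have := hd (s + 1); push_cast at this
        intro e; exact this (by linear_combination -e)
      have aD : algebraMap 𝕜 A (2 * s + 2 - d) = 2 * s + 2 - n - κ := by
        rw [map_sub, ← hκd]; simp only [map_add, map_mul, map_ofNat, map_natCast]; ring
      have e1 : ∀ i j, (2 * s + 2 - n - κ) * φ i j = θ * g i j := fun i j => by
        have := (hP.lead_warpedRic_MM hu hu1 hv hψ hv' κ i j).coeff_eq
        rw [hE, hE', sub_zero, map_zero] at this
        refine sub_eq_zero.mp (algebraMap_cancel s1' ?_)
        rw [s1, mul_zero]; exact this.symm
      have e2 : s * ((s + 1) * θ) = 0 := by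
        have := (hP.lead_X_warpedRic_inf hu1 hv hψ hv' κ).coeff_eq
        rw [hE, hE', sub_zero, mul_zero, map_zero] at this
        exact neg_eq_zero.mp this.symm
      have e3 : κ * (2 * (2 * s + 2 - n - κ) * ψ0) = κ * θ ∧
          (θ = 0 → ψ0 = 0) := by
        rcases hS with ⟨hS, hS'⟩ | ⟨hS, hS'⟩
        · have := (hP.lead_warpedFlat hu hu1 dψ hψ κ).coeff_eq
          rw [hS, hS', sub_zero, map_zero] at this
          have e : θ + 2 * (n + κ - 2 * s - 2) * ψ0 = 0 :=
            algebraMap_cancel s1' (by rw [s1, mul_zero]; exact this.symm)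
          refine ⟨by linear_combination (-κ) * e, fun h0 => ?_⟩
          rw [h0] at e
          refine algebraMap_cancel nD ?_
          rw [aD]
          refine (isUnit_two_of_field 𝕜).mul_left_cancel ?_
          linear_combination -e
        · have : κ = 0 := by rw [hκ, hS, sub_self, map_zero]
          refine ⟨by rw [this]; ring, fun _ => ?_⟩
          rw [hψ0, hψu hS', map_zero]
      have e4 : (2 * s + 2 - n - κ) * θ = (n + κ) * θ := by
        have t : (2 * s + 2 - n - κ) * ∑ k, ∑ l, gi k l * φ k l
            = (∑ i, ∑ j, gi i j * g i j) * θ := by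
          rw [mul_sum, sum_mul]
          refine sum_congr rfl fun k _ => ?_
          rw [mul_sum, sum_mul]
          exact sum_congr rfl fun l _ => by linear_combination gi k l * e1 k l
        rw [h.sum_gi_g, hθ] at t
        rw [hθ]
        rw [hθ] at e3
        linear_combination t + e3.1
      have θ0 : θ = 0 := by
        rcases Nat.eq_zero_or_pos s with hs | hs
        · refine algebraMap_cancel (sub_ne_zero.mpr hd1) ?_
          refine (isUnit_two_of_field 𝕜).mul_left_cancel ?_
          rw [map_sub, ← hκd, map_one]
          rw [hs, Nat.cast_zero] at e4
          linear_combination -e4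
        · have nz : (s : 𝕜) * (s + 1) ≠ 0 :=
            mul_ne_zero (Nat.cast_ne_zero.mpr hs.ne') s1'
          refine algebraMap_cancel nz ?_
          rw [map_mul, s1, map_natCast, mul_zero, ← e2]; ring
      have φ0 : ∀ i j, φ i j = 0 := fun i j => by
        refine algebraMap_cancel nD ?_
        rw [aD, e1, θ0]; ring
      have ψ00 := e3.2 θ0
      refine ⟨fun i j => ?_, ?_⟩
      · rw [hΦ, add_sub_cancel_left, pow_succ (X : A⟦X⟧) (s + 1)]
        exact Dvd.dvd.mul_left (mul_dvd_mul_left _ (X_dvd_iff.mpr (φ0 i j))) _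
      · rw [hψ, add_sub_cancel_left, pow_succ (X : A⟦X⟧) (s + 1)]
        exact Dvd.dvd.mul_left (mul_dvd_mul_left _ (X_dvd_iff.mpr ψ00)) _
  have drop : ∀ {s : ℕ} {P : A⟦X⟧}, X ^ (s + 1) ∣ P → X ^ s ∣ P := fun h =>
    (pow_dvd_pow _ (Nat.le_succ _)).trans h
  refine ⟨?_, eq_of_forall_dvd fun s => drop (key s).2⟩
  ext1 i j
  exact eq_of_forall_dvd fun s => drop ((key s).1 i j)

end

section

variable {𝕜 A : Type*} [Field 𝕜] [CharZero 𝕜] [CommRing A] [Algebra 𝕜 A] {n : ℕ}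
  {b : AmbBase 𝕜 A n} {g gi : BaseMat n A} {α : Fin n → A⟦X⟧}

/-! ### Existence -/

/-- The Ricci tensor of formal dimension `d + 2` vanishes to order `s` along `M`, in the flat
directions, and, up to a factor `X`, in the normal direction. -/
structure FlatTo (b : AmbBase 𝕜 A n) (d : 𝕜) (Gi : AmbMat n A⟦X⟧)
    (Γ : Idx n → AmbMat n A⟦X⟧) (u v : A⟦X⟧) (s : ℕ) : Prop where
  MM : ∀ i j, X ^ s ∣ warpedRic b.D Γ (C (algebraMap 𝕜 A (d - n))) v (b.τ * u) (idxM i) (idxM j)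
  flat : X ^ s ∣ warpedFlat b.D Gi Γ (C (algebraMap 𝕜 A (d - n))) (b.τ * u)
  inf : X ^ s ∣ X * warpedRic b.D Γ (C (algebraMap 𝕜 A (d - n))) v (b.τ * u) (idxInf n) (idxInf n)

lemma dvd_of_X_mul_dvd {s : ℕ} {P : A⟦X⟧} (h : X ^ (s + 1) ∣ X * P) : X ^ s ∣ P := by
  rw [X_pow_dvd_iff] at h ⊢
  intro m hm
  rw [← coeff_succ_X_mul]
  exact h (m + 1) (by omega)

lemma FlatTo.Minf {q : BaseMat n A⟦X⟧}
    {Gi : AmbMat n A⟦X⟧} {Γ : Idx n → AmbMat n A⟦X⟧} {u v : A⟦X⟧}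
    {s : ℕ} {d : 𝕜} (hF : FlatTo b d Gi Γ u v s)
    (h : IsNormalData b g gi (2 * X) 0 q α Gi Γ) (hd : ∀ m : ℕ, d ≠ 2 * m)
    (hu : liftD b.d0 u = 0) (hu1 : constantCoeff u = 1) (hv : b.τ * u * v = 1) (i : Fin n) :
    X ^ s ∣ warpedRic b.D Γ (C (algebraMap 𝕜 A (d - n))) v (b.τ * u) (idxM i) (idxInf n) := by
  have key : ∀ r ≤ s, ∀ i, X ^ r ∣
      warpedRic b.D Γ (C (algebraMap 𝕜 A (d - n))) v (b.τ * u) (idxM i) (idxInf n) := by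
    intro r
    induction r with
    | zero => intro _ i; simp
    | succ r ih =>
      intro hr i
      have ih := ih (Nat.le_of_succ_le hr)
      refine dvd_succ_of_coeff (ih i) ?_
      have e := h.coeff_warpedRic_Minf hu hu1 hv (d := d - n) (s := r)
        (fun j k => (pow_dvd_pow _ hr).trans (hF.MM j k)) ih
        (dvd_of_X_mul_dvd ((pow_dvd_pow _ hr).trans hF.inf))
        ((pow_dvd_pow _ hr).trans hF.flat) i
      have nz : d - 2 * ((r + 1 : ℕ) : 𝕜) ≠ 0 := sub_ne_zero.mpr (hd (r + 1))
      refine algebraMap_cancel nz ?_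
      rw [mul_zero, ← e]
      congr 1
      simp only [map_sub, map_mul, map_natCast, map_ofNat]
      push_cast; ring
  exact key s le_rfl i

lemma FlatTo.of_dvd {q q' : BaseMat n A⟦X⟧} {Gi Gi' : AmbMat n A⟦X⟧}
    {Γ Γ' : Idx n → AmbMat n A⟦X⟧} {u v u' v' : A⟦X⟧} {s : ℕ} {d : 𝕜}
    (hF : FlatTo b d Gi Γ u v s) (hs : IsSeed b g q u) (hs' : IsSeed b g q' u')
    (h : IsNormalData b g gi (2 * X) 0 q α Gi Γ) (h' : IsNormalData b g gi (2 * X) 0 q' α Gi' Γ')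
    (hv : b.τ * u * v = 1) (hv' : b.τ * u' * v' = 1)
    (hq : ∀ i j, X ^ (s + 1) ∣ q' i j - q i j) (huu : X ^ (s + 1) ∣ u' - u) :
    FlatTo b d Gi' Γ' u' v' s := by
  choose Φ hΦ using fun i j => exists_eq_two_mul 𝕜 (hq i j)
  obtain ⟨ψ, hψ⟩ := exists_eq_two_mul 𝕜 huu
  have hP : IsPert b g gi q α Gi Γ q' Gi' Γ' s (Matrix.of Φ) := ⟨h, h', hΦ⟩
  have dψ : liftD b.d0 ψ = 0 := by
    refine liftD_of_X_pow_mul (s := s + 1) ?_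
    have e := hs'.d0_u
    rw [hψ, map_add, hs.d0_u, zero_add, two_mul, map_add, ← two_mul] at e
    exact (isUnit_two_of_field 𝕜).mul_left_cancel (e.trans (mul_zero _).symm)
  refine ⟨fun i j => ?_, ?_, ?_⟩
  · exact (dvd_sub_left (hF.MM i j)).mp
      (hP.lead_warpedRic_MM hs.d0_u hs.cc_u hv hψ hv' _ i j).dvd
  · exact (dvd_sub_left hF.flat).mp
      (hP.lead_warpedFlat hs.d0_u hs.cc_u dψ hψ _).dvd
  · have := (hP.lead_X_warpedRic_inf hs.cc_u hv hψ hv' (algebraMap 𝕜 A (d - n))).dvd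
    rw [mul_sub] at this
    exact (dvd_sub_left hF.inf).mp this

/-- The correction of a solution to order `s`. -/
lemma exists_correction {d : 𝕜} (hd1 : d ≠ 1) (hd : ∀ m : ℕ, d ≠ 2 * m)
    (e : Fin n → Fin n → A) (σ c : A) (s : ℕ) (hg : ∑ i, ∑ j, gi i j * g i j = n)
    (gd : ∀ i j, b.d0 (g i j) = 0) (gid : ∀ i j, b.d0 (gi i j) = 0) (gs : ∀ i j, g i j = g j i)
    (ed : ∀ i j, b.d0 (e i j) = 0) (σd : b.d0 σ = 0) (cd : b.d0 c = 0)
    (es : ∀ i j, e i j = e j i) (hc : s = 0 → c = 0)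
    (hB : 2 * (n + algebraMap 𝕜 A (d - n) - s - 1) * c
      = s * ((∑ i, ∑ j, gi i j * e i j) - algebraMap 𝕜 A (d - n) * σ)) :
    ∃ (φ : Fin n → Fin n → A) (ψ : A), (∀ i j, φ i j = φ j i) ∧ (∀ i j, b.d0 (φ i j) = 0) ∧
      b.d0 ψ = 0 ∧
      (∀ i j, (s + 1) * ((2 * s + 2 - n - algebraMap 𝕜 A (d - n)) * φ i j
        - ((∑ k, ∑ l, gi k l * φ k l) + 2 * algebraMap 𝕜 A (d - n) * ψ) * g i j) = -e i j) ∧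
      (s + 1) * (((∑ k, ∑ l, gi k l * φ k l) + 2 * algebraMap 𝕜 A (d - n) * ψ)
        + 2 * (n + algebraMap 𝕜 A (d - n) - 2 * s - 2) * ψ) = -σ ∧
      -(s * ((s + 1) * ((∑ k, ∑ l, gi k l * φ k l)
        + 2 * algebraMap 𝕜 A (d - n) * ψ))) = -c := by
  set κ := algebraMap 𝕜 A (d - n) with hκ
  have hκd : (n : A) + κ = algebraMap 𝕜 A d := by rw [hκ, map_sub, map_natCast]; ring
  have s1' : (s : 𝕜) + 1 ≠ 0 := Nat.cast_add_one_ne_zero s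
  have nD : (2 * s + 2 - d : 𝕜) ≠ 0 := by
    have := hd (s + 1); push_cast at this
    intro e; exact this (by linear_combination -e)
  have inv : ∀ {x : 𝕜}, x ≠ 0 → algebraMap 𝕜 A x * algebraMap 𝕜 A x⁻¹ = 1 := fun hx => by
    rw [← map_mul, mul_inv_cancel₀ hx, map_one]
  have aD : algebraMap 𝕜 A (2 * s + 2 - d) = 2 * s + 2 - n - κ := by
    rw [map_sub, ← hκd]; simp only [map_add, map_mul, map_ofNat, map_natCast]; ring
  have as1 : algebraMap 𝕜 A (s + 1) = s + 1 := by simp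
  have dmul : ∀ (x : 𝕜) {y : A}, b.d0 y = 0 → b.d0 (algebraMap 𝕜 A x * y) = 0 := fun x y hy => by
    rw [Derivation.leibniz, hy, Derivation.map_algebraMap]; simp
  set tr := (∑ i, ∑ j, gi i j * e i j) - κ * σ with htr
  have trd : b.d0 tr = 0 := by
    rw [htr, map_sub, dmul _ σd, map_sum, sub_zero]
    refine sum_eq_zero fun i _ => ?_
    rw [map_sum]
    refine sum_eq_zero fun j _ => ?_
    rw [Derivation.leibniz, ed, gid]; simp
  obtain ⟨θ, θd, θ1, θ2⟩ : ∃ θ : A, b.d0 θ = 0 ∧ s * ((s + 1) * θ) = c ∧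
      2 * (n + κ - s - 1) * ((s + 1) * θ) = tr := by
    rcases Nat.eq_zero_or_pos s with hs | hs
    · have n2 : 2 * (d - 1) ≠ 0 := mul_ne_zero two_ne_zero (sub_ne_zero.mpr hd1)
      refine ⟨algebraMap 𝕜 A (2 * (d - 1))⁻¹ * tr, dmul _ trd, by rw [hc hs, hs]; simp, ?_⟩
      have i2 := inv n2
      rw [map_mul, map_sub, ← hκd] at i2
      simp only [map_ofNat, map_one] at i2
      rw [hs, Nat.cast_zero]
      linear_combination tr * i2
    · have n2 : (s : 𝕜) * (s + 1) ≠ 0 := mul_ne_zero (Nat.cast_ne_zero.mpr hs.ne') s1'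
      have i2 := inv n2
      rw [map_mul, as1, map_natCast] at i2
      refine ⟨algebraMap 𝕜 A ((s : 𝕜) * (s + 1))⁻¹ * c, dmul _ cd, by linear_combination c * i2, ?_⟩
      have ns : (s : 𝕜) ≠ 0 := Nat.cast_ne_zero.mpr hs.ne'
      refine algebraMap_cancel ns ?_
      rw [map_natCast]
      linear_combination 2 * (n + κ - s - 1) * c * i2 + hB
  have iD := inv nD
  have iS := inv s1'
  rw [aD] at iD
  rw [as1] at iS
  have i2 := inv (two_ne_zero (α := 𝕜))
  rw [map_ofNat] at i2
  set D := algebraMap 𝕜 A (2 * s + 2 - d)⁻¹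
  set S := algebraMap 𝕜 A (s + 1)⁻¹
  set H := algebraMap 𝕜 A 2⁻¹
  have sub0 : ∀ {x y : A}, b.d0 x = 0 → b.d0 y = 0 → b.d0 (x - y) = 0 := fun hx hy => by
    rw [map_sub, hx, hy, sub_zero]
  have add0 : ∀ {x y : A}, b.d0 x = 0 → b.d0 y = 0 → b.d0 (x + y) = 0 := fun hx hy => by
    rw [map_add, hx, hy, add_zero]
  have hθ : (∑ k, ∑ l, gi k l * (D * (θ * g k l - S * e k l)))
      + 2 * κ * (H * (D * (θ + S * σ))) = θ := by
    have t : ∑ k, ∑ l, gi k l * (D * (θ * g k l - S * e k l))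
        = D * (θ * (∑ i, ∑ j, gi i j * g i j) - S * ∑ i, ∑ j, gi i j * e i j) := by
      simp only [mul_sum, ← sum_sub_distrib]
      exact sum_congr₂ fun _ _ => by ring
    rw [t, hg]
    rw [htr] at θ2
    linear_combination (κ * D * (θ + S * σ)) * i2 + D * S * θ2
      - D * 2 * (n + κ - s - 1) * θ * iS + θ * iD
  refine ⟨fun i j => D * (θ * g i j - S * e i j), H * (D * (θ + S * σ)), fun i j => ?_,
    fun i j => ?_, ?_, fun i j => ?_, ?_, ?_⟩
  · change D * (θ * g i j - S * e i j) = D * (θ * g j i - S * e j i)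
    rw [gs, es]
  · refine dmul _ (sub0 ?_ (dmul _ (ed i j)))
    rw [Derivation.leibniz, θd, gd]; simp
  · exact dmul _ (dmul _ (add0 θd (dmul _ σd)))
  · rw [hθ]
    linear_combination ((s + 1) * (θ * g i j - S * e i j)) * iD - e i j * iS
  · rw [hθ]
    linear_combination (-(s + 1) * (2 * s + 2 - n - κ) * D * (θ + S * σ)) * i2
      - (s + 1) * (θ + S * σ) * iD - σ * iS
  · rw [hθ, θ1]

theorem exists_next {q : BaseMat n A⟦X⟧} {u : A⟦X⟧} {d : 𝕜} (hd1 : d ≠ 1)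
    (hd : ∀ m : ℕ, d ≠ 2 * m) (hα : ∀ i, liftD b.d0 (α i) = 0) (hg : g * gi = 1)
    (gid : ∀ i j, b.d0 (gi i j) = 0) {s : ℕ} (hs : IsSeed b g q u)
    (hF : ∀ Gi Γ v, IsNormalData b g gi (2 * X) 0 q α Gi Γ → b.τ * u * v = 1 →
      FlatTo b d Gi Γ u v s) :
    ∃ q' u', IsSeed b g q' u' ∧ (∀ i j, X ^ (s + 1) ∣ q' i j - q i j) ∧ X ^ (s + 1) ∣ u' - u ∧
      ∀ Gi Γ v, IsNormalData b g gi (2 * X) 0 q' α Gi Γ → b.τ * u' * v = 1 →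
        FlatTo b d Gi Γ u' v (s + 1) := by
  obtain ⟨Gi, Γ, v, h, hv⟩ := hs.exists_data hg hα
  have F := hF Gi Γ v h hv
  have hB := h.coeff_X_warpedRic_inf hs.d0_u hs.cc_u hv F.MM
    (F.Minf h hd hs.d0_u hs.cc_u hv) F.inf F.flat
  have E := fun i j : Fin n ⊕ Unit => h.d0_warpedRic hs.d0_u hv (d := d - n) i j
  have hcl : ∀ {P : A⟦X⟧}, liftD b.d0 P = 0 → b.d0 (coeff s P) = 0 := fun hP => by
    rw [← coeff_liftD, hP, map_zero]
  obtain ⟨φ, ψ, φs, φd, ψd, r1, r2, r3⟩ := exists_correction (b := b) (g := g) (gi := gi) hd1 hd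
    (fun i j => coeff s
      (warpedRic b.D Γ (C (algebraMap 𝕜 A (d - n))) v (b.τ * u) (idxM i) (idxM j)))
    (coeff s (warpedFlat b.D Gi Γ (C (algebraMap 𝕜 A (d - n))) (b.τ * u)))
    (coeff s (X * warpedRic b.D Γ (C (algebraMap 𝕜 A (d - n))) v (b.τ * u) (idxInf n) (idxInf n)))
    s h.sum_gi_g (fun i j => by rw [← hs.cc, ← constantCoeff_liftD, hs.d0, map_zero]) gid
    h.g_symm (fun i j => hcl (E _ _)) (hcl (h.d0_warpedFlat hs.d0_u))
    (hcl (by rw [Derivation.leibniz, liftD_X, show liftD b.d0 _ = 0 from E (Sum.inr ()) (Sum.inr ())]; simp))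
    (fun i j => by rw [warpedRic_symm h.lc h.inv b.commutes]) (by rintro rfl; simp) hB
  have hX : ∀ x : A, liftD b.d0 (X ^ (s + 1) * C x) = X ^ (s + 1) * C (b.d0 x) := fun x => by
    rw [Derivation.leibniz, Derivation.leibniz_pow, liftD_X, liftD_C]; simp
  have hs' : IsSeed b g (Matrix.of fun i j => q i j + 2 * (X ^ (s + 1) * C (φ i j)))
      (u + 2 * (X ^ (s + 1) * C ψ)) := by
    refine ⟨fun i j => ?_, fun i j => ?_, fun i j => ?_, ?_, ?_⟩
    · simp only [Matrix.of_apply]; rw [hs.symm, φs]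
    · simp [hs.cc]
    · simp only [Matrix.of_apply]
      rw [map_add, hs.d0, two_mul, map_add, hX, φd]; simp
    · simp [hs.cc_u]
    · rw [map_add, hs.d0_u, two_mul, map_add, hX, ψd]; simp
  refine ⟨_, _, hs', fun i j => ?_, ?_, fun Gi' Γ' v' h' hv' => ?_⟩
  · rw [Matrix.of_apply, add_sub_cancel_left]; exact Dvd.dvd.mul_left (Dvd.intro _ rfl) _
  · rw [add_sub_cancel_left]; exact Dvd.dvd.mul_left (Dvd.intro _ rfl) _
  have hP : IsPert b g gi q α Gi Γ (Matrix.of fun i j => q i j + 2 * (X ^ (s + 1) * C (φ i j)))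
      Gi' Γ' s (Matrix.of fun i j => C (φ i j)) := ⟨h, h', fun i j => rfl⟩
  have lift : ∀ {P Q : A⟦X⟧} {c : A}, Lead s (Q - P) c → X ^ s ∣ P → c = -coeff s P →
      X ^ (s + 1) ∣ Q := fun {P Q c} hL hP hc => by
    refine (((hL.add (Lead.self hP)).congr (by ring) ?_ : Lead s Q 0)).dvd_succ
    rw [hc, neg_add_cancel]
  refine ⟨fun i j => ?_, ?_, ?_⟩
  · refine lift (hP.lead_warpedRic_MM hs.d0_u hs.cc_u hv rfl hv' _ i j) (F.MM i j) ?_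
    simpa using r1 i j
  · refine lift (hP.lead_warpedFlat hs.d0_u hs.cc_u (by rw [liftD_C, ψd, map_zero]) rfl _)
      F.flat ?_
    simpa using r2
  · have l := hP.lead_X_warpedRic_inf hs.cc_u hv rfl hv' (algebraMap 𝕜 A (d - n))
    rw [mul_sub] at l
    refine lift l F.inf ?_
    simpa using r3

theorem exists_normalData {d : 𝕜} (hd1 : d ≠ 1)
    (hd : ∀ m : ℕ, d ≠ 2 * m) (hα : ∀ i, liftD b.d0 (α i) = 0) (hg : g * gi = 1)
    (gs : ∀ i j, g i j = g j i) (gd : ∀ i j, b.d0 (g i j) = 0) (gid : ∀ i j, b.d0 (gi i j) = 0) :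
    ∃ q u v Gi Γ, IsSeed b g q u ∧ IsNormalData b g gi (2 * X) 0 q α Gi Γ ∧ b.τ * u * v = 1 ∧
      (∀ I J, warpedRic b.D Γ (C (algebraMap 𝕜 A (d - n))) v (b.τ * u) I J = 0) ∧
      warpedFlat b.D Gi Γ (C (algebraMap 𝕜 A (d - n))) (b.τ * u) = 0 := by
  let P : ℕ → BaseMat n A⟦X⟧ × A⟦X⟧ → Prop := fun s p => IsSeed b g p.1 p.2 ∧
    ∀ Gi Γ v, IsNormalData b g gi (2 * X) 0 p.1 α Gi Γ → b.τ * p.2 * v = 1 →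
      FlatTo b d Gi Γ p.2 v s
  have start : P 0 (Matrix.of fun i j => C (g i j), 1) := by
    refine ⟨⟨fun i j => by simp only [Matrix.of_apply]; rw [gs], fun i j => by simp,
      fun i j => by
        change liftD b.d0 (C (g i j)) = 0
        rw [liftD_C, gd, map_zero], map_one _,
      Derivation.map_one_eq_zero _⟩, fun _ _ _ _ _ => ⟨fun _ _ => ?_, ?_, ?_⟩⟩ <;>
      rw [pow_zero] <;> exact one_dvd _
  have next : ∀ s p, P s p → ∃ p', P (s + 1) p' ∧ (∀ i j, X ^ (s + 1) ∣ p'.1 i j - p.1 i j) ∧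
      X ^ (s + 1) ∣ p'.2 - p.2 := fun s p hp => by
    obtain ⟨q', u', a1, a2, a3, a4⟩ := exists_next hd1 hd hα hg gid hp.1 hp.2
    exact ⟨(q', u'), ⟨a1, a4⟩, a2, a3⟩
  choose! f hf1 hf2 hf3 using next
  let w : ℕ → BaseMat n A⟦X⟧ × A⟦X⟧ :=
    fun s => Nat.rec (Matrix.of fun i j => C (g i j), 1) f s
  have hw : ∀ s, P s (w s) := fun s => by
    induction s with
    | zero => exact start
    | succ s ih => exact hf1 s _ ih
  have stable : ∀ (F : ℕ → A⟦X⟧), (∀ s, X ^ (s + 1) ∣ F (s + 1) - F s) → ∀ s,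
      X ^ (s + 1) ∣ PowerSeries.mk (fun m => coeff m (F m)) - F s := by
    intro F hF s
    have st : ∀ m k, coeff m (F (m + k)) = coeff m (F m) := fun m k => by
      induction k with
      | zero => rfl
      | succ k ih =>
        have := X_pow_dvd_iff.mp (hF (m + k)) m (by omega)
        rw [map_sub, sub_eq_zero] at this
        rw [← add_assoc, this, ih]
    rw [X_pow_dvd_iff]
    intro m hm
    obtain ⟨k, rfl⟩ := Nat.exists_eq_add_of_le (Nat.lt_succ_iff.mp hm)
    rw [map_sub, coeff_mk, st, sub_self]
  let q : BaseMat n A⟦X⟧ :=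
    Matrix.of fun i j => PowerSeries.mk fun m => coeff m ((w m).1 i j)
  let u : A⟦X⟧ := PowerSeries.mk fun m => coeff m (w m).2
  have hq : ∀ s i j, X ^ (s + 1) ∣ q i j - (w s).1 i j := fun s i j =>
    stable (fun m => (w m).1 i j) (fun s => hf2 s _ (hw s) i j) s
  have hu : ∀ s, X ^ (s + 1) ∣ u - (w s).2 := fun s =>
    stable (fun m => (w m).2) (fun s => hf3 s _ (hw s)) s
  have seed : IsSeed b g q u := by
    refine ⟨fun i j => ?_, fun i j => ?_, fun i j => ?_, ?_, ?_⟩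
    · ext m; simp only [q, Matrix.of_apply, coeff_mk]; rw [(hw m).1.symm]
    · rw [← coeff_zero_eq_constantCoeff_apply]
      change coeff 0 (PowerSeries.mk fun m => coeff m ((w m).1 i j)) = g i j
      rw [coeff_mk, coeff_zero_eq_constantCoeff_apply, (hw 0).1.cc]
    · ext m
      rw [coeff_liftD]
      change b.d0 (coeff m (PowerSeries.mk fun m => coeff m ((w m).1 i j))) = _
      rw [coeff_mk, ← coeff_liftD, (hw m).1.d0]
    · rw [← coeff_zero_eq_constantCoeff_apply, coeff_mk, coeff_zero_eq_constantCoeff_apply,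
        (hw 0).1.cc_u]
    · ext m
      rw [coeff_liftD, coeff_mk, ← coeff_liftD, (hw m).1.d0_u]
  obtain ⟨Gi, Γ, v, h, hv⟩ := seed.exists_data hg hα
  have F : ∀ s, FlatTo b d Gi Γ u v s := fun s => by
    obtain ⟨Gi', Γ', v', h', hv'⟩ := (hw s).1.exists_data hg hα
    exact ((hw s).2 _ _ _ h' hv').of_dvd (hw s).1 seed h' h hv' hv (hq s) (hu s)
  have zero : ∀ {P : A⟦X⟧}, (∀ s, X ^ s ∣ P) → P = 0 := fun hP =>
    eq_of_forall_dvd fun s => by rw [sub_zero]; exact hP s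
  refine ⟨q, u, v, Gi, Γ, seed, h, hv, fun I J => ?_, zero fun s => (F s).flat⟩
  have E0 := h.warpedRic_zero seed.d0_u (C (algebraMap 𝕜 A (d - n))) v
  have Es := warpedRic_symm h.lc h.inv b.commutes (C (algebraMap 𝕜 A (d - n))) v (b.τ * u)
  have Ei : ∀ i, _ := fun i => zero fun s => (F s).Minf h hd seed.d0_u seed.cc_u hv i
  induction I using idx_cases with
  | h0 => exact E0 J
  | hM i =>
    induction J using idx_cases with
    | h0 => rw [Es, E0]
    | hM j => exact zero fun s => (F s).MM i j
    | hInf => exact Ei i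
  | hInf =>
    induction J using idx_cases with
    | h0 => rw [Es, E0]
    | hM j => rw [Es, Ei]
    | hInf => exact zero fun s => dvd_of_X_mul_dvd (F (s + 1)).inf

end

section

/-! ### Rings of smooth functions -/

section SmoothFun

variable {E E' : Type*} [NormedAddCommGroup E] [NormedSpace ℝ E] [NormedAddCommGroup E']
  [NormedSpace ℝ E'] (𝕜 : Type*) [RCLike 𝕜]

/-- The algebra of functions on `Ω` that are restrictions of functions smooth on `Ω`. -/
def smoothSubalgebra (Ω : Opens E) : Subalgebra 𝕜 (Ω → 𝕜) where
  carrier := {f | ∃ F : E → 𝕜, ContDiffOn ℝ ∞ F Ω ∧ ∀ x (hx : x ∈ Ω), f ⟨x, hx⟩ = F x}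
  mul_mem' := by
    rintro f g ⟨F, hF, hf⟩ ⟨G, hG, hg⟩
    exact ⟨fun x => F x * G x, hF.mul hG, fun x hx => by rw [Pi.mul_apply, hf, hg]⟩
  add_mem' := by
    rintro f g ⟨F, hF, hf⟩ ⟨G, hG, hg⟩
    exact ⟨fun x => F x + G x, hF.add hG, fun x hx => by rw [Pi.add_apply, hf, hg]⟩
  algebraMap_mem' c := ⟨fun _ => c, contDiffOn_const, fun _ _ => rfl⟩

/-- Smooth functions on `Ω`. -/
def SmoothFun (Ω : Opens E) : Type _ := smoothSubalgebra 𝕜 Ω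

variable {𝕜}

namespace SmoothFun

variable {Ω : Opens E} {Ω' : Opens E'}

instance : CommRing (SmoothFun 𝕜 Ω) := inferInstanceAs (CommRing (smoothSubalgebra 𝕜 Ω))

instance : Algebra 𝕜 (SmoothFun 𝕜 Ω) := inferInstanceAs (Algebra 𝕜 (smoothSubalgebra 𝕜 Ω))

/-- The underlying function. -/
def val (f : SmoothFun 𝕜 Ω) : Ω → 𝕜 := Subtype.val f

/-- The function `F` represents `f` on `Ω`. -/
def Rep (f : SmoothFun 𝕜 Ω) (F : E → 𝕜) : Prop := ∀ x (hx : x ∈ Ω), f.val ⟨x, hx⟩ = F x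

/-- The smooth function represented by `F`. -/
def mk (F : E → 𝕜) (hF : ContDiffOn ℝ ∞ F Ω) : SmoothFun 𝕜 Ω := ⟨fun x => F x, F, hF, fun _ _ => rfl⟩

lemma rep_mk (F : E → 𝕜) (hF : ContDiffOn ℝ ∞ F Ω) : Rep (mk F hF) F := fun _ _ => rfl

lemma exists_rep (f : SmoothFun 𝕜 Ω) : ∃ F, ContDiffOn ℝ ∞ F Ω ∧ Rep f F := f.2

/-- A representative. -/
def rep (f : SmoothFun 𝕜 Ω) : E → 𝕜 := f.exists_rep.choose

lemma contDiffOn_rep (f : SmoothFun 𝕜 Ω) : ContDiffOn ℝ ∞ f.rep Ω := f.exists_rep.choose_spec.1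

lemma rep_rep (f : SmoothFun 𝕜 Ω) : Rep f f.rep := f.exists_rep.choose_spec.2

lemma Rep.contDiffOn {f : SmoothFun 𝕜 Ω} {F : E → 𝕜} (h : Rep f F) : ContDiffOn ℝ ∞ F Ω :=
  f.contDiffOn_rep.congr fun x hx => by rw [← h x hx, ← f.rep_rep x hx]

lemma Rep.eqOn {f : SmoothFun 𝕜 Ω} {F G : E → 𝕜} (h : Rep f F) (h' : Rep f G) {x : E}
    (hx : x ∈ Ω) : F x = G x := by rw [← h x hx, ← h' x hx]

lemma Rep.ext {f g : SmoothFun 𝕜 Ω} {F G : E → 𝕜} (h : Rep f F) (h' : Rep g G)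
    (e : ∀ x ∈ Ω, F x = G x) : f = g :=
  Subtype.ext (funext fun x => (h x.1 x.2).trans ((e _ x.2).trans (h' x.1 x.2).symm))

lemma Rep.congr {f : SmoothFun 𝕜 Ω} {F G : E → 𝕜} (h : Rep f F) (e : ∀ x ∈ Ω, F x = G x) :
    Rep f G := fun x hx => by rw [h x hx, e x hx]

section Operations

variable {f g : SmoothFun 𝕜 Ω} {F G : E → 𝕜}

lemma Rep.add (h : Rep f F) (h' : Rep g G) : Rep (f + g) (fun x => F x + G x) :=
  fun x hx => congrArg₂ (· + ·) (h x hx) (h' x hx)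

lemma Rep.sub (h : Rep f F) (h' : Rep g G) : Rep (f - g) (fun x => F x - G x) :=
  fun x hx => congrArg₂ (· - ·) (h x hx) (h' x hx)

lemma Rep.mul (h : Rep f F) (h' : Rep g G) : Rep (f * g) (fun x => F x * G x) :=
  fun x hx => congrArg₂ (· * ·) (h x hx) (h' x hx)

lemma Rep.neg (h : Rep f F) : Rep (-f) (fun x => -F x) :=
  fun x hx => congrArg (-·) (h x hx)

lemma Rep.pow (h : Rep f F) (m : ℕ) : Rep (f ^ m) (fun x => F x ^ m) :=
  fun x hx => congrArg (· ^ m) (h x hx)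

lemma rep_algebraMap (c : 𝕜) : Rep (algebraMap 𝕜 (SmoothFun 𝕜 Ω) c) fun _ => c := fun _ _ => rfl

lemma rep_zero : Rep (0 : SmoothFun 𝕜 Ω) fun _ => 0 := fun _ _ => rfl

lemma rep_one : Rep (1 : SmoothFun 𝕜 Ω) fun _ => 1 := fun _ _ => rfl

lemma Rep.smul (c : 𝕜) (h : Rep f F) : Rep (c • f) (fun x => c * F x) :=
  fun x hx => congrArg (c * ·) (h x hx)

lemma Rep.sum {ι : Type*} {s : Finset ι} {f : ι → SmoothFun 𝕜 Ω} {F : ι → E → 𝕜}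
    (h : ∀ i ∈ s, Rep (f i) (F i)) : Rep (∑ i ∈ s, f i) (fun x => ∑ i ∈ s, F i x) := by
  classical
  induction s using Finset.induction_on with
  | empty => exact fun _ _ => rfl
  | insert a s ha ih =>
    simp only [Finset.sum_insert ha]
    exact (h a (Finset.mem_insert_self _ _)).add
      (ih fun i hi => h i (Finset.mem_insert_of_mem hi))

lemma Rep.hasFDerivAt (h : Rep f F) {x : E} (hx : x ∈ Ω) : HasFDerivAt F (fderiv ℝ F x) x :=
  ((h.contDiffOn.contDiffAt (Ω.isOpen.mem_nhds hx)).differentiableAt (by simp)).hasFDerivAt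

lemma Rep.fderiv_eq (h : Rep f F) (h' : Rep f G) {x : E} (hx : x ∈ Ω) :
    fderiv ℝ F x = fderiv ℝ G x :=
  Filter.EventuallyEq.fderiv_eq
    (Filter.eventually_of_mem (Ω.isOpen.mem_nhds hx) fun _ hy => h.eqOn h' hy)

lemma Rep.contDiffOn_fderiv (h : Rep f F) (v : E) :
    ContDiffOn ℝ ∞ (fun x => fderiv ℝ F x v) Ω :=
  (h.contDiffOn.fderiv_of_isOpen Ω.isOpen (by simp)).clm_apply contDiffOn_const

end Operations

/-- The derivative in the direction `v`, as a function. -/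
def dirFun (v : E) (f : SmoothFun 𝕜 Ω) : SmoothFun 𝕜 Ω :=
  mk (fun x => fderiv ℝ f.rep x v) (f.rep_rep.contDiffOn_fderiv v)

/-- The derivative in the direction `v`. -/
def dir (v : E) : Derivation 𝕜 (SmoothFun 𝕜 Ω) (SmoothFun 𝕜 Ω) :=
  Derivation.mk'
    { toFun := dirFun v
      map_add' := fun f g => by
        refine (rep_mk _ _).ext ((rep_mk _ _).add (rep_mk _ _)) fun x hx => ?_
        rw [(f + g).rep_rep.fderiv_eq (f.rep_rep.add g.rep_rep) hx,
          ((f.rep_rep.hasFDerivAt hx).fun_add (g.rep_rep.hasFDerivAt hx)).fderiv]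
        rfl
      map_smul' := fun c f => by
        refine (rep_mk _ _).ext ((rep_mk _ _).smul c) fun x hx => ?_
        rw [(c • f).rep_rep.fderiv_eq (f.rep_rep.smul c) hx,
          ((f.rep_rep.hasFDerivAt hx).const_mul c).fderiv]
        rfl }
    (fun f g => by
      change dirFun v (f * g) = f * dirFun v g + g * dirFun v f
      refine (rep_mk _ _).ext ((f.rep_rep.mul (rep_mk _ _)).add (g.rep_rep.mul (rep_mk _ _)))
        fun x hx => ?_
      rw [(f * g).rep_rep.fderiv_eq (f.rep_rep.mul g.rep_rep) hx,
        ((f.rep_rep.hasFDerivAt hx).fun_mul (g.rep_rep.hasFDerivAt hx)).fderiv]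
      rfl)

lemma Rep.dir {f : SmoothFun 𝕜 Ω} {F : E → 𝕜} (h : Rep f F) (v : E) :
    Rep (dir v f) (fun x => fderiv ℝ F x v) := fun x hx =>
  (rep_mk (fun x => fderiv ℝ f.rep x v) (f.rep_rep.contDiffOn_fderiv v) x hx).trans
    (congrFun (congrArg DFunLike.coe (f.rep_rep.fderiv_eq h hx)) v)

lemma dir_comm (v w : E) (f : SmoothFun 𝕜 Ω) : dir v (dir w f) = dir w (dir v f) := by
  have h := f.rep_rep
  refine ((h.dir w).dir v).ext ((h.dir v).dir w) fun x hx => ?_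
  have hc := f.contDiffOn_rep.contDiffAt (Ω.isOpen.mem_nhds hx)
  have hs : IsSymmSndFDerivAt ℝ f.rep x := hc.isSymmSndFDerivAt (by
    simp only [minSmoothness_of_isRCLikeNormedField]
    exact WithTop.coe_le_coe.mpr (le_top : (2 : ℕ∞) ≤ ⊤))
  have hd : DifferentiableAt ℝ (fderiv ℝ f.rep) x :=
    (hc.fderiv_right (m := ∞) (by simp)).differentiableAt (by simp)
  rw [fderiv_clm_apply hd (differentiableAt_const _), fderiv_clm_apply hd (differentiableAt_const _)]
  simp only [fderiv_fun_const, Pi.zero_apply, ContinuousLinearMap.comp_zero, zero_add,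
    ContinuousLinearMap.flip_apply]
  exact hs v w

/-- The pullback of smooth functions along a smooth map. -/
def pull (χ : E' → E) (hχ : ContDiffOn ℝ ∞ χ Ω') (hm : ∀ x ∈ Ω', χ x ∈ Ω) :
    SmoothFun 𝕜 Ω →ₐ[𝕜] SmoothFun 𝕜 Ω' where
  toFun f := ⟨fun x => f.val ⟨χ x.1, hm x.1 x.2⟩, fun x => f.rep (χ x),
    f.contDiffOn_rep.comp hχ hm, fun x hx => f.rep_rep _ (hm x hx)⟩
  map_one' := rfl
  map_mul' _ _ := rfl
  map_zero' := rfl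
  map_add' _ _ := rfl
  commutes' _ := rfl

lemma Rep.pull {f : SmoothFun 𝕜 Ω} {F : E → 𝕜} (h : Rep f F) {χ : E' → E}
    (hχ : ContDiffOn ℝ ∞ χ Ω') (hm : ∀ x ∈ Ω', χ x ∈ Ω) :
    Rep (SmoothFun.pull χ hχ hm f) (fun x => F (χ x)) := fun x hx => h _ (hm x hx)

lemma Rep.dir_pull {f : SmoothFun 𝕜 Ω} {F : E → 𝕜} (h : Rep f F) {χ : E' → E}
    (hχ : ContDiffOn ℝ ∞ χ Ω') (hm : ∀ x ∈ Ω', χ x ∈ Ω) (v : E') :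
    Rep (SmoothFun.dir v (SmoothFun.pull χ hχ hm f))
      (fun x => fderiv ℝ F (χ x) (fderiv ℝ χ x v)) := by
  refine ((h.pull hχ hm).dir v).congr fun x hx => ?_
  have hd : DifferentiableAt ℝ χ x :=
    (hχ.contDiffAt (Ω'.isOpen.mem_nhds hx)).differentiableAt (by simp)
  have := ((h.hasFDerivAt (hm x hx)).comp x hd.hasFDerivAt).fderiv
  rw [show (fun x => F (χ x)) = F ∘ χ from rfl, this]
  rfl

/-- Nowhere vanishing functions are invertible. -/
lemma Rep.exists_inv {f : SmoothFun 𝕜 Ω} {F : E → 𝕜} (h : Rep f F) (h0 : ∀ x ∈ Ω, F x ≠ 0) :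
    ∃ g, f * g = 1 ∧ Rep g (fun x => (F x)⁻¹) := by
  refine ⟨mk (fun x => (F x)⁻¹) (h.contDiffOn.inv h0), ?_, rep_mk _ _⟩
  exact (h.mul (rep_mk _ _)).ext rep_one fun x hx => mul_inv_cancel₀ (h0 x hx)

/-- Evaluation at a point. -/
def eval (x : E) (hx : x ∈ Ω) : SmoothFun 𝕜 Ω →+* 𝕜 where
  toFun f := f.val ⟨x, hx⟩
  map_one' := rfl
  map_mul' _ _ := rfl
  map_zero' := rfl
  map_add' _ _ := rfl

lemma Rep.eval {f : SmoothFun 𝕜 Ω} {F : E → 𝕜} (h : Rep f F) {x : E} (hx : x ∈ Ω) :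
    SmoothFun.eval x hx f = F x := h x hx

end SmoothFun

end SmoothFun

/-! ### Formal Taylor series -/

section Taylor

variable {𝕜 R A : Type*} [Field 𝕜] [CharZero 𝕜] [CommRing R] [Algebra 𝕜 R] [CommRing A]
  [Algebra 𝕜 A] (δ : Derivation 𝕜 R R) (ι : R →ₐ[𝕜] A)

/-- The coefficients of the Taylor series. -/
def taylorCoeff (m : ℕ) (x : R) : A := algebraMap 𝕜 A (m.factorial : 𝕜)⁻¹ * ι (δ^[m] x)

lemma taylorCoeff_succ (m : ℕ) (x : R) :
    taylorCoeff δ ι (m + 1) x * (m + 1) = taylorCoeff δ ι m (δ x) := by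
  have e : algebraMap 𝕜 A ((m + 1).factorial : 𝕜)⁻¹ * (m + 1)
      = algebraMap 𝕜 A (m.factorial : 𝕜)⁻¹ := by
    have : (m : A) + 1 = algebraMap 𝕜 A (m + 1) := by simp
    rw [this, ← map_mul, Nat.factorial_succ]
    congr 1
    have := Nat.cast_add_one_ne_zero (R := 𝕜) m
    push_cast
    rw [mul_inv, mul_comm, ← mul_assoc, mul_inv_cancel₀ this, one_mul]
  rw [taylorCoeff, taylorCoeff, Function.iterate_succ_apply, mul_right_comm, e]

lemma taylorCoeff_add (m : ℕ) (x y : R) :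
    taylorCoeff δ ι m (x + y) = taylorCoeff δ ι m x + taylorCoeff δ ι m y := by
  have : δ^[m] (x + y) = δ^[m] x + δ^[m] y := by
    induction m generalizing x y with
    | zero => rfl
    | succ m ih => simp only [Function.iterate_succ_apply, map_add, ih]
  simp only [taylorCoeff, this, map_add, mul_add]

lemma cancel_succ (𝕜 : Type*) {A : Type*} [Field 𝕜] [CharZero 𝕜] [CommRing A] [Algebra 𝕜 A]
    {m : ℕ} {x y : A} (h : x * (m + 1) = y * (m + 1)) : x = y := by
  have : (m : A) + 1 = algebraMap 𝕜 A (m + 1) := by simp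
  rw [this, mul_comm, mul_comm y] at h
  exact algebraMap_cancel (Nat.cast_add_one_ne_zero m) h

lemma mk_taylorCoeff_mul (x y : R) : PowerSeries.mk (fun m => taylorCoeff δ ι m (x * y))
    = PowerSeries.mk (fun m => taylorCoeff δ ι m x) * PowerSeries.mk fun m => taylorCoeff δ ι m y := by
  have dX : ∀ x, derivX 𝕜 A (PowerSeries.mk fun m => taylorCoeff δ ι m x)
      = PowerSeries.mk fun m => taylorCoeff δ ι m (δ x) := fun x => by
    ext m; rw [coeff_derivX, coeff_mk, coeff_mk, taylorCoeff_succ]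
  ext m
  rw [coeff_mk]
  induction m generalizing x y with
  | zero =>
    rw [coeff_zero_eq_constantCoeff_apply, map_mul, ← coeff_zero_eq_constantCoeff_apply,
      ← coeff_zero_eq_constantCoeff_apply, coeff_mk, coeff_mk]
    simp [taylorCoeff]
  | succ m ih =>
    refine cancel_succ 𝕜 (m := m) ?_
    rw [taylorCoeff_succ, ← coeff_derivX (𝕜 := 𝕜), Derivation.leibniz, Derivation.leibniz, dX, dX,
      smul_eq_mul, smul_eq_mul, smul_eq_mul, smul_eq_mul, taylorCoeff_add, ih, ih, map_add]

/-- The Taylor series in the direction of `δ`, along the restriction map `ι`. -/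
def taylor : R →+* A⟦X⟧ where
  toFun x := PowerSeries.mk fun m => taylorCoeff δ ι m x
  map_one' := by
    ext m
    rw [coeff_mk, coeff_one]
    cases m with
    | zero => simp [taylorCoeff]
    | succ m =>
      have z : ∀ m, δ^[m] (0 : R) = 0 := fun m => by
        induction m with
        | zero => rfl
        | succ m ih => rw [Function.iterate_succ_apply, map_zero, ih]
      rw [taylorCoeff, Function.iterate_succ_apply, Derivation.map_one_eq_zero, z]; simp
  map_mul' := mk_taylorCoeff_mul δ ι
  map_zero' := by
    ext m
    have := taylorCoeff_add δ ι m 0 0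
    rw [add_zero] at this
    rw [coeff_mk, map_zero]
    exact left_eq_add.mp this
  map_add' x y := by ext m; simp only [coeff_mk, map_add, taylorCoeff_add]

@[simp] lemma coeff_taylor (m : ℕ) (x : R) : coeff m (taylor δ ι x) = taylorCoeff δ ι m x := by
  change coeff m (PowerSeries.mk fun m => taylorCoeff δ ι m x) = _
  exact coeff_mk _ _

lemma constantCoeff_taylor (x : R) : constantCoeff (taylor δ ι x) = ι x := by
  rw [← coeff_zero_eq_constantCoeff_apply, coeff_taylor]; simp [taylorCoeff]

lemma taylor_algebraMap (c : 𝕜) : taylor δ ι (algebraMap 𝕜 R c) = C (algebraMap 𝕜 A c) := by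
  ext m
  rw [coeff_taylor, coeff_C]
  cases m with
  | zero => simp [taylorCoeff]
  | succ m =>
    refine cancel_succ 𝕜 (m := m) ?_
    rw [taylorCoeff_succ, Derivation.map_algebraMap, ← coeff_taylor, map_zero, map_zero]
    simp

lemma derivX_taylor (x : R) : derivX 𝕜 A (taylor δ ι x) = taylor δ ι (δ x) := by
  ext m; rw [coeff_derivX, coeff_taylor, coeff_taylor, taylorCoeff_succ]

lemma liftD_taylor {D : Derivation 𝕜 R R} {D' : Derivation 𝕜 A A} (h : ∀ x, D (δ x) = δ (D x))
    (hι : ∀ x, D' (ι x) = ι (D x)) (x : R) : liftD D' (taylor δ ι x) = taylor δ ι (D x) := by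
  have e : ∀ (m : ℕ) (x : R), D (δ^[m] x) = δ^[m] (D x) := fun m => by
    induction m with
    | zero => intro x; rfl
    | succ m ih => intro x; rw [Function.iterate_succ_apply, ih, h, ← Function.iterate_succ_apply]
  ext m
  rw [coeff_liftD, coeff_taylor, coeff_taylor, taylorCoeff, taylorCoeff, Derivation.leibniz,
    Derivation.map_algebraMap, hι, e]
  simp

end Taylor

end

section

/-! ### Taylor series of smooth functions along `ρ = 0` -/

variable {n : ℕ} {𝕜 : Type*} [RCLike 𝕜]

/-- The points `(t, x)` with `t > 0` and `x ∈ V`. -/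
def baseSet (V : Opens (Model n)) : Opens (ℝ × Model n) :=
  ⟨{p | 0 < p.1 ∧ p.2 ∈ V}, (isOpen_lt continuous_const continuous_fst).inter
    (V.isOpen.preimage continuous_snd)⟩

/-- The coordinate `t` on `baseSet V`. -/
def baseT (𝕜 : Type*) [RCLike 𝕜] (V : Opens (Model n)) : SmoothFun 𝕜 (baseSet V) :=
  SmoothFun.mk (fun p => (p.1 : 𝕜)) ((RCLike.ofRealCLM (K := 𝕜)).contDiff.comp contDiff_fst).contDiffOn

lemma rep_baseT (V : Opens (Model n)) : (baseT 𝕜 V).Rep fun p => (p.1 : 𝕜) := SmoothFun.rep_mk _ _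

lemma exists_baseT_inv (V : Opens (Model n)) : ∃ ti, baseT 𝕜 V * ti = 1 :=
  let ⟨ti, h, _⟩ := (rep_baseT V).exists_inv fun p hp => by
    simpa using (show 0 < p.1 from hp.1).ne'
  ⟨ti, h⟩

lemma rep_dir_baseT (V : Opens (Model n)) (v : ℝ × Model n) :
    (SmoothFun.dir v (baseT 𝕜 V)).Rep fun _ => (v.1 : 𝕜) := by
  refine ((rep_baseT V).dir v).congr fun p _ => ?_
  have : HasFDerivAt (fun p : ℝ × Model n => (p.1 : 𝕜))
      (RCLike.ofRealCLM.comp (ContinuousLinearMap.fst ℝ ℝ (Model n))) p :=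
    (RCLike.ofRealCLM.comp (ContinuousLinearMap.fst ℝ ℝ (Model n))).hasFDerivAt
  rw [this.fderiv]; rfl

/-- The base ring of the formal ambient calculus over `V`. -/
def base (𝕜 : Type*) [RCLike 𝕜] (V : Opens (Model n)) :
    AmbBase 𝕜 (SmoothFun 𝕜 (baseSet V)) n where
  d0 := SmoothFun.dir (1, 0)
  d i := SmoothFun.dir (0, EuclideanSpace.single i 1)
  d0_d _ _ := SmoothFun.dir_comm _ _ _
  d_d _ _ _ := SmoothFun.dir_comm _ _ _
  t := baseT 𝕜 V
  ti := (exists_baseT_inv V).choose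
  t_mul := (exists_baseT_inv V).choose_spec
  d0_t := (rep_dir_baseT V _).ext SmoothFun.rep_one fun _ _ => by simp
  d_t _ := (rep_dir_baseT V _).ext SmoothFun.rep_zero fun _ _ => by simp

lemma exists_sum_basisVec (v : Coord n) : ∃ c : Idx n → ℝ, v = ∑ I, c I • basisVec I := by
  refine ⟨fun I => match I with
    | Sum.inl _ => v.1
    | Sum.inr (Sum.inl i) => v.2.1 i
    | Sum.inr (Sum.inr _) => v.2.2, ?_⟩
  simp only [Fintype.sum_sum_type, Finset.univ_unique, Finset.sum_singleton, basisVec]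
  refine Prod.ext ?_ (Prod.ext ?_ ?_)
  · simp [Prod.fst_sum]
  · ext j
    simp [Prod.fst_sum, Prod.snd_sum, Finset.sum_apply, Pi.single_apply]
  · simp [Prod.snd_sum]

/-- `Ω` is a neighbourhood of the points `(t, x, 0)` with `t > 0` and `x ∈ V`. -/
def LiesOver (V : Opens (Model n)) (Ω : Opens (Coord n)) : Prop :=
  ∀ p ∈ baseSet V, (p.1, p.2, (0 : ℝ)) ∈ Ω

variable {V : Opens (Model n)} {Ω : Opens (Coord n)}

lemma contDiff_zeroSection :
    ContDiff ℝ ∞ fun p : ℝ × Model n => ((p.1, p.2, 0) : Coord n) := by fun_prop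

/-- Restriction to `ρ = 0`. -/
def restr (h : LiesOver V Ω) : SmoothFun 𝕜 Ω →ₐ[𝕜] SmoothFun 𝕜 (baseSet V) :=
  SmoothFun.pull (fun p => (p.1, p.2, 0)) contDiff_zeroSection.contDiffOn h

/-- The Taylor series in `ρ`. -/
def tay (h : LiesOver V Ω) : SmoothFun 𝕜 Ω →+* (SmoothFun 𝕜 (baseSet V))⟦X⟧ :=
  taylor (SmoothFun.dir (basisVec (idxInf n))) (restr h)

/-- The coordinate derivations on smooth functions. -/
def ambD (𝕜 : Type*) [RCLike 𝕜] (Ω : Opens (Coord n)) (I : Idx n) :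
    Derivation 𝕜 (SmoothFun 𝕜 Ω) (SmoothFun 𝕜 Ω) := SmoothFun.dir (basisVec I)

lemma SmoothFun.Rep.ambD {f : SmoothFun 𝕜 Ω} {F : Coord n → 𝕜} (h : f.Rep F) (I : Idx n) :
    (WeylAmbient.ambD 𝕜 Ω I f).Rep (pd I F) := h.dir _

lemma dir_restr (h : LiesOver V Ω) (v : ℝ × Model n) (f : SmoothFun 𝕜 Ω) :
    SmoothFun.dir v (restr h f) = restr h (SmoothFun.dir (v.1, v.2, 0) f) := by
  refine (f.rep_rep.dir_pull contDiff_zeroSection.contDiffOn h v).ext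
    ((f.rep_rep.dir _).pull _ _) fun p _ => ?_
  have : HasFDerivAt (fun p : ℝ × Model n => ((p.1, p.2, 0) : Coord n))
      ((ContinuousLinearMap.fst ℝ ℝ (Model n)).prod
        ((ContinuousLinearMap.snd ℝ ℝ (Model n)).prod 0)) p :=
    hasFDerivAt_fst.prodMk (hasFDerivAt_snd.prodMk (hasFDerivAt_const _ _))
  rw [this.fderiv]; rfl

lemma base_D_tay (h : LiesOver V Ω) (I : Idx n) (f : SmoothFun 𝕜 Ω) :
    (base 𝕜 V).D I (tay h f) = tay h (ambD 𝕜 Ω I f) := by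
  rcases I with _ | i | _
  · exact liftD_taylor _ _ (fun _ => SmoothFun.dir_comm _ _ _) (fun _ => dir_restr h _ _) f
  · exact liftD_taylor _ _ (fun _ => SmoothFun.dir_comm _ _ _) (fun _ => dir_restr h _ _) f
  · exact derivX_taylor _ _ f

lemma rep_constantCoeff_tay (h : LiesOver V Ω) {f : SmoothFun 𝕜 Ω} {F : Coord n → 𝕜}
    (hf : f.Rep F) : (constantCoeff (tay h f)).Rep fun p => F (p.1, p.2, 0) := by
  rw [tay, constantCoeff_taylor]; exact hf.pull _ _

lemma iteratedFDeriv_fderiv_apply {E : Type*} [NormedAddCommGroup E] [NormedSpace ℝ E] {F : E → 𝕜}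
    {z : E} (hF : ContDiffAt ℝ ∞ F z) (v : E) (k : ℕ) (m : Fin k → E) :
    iteratedFDeriv ℝ k (fun x => fderiv ℝ F x v) z m
      = iteratedFDeriv ℝ (k + 1) F z (Fin.snoc m v : Fin (k + 1) → E) := by
  rw [iteratedFDeriv_succ_apply_right, Fin.init_snoc, Fin.snoc_last]
  have h : ContDiffAt ℝ ∞ (fderiv ℝ F) z := hF.fderiv_right (by simp)
  have := (ContinuousLinearMap.apply ℝ 𝕜 v).iteratedFDeriv_comp_left h (i := k)
    (WithTop.coe_le_coe.mpr le_top)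
  rw [show (fun x => fderiv ℝ F x v) = ContinuousLinearMap.apply ℝ 𝕜 v ∘ fderiv ℝ F from rfl, this]
  rfl

lemma SmoothFun.Rep.contDiffAt {E : Type*} [NormedAddCommGroup E] [NormedSpace ℝ E] {Ω : Opens E}
    {f : SmoothFun 𝕜 Ω} {F : E → 𝕜} (h : f.Rep F) {z : E} (hz : z ∈ Ω) : ContDiffAt ℝ ∞ F z :=
  h.contDiffOn.contDiffAt (Ω.isOpen.mem_nhds hz)

/-- The Taylor series vanishes iff the function vanishes to infinite order. -/
lemma tay_eq_zero_iff (h : LiesOver V Ω) {f : SmoothFun 𝕜 Ω} {F : Coord n → 𝕜} (hf : f.Rep F) :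
    tay h f = 0 ↔ ∀ p ∈ baseSet V, VanishesToInfiniteOrder F (p.1, p.2, 0) := by
  constructor
  · intro h0 p hp k
    induction k generalizing f F with
    | zero =>
      have := (rep_constantCoeff_tay h hf).eval hp
      rw [h0, map_zero, map_zero] at this
      ext m; simpa using this.symm
    | succ k ih =>
      ext m
      obtain ⟨c, hc⟩ := exists_sum_basisVec (m (Fin.last k))
      have e : ∀ I, tay h (ambD 𝕜 Ω I f) = 0 := fun I => by rw [← base_D_tay, h0, map_zero]
      have e' : ∀ I, iteratedFDeriv ℝ k (fderiv ℝ F) (p.1, p.2, 0) (Fin.init m) (basisVec I) = 0 := by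
        intro I
        have := iteratedFDeriv_fderiv_apply (hf.contDiffAt (h p hp)) (basisVec I) k (Fin.init m)
        rw [iteratedFDeriv_succ_apply_right, Fin.init_snoc, Fin.snoc_last] at this
        refine this.symm.trans ?_
        have e2 := ih (hf.ambD I) (e I)
        change iteratedFDeriv ℝ k (pd I F) _ _ = 0
        rw [e2]; rfl
      rw [iteratedFDeriv_succ_apply_right, hc]
      simp [e']
  · intro hv
    ext m
    rw [tay, coeff_taylor, map_zero, taylorCoeff]
    have : restr h ((SmoothFun.dir (basisVec (idxInf n)))^[m] f) = 0 := by
      induction m generalizing f F with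
      | zero =>
        refine (hf.pull _ _).ext SmoothFun.rep_zero fun p hp => ?_
        have := congrArg (fun T => T 0) (hv p hp 0)
        simpa using this
      | succ m ih =>
        rw [Function.iterate_succ_apply]
        refine ih (hf.dir _) fun p hp k => ?_
        ext m
        rw [iteratedFDeriv_fderiv_apply (hf.contDiffAt (h p hp)), hv p hp]; rfl
    rw [this, mul_zero]

lemma deriv_comp_rho {F : Coord n → 𝕜} {t : ℝ} {y : Model n} {ρ : ℝ}
    (hF : DifferentiableAt ℝ F (t, y, ρ)) :
    deriv (fun ρ => F (t, y, ρ)) ρ = pd (idxInf n) F (t, y, ρ) := by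
  have h1 : HasDerivAt (fun ρ : ℝ => ((t, y, ρ) : Coord n)) (0, 0, 1) ρ :=
    (hasDerivAt_const _ _).prodMk ((hasDerivAt_const _ _).prodMk (hasDerivAt_id _))
  exact (hF.hasFDerivAt.comp_hasDerivAt ρ h1).deriv

/-- The coefficients of the Taylor series. -/
lemma rep_coeff_tay (h : LiesOver V Ω) {f : SmoothFun 𝕜 Ω} {F : Coord n → 𝕜} (hf : f.Rep F)
    (m : ℕ) : (coeff m (tay h f)).Rep fun p =>
      (m.factorial : 𝕜)⁻¹ * iteratedDeriv m (fun ρ => F (p.1, p.2, ρ)) 0 := by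
  rw [tay, coeff_taylor, taylorCoeff]
  refine (SmoothFun.rep_algebraMap _).mul ?_
  induction m generalizing f F with
  | zero => simpa [restr] using hf.pull contDiff_zeroSection.contDiffOn h
  | succ m ih =>
    rw [Function.iterate_succ_apply]
    refine (ih (hf.ambD (idxInf n))).congr fun p hp => ?_
    rw [iteratedDeriv_succ']
    have : deriv (fun ρ => F (p.1, p.2, ρ)) =ᶠ[nhds 0] fun ρ => pd (idxInf n) F (p.1, p.2, ρ) := by
      have hc : Continuous fun ρ : ℝ => ((p.1, p.2, ρ) : Coord n) := by fun_prop
      filter_upwards [hc.continuousAt.preimage_mem_nhds (Ω.isOpen.mem_nhds (h p hp))] with ρ hρ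
      exact deriv_comp_rho ((hf.contDiffAt hρ).differentiableAt (by simp))
    exact (this.iteratedDeriv_eq m).symm

/-! ### The curvature of a smooth metric and of its Taylor series -/

section Curvature

variable {G : Coord n → AmbMat n 𝕜} {GR GiR : AmbMat n (SmoothFun 𝕜 Ω)}
  {Γ : Idx n → AmbMat n (SmoothFun 𝕜 Ω)}

lemma exists_matrix_inverse {E ι : Type*} [NormedAddCommGroup E] [NormedSpace ℝ E] [Fintype ι]
    [DecidableEq ι] {Ω : Opens E} {G : E → Matrix ι ι 𝕜} {GR : Matrix ι ι (SmoothFun 𝕜 Ω)}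
    (hG : ∀ I J, (GR I J).Rep fun z => G z I J) (hdet : ∀ z ∈ Ω, (G z).det ≠ 0) :
    ∃ GiR : Matrix ι ι (SmoothFun 𝕜 Ω), GR * GiR = 1 ∧
      ∀ I J, (GiR I J).Rep fun z => (G z)⁻¹ I J := by
  have hm : ∀ z (hz : z ∈ Ω), (SmoothFun.eval z hz).mapMatrix GR = G z := fun z hz => by
    ext I J; exact (hG I J).eval hz
  have hd : (GR.det).Rep fun z => (G z).det := fun z hz => by
    change SmoothFun.eval z hz GR.det = _
    rw [RingHom.map_det, hm]
  obtain ⟨e, he, -⟩ := hd.exists_inv hdet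
  have h1 : GR * GR⁻¹ = 1 := Matrix.mul_nonsing_inv _ (IsUnit.of_mul_eq_one _ he)
  refine ⟨GR⁻¹, h1, fun I J z hz => ?_⟩
  have := congrArg (SmoothFun.eval z hz).mapMatrix h1
  rw [map_mul, map_one, hm] at this
  exact (congrFun (congrFun (Matrix.inv_eq_right_inv this) I) J).symm

variable (hG : ∀ I J, (GR I J).Rep fun z => G z I J)
  (hGi : ∀ I J, (GiR I J).Rep fun z => (G z)⁻¹ I J) (hinv : GR * GiR = 1)
  (hΓ : IsLC (ambD 𝕜 Ω) GR Γ)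

include hG hGi hinv hΓ in
lemma rep_christoffel (K I J : Idx n) : (Γ I K J).Rep (christoffel G K I J) := by
  intro z hz
  have h := congrArg (SmoothFun.eval z hz) (hΓ.upper hinv K I J)
  rw [map_mul, map_ofNat] at h
  have h' := SmoothFun.Rep.eval (SmoothFun.Rep.sum (s := Finset.univ) fun L _ => (hGi K L).mul
    ((((hG J L).ambD I).add ((hG I L).ambD J)).sub ((hG I J).ambD L))) hz
  change SmoothFun.eval z hz _ = _
  rw [christoffel, ← h', ← h]; ring

include hG hGi hinv hΓ in
lemma rep_ricci (I J : Idx n) : (ric (ambD 𝕜 Ω) Γ I J).Rep (ricci G I J) := by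
  have c := rep_christoffel hG hGi hinv hΓ
  exact (((SmoothFun.Rep.sum fun K _ => (c K I J).ambD K).sub
    (SmoothFun.Rep.sum fun K _ => (c K I K).ambD J)).add
    (SmoothFun.Rep.sum fun K _ => SmoothFun.Rep.sum fun L _ => (c K K L).mul (c L I J))).sub
    (SmoothFun.Rep.sum fun K _ => SmoothFun.Rep.sum fun L _ => (c K J L).mul (c L I K))

include hG hGi hinv hΓ in
lemma rep_hess {f : SmoothFun 𝕜 Ω} {F : Coord n → 𝕜} (hf : f.Rep F) (I J : Idx n) :
    (hes (ambD 𝕜 Ω) Γ f I J).Rep (hess G F I J) :=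
  ((hf.ambD J).ambD I).sub
    (SmoothFun.Rep.sum fun K _ => (rep_christoffel hG hGi hinv hΓ K I J).mul (hf.ambD K))

include hG hGi hinv hΓ in
lemma rep_formalRicci {f v : SmoothFun 𝕜 Ω} {F : Coord n → 𝕜} (hf : f.Rep F)
    (hv : v.Rep fun z => (F z)⁻¹) (d : 𝕜) (I J : Idx n) :
    (warpedRic (ambD 𝕜 Ω) Γ (algebraMap 𝕜 _ (d - n)) v f I J).Rep (formalRicci d G F I J) :=
  (rep_ricci hG hGi hinv hΓ I J).sub
    (((SmoothFun.rep_algebraMap _).mul hv).mul (rep_hess hG hGi hinv hΓ hf I J))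

include hG hGi hinv hΓ in
lemma rep_formalRicciFlat {f : SmoothFun 𝕜 Ω} {F : Coord n → 𝕜} (hf : f.Rep F) (d : 𝕜) :
    (-warpedFlat (ambD 𝕜 Ω) GiR Γ (algebraMap 𝕜 _ (d - n)) f).Rep (formalRicciFlat d G F) := by
  refine SmoothFun.Rep.neg ((hf.mul (SmoothFun.Rep.sum fun I _ => SmoothFun.Rep.sum fun J _ =>
    (hGi I J).mul (rep_hess hG hGi hinv hΓ hf I J))).add (SmoothFun.Rep.mul
      ((SmoothFun.rep_algebraMap _).sub SmoothFun.rep_one)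
      (SmoothFun.Rep.sum fun I _ => SmoothFun.Rep.sum fun J _ => (hGi I J).mul
        ((hf.ambD I).mul (hf.ambD J)))))

end Curvature

/-- The Taylor series of a smooth ambient metric has a Levi-Civita connection, and its curvature
vanishes iff that of the smooth metric vanishes to infinite order. -/
lemma exists_taylor_curvature (h : LiesOver V Ω) {G : Coord n → AmbMat n 𝕜}
    {GR : AmbMat n (SmoothFun 𝕜 Ω)} {f : SmoothFun 𝕜 Ω} {F : Coord n → 𝕜}
    (hG : ∀ I J, (GR I J).Rep fun z => G z I J) (hs : ∀ z ∈ Ω, ∀ I J, G z I J = G z J I)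
    (hdet : ∀ z ∈ Ω, (G z).det ≠ 0) (hf : f.Rep F) (hf0 : ∀ z ∈ Ω, F z ≠ 0) :
    ∃ Gi Γ v, GR.map (tay h) * Gi = 1 ∧ IsLC (base 𝕜 V).D (GR.map (tay h)) Γ ∧ tay h f * v = 1 ∧
      (∀ d I J, warpedRic (base 𝕜 V).D Γ (C (algebraMap 𝕜 _ (d - n))) v (tay h f) I J = 0 ↔
        ∀ p ∈ baseSet V, VanishesToInfiniteOrder (formalRicci d G F I J) (p.1, p.2, 0)) ∧
      ∀ d, warpedFlat (base 𝕜 V).D Gi Γ (C (algebraMap 𝕜 _ (d - n))) (tay h f) = 0 ↔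
        ∀ p ∈ baseSet V, VanishesToInfiniteOrder (formalRicciFlat d G F) (p.1, p.2, 0) := by
  obtain ⟨GiR, hinv, hGi⟩ := exists_matrix_inverse hG hdet
  obtain ⟨Γ, hΓ⟩ := exists_isLC (ambD 𝕜 Ω)
    (fun I J => (hG I J).ext (hG J I) fun z hz => hs z hz I J) hinv
  obtain ⟨v, hv, hvr⟩ := hf.exists_inv hf0
  have hσ := fun I x => base_D_tay (𝕜 := 𝕜) h I x
  have hκ : ∀ d : 𝕜, C (algebraMap 𝕜 (SmoothFun 𝕜 (baseSet V)) (d - n))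
      = tay h (algebraMap 𝕜 _ (d - n)) := fun d => (taylor_algebraMap _ _ _).symm
  refine ⟨GiR.map (tay h), fun I => (Γ I).map (tay h), tay h v, ?_, hΓ.map hσ, ?_, ?_, ?_⟩
  · rw [← Matrix.map_mul, hinv, Matrix.map_one _ (map_zero _) (map_one _)]
  · rw [← map_mul, hv, map_one]
  · intro d I J
    rw [hκ, warpedRic_map hσ]
    exact tay_eq_zero_iff h (rep_formalRicci hG hGi hinv hΓ hf hvr d I J)
  · intro d
    rw [hκ, warpedFlat_map hσ, ← neg_eq_zero, ← map_neg]
    exact tay_eq_zero_iff h (rep_formalRicciFlat hG hGi hinv hΓ hf d)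

/-- The acceleration in terms of the metric. -/
lemma accelLow_eq {G : Coord n → AmbMat n 𝕜} {z : Coord n} (hdet : (G z).det ≠ 0)
    (I : Idx n) : accelLow G I z = pd (idxInf n) (fun w => G w (idxInf n) I) z
      - 1 / 2 * pd I (fun w => G w (idxInf n) (idxInf n)) z := by
  have hG : G z * (G z)⁻¹ = 1 := Matrix.mul_nonsing_inv _ (isUnit_iff_ne_zero.mpr hdet)
  set c : Idx n → 𝕜 := fun L => pd (idxInf n) (fun w => G w (idxInf n) L) z
      + pd (idxInf n) (fun w => G w (idxInf n) L) z
      - pd L (fun w => G w (idxInf n) (idxInf n)) z with hc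
  have : accelLow G I z = 1 / 2 * ∑ L, (G z * (G z)⁻¹) I L * c L := by
    simp only [accelLow, accel, christoffel, Matrix.mul_apply, mul_sum, sum_mul]
    exact sum_swap fun _ _ => by rw [hc]; ring
  rw [this, hG]
  simp only [Matrix.one_apply, ite_mul, one_mul, zero_mul, Finset.sum_ite_eq, Finset.mem_univ,
    if_true, hc]
  ring

end

section

variable {n : ℕ} {𝕜 : Type*} [RCLike 𝕜] {V : Opens (Model n)} {Ω : Opens (Coord n)}

/-! ### Smooth metrics in Weyl-normal form -/

lemma eq_C_of_derivX_eq_zero {A : Type*} [CommRing A] [Algebra 𝕜 A] {P : A⟦X⟧}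
    (h : derivX 𝕜 A P = 0) : P = C (constantCoeff P) := by
  ext m
  cases m with
  | zero => simp
  | succ m =>
    have := congrArg (coeff m) h
    rw [coeff_derivX, map_zero] at this
    rw [coeff_C, if_neg m.succ_ne_zero]
    exact cancel_succ 𝕜 (this.trans (zero_mul _).symm)

/-- The coordinate `t` on `Ω`. -/
def ambT (𝕜 : Type*) [RCLike 𝕜] (Ω : Opens (Coord n)) : SmoothFun 𝕜 Ω :=
  SmoothFun.mk (fun p => (p.1 : 𝕜)) ((RCLike.ofRealCLM (K := 𝕜)).contDiff.comp contDiff_fst).contDiffOn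

lemma rep_ambT : (ambT 𝕜 Ω).Rep fun p => (p.1 : 𝕜) := SmoothFun.rep_mk _ _

lemma pd_comp_fst {F : Coord n → 𝕜} {z : Coord n} (hF : DifferentiableAt ℝ F z) :
    pd (idx0 n) F z = deriv (fun t => F (t, z.2)) z.1 := by
  have h1 : HasDerivAt (fun t : ℝ => ((t, z.2) : Coord n)) (1, 0) z.1 :=
    (hasDerivAt_id _).prodMk (hasDerivAt_const _ _)
  exact (hF.hasFDerivAt.comp_hasDerivAt z.1 h1).deriv.symm

lemma tay_eq_C (h : LiesOver V Ω) {f : SmoothFun 𝕜 Ω} {F : Coord n → 𝕜} (hf : f.Rep F)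
    {a : SmoothFun 𝕜 (baseSet V)} (ha : a.Rep fun p => F (p.1, p.2, 0))
    (h0 : ∀ z ∈ Ω, pd (idxInf n) F z = 0) : tay h f = C a := by
  have : derivX 𝕜 _ (tay h f) = 0 := by
    rw [← AmbBase.D_inf (base 𝕜 V), base_D_tay, ← map_zero (tay h)]
    exact congrArg _ ((hf.ambD _).ext SmoothFun.rep_zero h0)
  rw [eq_C_of_derivX_eq_zero this]
  exact congrArg _ ((rep_constantCoeff_tay h hf).ext ha fun _ _ => rfl)

lemma tay_ambT (h : LiesOver V Ω) : tay h (ambT 𝕜 Ω) = (base 𝕜 V).τ := by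
  refine tay_eq_C h rep_ambT (rep_baseT V) fun z _ => ?_
  have : HasFDerivAt (fun p : Coord n => (p.1 : 𝕜))
      (RCLike.ofRealCLM.comp (ContinuousLinearMap.fst ℝ ℝ (Model n × ℝ))) z :=
    (RCLike.ofRealCLM.comp (ContinuousLinearMap.fst ℝ ℝ (Model n × ℝ))).hasFDerivAt
  rw [pd, this.fderiv]
  simp [basisVec]

/-- Homogeneous functions have Taylor series of the form `t^w P` with `P` independent of `t`. -/
lemma exists_tay_of_homogeneous (h : LiesOver V Ω) (hpos : ∀ z ∈ Ω, 0 < z.1) {f : SmoothFun 𝕜 Ω}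
    {F : Coord n → 𝕜} (hf : f.Rep F) (w : ℕ)
    (hF : ∀ z ∈ Ω, ∀ s : ℝ, 0 < s → F (s * z.1, z.2) = (s : 𝕜) ^ w * F z) :
    ∃ P, tay h f = (base 𝕜 V).τ ^ w * P ∧ liftD (base 𝕜 V).d0 P = 0 := by
  have ne : ∀ z ∈ Ω, (z.1 : 𝕜) ≠ 0 := fun z hz => by simpa using (hpos z hz).ne'
  obtain ⟨ti, ht, hti⟩ := (rep_ambT (𝕜 := 𝕜) (Ω := Ω)).exists_inv ne
  refine ⟨tay h (ti ^ w * f), ?_, ?_⟩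
  · rw [← tay_ambT h, ← map_pow, ← map_mul, ← mul_assoc, ← mul_pow, ht, one_pow, one_mul]
  · rw [← AmbBase.D_zero, base_D_tay, ← map_zero (tay h)]
    have hr := (hti.pow w).mul hf
    refine congrArg _ ((hr.ambD _).ext SmoothFun.rep_zero fun z hz => ?_)
    rw [pd_comp_fst ((hr.contDiffAt hz).differentiableAt (by simp))]
    have : (fun t : ℝ => ((t : 𝕜)⁻¹ ^ w * F (t, z.2))) =ᶠ[nhds z.1]
        fun _ => (z.1 : 𝕜)⁻¹ ^ w * F z := by
      filter_upwards [lt_mem_nhds (hpos z hz)] with t ht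
      have h1 := hF z hz (t / z.1) (div_pos ht (hpos z hz))
      rw [div_mul_cancel₀ _ (hpos z hz).ne'] at h1
      have h2 := ne z hz
      have h3 : (t : 𝕜) ≠ 0 := by simpa using ht.ne'
      rw [h1, ← mul_assoc, ← mul_pow]
      push_cast
      congr 2
      field_simp
    rw [this.deriv_eq, deriv_const]

/-- The weight of a component under dilatations. -/
def weight : Idx n → ℕ
  | Sum.inl _ => 0
  | Sum.inr _ => 1

/-- The components of a smooth ambient metric `G + F² δ` on `Ω` in Weyl-normal form, with the
initial values `t² g + 2 t² (t⁻¹ dt + a) dρ` and the acceleration `t² ϕ`. -/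
structure IsChartNormal (V : Opens (Model n)) (Ω : Opens (Coord n))
    (G : Coord n → AmbMat n 𝕜) (F : Coord n → 𝕜)
    (g : Model n → BaseMat n 𝕜) (a : Model n → Fin n → 𝕜)
    (ϕ : Coord n → Fin n → 𝕜) : Prop where
  pos : ∀ z ∈ Ω, 0 < z.1
  smooth : ∀ I J, ContDiffOn ℝ ∞ (fun z => G z I J) Ω
  smooth_flat : ContDiffOn ℝ ∞ F Ω
  symm : ∀ z ∈ Ω, ∀ I J, G z I J = G z J I
  det : ∀ z ∈ Ω, (G z).det ≠ 0
  flat_ne : ∀ z ∈ Ω, F z ≠ 0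
  homogeneous : ∀ z ∈ Ω, ∀ s : ℝ, 0 < s → ∀ I J,
    G (s * z.1, z.2) I J = (s : 𝕜) ^ (weight I + weight J) * G z I J
  homogeneous_flat : ∀ z ∈ Ω, ∀ s : ℝ, 0 < s → F (s * z.1, z.2) = (s : 𝕜) * F z
  flat_zero : ∀ p ∈ baseSet V, F (p.1, p.2, 0) = p.1
  zero_00 : ∀ p ∈ baseSet V, G (p.1, p.2, 0) (idx0 n) (idx0 n) = 0
  zero_0M : ∀ p ∈ baseSet V, ∀ i, G (p.1, p.2, 0) (idx0 n) (idxM i) = 0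
  zero_0inf : ∀ p ∈ baseSet V, G (p.1, p.2, 0) (idx0 n) (idxInf n) = p.1
  zero_MM : ∀ p ∈ baseSet V, ∀ i j, G (p.1, p.2, 0) (idxM i) (idxM j) = (p.1 : 𝕜) ^ 2 * g p.2 i j
  zero_Minf : ∀ p ∈ baseSet V, ∀ i, G (p.1, p.2, 0) (idxM i) (idxInf n) = (p.1 : 𝕜) ^ 2 * a p.2 i
  zero_infinf : ∀ p ∈ baseSet V, G (p.1, p.2, 0) (idxInf n) (idxInf n) = 0
  accel_0 : ∀ z ∈ Ω, accelLow G (idx0 n) z = 0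
  accel_M : ∀ z ∈ Ω, ∀ i, accelLow G (idxM i) z = (z.1 : 𝕜) ^ 2 * ϕ z i
  accel_inf : ∀ z ∈ Ω, accelLow G (idxInf n) z = 0

namespace IsChartNormal

variable {G : Coord n → AmbMat n 𝕜} {F : Coord n → 𝕜}
    {g : Model n → BaseMat n 𝕜} {a : Model n → Fin n → 𝕜}
    {ϕ : Coord n → Fin n → 𝕜} (hN : IsChartNormal V Ω G F g a ϕ) (h : LiesOver V Ω)

/-- The components as smooth functions. -/
def matrix : AmbMat n (SmoothFun 𝕜 Ω) :=
  Matrix.of fun I J => SmoothFun.mk _ (hN.smooth I J)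

lemma rep_matrix (I J : Idx n) : (hN.matrix I J).Rep fun z => G z I J := SmoothFun.rep_mk _ (hN.smooth I J)

include hN in
lemma pd_infinf {z : Coord n} (hz : z ∈ Ω) :
    pd (idxInf n) (fun w => G w (idxInf n) (idxInf n)) z = 0 := by
  have := accelLow_eq (hN.det z hz) (idxInf n)
  rw [hN.accel_inf z hz] at this
  linear_combination -2 * this

lemma tay_infinf : tay h (hN.matrix (idxInf n) (idxInf n)) = 0 := by
  rw [tay_eq_C h (hN.rep_matrix _ _) (a := 0) (SmoothFun.rep_zero.congr fun p hp =>
    (hN.zero_infinf p hp).symm) fun z hz => hN.pd_infinf hz, map_zero]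

/-- `∂_∞ G_{I∞} = 𝒜_I` on the level of Taylor series. -/
lemma derivX_tay {I : Idx n} {x : SmoothFun 𝕜 Ω} (hx : x.Rep (accelLow G I)) :
    derivX 𝕜 _ (tay h (hN.matrix (idxInf n) I)) = tay h x := by
  have e : ambD 𝕜 Ω (idxInf n) (hN.matrix (idxInf n) I) = x + algebraMap 𝕜 _ (1 / 2) *
      ambD 𝕜 Ω I (hN.matrix (idxInf n) (idxInf n)) := by
    refine ((hN.rep_matrix _ _).ambD _).ext (hx.add ((SmoothFun.rep_algebraMap _).mul
      ((hN.rep_matrix _ _).ambD _))) fun z hz => ?_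
    rw [accelLow_eq (hN.det z hz)]; ring
  rw [← AmbBase.D_inf (base 𝕜 V), base_D_tay, e, map_add, map_mul, ← base_D_tay, hN.tay_infinf,
    map_zero, mul_zero, add_zero]

lemma matrix_symm (I J : Idx n) : hN.matrix I J = hN.matrix J I :=
  (hN.rep_matrix I J).ext (hN.rep_matrix J I) fun z hz => hN.symm z hz I J

lemma tay_0inf : tay h (hN.matrix (idx0 n) (idxInf n)) = (base 𝕜 V).τ := by
  have e := hN.derivX_tay h (I := idx0 n) (x := 0)
    (SmoothFun.rep_zero.congr fun z hz => (hN.accel_0 z hz).symm)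
  rw [map_zero] at e
  rw [hN.matrix_symm, eq_C_of_derivX_eq_zero e, hN.matrix_symm, AmbBase.τ]
  exact congrArg _ ((rep_constantCoeff_tay h (hN.rep_matrix _ _)).ext (rep_baseT V) hN.zero_0inf)

variable {gR gi : BaseMat n (SmoothFun 𝕜 (baseSet V))}
  (hg : ∀ i j, (gR i j).Rep fun p => g p.2 i j) (hgi : gR * gi = 1)

include hg hgi in
/-- The Taylor series of a smooth metric in Weyl-normal form. -/
lemma exists_normalData : ∃ h0 h1 q α u v Gi Γ,
    hN.matrix.map (tay h) = (base 𝕜 V).normalG h0 h1 q α ∧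
    tay h (SmoothFun.mk F hN.smooth_flat) = (base 𝕜 V).τ * u ∧
    IsNormalData (base 𝕜 V) gR gi h0 h1 q α Gi Γ ∧ liftD (base 𝕜 V).d0 u = 0 ∧
    constantCoeff u = 1 ∧ (base 𝕜 V).τ * u * v = 1 ∧
    (∀ d I J, warpedRic (base 𝕜 V).D Γ (C (algebraMap 𝕜 _ (d - n))) v ((base 𝕜 V).τ * u) I J = 0 ↔
      ∀ p ∈ baseSet V, VanishesToInfiniteOrder (formalRicci d G F I J) (p.1, p.2, 0)) ∧
    ∀ d, warpedFlat (base 𝕜 V).D Gi Γ (C (algebraMap 𝕜 _ (d - n))) ((base 𝕜 V).τ * u) = 0 ↔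
      ∀ p ∈ baseSet V, VanishesToInfiniteOrder (formalRicciFlat d G F) (p.1, p.2, 0) := by
  have hom : ∀ I J, ∃ P, tay h (hN.matrix I J) = (base 𝕜 V).τ ^ (weight I + weight J) * P ∧
      liftD (base 𝕜 V).d0 P = 0 := fun I J => exists_tay_of_homogeneous h hN.pos
    (hN.rep_matrix I J) _ fun z hz s hs => hN.homogeneous z hz s hs I J
  choose P hP hP0 using hom
  obtain ⟨u, hu, hu0⟩ := exists_tay_of_homogeneous h hN.pos (SmoothFun.rep_mk F hN.smooth_flat) 1
    fun z hz s hs => by rw [pow_one]; exact hN.homogeneous_flat z hz s hs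
  rw [pow_one] at hu
  obtain ⟨Gi, Γ, v, hinv, hlc, hv, hR, hS⟩ := exists_taylor_curvature h hN.rep_matrix hN.symm hN.det
    (SmoothFun.rep_mk F hN.smooth_flat) hN.flat_ne
  have cc := fun I J => rep_constantCoeff_tay h (hN.rep_matrix I J)
  have ccτ : constantCoeff (base 𝕜 V).τ = (base 𝕜 V).t := by simp [AmbBase.τ]
  have sq : ∀ {x y : SmoothFun 𝕜 (baseSet V)}, (base 𝕜 V).t ^ 2 * x = (base 𝕜 V).t ^ 2 * y → x = y :=
    fun e => (base 𝕜 V).t_cancel ((base 𝕜 V).t_cancel (by simpa [sq, mul_assoc] using e))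
  have hnorm : hN.matrix.map (tay h) = (base 𝕜 V).normalG (P (idx0 n) (idx0 n))
      (fun i => P (idx0 n) (idxM i)) (Matrix.of fun i j => P (idxM i) (idxM j))
      fun i => P (idxM i) (idxInf n) := by
    ext1 I J
    rw [Matrix.map_apply]
    induction I using idx_cases <;> induction J using idx_cases
    · rw [hP]; simp [weight]
    · rw [hP]; simp [weight]
    · exact hN.tay_0inf h
    · rw [hN.matrix_symm, hP]; simp [weight]
    · rw [hP]; simp [weight]
    · rw [hP]; simp [weight]
    · rw [hN.matrix_symm]; exact hN.tay_0inf h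
    · rw [hN.matrix_symm, hP]; simp [weight]
    · exact hN.tay_infinf h
  refine ⟨_, _, _, _, u, v, Gi, Γ, hnorm, hu,
    ⟨by rw [← hnorm]; exact hlc, by rw [← hnorm]; exact hinv, hgi, ?_, fun i => ?_, fun i j => ?_,
      hP0 _ _, fun _ => hP0 _ _, fun _ _ => hP0 _ _, fun _ => hP0 _ _⟩, hu0, ?_, hu ▸ hv, ?_, ?_⟩
  · have := cc (idx0 n) (idx0 n)
    rw [hP, weight, pow_zero, one_mul] at this
    exact this.ext SmoothFun.rep_zero hN.zero_00
  · have := cc (idx0 n) (idxM i)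
    rw [hP, weight, weight, zero_add, pow_one, map_mul, ccτ] at this
    refine (base 𝕜 V).t_cancel ?_
    rw [mul_zero]
    exact this.ext SmoothFun.rep_zero fun p hp => hN.zero_0M p hp i
  · have := cc (idxM i) (idxM j)
    rw [hP, weight, weight, map_mul, map_pow, ccτ] at this
    exact sq (this.ext (((rep_baseT V).pow 2).mul (hg i j)) fun p hp => hN.zero_MM p hp i j)
  · have := rep_constantCoeff_tay h (SmoothFun.rep_mk F hN.smooth_flat)
    rw [hu, map_mul, ccτ] at this
    refine (base 𝕜 V).t_cancel ?_
    rw [mul_one]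
    exact this.ext (rep_baseT V) hN.flat_zero
  · rw [← hu]; exact hR
  · rw [← hu]; exact hS

include hN h hg hgi in
/-- Uniqueness in a chart. -/
lemma unique {G' : Coord n → AmbMat n 𝕜} {F' : Coord n → 𝕜}
    (hN' : IsChartNormal V Ω G' F' g a ϕ) {d : 𝕜} (hd1 : d ≠ 1) (hd : ∀ m : ℕ, d ≠ 2 * m)
    (hE : ∀ I J, ∀ p ∈ baseSet V, VanishesToInfiniteOrder (formalRicci d G F I J) (p.1, p.2, 0))
    (hE' : ∀ I J, ∀ p ∈ baseSet V, VanishesToInfiniteOrder (formalRicci d G' F' I J) (p.1, p.2, 0))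
    (hS : (∀ p ∈ baseSet V, VanishesToInfiniteOrder (formalRicciFlat d G F) (p.1, p.2, 0) ∧
      VanishesToInfiniteOrder (formalRicciFlat d G' F') (p.1, p.2, 0)) ∨ (d = n ∧ F' = F)) :
    ∀ p ∈ baseSet V,
      (∀ I J, VanishesToInfiniteOrder (fun z => G z I J - G' z I J) (p.1, p.2, 0)) ∧
      VanishesToInfiniteOrder (fun z => F z - F' z) (p.1, p.2, 0) := by
  obtain ⟨h0, h1, q, α, u, v, Gi, Γ, e, eu, hn, hu, hu1, hv, hR, hF⟩ :=
    hN.exists_normalData h hg hgi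
  obtain ⟨h0', h1', q', α', u', v', Gi', Γ', e', eu', hn', hu', hu1', hv', hR', hF'⟩ :=
    hN'.exists_normalData h hg hgi
  obtain rfl : α = α' := by
    funext i
    have key : tay h (hN.matrix (idxInf n) (idxM i)) = tay h (hN'.matrix (idxInf n) (idxM i)) := by
      have acc : (SmoothFun.dir (basisVec (idxInf n)) (hN.matrix (idxInf n) (idxM i))
          - algebraMap 𝕜 _ (1 / 2) * ambD 𝕜 Ω (idxM i) (hN.matrix (idxInf n) (idxInf n))).Rep
          (accelLow G (idxM i)) :=
        (((hN.rep_matrix _ _).ambD _).sub ((SmoothFun.rep_algebraMap _).mul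
          ((hN.rep_matrix _ _).ambD _))).congr fun z hz => (accelLow_eq (hN.det z hz) _).symm
      have d1 := hN.derivX_tay h acc
      have d2 := hN'.derivX_tay h (acc.congr fun z hz =>
        (hN.accel_M z hz i).trans (hN'.accel_M z hz i).symm)
      have d3 : derivX 𝕜 _ (tay h (hN.matrix (idxInf n) (idxM i))
          - tay h (hN'.matrix (idxInf n) (idxM i))) = 0 := by rw [map_sub, d1, d2, sub_self]
      refine sub_eq_zero.mp ((eq_C_of_derivX_eq_zero d3).trans ?_)
      rw [map_sub, (rep_constantCoeff_tay h (hN.rep_matrix _ _)).ext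
        (rep_constantCoeff_tay h (hN'.rep_matrix _ _)) fun p hp => ?_, sub_self, map_zero]
      rw [hN.symm _ (h p hp), hN'.symm _ (h p hp), hN.zero_Minf p hp, hN'.zero_Minf p hp]
    have k1 := congrFun (congrFun e (idxInf n)) (idxM i)
    have k2 := congrFun (congrFun e' (idxInf n)) (idxM i)
    rw [Matrix.map_apply] at k1 k2
    rw [k1, k2] at key
    simp only [AmbBase.normalG_infM] at key
    exact (base 𝕜 V).τ_cancel ((base 𝕜 V).τ_cancel (by simpa [sq, mul_assoc] using key))
  have E := fun I J => (hR d I J).mpr (hE I J)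
  have E' := fun I J => (hR' d I J).mpr (hE' I J)
  obtain ⟨rfl, rfl⟩ := hn.straight hd hu hu1 hv (E _)
  obtain ⟨rfl, rfl⟩ := hn'.straight hd hu' hu1' hv' (E' _)
  obtain ⟨rfl, rfl⟩ := normalData_unique hn hn' hd1 hd hu hu1 hv hu' hu1' hv' E E' (by
    rcases hS with hS | ⟨hdn, rfl⟩
    · exact Or.inl ⟨(hF d).mpr fun p hp => (hS p hp).1, (hF' d).mpr fun p hp => (hS p hp).2⟩
    · exact Or.inr ⟨hdn, (base 𝕜 V).τ_cancel (eu'.symm.trans eu)⟩)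
  refine fun p hp => ⟨fun I J => ?_, ?_⟩
  · refine (tay_eq_zero_iff h ((hN.rep_matrix I J).sub (hN'.rep_matrix I J))).mp ?_ p hp
    have := congrFun (congrFun (e.trans e'.symm) I) J
    rw [Matrix.map_apply, Matrix.map_apply] at this
    rw [map_sub, this, sub_self]
  · refine (tay_eq_zero_iff h ((SmoothFun.rep_mk F hN.smooth_flat).sub
      (SmoothFun.rep_mk F' hN'.smooth_flat))).mp ?_ p hp
    rw [map_sub, eu, eu', sub_self]

end IsChartNormal

end

section

/-! ### Nondegeneracy -/

section Signature

variable {V : Type*} [AddCommGroup V] [Module ℝ V] [FiniteDimensional ℝ V]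
  {B : V →ₗ[ℝ] V →ₗ[ℝ] ℝ} {p q : ℕ}

lemma HasSignature.eq_zero (h : HasSignature B p q) {v : V} (hv : ∀ w, B w v = 0) : v = 0 := by
  have h1 := QuadraticForm.sigPos_add_sigNeg_add_radical (Q := LinearMap.BilinMap.toQuadraticMap B)
  rw [h.pos, h.neg, h.finrank_eq] at h1
  have h2 : Module.finrank ℝ (LinearMap.BilinMap.toQuadraticMap B).radical = 0 := by omega
  rw [Submodule.finrank_eq_zero, Submodule.eq_bot_iff] at h2
  refine h2 v ⟨hv v, ?_⟩
  ext w
  simp [QuadraticMap.polar, hv, h.symm v w]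

lemma HasSignature.det_ne_zero {ι : Type*} [Fintype ι] [DecidableEq ι] (h : HasSignature B p q)
    (b : Module.Basis ι ℝ V) : (Matrix.of fun i j => B (b i) (b j)).det ≠ 0 := by
  intro h0
  obtain ⟨c, hc, e⟩ := Matrix.exists_mulVec_eq_zero_iff.mpr h0
  refine hc (b.equivFun.symm.map_eq_zero_iff.mp (h.eq_zero fun w => ?_))
  have : B.flip (b.equivFun.symm c) = 0 := b.ext fun i => by
    have := congrFun e i
    simpa [Matrix.mulVec, dotProduct, Module.Basis.equivFun_symm_apply, mul_comm] using this
  exact congrArg (fun T => T w) this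

end Signature

variable {n : ℕ} {M : Type*} [TopologicalSpace M] [ChartedSpace (Model n) M]

instance (x : M) : FiniteDimensional ℝ (Tan n x) :=
  inferInstanceAs (FiniteDimensional ℝ (Model n))

/-! ### Coordinate vectors -/

section Charts

variable {φ ψ : Chart n M}

lemma contMDiffOn_chart (hφ : φ ∈ charts n M) :
    ContMDiffOn 𝓘(ℝ, Model n) 𝓘(ℝ, Model n) ∞ φ φ.source := contMDiffOn_of_mem_maximalAtlas hφ

lemma contMDiffOn_chart_symm (hφ : φ ∈ charts n M) :
    ContMDiffOn 𝓘(ℝ, Model n) 𝓘(ℝ, Model n) ∞ φ.symm φ.target :=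
  contMDiffOn_symm_of_mem_maximalAtlas hφ

lemma mdifferentiable_chart' (hφ : φ ∈ charts n M) :
    φ.MDifferentiable 𝓘(ℝ, Model n) 𝓘(ℝ, Model n) :=
  ⟨(contMDiffOn_chart hφ).mdifferentiableOn (by simp),
    (contMDiffOn_chart_symm hφ).mdifferentiableOn (by simp)⟩

/-- The differential of a chart. -/
def dchart (φ : Chart n M) (x : M) : Tan n x →L[ℝ] Model n :=
  mfderiv 𝓘(ℝ, Model n) 𝓘(ℝ, Model n) φ x

/-- The transition map between two charts. -/
def transition (φ ψ : Chart n M) (y : Model n) : Model n := ψ (φ.symm y)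

/-- The domain of the transition map. -/
def overlap (φ ψ : Chart n M) : Opens (Model n) :=
  ⟨φ.target ∩ φ.symm ⁻¹' ψ.source, φ.symm.isOpen_inter_preimage ψ.open_source⟩

lemma contDiffOn_transition (hφ : φ ∈ charts n M) (hψ : ψ ∈ charts n M) :
    ContDiffOn ℝ ∞ (transition φ ψ) (overlap φ ψ) := by
  rw [← contMDiffOn_iff_contDiffOn]
  exact (contMDiffOn_chart hψ).comp ((contMDiffOn_chart_symm hφ).mono Set.inter_subset_left)
    Set.inter_subset_right

/-- The Jacobian of the transition map. -/
def jacobian (φ ψ : Chart n M) (y : Model n) : BaseMat n ℝ :=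
  Matrix.of fun k i => fderiv ℝ (transition φ ψ) y (EuclideanSpace.single i 1) k

lemma dchart_coordVec (hφ : φ ∈ charts n M) (hψ : ψ ∈ charts n M) {y : Model n}
    (hy : y ∈ overlap φ ψ) (i : Fin n) :
    dchart ψ (φ.symm y) (coordVec φ y i)
      = fderiv ℝ (transition φ ψ) y (EuclideanSpace.single i 1) := by
  have h1 := (mdifferentiable_chart' hφ).mdifferentiableAt_symm hy.1
  have h2 := (mdifferentiable_chart' hψ).mdifferentiableAt hy.2
  have := mfderiv_comp y h2 h1
  rw [← mfderiv_eq_fderiv]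
  exact (congrArg (fun T => T (EuclideanSpace.single i 1 : Model n)) this).symm

lemma dchart_apply_coordVec (hφ : φ ∈ charts n M) (hψ : ψ ∈ charts n M) {y : Model n}
    (hy : y ∈ overlap φ ψ) (i k : Fin n) :
    dchart ψ (φ.symm y) (coordVec φ y i) k = jacobian φ ψ y k i := by
  rw [dchart_coordVec hφ hψ hy]; rfl

/-- The coordinate vectors as a basis. -/
def coordBasis (hφ : φ ∈ charts n M) {y : Model n} (hy : y ∈ φ.target) :
    Module.Basis (Fin n) ℝ (Tan n (φ.symm y)) :=
  (EuclideanSpace.basisFun (Fin n) ℝ).toBasis.map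
    ((mdifferentiable_chart' hφ).symm.mfderiv hy).toLinearEquiv

lemma coordBasis_apply (hφ : φ ∈ charts n M) {y : Model n} (hy : y ∈ φ.target) (i : Fin n) :
    coordBasis hφ hy i = coordVec φ y i := by
  refine (Module.Basis.map_apply _ _ i).trans (congrArg _ ?_)
  rw [OrthonormalBasis.coe_toBasis, EuclideanSpace.basisFun_apply]

/-- Coordinate vectors of different charts. -/
lemma coordVec_eq_sum (hφ : φ ∈ charts n M) (hψ : ψ ∈ charts n M) {y : Model n}
    (hy : y ∈ overlap φ ψ) (i : Fin n) : (coordVec φ y i : Model n)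
      = ∑ k, jacobian φ ψ y k i • (coordVec ψ (transition φ ψ y) k : Model n) := by
  have h := (mdifferentiable_chart' hψ).symm_comp_deriv hy.2
  have h' := congrArg (fun T => T (coordVec φ y i)) h
  have e : (coordVec φ y i : Model n)
      = mfderiv 𝓘(ℝ, Model n) 𝓘(ℝ, Model n) ψ.symm (transition φ ψ y)
        (dchart ψ (φ.symm y) (coordVec φ y i) : Model n) := h'.symm
  rw [e]
  have s : (dchart ψ (φ.symm y) (coordVec φ y i) : Model n)
      = ∑ k, jacobian φ ψ y k i • (EuclideanSpace.single k 1 : Model n) := by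
    ext k
    rw [dchart_apply_coordVec hφ hψ hy]
    simp [Finset.sum_apply, Pi.single_apply]
  rw [s]
  exact (map_sum _ _ _).trans (sum_congr rfl fun k _ => map_smul _ _ _)

/-- Transformation of the components of a one-form. -/
lemma form_transform {𝕜 : Type*} [RCLike 𝕜] (hφ : φ ∈ charts n M) (hψ : ψ ∈ charts n M)
    (a : ∀ x : M, Tan n x →ₗ[ℝ] 𝕜) {y : Model n} (hy : y ∈ overlap φ ψ) (i : Fin n) :
    a (φ.symm y) (coordVec φ y i) = ∑ k, (jacobian φ ψ y k i : 𝕜) *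
      a (ψ.symm (transition φ ψ y)) (coordVec ψ (transition φ ψ y) k) := by
  have h : ψ.symm (transition φ ψ y) = φ.symm y := ψ.left_inv hy.2
  have h' : ∀ v : Model n, a (ψ.symm (transition φ ψ y)) v = a (φ.symm y) v := by rw [h]; simp
  refine (congrArg (a (φ.symm y)) (coordVec_eq_sum hφ hψ hy i)).trans ?_
  refine (map_sum (a (φ.symm y)) _ _).trans (sum_congr rfl fun k _ => ?_)
  refine (map_smul (a (φ.symm y)) _ _).trans ?_
  rw [RCLike.real_smul_eq_coe_mul]
  exact congrArg _ (h' _).symm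

lemma bilin_sum {ι V : Type*} [Fintype ι] [AddCommGroup V] [Module ℝ V] (B : V →ₗ[ℝ] V →ₗ[ℝ] ℝ)
    (v w : ι → V) (c d : ι → ℝ) :
    B (∑ k, c k • v k) (∑ l, d l • w l) = ∑ k, ∑ l, c k * d l * B (v k) (w l) := by
  simp only [map_sum, map_smul, LinearMap.sum_apply, LinearMap.smul_apply, smul_eq_mul,
    mul_sum]
  exact sum_swap fun _ _ => by ring

lemma form_transform₂ (hφ : φ ∈ charts n M) (hψ : ψ ∈ charts n M)
    (g : ∀ x : M, Tan n x →ₗ[ℝ] Tan n x →ₗ[ℝ] ℝ) {y : Model n} (hy : y ∈ overlap φ ψ)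
    (i j : Fin n) :
    g (φ.symm y) (coordVec φ y i) (coordVec φ y j) = ∑ k, ∑ l, jacobian φ ψ y k i *
      jacobian φ ψ y l j * g (ψ.symm (transition φ ψ y)) (coordVec ψ (transition φ ψ y) k)
        (coordVec ψ (transition φ ψ y) l) := by
  have h : ψ.symm (transition φ ψ y) = φ.symm y := ψ.left_inv hy.2
  have h' : ∀ v w : Model n, g (ψ.symm (transition φ ψ y)) v w = g (φ.symm y) v w := by
    rw [h]; simp
  have e := coordVec_eq_sum hφ hψ hy
  refine (congrArg₂ (fun v w : Model n => g (φ.symm y) v w) (e i) (e j)).trans ?_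
  exact (bilin_sum (g (φ.symm y)) _ _ _ _).trans (sum_congr₂ fun k l => congrArg _ (h' _ _).symm)

/-- The basis of `ℝ × V × ℝ` given by a basis of `V`. -/
def tripleBasis {ι V : Type*} [AddCommGroup V] [Module ℝ V] (b : Module.Basis ι ℝ V) :
    Module.Basis (Unit ⊕ ι ⊕ Unit) ℝ (ℝ × V × ℝ) :=
  (Module.Basis.singleton Unit ℝ).prod (b.prod (Module.Basis.singleton Unit ℝ))

lemma tripleBasis_apply {ι V : Type*} [AddCommGroup V] [Module ℝ V] (b : Module.Basis ι ℝ V)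
    : tripleBasis b (Sum.inl ()) = (1, 0, 0) ∧
      (∀ i, tripleBasis b (Sum.inr (Sum.inl i)) = (0, b i, 0)) ∧
      tripleBasis b (Sum.inr (Sum.inr ())) = (0, 0, 1) := by
  simp [tripleBasis, Module.Basis.prod_apply, Prod.ext_iff]

/-- The ambient coordinate vectors as a basis. -/
def ambBasis (hφ : φ ∈ charts n M) {z : Coord n} (hz : z.2.1 ∈ φ.target) :
    Module.Basis (Idx n) ℝ (AmbTan n (ambPoint φ z)) := tripleBasis (coordBasis hφ hz)

lemma ambBasis_apply (hφ : φ ∈ charts n M) {z : Coord n} (hz : z.2.1 ∈ φ.target) (I : Idx n) :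
    ambBasis hφ hz I = ambVec φ z I := by
  rcases I with _ | i | _
  · exact (tripleBasis_apply _).1
  · exact ((tripleBasis_apply _).2.1 i).trans 
      (congrArg (fun v : Model n => ((0, v, 0) : ℝ × Model n × ℝ)) (coordBasis_apply hφ hz i))
  · exact (tripleBasis_apply _).2.2

lemma isOpen_chartDomain (φ : Chart n M) {D : Set (ℝ × M × ℝ)}
    (hD : IsOpen D) : IsOpen (chartDomain φ D) := by
  have h1 : IsOpen {z : Coord n | z.2.1 ∈ φ.target} :=
    φ.open_target.preimage (continuous_fst.comp continuous_snd)
  have h2 : ContinuousOn (ambPoint φ) {z : Coord n | z.2.1 ∈ φ.target} :=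
    continuousOn_fst.prodMk ((φ.continuousOn_symm.comp
      (continuous_fst.comp continuous_snd).continuousOn fun _ h => h).prodMk
      (continuous_snd.comp continuous_snd).continuousOn)
  exact h2.isOpen_inter_preimage h1 hD

/-- The image of a chart. -/
def targetOpens (φ : Chart n M) : Opens (Model n) := ⟨φ.target, φ.open_target⟩

/-- The part of an ambient domain over the domain of a chart. -/
def chartOpens (φ : Chart n M) {D : Set (ℝ × M × ℝ)} (hD : IsOpen D) :
    Opens (Coord n) := ⟨chartDomain φ D, isOpen_chartDomain φ hD⟩

end Charts

/-! ### Uniqueness -/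

section Uniqueness

variable {𝕜 : Type*} [RCLike 𝕜] {p q : ℕ} {φ : Chart n M}

/-- The components of the metric. -/
def gComp (𝕜 : Type*) [RCLike 𝕜] (r : WeylRep n M p q) (φ : Chart n M)
    (y : Model n) : BaseMat n 𝕜 :=
  Matrix.of fun i j => ((r.g (φ.symm y) (coordVec φ y i) (coordVec φ y j) : ℝ) : 𝕜)

/-- The components of the one-form. -/
def aComp (𝕜 : Type*) [RCLike 𝕜] (r : WeylRep n M p q) (φ : Chart n M)
    (y : Model n) (i : Fin n) : 𝕜 := ((r.a (φ.symm y) (coordVec φ y i) : ℝ) : 𝕜)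

/-- The components of the acceleration. -/
def accComp (𝕜 : Type*) [RCLike 𝕜] (A : Acceleration n M) (φ : Chart n M)
    (z : Coord n) (i : Fin n) : 𝕜 := ((A.form (φ.symm z.2.1) z.2.2 (coordVec φ z.2.1 i) : ℝ) : 𝕜)

lemma contDiffOn_gComp (r : WeylRep n M p q) (hφ : φ ∈ charts n M) (i j : Fin n) :
    ContDiffOn ℝ ∞ (fun w : ℝ × Model n => gComp 𝕜 r φ w.2 i j) (baseSet (targetOpens φ)) :=
  (RCLike.ofRealCLM (K := 𝕜)).contDiff.comp_contDiffOn
    ((r.smooth_g φ hφ i j).comp contDiff_snd.contDiffOn fun _ h => h.2)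

/-- The metric as a matrix of smooth functions of `(t, x)`. -/
def gMat (𝕜 : Type*) [RCLike 𝕜] (r : WeylRep n M p q) (hφ : φ ∈ charts n M) :
    BaseMat n (SmoothFun 𝕜 (baseSet (targetOpens φ))) :=
  Matrix.of fun i j => SmoothFun.mk _ (contDiffOn_gComp r hφ i j)

lemma rep_gMat (r : WeylRep n M p q) (hφ : φ ∈ charts n M) (i j : Fin n) :
    (gMat 𝕜 r hφ i j).Rep fun w => gComp 𝕜 r φ w.2 i j :=
  SmoothFun.rep_mk _ (contDiffOn_gComp r hφ i j)

lemma det_gComp (r : WeylRep n M p q) (hφ : φ ∈ charts n M) {y : Model n} (hy : y ∈ φ.target) :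
    (gComp 𝕜 r φ y).det ≠ 0 := by
  have h := (r.signature (φ.symm y)).det_ne_zero (coordBasis hφ hy)
  simp only [coordBasis_apply] at h
  have e : gComp 𝕜 r φ y = (RCLike.ofRealAm (K := 𝕜)).toRingHom.mapMatrix
      (Matrix.of fun i j => r.g (φ.symm y) (coordVec φ y i) (coordVec φ y j)) := by
    ext i j; rfl
  rw [e, ← RingHom.map_det]
  exact fun h0 => h (RCLike.ofReal_eq_zero.mp h0)

lemma exists_gMat_inv (r : WeylRep n M p q) (hφ : φ ∈ charts n M) :
    ∃ gi : BaseMat n (SmoothFun 𝕜 (baseSet (targetOpens φ))), gMat 𝕜 r hφ * gi = 1 ∧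
      ∀ i j, (gi i j).Rep fun w => (gComp 𝕜 r φ w.2)⁻¹ i j :=
  exists_matrix_inverse (rep_gMat r hφ) fun _ hz => det_gComp r hφ hz.2

lemma comps_homogeneous {D : Set (ℝ × M × ℝ)} {G : AmbForm 𝕜 n M} (hG : HomogeneousOn D G)
    {z : Coord n} (hz : z ∈ chartDomain φ D) {s : ℝ} (hs : 0 < s) (I J : Idx n) :
    comps φ G (s * z.1, z.2) I J = (s : 𝕜) ^ (weight I + weight J) * comps φ G z I J := by
  have hI : ∀ I : Idx n, ((s * (ambVec φ z I).1, (ambVec φ z I).2.1, (ambVec φ z I).2.2) :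
      AmbTan n (ambPoint φ (s * z.1, z.2))) = s ^ (1 - weight I) • ambVec φ (s * z.1, z.2) I := by
    intro I
    rcases I with _ | i | _
    · simp [ambVec, weight]; rfl
    · simp [ambVec, weight]
    · simp [ambVec, weight]; rfl
  have h := hG s hs z.1 (φ.symm z.2.1) z.2.2 hz.2 (ambVec φ z I).1 (ambVec φ z J).1
    (ambVec φ z I).2.2 (ambVec φ z J).2.2 (ambVec φ z I).2.1 (ambVec φ z J).2.1
  have h2 := congrArg₂ (fun v w => G (ambPoint φ (s * z.1, z.2)) v w) (hI I) (hI J)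
  rw [LinearMap.map_smul₂, map_smul, RCLike.real_smul_eq_coe_mul, RCLike.real_smul_eq_coe_mul] at h2
  have h3 : ((s ^ (1 - weight I) : ℝ) : 𝕜) * (((s ^ (1 - weight J) : ℝ) : 𝕜)
      * comps φ G (s * z.1, z.2) I J) = (s : 𝕜) ^ 2 * comps φ G z I J := h2.symm.trans h
  have hs' : (s : 𝕜) ≠ 0 := by simpa using hs.ne'
  have hw : ∀ I : Idx n, weight I = 0 ∨ weight I = 1 := fun I => by
    rcases I with _ | _ <;> simp [weight]
  push_cast at h3
  rcases hw I with e | e <;> rcases hw J with e' | e' <;> rw [e, e'] at h3 ⊢ <;>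
    simp only [Nat.sub_zero, Nat.sub_self, pow_zero, pow_one, one_mul, add_zero, zero_add] at h3 ⊢
  · exact mul_left_cancel₀ (mul_ne_zero hs' hs') (by linear_combination h3)
  · exact mul_left_cancel₀ hs' (by linear_combination h3)
  · exact mul_left_cancel₀ hs' (by linear_combination h3)
  · linear_combination h3

/-- The components of a metric in Weyl-normal form. -/
lemma IsWeylNormal.isChartNormal {r : WeylRep n M p q} {A : Acceleration n M}
    {D : Set (ℝ × M × ℝ)} {G : AmbForm 𝕜 n M} {f : ℝ × M × ℝ → 𝕜} (hN : IsWeylNormal r A D G)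
    (hφ : φ ∈ charts n M) (hD : IsAmbientDomain D) (hsm : SmoothOn D G)
    (hs : ∀ z ∈ D, ∀ v w, G z v w = G z w v)
    (hdet : ∀ z ∈ chartDomain φ D, (comps φ G z).det ≠ 0) (hhom : HomogeneousOn D G)
    (hf : ContDiffOn ℝ ∞ (fun z => f (ambPoint φ z)) (chartDomain φ D)) (hf0 : ∀ z ∈ D, f z ≠ 0)
    (hfh : ∀ s : ℝ, 0 < s → ∀ z ∈ D, f (s * z.1, z.2) = (s : 𝕜) * f z)
    (hft : ∀ t : ℝ, 0 < t → ∀ x : M, f (t, x, 0) = (t : 𝕜)) {Ω : Opens (Coord n)}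
    (hΩ : ∀ z ∈ Ω, z ∈ chartDomain φ D) :
    IsChartNormal (targetOpens φ) Ω (comps φ G) (fun z => f (ambPoint φ z)) (gComp 𝕜 r φ)
      (aComp 𝕜 r φ) (accComp 𝕜 A φ) := by
  have init := fun (p : ℝ × Model n) (hp : p ∈ baseSet (targetOpens φ)) =>
    hN.initial p.1 hp.1 (φ.symm p.2)
  have ne : ∀ p ∈ baseSet (targetOpens φ), (p.1 : ℝ) ≠ 0 :=
    fun p hp => (show 0 < p.1 from hp.1).ne'
  refine ⟨fun z hz => hD.pos _ (hΩ z hz).2, fun I J => (hsm φ hφ I J).mono hΩ, hf.mono hΩ,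
    fun z hz I J => hs _ (hΩ z hz).2 _ _, fun z hz => hdet z (hΩ z hz),
    fun z hz => hf0 _ (hΩ z hz).2, fun z hz s hs I J => comps_homogeneous hhom (hΩ z hz) hs I J,
    fun z hz s hs => hfh s hs _ (hΩ z hz).2, fun p hp => hft p.1 hp.1 _, fun p hp => ?_,
    fun p hp i => ?_, fun p hp => ?_, fun p hp i j => ?_, fun p hp i => ?_, fun p hp => ?_,
    fun z hz => ?_, fun z hz i => ?_, fun z hz => hN.accel_U φ hφ z (hΩ z hz)⟩
  · exact (init p hp 1 1 0 0 0 0).trans (by simp)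
  · exact (init p hp 1 0 0 0 0 (coordVec φ p.2 i)).trans (by simp)
  · refine (init p hp 1 0 0 1 0 0).trans ?_
    have := ne p hp
    congr 1
    simp; field_simp
  · refine (init p hp 0 0 0 0 (coordVec φ p.2 i) (coordVec φ p.2 j)).trans ?_
    simp [gComp]
  · refine (init p hp 0 0 0 1 (coordVec φ p.2 i) 0).trans ?_
    simp [aComp]
  · exact (init p hp 0 0 1 1 0 0).trans (by simp)
  · have := hN.accel_T φ hφ z (hΩ z hz)
    exact (mul_eq_zero.mp this).resolve_left 
      (RCLike.ofReal_ne_zero.mpr (hD.pos _ (hΩ z hz).2).ne')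
  · rw [hN.accel_M φ hφ z (hΩ z hz) i, accComp]
    push_cast; rfl

lemma liesOver_chart {D₁ D₂ : Set (ℝ × M × ℝ)} (h₁ : IsAmbientDomain D₁) (h₂ : IsAmbientDomain D₂) :
    LiesOver (targetOpens φ) (chartOpens φ h₁.isOpen ⊓ chartOpens φ h₂.isOpen) := fun p hp =>
  ⟨⟨hp.2, h₁.zero_mem p.1 hp.1 _⟩, ⟨hp.2, h₂.zero_mem p.1 hp.1 _⟩⟩

lemma formalRicci_natCast (G : Coord n → AmbMat n 𝕜) (f : Coord n → 𝕜) (I J : Idx n) :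
    formalRicci (n : 𝕜) G f I J = ricci G I J := by
  funext z; simp [formalRicci]

variable {r : WeylRep n M p q} {A : Acceleration n M} {D₁ D₂ : Set (ℝ × M × ℝ)}

theorem agree_of_formal {G₁ G₂ : AmbForm 𝕜 n M} {f₁ f₂ : ℝ × M × ℝ → 𝕜} {d : 𝕜} (hd1 : d ≠ 1)
    (hd : ∀ m : ℕ, d ≠ 2 * m) (h₁ : IsFormalWeylAmbient r d D₁ G₁ f₁) (hN₁ : IsWeylNormal r A D₁ G₁)
    (h₂ : IsFormalWeylAmbient r d D₂ G₂ f₂) (hN₂ : IsWeylNormal r A D₂ G₂) :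
    AgreeToInfiniteOrder G₁ G₂ ∧ AgreeToInfiniteOrderFlat (n := n) f₁ f₂ := by
  have key : ∀ φ ∈ charts n M, ∀ p ∈ baseSet (targetOpens φ),
      (∀ I J, VanishesToInfiniteOrder (fun z => comps φ G₁ z I J - comps φ G₂ z I J)
        (p.1, p.2, 0)) ∧
      VanishesToInfiniteOrder (fun z => f₁ (ambPoint φ z) - f₂ (ambPoint φ z)) (p.1, p.2, 0) := by
    intro φ hφ
    obtain ⟨gi, hgi, -⟩ := exists_gMat_inv (𝕜 := 𝕜) r hφ
    refine (hN₁.isChartNormal hφ h₁.domain h₁.smooth h₁.symm (h₁.nondegenerate φ hφ) h₁.homogeneous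
      (h₁.smooth_flat φ hφ) h₁.nondegenerate_flat h₁.homogeneous_flat h₁.tautological_flat
      (Ω := chartOpens φ h₁.domain.isOpen ⊓ chartOpens φ h₂.domain.isOpen) fun z hz => hz.1).unique
      (liesOver_chart h₁.domain h₂.domain) (rep_gMat r hφ) hgi
      (hN₂.isChartNormal hφ h₂.domain h₂.smooth h₂.symm (h₂.nondegenerate φ hφ) h₂.homogeneous
      (h₂.smooth_flat φ hφ) h₂.nondegenerate_flat h₂.homogeneous_flat h₂.tautological_flat
      fun z hz => hz.2) hd1 hd (fun I J p hp => h₁.ricciFlat φ hφ _ hp.1 _ hp.2 I J)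
      (fun I J p hp => h₂.ricciFlat φ hφ _ hp.1 _ hp.2 I J)
      (Or.inl fun p hp => ⟨h₁.ricciFlat_flat φ hφ _ hp.1 _ hp.2,
        h₂.ricciFlat_flat φ hφ _ hp.1 _ hp.2⟩)
  exact ⟨fun φ hφ t ht y hy I J => (key φ hφ (t, y) ⟨ht, hy⟩).1 I J,
    fun φ hφ t ht y hy => (key φ hφ (t, y) ⟨ht, hy⟩).2⟩

lemma det_comps_of_signature {G : AmbForm ℝ n M} {D : Set (ℝ × M × ℝ)} {p q : ℕ}
    (h : ∀ z ∈ D, HasSignature (G z) p q) (hφ : φ ∈ charts n M) :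
    ∀ z ∈ chartDomain φ D, (comps φ G z).det ≠ 0 := fun z hz => by
  have := (h _ hz.2).det_ne_zero (ambBasis hφ hz.1)
  simp only [ambBasis_apply] at this
  exact this

theorem agree_of_ambient {G₁ G₂ : AmbForm ℝ n M} (hn : Odd n) (hn3 : 3 ≤ n)
    (h₁ : IsWeylAmbient r D₁ G₁) (hN₁ : IsWeylNormal r A D₁ G₁)
    (h₂ : IsWeylAmbient r D₂ G₂) (hN₂ : IsWeylNormal r A D₂ G₂) : AgreeToInfiniteOrder G₁ G₂ := by
  intro φ hφ t ht y hy I J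
  obtain ⟨gi, hgi, -⟩ := exists_gMat_inv (𝕜 := ℝ) r hφ
  have fl : ContDiff ℝ ∞ fun z : Coord n => z.1 := contDiff_fst
  have c₁ := hN₁.isChartNormal (f := fun z => z.1) hφ h₁.domain h₁.smooth
    (fun z hz => (h₁.signature z hz).symm) (det_comps_of_signature h₁.signature hφ) h₁.homogeneous
    fl.contDiffOn (fun z hz => (h₁.domain.pos z hz).ne') (fun _ _ _ _ => rfl) (fun _ _ _ => rfl)
    (Ω := chartOpens φ h₁.domain.isOpen ⊓ chartOpens φ h₂.domain.isOpen) fun z hz => hz.1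
  have c₂ := hN₂.isChartNormal (f := fun z => z.1) hφ h₂.domain h₂.smooth
    (fun z hz => (h₂.signature z hz).symm) (det_comps_of_signature h₂.signature hφ) h₂.homogeneous
    fl.contDiffOn (fun z hz => (h₂.domain.pos z hz).ne') (fun _ _ _ _ => rfl) (fun _ _ _ => rfl)
    (Ω := chartOpens φ h₁.domain.isOpen ⊓ chartOpens φ h₂.domain.isOpen) fun z hz => hz.2
  refine (c₁.unique (liesOver_chart h₁.domain h₂.domain) (rep_gMat r hφ) hgi c₂ (d := (n : ℝ)) ?_ ?_
    (fun I J p hp => ?_) (fun I J p hp => ?_) (Or.inr ⟨rfl, rfl⟩) (t, y) ⟨ht, hy⟩).1 I J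
  · exact_mod_cast (by omega : n ≠ 1)
  · intro m h
    have : n = 2 * m := by exact_mod_cast h
    obtain ⟨k, hk⟩ := hn
    omega
  · rw [formalRicci_natCast]; exact h₁.ricciFlat φ hφ _ hp.1 _ hp.2 I J
  · rw [formalRicci_natCast]; exact h₂.ricciFlat φ hφ _ hp.1 _ hp.2 I J

end Uniqueness

end

section

/-! ### Integrals depending smoothly on parameters -/

section Integral

universe u

variable {E : Type u} [NormedAddCommGroup E] [NormedSpace ℝ E]

lemma aestronglyMeasurable_unitInterval {F : Type*} [NormedAddCommGroup F] {K : ℝ → F}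
    (hK : ContinuousOn K (Set.Icc 0 1)) : MeasureTheory.AEStronglyMeasurable K
      (MeasureTheory.volume.restrict (Set.uIoc (0 : ℝ) 1)) := by
  rw [Set.uIoc_of_le zero_le_one]
  exact (hK.mono Set.Ioc_subset_Icc_self).aestronglyMeasurable measurableSet_Ioc

lemma hasFDerivAt_unitInterval_integral {F : Type*} [NormedAddCommGroup F] [NormedSpace ℝ F]
    {H : E × ℝ → F} {O : Set (E × ℝ)} (hO : IsOpen O) (hH : ContDiffOn ℝ ∞ H O) {x₀ : E}
    (hx : ∀ s ∈ Set.Icc (0 : ℝ) 1, (x₀, s) ∈ O) :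
    HasFDerivAt (fun x => ∫ s in (0 : ℝ)..1, H (x, s))
      (∫ s in (0 : ℝ)..1, (fderiv ℝ H (x₀, s)).comp (ContinuousLinearMap.inl ℝ E ℝ)) x₀ := by
  have hd : ContinuousOn (fun p => (fderiv ℝ H p).comp (ContinuousLinearMap.inl ℝ E ℝ)) O :=
    ((hH.continuousOn_fderiv_of_isOpen hO (by simp)).clm_comp continuousOn_const)
  have hm : ∀ x : E, Continuous fun s : ℝ => (x, s) := fun x => by fun_prop
  obtain ⟨c, hc⟩ := isCompact_Icc.exists_bound_of_continuousOn
    (hd.comp (hm x₀).continuousOn hx)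
  have ev : ∀ᶠ x in nhds x₀, ∀ s ∈ Set.Icc (0 : ℝ) 1, (x, s) ∈ O ∧
      ‖(fderiv ℝ H (x, s)).comp (ContinuousLinearMap.inl ℝ E ℝ)‖ < c + 1 := by
    refine isCompact_Icc.eventually_forall_of_forall_eventually fun s hs => ?_
    have hO' := hO.mem_nhds (hx s hs)
    refine Filter.Eventually.and hO' ?_
    have h1 := (hd.continuousAt hO').norm
    exact h1.eventually (gt_mem_nhds (lt_of_le_of_lt (hc s hs) (lt_add_one c)))
  have hcont : ∀ x, (∀ s ∈ Set.Icc (0 : ℝ) 1, (x, s) ∈ O) →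
      ContinuousOn (fun s => H (x, s)) (Set.Icc 0 1) := fun x h =>
    hH.continuousOn.comp (hm x).continuousOn h
  have hsub : ∀ {s : ℝ}, s ∈ Set.uIoc (0 : ℝ) 1 → s ∈ Set.Icc (0 : ℝ) 1 := fun hs => by
    rw [Set.uIoc_of_le zero_le_one] at hs; exact Set.Ioc_subset_Icc_self hs
  refine intervalIntegral.hasFDerivAt_integral_of_dominated_of_fderiv_le (bound := fun _ => c + 1)
    (F' := fun x s => (fderiv ℝ H (x, s)).comp (ContinuousLinearMap.inl ℝ E ℝ)) ev
    (ev.mono fun x h => aestronglyMeasurable_unitInterval (hcont x fun s hs => (h s hs).1)) ?_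
    (aestronglyMeasurable_unitInterval (hd.comp (hm x₀).continuousOn hx)) ?_ intervalIntegrable_const ?_
  · refine ContinuousOn.intervalIntegrable ?_
    rw [Set.uIcc_of_le zero_le_one]
    exact hcont x₀ hx
  · exact Filter.Eventually.of_forall fun s hs x h => (h s (hsub hs)).2.le
  · refine Filter.Eventually.of_forall fun s hs x h => ?_
    have hxs := (h s (hsub hs)).1
    have h1 : HasFDerivAt H (fderiv ℝ H (x, s)) (x, s) :=
      ((hH.contDiffAt (hO.mem_nhds hxs)).differentiableAt (by simp)).hasFDerivAt
    have h2 : HasFDerivAt (fun x : E => (x, s)) (ContinuousLinearMap.inl ℝ E ℝ) x :=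
      hasFDerivAt_prodMk_left x s
    exact h1.comp x h2

lemma contDiffOn_unitInterval_integral (N : ℕ) :
    ∀ {F : Type u} [NormedAddCommGroup F] [NormedSpace ℝ F] {H : E × ℝ → F} {O : Set (E × ℝ)}
      {U : Set E}, IsOpen O → ContDiffOn ℝ ∞ H O → IsOpen U →
      (∀ x ∈ U, ∀ s ∈ Set.Icc (0 : ℝ) 1, (x, s) ∈ O) →
      ContDiffOn ℝ N (fun x => ∫ s in (0 : ℝ)..1, H (x, s)) U := by
  induction N with
  | zero =>
    intro F _ _ H O U hO hH hU h
    exact contDiffOn_zero.mpr fun x hx =>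
      (hasFDerivAt_unitInterval_integral hO hH (h x hx)).continuousAt.continuousWithinAt
  | succ N ih =>
    intro F _ _ H O U hO hH hU h
    have key := fun x hx => hasFDerivAt_unitInterval_integral hO hH (h x hx)
    push_cast
    rw [contDiffOn_succ_iff_fderiv_of_isOpen hU]
    refine ⟨fun x hx => (key x hx).differentiableAt.differentiableWithinAt, by simp, ?_⟩
    refine ContDiffOn.congr (ih hO (H := fun p => (fderiv ℝ H p).comp
      (ContinuousLinearMap.inl ℝ E ℝ)) ?_ hU h) fun x hx => (key x hx).fderiv
    exact (hH.fderiv_of_isOpen hO (by simp)).clm_comp contDiffOn_const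

end Integral

/-! ### Star-shaped neighbourhoods -/

section Star

variable {M : Type*} [TopologicalSpace M]

/-- The points `(x, ρ)` such that the segment from `(x, 0)` to `(x, ρ)` lies in `S`. -/
def star (S : Set (M × ℝ)) : Set (M × ℝ) := {w | ∀ s ∈ Set.Icc (0 : ℝ) 1, (w.1, s * w.2) ∈ S}

lemma isOpen_star {S : Set (M × ℝ)} (hS : IsOpen S) : IsOpen (star S) := by
  rw [isOpen_iff_eventually]
  intro w hw
  refine isCompact_Icc.eventually_forall_of_forall_eventually fun s hs => ?_
  have hc : Continuous fun p : (M × ℝ) × ℝ => (p.1.1, p.2 * p.1.2) := by fun_prop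
  exact hc.continuousAt.preimage_mem_nhds (hS.mem_nhds (hw s hs))

lemma star_subset {S : Set (M × ℝ)} {w : M × ℝ} (hw : w ∈ star S) : w ∈ S := by
  simpa using hw 1 (by simp)

lemma zero_mem_star {S : Set (M × ℝ)} {x : M} (hx : (x, 0) ∈ S) : (x, (0 : ℝ)) ∈ star S :=
  fun s _ => by simpa using hx

lemma smul_mem_star {S : Set (M × ℝ)} {w : M × ℝ} (hw : w ∈ star S) {s : ℝ}
    (hs : s ∈ Set.Icc (0 : ℝ) 1) : (w.1, s * w.2) ∈ star S := fun s' hs' => by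
  rw [← mul_assoc]
  exact hw _ ⟨mul_nonneg hs'.1 hs.1, mul_le_one₀ hs'.2 hs.1 hs.2⟩

lemma ordConnected_star (S : Set (M × ℝ)) (x : M) : {ρ : ℝ | (x, ρ) ∈ star S}.OrdConnected := by
  have key : ∀ {ρ c : ℝ}, (x, ρ) ∈ star S → 0 ≤ c * ρ → |c| ≤ |ρ| → (x, c) ∈ star S := by
    intro ρ c h h0 hle
    rcases eq_or_ne ρ 0 with rfl | hρ
    · obtain rfl : c = 0 := by simpa using hle
      exact h
    · have hs : c / ρ ∈ Set.Icc (0 : ℝ) 1 := by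
        have e : c / ρ = c * ρ / ρ ^ 2 := by field_simp
        refine ⟨e ▸ div_nonneg h0 (sq_nonneg ρ), (le_abs_self _).trans ?_⟩
        rw [abs_div]
        exact div_le_one_of_le₀ hle (abs_nonneg _)
      simpa [div_mul_cancel₀ _ hρ] using smul_mem_star h hs
  refine ⟨fun a ha b hb c hc => ?_⟩
  rcases le_total 0 c with h | h
  · have hb0 := h.trans hc.2
    exact key hb (mul_nonneg h hb0) (by rw [abs_of_nonneg h, abs_of_nonneg hb0]; exact hc.2)
  · have ha0 := hc.1.trans h
    exact key ha (mul_nonneg_of_nonpos_of_nonpos h ha0)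
      (by rw [abs_of_nonpos h, abs_of_nonpos ha0]; exact neg_le_neg hc.1)

end Star

/-! ### The one-forms `a + ∫ ϕ dρ` -/

section Connection

variable {n : ℕ} {M : Type*} [TopologicalSpace M] [ChartedSpace (Model n) M] {p q : ℕ}
  {φ : Chart n M}

/-- The mean of the one-forms `ϕ(x, r)` for `r` between `0` and `ρ`. -/
def meanForm (A : Acceleration n M) (x : M) (ρ : ℝ) : Tan n x →ₗ[ℝ] ℝ :=
  (Module.finBasis ℝ (Tan n x)).constr ℝ
    fun i => ∫ s in (0 : ℝ)..1, A.form x (s * ρ) (Module.finBasis ℝ (Tan n x) i)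

/-- The one-forms `a + ∫_0^ρ ϕ dρ`. -/
def connForm (r : WeylRep n M p q) (A : Acceleration n M) (x : M) (ρ : ℝ) : Tan n x →ₗ[ℝ] ℝ :=
  r.a x + ρ • meanForm A x ρ

/-- The coordinates of a subset of `M × ℝ`. -/
def chartSet (φ : Chart n M) (S : Set (M × ℝ)) : Set (Model n × ℝ) :=
  {w | w.1 ∈ φ.target ∧ (φ.symm w.1, w.2) ∈ S}

lemma isOpen_chartSet (φ : Chart n M) {S : Set (M × ℝ)} (hS : IsOpen S) :
    IsOpen (chartSet φ S) := by
  have h1 : IsOpen {w : Model n × ℝ | w.1 ∈ φ.target} := φ.open_target.preimage continuous_fst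
  exact ((φ.continuousOn_symm.comp continuousOn_fst fun _ h => h).prodMk
    continuousOn_snd).isOpen_inter_preimage h1 hS

lemma constr_integral {V : Type*} [AddCommGroup V] [Module ℝ V] {ι κ : Type*} [Fintype ι] [Fintype κ]
    (b : Module.Basis ι ℝ V) (b' : Module.Basis κ ℝ V) {L : ℝ → V →ₗ[ℝ] ℝ}
    (hL : ∀ i, IntervalIntegrable (fun s => L s (b i)) MeasureTheory.volume 0 1) (v : V) :
    b'.constr ℝ (fun i => ∫ s in (0 : ℝ)..1, L s (b' i)) v = ∫ s in (0 : ℝ)..1, L s v := by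
  have hv : ∀ v, IntervalIntegrable (fun s => L s v) MeasureTheory.volume 0 1 := fun v => by
    have e : (fun s => L s v) = ∑ i, fun s => b.repr v i * L s (b i) := by
      funext s
      conv_lhs => rw [← b.sum_repr v]
      simp only [map_sum, map_smul, smul_eq_mul, Finset.sum_apply]
    rw [e]
    exact IntervalIntegrable.sum _ fun i _ => (hL i).const_mul _
  rw [Module.Basis.constr_apply_fintype]
  have e : (fun s => L s v) = fun s => ∑ i, b'.equivFun v i * L s (b' i) := by
    funext s
    conv_lhs => rw [← b'.sum_equivFun v]
    simp only [map_sum, map_smul, smul_eq_mul]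
  rw [e, intervalIntegral.integral_finsetSum fun i _ => (hv _).const_mul _]
  simp

variable (r : WeylRep n M p q) (A : Acceleration n M) (hφ : φ ∈ charts n M)

include hφ in
lemma connForm_coordVec {w : Model n × ℝ} (hw : w ∈ chartSet φ (star A.dom)) (i : Fin n) :
    connForm r A (φ.symm w.1) w.2 (coordVec φ w.1 i) = r.a (φ.symm w.1) (coordVec φ w.1 i)
      + w.2 * ∫ s in (0 : ℝ)..1, A.form (φ.symm w.1) (s * w.2) (coordVec φ w.1 i) := by
  have h : meanForm A (φ.symm w.1) w.2 (coordVec φ w.1 i)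
      = ∫ s in (0 : ℝ)..1, A.form (φ.symm w.1) (s * w.2) (coordVec φ w.1 i) := by
    refine constr_integral (coordBasis hφ hw.1) _ (fun j => ContinuousOn.intervalIntegrable ?_) _
    rw [Set.uIcc_of_le zero_le_one]
    simp only [coordBasis_apply]
    have hc : Continuous fun s : ℝ => (w.1, s * w.2) := by fun_prop
    exact (A.smooth φ hφ j).continuousOn.comp hc.continuousOn fun s hs => ⟨hw.1, hw.2 s hs⟩
  rw [← h]; rfl

include hφ in
lemma contDiffOn_connForm (i : Fin n) :
    ContDiffOn ℝ ∞ (fun w : Model n × ℝ => connForm r A (φ.symm w.1) w.2 (coordVec φ w.1 i))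
      (chartSet φ (star A.dom)) := by
  refine ContDiffOn.congr ?_ fun w hw => connForm_coordVec r A hφ hw i
  refine ((r.smooth_a φ hφ i).comp contDiffOn_fst fun w hw => hw.1).add (contDiffOn_snd.mul ?_)
  refine contDiffOn_infty.mpr fun N => ?_
  have hm : ContDiff ℝ ∞ fun p : (Model n × ℝ) × ℝ => (p.1.1, p.2 * p.1.2) := by fun_prop
  exact contDiffOn_unitInterval_integral N
    (O := (fun p : (Model n × ℝ) × ℝ => (p.1.1, p.2 * p.1.2)) ⁻¹' chartSet φ A.dom)
    (H := fun p => A.form (φ.symm p.1.1) (p.2 * p.1.2) (coordVec φ p.1.1 i))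
    ((isOpen_chartSet φ A.isOpen_dom).preimage hm.continuous)
    ((A.smooth φ hφ i).comp hm.contDiffOn fun _ h => h)
    (isOpen_chartSet φ (isOpen_star A.isOpen_dom)) fun w hw s hs => ⟨hw.1, hw.2 s hs⟩

include hφ in
lemma hasDerivAt_connForm {w : Model n × ℝ} (hw : w ∈ chartSet φ (star A.dom)) (i : Fin n) :
    HasDerivAt (fun ρ => connForm r A (φ.symm w.1) ρ (coordVec φ w.1 i))
      (A.form (φ.symm w.1) w.2 (coordVec φ w.1 i)) w.2 := by
  set F : ℝ → ℝ := fun ρ => A.form (φ.symm w.1) ρ (coordVec φ w.1 i) with hF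
  have hc : Continuous fun ρ : ℝ => (w.1, ρ) := by fun_prop
  have hcon : ∀ ρ, (φ.symm w.1, ρ) ∈ A.dom → ContinuousAt F ρ := fun ρ hρ =>
    ContinuousAt.comp (f := fun ρ : ℝ => (w.1, ρ)) (x := ρ)
      ((A.smooth φ hφ i).continuousOn.continuousAt ((isOpen_chartSet φ A.isOpen_dom).mem_nhds
        ⟨hw.1, hρ⟩)) hc.continuousAt
  have hnear : ∀ᶠ ρ in nhds w.2, (w.1, ρ) ∈ chartSet φ (star A.dom) :=
    hc.continuousAt.preimage_mem_nhds ((isOpen_chartSet φ (isOpen_star A.isOpen_dom)).mem_nhds hw)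
  have e : (fun ρ => connForm r A (φ.symm w.1) ρ (coordVec φ w.1 i)) =ᶠ[nhds w.2]
      fun ρ => r.a (φ.symm w.1) (coordVec φ w.1 i) + ∫ s in (0 : ℝ)..ρ, F s := by
    filter_upwards [hnear] with ρ hρ
    rw [connForm_coordVec r A hφ (w := (w.1, ρ)) hρ]
    congr 1
    have := intervalIntegral.mul_integral_comp_mul_right (a := 0) (b := 1) (f := F) ρ
    rwa [zero_mul, one_mul] at this
  refine HasDerivAt.congr_of_eventuallyEq ?_ e
  refine HasDerivAt.const_add _ (intervalIntegral.integral_hasDerivAt_right ?_ ?_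
    (hcon _ (star_subset hw.2)))
  · refine ContinuousOn.intervalIntegrable fun ρ hρ => ContinuousAt.continuousWithinAt (hcon ρ ?_)
    have hm := (ordConnected_star A.dom (φ.symm w.1)).uIcc_subset
      (zero_mem_star (A.zero_mem _)) hw.2 hρ
    exact star_subset hm
  · have ho : IsOpen {ρ | (φ.symm w.1, ρ) ∈ A.dom} := A.isOpen_dom.preimage (by fun_prop)
    exact ContinuousOn.stronglyMeasurableAtFilter ho
      (fun ρ hρ => (hcon ρ hρ).continuousWithinAt) _ (star_subset hw.2)

end Connection

end

section

/-! ### Smooth functions with prescribed Taylor coefficients -/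

section Borel

variable {E F : Type*} [NormedAddCommGroup E] [NormedSpace ℝ E] [NormedAddCommGroup F]
  [NormedSpace ℝ F]

/-- The dilatation of the second factor of `E × ℝ`. -/
def stretch (E : Type*) [NormedAddCommGroup E] [NormedSpace ℝ E] (c : ℝ) : E × ℝ →L[ℝ] E × ℝ :=
  (ContinuousLinearMap.id ℝ E).prodMap (c • ContinuousLinearMap.id ℝ ℝ)

lemma norm_stretch_le {c : ℝ} (hc : 1 ≤ c) : ‖stretch E c‖ ≤ c := by
  refine ContinuousLinearMap.opNorm_le_bound _ (zero_le_one.trans hc) fun w => ?_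
  have h0 := zero_le_one.trans hc
  rw [Prod.norm_def, Prod.norm_def]
  refine max_le ?_ ?_
  · exact (le_max_left _ _).trans (le_mul_of_one_le_left (by positivity) hc)
  · change ‖c * w.2‖ ≤ _
    rw [norm_mul, Real.norm_of_nonneg h0]
    exact mul_le_mul_of_nonneg_left (le_max_right _ _) h0

/-- The cut-off function. -/
def cutoff : ContDiffBump (0 : ℝ) := ⟨1, 2, one_pos, one_lt_two⟩

/-- The cut-off monomial `r ^ m f(x)`. -/
def cutMonomial (f : E → F) (m : ℕ) (w : E × ℝ) : F := (w.2 ^ m * cutoff w.2) • f w.1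

lemma contDiff_cutMonomial {f : E → F} (hf : ContDiff ℝ ∞ f) (m : ℕ) :
    ContDiff ℝ ∞ (cutMonomial f m) :=
  ((contDiff_snd.pow m).mul (cutoff.contDiff.comp contDiff_snd)).smul (hf.comp contDiff_fst)

lemma hasCompactSupport_cutMonomial {f : E → F} (hf : HasCompactSupport f) (m : ℕ) :
    HasCompactSupport (cutMonomial f m) := by
  refine HasCompactSupport.intro (hf.prod cutoff.hasCompactSupport) fun w hw => ?_
  rw [Set.mem_prod, not_and_or] at hw
  rcases hw with hw | hw
  · rw [cutMonomial, image_eq_zero_of_notMem_tsupport hw, smul_zero]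
  · rw [cutMonomial, image_eq_zero_of_notMem_tsupport hw, mul_zero, zero_smul]

lemma exists_bound_cutMonomial {f : E → F} (hf : ContDiff ℝ ∞ f) (hs : HasCompactSupport f) (m k : ℕ) :
    ∃ C, ∀ w, ‖iteratedFDeriv ℝ k (cutMonomial f m) w‖ ≤ C :=
  ((hasCompactSupport_cutMonomial hs m).iteratedFDeriv (𝕜 := ℝ) k).exists_bound_of_continuous
    ((contDiff_cutMonomial hf m).continuous_iteratedFDeriv (WithTop.coe_le_coe.mpr le_top))

/-- The rescaled cut-off monomial. -/
def borelTerm (f : E → F) (m : ℕ) (c : ℝ) (w : E × ℝ) : F :=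
  (c⁻¹ ^ m) • cutMonomial f m (stretch E c w)

lemma contDiff_borelTerm {f : E → F} (hf : ContDiff ℝ ∞ f) (m : ℕ) (c : ℝ) :
    ContDiff ℝ ∞ (borelTerm f m c) :=
  contDiff_const.smul ((contDiff_cutMonomial hf m).comp (stretch E c).contDiff)

lemma norm_iteratedFDeriv_borelTerm {f : E → F} (hf : ContDiff ℝ ∞ f) {m k : ℕ} {c C : ℝ}
    (hc : 1 ≤ c) (hC : ∀ w, ‖iteratedFDeriv ℝ k (cutMonomial f m) w‖ ≤ C) (w : E × ℝ) :
    ‖iteratedFDeriv ℝ k (borelTerm f m c) w‖ ≤ c⁻¹ ^ m * (C * c ^ k) := by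
  have h0 := zero_le_one.trans hc
  have hk : (k : WithTop ℕ∞) ≤ ∞ := WithTop.coe_le_coe.mpr le_top
  have hcd := (contDiff_cutMonomial hf m).comp (stretch E c).contDiff
  have e : borelTerm f m c = (c⁻¹ ^ m) • (cutMonomial f m ∘ stretch E c) := rfl
  rw [e, iteratedFDeriv_const_smul_apply ((hcd.of_le hk).contDiffAt), norm_smul,
    Real.norm_of_nonneg (by positivity),
    (stretch E c).iteratedFDeriv_comp_right (contDiff_cutMonomial hf m) w hk]
  refine mul_le_mul_of_nonneg_left ?_ (by positivity)
  refine (ContinuousMultilinearMap.norm_compContinuousLinearMap_le _ _).trans ?_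
  rw [Finset.prod_const, Finset.card_univ, Fintype.card_fin]
  exact mul_le_mul (hC _) (pow_le_pow_left₀ (norm_nonneg _) (norm_stretch_le hc) k) (by positivity)
    ((norm_nonneg _).trans (hC w))

lemma iteratedDeriv_comp_prodMk {f : E × ℝ → F} (hf : ContDiff ℝ ∞ f) (k : ℕ) (x : E) :
    iteratedDeriv k (fun ρ => f (x, ρ)) 0 = iteratedFDeriv ℝ k f (x, 0) fun _ => (0, 1) := by
  have e : (fun ρ : ℝ => f (x, ρ))
      = (fun w => f ((x, 0) + w)) ∘ ContinuousLinearMap.inr ℝ E ℝ := by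
    funext ρ; simp
  have hf' : ContDiff ℝ ∞ fun w => f ((x, 0) + w) := hf.comp (contDiff_const.add contDiff_id)
  rw [iteratedDeriv_eq_iteratedFDeriv, e,
    (ContinuousLinearMap.inr ℝ E ℝ).iteratedFDeriv_comp_right hf' 0 (WithTop.coe_le_coe.mpr le_top),
    iteratedFDeriv_comp_add_left]
  simp

lemma iteratedDeriv_borelTerm (f : E → F) (m k : ℕ) {c : ℝ} (hc : 1 ≤ c) (x : E) :
    iteratedDeriv k (fun ρ => borelTerm f m c (x, ρ)) 0
      = if k = m then (m.factorial : ℝ) • f x else 0 := by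
  have hc0 : c ≠ 0 := (zero_lt_one.trans_le hc).ne'
  have e : (fun ρ => borelTerm f m c (x, ρ)) =ᶠ[nhds 0] fun ρ : ℝ => ρ ^ m • f x := by
    have h1 : Filter.Tendsto (fun ρ : ℝ => c * ρ) (nhds 0) (nhds 0) := by
      have : Continuous fun ρ : ℝ => c * ρ := by fun_prop
      simpa using this.tendsto 0
    filter_upwards [h1.eventually cutoff.eventuallyEq_one] with ρ hρ
    change c⁻¹ ^ m • ((c * ρ) ^ m * cutoff (c * ρ)) • f x = _
    rw [hρ, Pi.one_apply, mul_one, smul_smul, ← mul_pow, inv_mul_cancel_left₀ hc0]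
  rw [e.iteratedDeriv_eq, iteratedDeriv_smul_const (by fun_prop), iteratedDeriv_fun_pow_zero]
  split_ifs <;> simp

/-- Borel's lemma with parameters. -/
theorem exists_borel [CompleteSpace F] {f : ℕ → E → F} (hf : ∀ m, ContDiff ℝ ∞ (f m))
    (hs : ∀ m, HasCompactSupport (f m)) :
    ∃ H : E × ℝ → F, ContDiff ℝ ∞ H ∧
      (∀ x m, iteratedDeriv m (fun ρ => H (x, ρ)) 0 = (m.factorial : ℝ) • f m x) ∧
      ∀ x, (∀ m, f m x = 0) → ∀ ρ, H (x, ρ) = 0 := by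
  choose C hC using fun m k => exists_bound_cutMonomial (hf m) (hs m) m k
  set c : ℕ → ℝ := fun m => 1 + 2 ^ m * ∑ k ∈ Finset.range m, |C m k| with hcdef
  have hc : ∀ m, 1 ≤ c m := fun m => le_add_of_nonneg_right
    (mul_nonneg (by positivity) (Finset.sum_nonneg fun _ _ => abs_nonneg _))
  set v : ℕ → ℕ → ℝ := fun k m => (c m)⁻¹ ^ m * (C m k * c m ^ k) with hv
  have hb : ∀ k m w, ‖iteratedFDeriv ℝ k (borelTerm (f m) m (c m)) w‖ ≤ v k m := fun k m w =>
    norm_iteratedFDeriv_borelTerm (hf m) (hc m) (hC m k) w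
  have hsum : ∀ k, Summable (v k) := fun k => by
    refine Summable.of_norm_bounded_eventually_nat summable_geometric_two ?_
    filter_upwards [Filter.eventually_gt_atTop k] with m hm
    have hp : 0 < c m := zero_lt_one.trans_le (hc m)
    have h1 : c m ^ k * c m ≤ c m ^ m := by
      rw [← pow_succ]; exact pow_le_pow_right₀ (hc m) hm
    have h2 : |C m k| * 2 ^ m ≤ c m := by
      have := Finset.single_le_sum (f := fun k => |C m k|) (fun _ _ => abs_nonneg _)
        (Finset.mem_range.mpr hm)
      have := mul_le_mul_of_nonneg_left this (by positivity : (0 : ℝ) ≤ 2 ^ m)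
      rw [hcdef]; simp only at this ⊢; linarith
    rw [hv, Real.norm_eq_abs, abs_mul, abs_mul, abs_of_nonneg (by positivity : 0 ≤ (c m)⁻¹ ^ m),
      abs_of_nonneg (by positivity : 0 ≤ c m ^ k), inv_pow, one_div, inv_pow,
      inv_mul_le_iff₀ (by positivity), ← div_eq_mul_inv, le_div_iff₀ (by positivity)]
    calc |C m k| * c m ^ k * 2 ^ m = c m ^ k * (|C m k| * 2 ^ m) := by ring
      _ ≤ c m ^ k * c m := mul_le_mul_of_nonneg_left h2 (by positivity)
      _ ≤ c m ^ m := h1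
  have hcd : ∀ m, ContDiff ℝ ((⊤ : ℕ∞) : WithTop ℕ∞) (borelTerm (f m) m (c m)) :=
    fun m => contDiff_borelTerm (hf m) m (c m)
  have hH := contDiff_tsum hcd (fun k _ => hsum k) (fun k m w _ => hb k m w)
  refine ⟨_, hH, fun x k => ?_, fun x hx ρ => ?_⟩
  · rw [iteratedDeriv_comp_prodMk hH, iteratedFDeriv_tsum_apply hcd (fun k _ => hsum k)
      (fun k m w _ => hb k m w) le_top]
    have hsm : Summable fun m => iteratedFDeriv ℝ k (borelTerm (f m) m (c m)) (x, 0) :=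
      Summable.of_norm_bounded (hsum k) fun m => hb k m _
    have := (ContinuousMultilinearMap.apply ℝ (fun _ : Fin k => E × ℝ) F
      (fun _ => (0, 1))).map_tsum hsm
    simp only [ContinuousMultilinearMap.apply_apply] at this
    rw [this]
    simp only [← iteratedDeriv_comp_prodMk (hcd _), iteratedDeriv_borelTerm _ _ _ (hc _)]
    rw [tsum_eq_single k fun m hm => if_neg hm.symm, if_pos rfl]
  · change ∑' m, borelTerm (f m) m (c m) (x, ρ) = 0
    have : ∀ m, borelTerm (f m) m (c m) (x, ρ) = 0 := fun m => by
      change (c m)⁻¹ ^ m • ((c m * ρ) ^ m * cutoff (c m * ρ)) • f m x = 0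
      rw [hx, smul_zero, smul_zero]
    simp [this]

end Borel

end

section

/-! ### Formal solutions and changes of coordinates -/

section Formal

variable {𝕜 A A' : Type*} [Field 𝕜] [CharZero 𝕜] [CommRing A] [Algebra 𝕜 A] [CommRing A']
  [Algebra 𝕜 A'] {n : ℕ}

/-- Formal Ricci-flat metrics in Weyl-normal form. -/
structure IsFormalSolution (b : AmbBase 𝕜 A n) (d : 𝕜) (g gi : BaseMat n A)
    (α : Fin n → A⟦X⟧) (q : BaseMat n A⟦X⟧) (u : A⟦X⟧) : Prop where
  seed : IsSeed b g q u
  flat : ∃ Gi Γ v, IsNormalData b g gi (2 * X) 0 q α Gi Γ ∧ b.τ * u * v = 1 ∧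
    (∀ I J, warpedRic b.D Γ (C (algebraMap 𝕜 A (d - n))) v (b.τ * u) I J = 0) ∧
    warpedFlat b.D Gi Γ (C (algebraMap 𝕜 A (d - n))) (b.τ * u) = 0

lemma IsFormalSolution.unique {b : AmbBase 𝕜 A n} {d : 𝕜} {g gi gi' : BaseMat n A}
    {α : Fin n → A⟦X⟧} {q q' : BaseMat n A⟦X⟧} {u u' : A⟦X⟧} (hd1 : d ≠ 1)
    (hd : ∀ m : ℕ, d ≠ 2 * m) (h : IsFormalSolution b d g gi α q u)
    (h' : IsFormalSolution b d g gi' α q' u') : q' = q ∧ u' = u := by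
  obtain ⟨Gi, Γ, v, hn, hv, hE, hS⟩ := h.flat
  obtain ⟨Gi', Γ', v', hn', hv', hE', hS'⟩ := h'.flat
  obtain rfl : gi = gi' := by
    rw [← one_mul gi', ← mul_eq_one_comm.mp hn.g_inv, mul_assoc, hn'.g_inv, mul_one]
  exact normalData_unique hn hn' hd1 hd h.seed.d0_u h.seed.cc_u hv h'.seed.d0_u h'.seed.cc_u hv' hE
    hE' (Or.inl ⟨hS, hS'⟩)

/-- A change of the coordinates `x` with Jacobian matrix `J`. -/
structure IsCoordChange (b : AmbBase 𝕜 A n) (b' : AmbBase 𝕜 A' n) (σ : A →ₐ[𝕜] A')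
    (J Ji : BaseMat n A') : Prop where
  inv : J * Ji = 1
  t : σ b.t = b'.t
  d0 : ∀ x, b'.d0 (σ x) = σ (b.d0 x)
  d : ∀ i x, b'.d i (σ x) = ∑ k, J k i * σ (b.d k x)
  d0_J : ∀ k i, b'.d0 (J k i) = 0
  d_J : ∀ k i j, b'.d i (J k j) = b'.d j (J k i)

/-- The Jacobian matrix in ambient coordinates. -/
def ambJ (J : BaseMat n A') : AmbMat n A'⟦X⟧ :=
  Matrix.of fun I K => match I, K with
  | Sum.inl _, Sum.inl _ => 1
  | Sum.inr (Sum.inl k), Sum.inr (Sum.inl i) => C (J k i)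
  | Sum.inr (Sum.inr _), Sum.inr (Sum.inr _) => 1
  | _, _ => 0

section Entries

variable (J : BaseMat n A') (i k : Fin n)

@[simp] lemma ambJ_00 : ambJ J (idx0 n) (idx0 n) = 1 := rfl
@[simp] lemma ambJ_0M : ambJ J (idx0 n) (idxM i) = 0 := rfl
@[simp] lemma ambJ_0inf : ambJ J (idx0 n) (idxInf n) = 0 := rfl
@[simp] lemma ambJ_M0 : ambJ J (idxM k) (idx0 n) = 0 := rfl
@[simp] lemma ambJ_MM : ambJ J (idxM k) (idxM i) = C (J k i) := rfl
@[simp] lemma ambJ_Minf : ambJ J (idxM k) (idxInf n) = 0 := rfl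
@[simp] lemma ambJ_inf0 : ambJ J (idxInf n) (idx0 n) = 0 := rfl
@[simp] lemma ambJ_infM : ambJ J (idxInf n) (idxM i) = 0 := rfl
@[simp] lemma ambJ_infinf : ambJ J (idxInf n) (idxInf n) = 1 := rfl

end Entries

lemma ambJ_mul {J Ji : BaseMat n A'} (h : J * Ji = 1) : ambJ J * ambJ Ji = 1 := by
  ext1 I K
  rw [Matrix.mul_apply, sum_idx]
  induction I using idx_cases <;> induction K using idx_cases <;> simp [Matrix.one_apply]
  rename_i i j
  have := congrFun (congrFun h i) j
  rw [Matrix.mul_apply, Matrix.one_apply] at this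
  rw [← map_one (C (R := A')), ← map_zero (C (R := A')), ← apply_ite (C (R := A')), ← this, map_sum]
  simp

/-- The transformed metric. -/
def pullQ (σ : A →+* A') (J : BaseMat n A') (q : BaseMat n A⟦X⟧) :
    BaseMat n A'⟦X⟧ :=
  Matrix.of fun i j => ∑ k, ∑ l, C (J k i * J l j) * PowerSeries.map σ (q k l)

/-- The transformed one-form. -/
def pullα (σ : A →+* A') (J : BaseMat n A') (α : Fin n → A⟦X⟧) (i : Fin n) : A'⟦X⟧ :=
  ∑ k, C (J k i) * PowerSeries.map σ (α k)

variable {b : AmbBase 𝕜 A n} {b' : AmbBase 𝕜 A' n} {σ : A →ₐ[𝕜] A'}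
  {J Ji : BaseMat n A'}

lemma IsCoordChange.map_τ (h : IsCoordChange b b' σ J Ji) :
    PowerSeries.map (σ : A →+* A') b.τ = b'.τ := by
  rw [AmbBase.τ, AmbBase.τ, PowerSeries.map_C, ← h.t]; rfl

lemma IsCoordChange.liftD_d0 (h : IsCoordChange b b' σ J Ji) (x : A⟦X⟧) :
    liftD b'.d0 (PowerSeries.map (σ : A →+* A') x) = PowerSeries.map (σ : A →+* A') (liftD b.d0 x) := by
  ext m; simp [h.d0]

lemma IsCoordChange.map_normalG (h : IsCoordChange b b' σ J Ji) (q : BaseMat n A⟦X⟧)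
    (α : Fin n → A⟦X⟧) :
    (ambJ J).transpose * (b.normalG (2 * X) 0 q α).map (PowerSeries.map (σ : A →+* A')) * ambJ J
      = b'.normalG (2 * X) 0 (pullQ (σ : A →+* A') J q) (pullα (σ : A →+* A') J α) := by
  ext1 I K
  simp only [Matrix.mul_apply, Matrix.transpose_apply, Matrix.map_apply, sum_idx]
  induction I using idx_cases <;> induction K using idx_cases <;>
    simp [h.map_τ, pullQ, pullα, mul_sum, sum_mul]
  · rw [map_ofNat]
  · exact sum_swap fun _ _ => by ring
  · exact sum_congr rfl fun _ _ => by ring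
  · exact sum_congr rfl fun _ _ => by ring

/-- Formal solutions can be pulled back. -/
theorem IsFormalSolution.pull (h : IsCoordChange b b' σ J Ji) {d : 𝕜}
    {g gi : BaseMat n A} {α : Fin n → A⟦X⟧} {q : BaseMat n A⟦X⟧} {u : A⟦X⟧}
    (hs : IsFormalSolution b d g gi α q u) :
    IsFormalSolution b' d (J.transpose * g.map σ * J) (Ji * gi.map σ * Ji.transpose)
      (pullα (σ : A →+* A') J α) (pullQ (σ : A →+* A') J q) (PowerSeries.map (σ : A →+* A') u) := by
  obtain ⟨Gi, Γ, v, hn, hv, hE, hS⟩ := hs.flat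
  set σ' := PowerSeries.map (σ : A →+* A') with hσ'
  have hd0J : ∀ k i, liftD b'.d0 (C (J k i)) = 0 := fun k i => by rw [liftD_C, h.d0_J, map_zero]
  have hd0C : ∀ (x : A⟦X⟧) (c : A'), liftD b.d0 x = 0 → b'.d0 c = 0 →
      liftD b'.d0 (C c * σ' x) = 0 := fun x c hx hc => by
    rw [Derivation.leibniz, h.liftD_d0, hx, liftD_C, hc, map_zero, map_zero, smul_zero, smul_zero,
      add_zero]
  have key := warped_natural (D := b.D) (D' := b'.D) (σ := σ') (ambJ_mul h.inv)
    (fun I x => by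
      rw [sum_idx]
      induction I using idx_cases with
      | h0 => simp [hσ', h.liftD_d0]
      | hM i =>
        simp only [ambJ_0M, ambJ_MM, ambJ_infM, zero_mul, zero_add, add_zero, AmbBase.D_M]
        ext m
        simp [hσ', h.d, map_sum]
      | hInf =>
        simp only [ambJ_0inf, ambJ_Minf, ambJ_infinf, zero_mul, sum_const_zero, zero_add,
          one_mul, AmbBase.D_inf]
        ext m; simp [hσ'])
    (fun I A K => by
      induction I using idx_cases <;> induction A using idx_cases <;>
        induction K using idx_cases <;> simp [hd0J, derivX_C, liftD_C, h.d_J])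
    b'.commutes hn.lc hn.inv
  rw [h.map_normalG] at key
  obtain ⟨Gi', Γ', hinv, hlc, hR, hF⟩ := key
  have hκ : C (algebraMap 𝕜 A' (d - n)) = σ' (C (algebraMap 𝕜 A (d - n))) := by
    rw [hσ', PowerSeries.map_C, AlgHom.coe_toRingHom, AlgHom.commutes]
  have hu : b'.τ * σ' u = σ' (b.τ * u) := by rw [map_mul, hσ', h.map_τ]
  have ccσ : ∀ x, constantCoeff (σ' x) = σ (constantCoeff x) := fun x => by
    rw [hσ', ← coeff_zero_eq_constantCoeff_apply, PowerSeries.coeff_map,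
      coeff_zero_eq_constantCoeff_apply]; rfl
  have hcc : ∀ i j, constantCoeff (pullQ (σ : A →+* A') J q i j) = (J.transpose * g.map σ * J) i j := by
    intro i j
    simp only [pullQ, Matrix.of_apply, map_sum, map_mul, constantCoeff_C, ← hσ', ccσ, hs.seed.cc,
      Matrix.mul_apply, Matrix.transpose_apply, Matrix.map_apply, sum_mul]
    exact sum_swap fun _ _ => by ring
  have hd0q : ∀ i j, liftD b'.d0 (pullQ (σ : A →+* A') J q i j) = 0 := fun i j => by
    rw [pullQ, Matrix.of_apply, map_sum]
    refine sum_eq_zero fun k _ => ?_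
    rw [map_sum]
    refine sum_eq_zero fun l _ => hd0C _ _ (hs.seed.d0 k l) ?_
    rw [Derivation.leibniz, h.d0_J, h.d0_J, smul_zero, smul_zero, add_zero]
  have hginv : J.transpose * g.map σ * J * (Ji * gi.map σ * Ji.transpose) = 1 := by
    have e1 : g.map σ * gi.map σ = 1 := by
      rw [← Matrix.map_mul, hn.g_inv, Matrix.map_one _ (map_zero _) (map_one _)]
    have e2 : J.transpose * Ji.transpose = 1 := by
      rw [← Matrix.transpose_mul, mul_eq_one_comm.mp h.inv, Matrix.transpose_one]
    calc _ = J.transpose * (g.map σ * (J * Ji) * gi.map σ) * Ji.transpose := by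
          simp only [Matrix.mul_assoc]
      _ = 1 := by rw [h.inv, mul_one, e1, mul_one, e2]
  refine ⟨⟨fun i j => ?_, hcc, hd0q, ?_, ?_⟩, Gi', Γ', σ' v,
    ⟨hlc, hinv, hginv, by simp, by simp, hcc, ?_, by simp, hd0q, fun i => ?_⟩, ?_, fun I K => ?_, ?_⟩
  · simp only [pullQ, Matrix.of_apply]
    exact sum_swap fun k l => by
      rw [hs.seed.symm l k, mul_comm (J l i)]
  · rw [ccσ, hs.seed.cc_u, map_one]
  · rw [h.liftD_d0, hs.seed.d0_u, map_zero]
  · rw [two_mul, map_add, liftD_X, add_zero]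
  · rw [pullα, map_sum]
    exact sum_eq_zero fun k _ => hd0C _ _ (hn.d0_α k) (h.d0_J _ _)
  · rw [hu, ← map_mul, hv, map_one]
  · rw [hκ, hu, hR]
    simp only [hE, map_zero, mul_zero, sum_const_zero]
  · rw [hκ, hu, hF, hS, map_zero]

end Formal

end

section

/-! ### Changes of charts -/

section CoordChange

variable {n : ℕ} {𝕜 : Type*} [RCLike 𝕜] {V W : Opens (Model n)}

lemma apply_eq_zero_of_hasFDerivAt {E : Type*} [NormedAddCommGroup E] [NormedSpace ℝ E] {F : E → 𝕜}
    {F' : E →L[ℝ] 𝕜} {x v : E} (h : HasFDerivAt F F' x) (hc : ∀ s : ℝ, F (x + s • v) = F x) :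
    F' v = 0 := by
  have h1 : HasDerivAt (fun s : ℝ => F (x + s • v)) (F' v) 0 := h.hasLineDerivAt v
  simp only [hc] at h1
  exact h1.unique (hasDerivAt_const _ _)

lemma base_d0_eq_zero {f : SmoothFun 𝕜 (baseSet V)} {F : Model n → 𝕜} (h : f.Rep fun p => F p.2) :
    (base 𝕜 V).d0 f = 0 :=
  (h.dir (1, 0)).ext SmoothFun.rep_zero fun _ hp =>
    apply_eq_zero_of_hasFDerivAt (h.hasFDerivAt hp) fun s => by simp

lemma rep_eq_of_d0_eq_zero {f : SmoothFun 𝕜 (baseSet V)} (h : (base 𝕜 V).d0 f = 0) {t : ℝ}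
    (ht : 0 < t) {y : Model n} (hy : y ∈ V) : f.rep (t, y) = f.rep (1, y) := by
  have hmem : ∀ s, (Real.exp s, y) ∈ baseSet V := fun s => ⟨Real.exp_pos s, hy⟩
  have hd : ∀ s, HasDerivAt (fun s => f.rep (Real.exp s, y)) 0 s := fun s => by
    have h1 : HasDerivAt (fun s => (Real.exp s, y)) (Real.exp s, (0 : Model n)) s :=
      (Real.hasDerivAt_exp s).prodMk (hasDerivAt_const _ _)
    have h2 := (f.rep_rep.hasFDerivAt (hmem s)).comp_hasDerivAt s h1
    have h3 : fderiv ℝ f.rep (Real.exp s, y) (1, 0) = 0 := by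
      have e := (f.rep_rep.dir (1, 0)).eval (hmem s)
      rw [← e]
      exact (congrArg _ h).trans (map_zero _)
    have h4 : ((Real.exp s, 0) : ℝ × Model n) = Real.exp s • (1, 0) := by simp
    rw [h4, map_smul, h3, smul_zero] at h2
    exact h2
  have := is_const_of_deriv_eq_zero (fun s => (hd s).differentiableAt) (fun s => (hd s).deriv)
    (Real.log t) 0
  simpa [Real.exp_log ht] using this

/-- The `k`-th component of a map as a smooth function. -/
def compFun (𝕜 : Type*) [RCLike 𝕜] {χ : Model n → Model n} (hχ : ContDiffOn ℝ ∞ χ W) (k : Fin n) :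
    SmoothFun 𝕜 (baseSet W) :=
  SmoothFun.mk (fun p => (χ p.2 k : 𝕜)) (((RCLike.ofRealCLM (K := 𝕜)).comp
    (EuclideanSpace.proj k : Model n →L[ℝ] ℝ)).contDiff.comp_contDiffOn
      (hχ.comp contDiffOn_snd fun _ h => h.2))

lemma rep_compFun {χ : Model n → Model n} (hχ : ContDiffOn ℝ ∞ χ W) (k : Fin n) :
    (compFun 𝕜 hχ k).Rep fun p => (χ p.2 k : 𝕜) := SmoothFun.rep_mk _ _

/-- The Jacobian matrix of a map. -/
def jacMat (𝕜 : Type*) [RCLike 𝕜] {χ : Model n → Model n} (hχ : ContDiffOn ℝ ∞ χ W) :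
    BaseMat n (SmoothFun 𝕜 (baseSet W)) :=
  Matrix.of fun k i => (base 𝕜 W).d i (compFun 𝕜 hχ k)

variable {χ : Model n → Model n} (hχ : ContDiffOn ℝ ∞ χ W)

include hχ in
lemma hasFDerivAt_of_mem {y : Model n} (hy : y ∈ W) : HasFDerivAt χ (fderiv ℝ χ y) y :=
  ((hχ.contDiffAt (W.isOpen.mem_nhds hy)).differentiableAt (by simp)).hasFDerivAt

lemma rep_jacMat (k i : Fin n) : (jacMat 𝕜 hχ k i).Rep fun p =>
    ((fderiv ℝ χ p.2 (EuclideanSpace.single i 1) k : ℝ) : 𝕜) := by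
  refine ((rep_compFun hχ k).dir (0, EuclideanSpace.single i 1)).congr fun p hp => ?_
  have h := (((RCLike.ofRealCLM (K := 𝕜)).comp
    (EuclideanSpace.proj k : Model n →L[ℝ] ℝ)).hasFDerivAt.comp p
      ((hasFDerivAt_of_mem hχ hp.2).comp p hasFDerivAt_snd)).fderiv
  exact congrArg (fun T => T (0, EuclideanSpace.single i 1)) h

/-- The map `(t, x) ↦ (t, χ x)`. -/
def baseMap (χ : Model n → Model n) (p : ℝ × Model n) : ℝ × Model n := (p.1, χ p.2)

include hχ in
lemma contDiffOn_baseMap : ContDiffOn ℝ ∞ (baseMap χ) (baseSet W) :=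
  contDiffOn_fst.prodMk (hχ.comp contDiffOn_snd fun _ h => h.2)

/-- The pullback of functions of `(t, x)` along `χ`. -/
def basePull (𝕜 : Type*) [RCLike 𝕜] (hχ : ContDiffOn ℝ ∞ χ W) (hm : ∀ y ∈ W, χ y ∈ V) : SmoothFun 𝕜 (baseSet V) →ₐ[𝕜] SmoothFun 𝕜 (baseSet W) :=
  SmoothFun.pull (baseMap χ) (contDiffOn_baseMap hχ) fun p hp => ⟨hp.1, hm p.2 hp.2⟩

lemma SmoothFun.Rep.basePull {f : SmoothFun 𝕜 (baseSet V)} {F : ℝ × Model n → 𝕜} (h : f.Rep F)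
    (hm : ∀ y ∈ W, χ y ∈ V) :
    (WeylAmbient.basePull 𝕜 hχ hm f).Rep fun p => F (p.1, χ p.2) := h.pull _ _

lemma isCoordChange (hm : ∀ y ∈ W, χ y ∈ V) {Ji : BaseMat n (SmoothFun 𝕜 (baseSet W))}
    (hJ : jacMat 𝕜 hχ * Ji = 1) :
    IsCoordChange (base 𝕜 V) (base 𝕜 W) (basePull 𝕜 hχ hm) (jacMat 𝕜 hχ) Ji := by
  have hf : ∀ p ∈ baseSet W, HasFDerivAt (baseMap χ) ((ContinuousLinearMap.fst ℝ ℝ (Model n)).prod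
      ((fderiv ℝ χ p.2).comp (ContinuousLinearMap.snd ℝ ℝ (Model n)))) p := fun p hp =>
    hasFDerivAt_fst.prodMk ((hasFDerivAt_of_mem hχ hp.2).comp p hasFDerivAt_snd)
  have h0 : (base 𝕜 W).d0 = SmoothFun.dir (1, 0) := rfl
  refine ⟨hJ, ?_, fun x => ?_, fun i x => ?_, fun k i => ?_, fun k i j => SmoothFun.dir_comm _ _ _⟩
  · exact ((rep_baseT V).basePull hχ hm).ext (rep_baseT W) fun _ _ => rfl
  · refine (x.rep_rep.dir_pull (contDiffOn_baseMap hχ) _ _).ext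
      ((x.rep_rep.dir (1, 0)).basePull hχ hm) fun p hp => ?_
    rw [(hf p hp).fderiv]
    simp [baseMap]
  · refine (x.rep_rep.dir_pull (contDiffOn_baseMap hχ) _ _).ext
      (SmoothFun.Rep.sum fun k _ => (rep_jacMat hχ k i).mul
        ((x.rep_rep.dir (0, EuclideanSpace.single k 1)).basePull hχ hm)) fun p hp => ?_
    rw [(hf p hp).fderiv]
    have e : (((ContinuousLinearMap.fst ℝ ℝ (Model n)).prod ((fderiv ℝ χ p.2).comp
        (ContinuousLinearMap.snd ℝ ℝ (Model n)))) (0, EuclideanSpace.single i 1))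
        = ∑ k, (fderiv ℝ χ p.2 (EuclideanSpace.single i 1) k) •
          ((0, EuclideanSpace.single k 1) : ℝ × Model n) := by
      refine Prod.ext (by simp [Prod.fst_sum]) ?_
      ext j
      simp [Prod.snd_sum, Finset.sum_apply, Pi.single_apply]
    rw [e, map_sum]
    exact sum_congr rfl fun k _ => by rw [map_smul, RCLike.real_smul_eq_coe_mul]; rfl
  · have : (base 𝕜 W).d0 (compFun 𝕜 hχ k) = 0 := base_d0_eq_zero (F := fun y => (χ y k : 𝕜))
      (rep_compFun hχ k)
    change (base 𝕜 W).d0 ((base 𝕜 W).d i (compFun 𝕜 hχ k)) = 0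
    rw [(base 𝕜 W).d0_d, this, map_zero]

lemma rep_coeff_pullQ (hm : ∀ y ∈ W, χ y ∈ V) (q : BaseMat n (SmoothFun 𝕜 (baseSet V))⟦X⟧)
    (m : ℕ) (i j : Fin n) :
    (coeff m (pullQ (basePull 𝕜 hχ hm : SmoothFun 𝕜 (baseSet V) →+* SmoothFun 𝕜 (baseSet W))
      (jacMat 𝕜 hχ) q i j)).Rep fun p => ∑ k, ∑ l,
        ((fderiv ℝ χ p.2 (EuclideanSpace.single i 1) k : ℝ) : 𝕜) *
        ((fderiv ℝ χ p.2 (EuclideanSpace.single j 1) l : ℝ) : 𝕜) *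
        (coeff m (q k l)).rep (p.1, χ p.2) := by
  simp only [pullQ, Matrix.of_apply, map_sum, coeff_C_mul, PowerSeries.coeff_map]
  exact SmoothFun.Rep.sum fun k _ => SmoothFun.Rep.sum fun l _ =>
    ((rep_jacMat hχ k i).mul (rep_jacMat hχ l j)).mul ((SmoothFun.rep_rep _).basePull hχ hm)

lemma rep_coeff_pullα (hm : ∀ y ∈ W, χ y ∈ V) (α : Fin n → (SmoothFun 𝕜 (baseSet V))⟦X⟧) (m : ℕ)
    (i : Fin n) {F : Fin n → ℝ × Model n → 𝕜} (hF : ∀ k, (coeff m (α k)).Rep (F k)) :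
    (coeff m (pullα (basePull 𝕜 hχ hm : SmoothFun 𝕜 (baseSet V) →+* SmoothFun 𝕜 (baseSet W))
      (jacMat 𝕜 hχ) α i)).Rep fun p => ∑ k,
        ((fderiv ℝ χ p.2 (EuclideanSpace.single i 1) k : ℝ) : 𝕜) * F k (p.1, χ p.2) := by
  simp only [pullα, map_sum, coeff_C_mul, PowerSeries.coeff_map]
  exact SmoothFun.Rep.sum fun k _ => (rep_jacMat hχ k i).mul ((hF k).basePull hχ hm)

lemma rep_pull_matrix (hm : ∀ y ∈ W, χ y ∈ V) {g : BaseMat n (SmoothFun 𝕜 (baseSet V))}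
    {F : Model n → BaseMat n 𝕜} (hF : ∀ i j, (g i j).Rep fun p => F p.2 i j) (i j : Fin n) :
    (((jacMat 𝕜 hχ).transpose * g.map (basePull 𝕜 hχ hm) * jacMat 𝕜 hχ) i j).Rep fun p =>
      ∑ k, ∑ l, ((fderiv ℝ χ p.2 (EuclideanSpace.single i 1) k : ℝ) : 𝕜) *
        ((fderiv ℝ χ p.2 (EuclideanSpace.single j 1) l : ℝ) : 𝕜) * F (χ p.2) k l := by
  simp only [Matrix.mul_apply, Matrix.transpose_apply, Matrix.map_apply, sum_mul]
  refine (SmoothFun.Rep.sum fun l _ => SmoothFun.Rep.sum fun k _ => ((rep_jacMat hχ k i).mul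
    ((hF k l).basePull hχ hm)).mul (rep_jacMat hχ l j)).congr fun p _ => ?_
  exact sum_swap fun _ _ => by ring

end CoordChange

/-! ### Formal solutions in charts -/

section Charts

variable {n : ℕ} {M : Type*} [TopologicalSpace M] [ChartedSpace (Model n) M] {p q : ℕ}
  {𝕜 : Type*} [RCLike 𝕜] (r : WeylRep n M p q) (A : Acceleration n M)
  {φ ψ : Chart n M} (hφ : φ ∈ charts n M) (hψ : ψ ∈ charts n M)

/-- The coordinates of the points `(t, x, ρ)` with `(x, ρ) ∈ S`. -/
def connOpens (A : Acceleration n M) (φ : Chart n M) : Opens (Coord n) :=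
  ⟨{z | z.2 ∈ chartSet φ (star A.dom)},
    (isOpen_chartSet φ (isOpen_star A.isOpen_dom)).preimage continuous_snd⟩

lemma liesOver_connOpens : LiesOver (targetOpens φ) (connOpens A φ) := fun _ hp =>
  ⟨hp.2, zero_mem_star (A.zero_mem _)⟩

/-- The components of the one-forms `a + ∫_0^ρ ϕ dρ`. -/
def connComp (𝕜 : Type*) [RCLike 𝕜] (r : WeylRep n M p q) (A : Acceleration n M)
    (φ : Chart n M) (i : Fin n) (z : Coord n) : 𝕜 :=
  ((connForm r A (φ.symm z.2.1) z.2.2 (coordVec φ z.2.1 i) : ℝ) : 𝕜)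

include hφ in
lemma contDiffOn_connComp (i : Fin n) : ContDiffOn ℝ ∞ (connComp 𝕜 r A φ i) (connOpens A φ) :=
  (RCLike.ofRealCLM (K := 𝕜)).contDiff.comp_contDiffOn
    ((contDiffOn_connForm r A hφ i).comp contDiffOn_snd fun _ h => h)

/-- The Taylor series of the one-forms `a + ∫_0^ρ ϕ dρ`. -/
def connSeries (𝕜 : Type*) [RCLike 𝕜] (i : Fin n) : (SmoothFun 𝕜 (baseSet (targetOpens φ)))⟦X⟧ :=
  tay (liesOver_connOpens A) (SmoothFun.mk _ (contDiffOn_connComp r A hφ i))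

lemma rep_coeff_connSeries (m : ℕ) (i : Fin n) : (coeff m (connSeries r A hφ 𝕜 i)).Rep fun p =>
    (m.factorial : 𝕜)⁻¹ * iteratedDeriv m (fun ρ => connComp 𝕜 r A φ i (p.1, p.2, ρ)) 0 :=
  rep_coeff_tay _ (SmoothFun.rep_mk _ _) m

theorem exists_formalSolution {d : 𝕜} (hd1 : d ≠ 1) (hd : ∀ m : ℕ, d ≠ 2 * m) :
    ∃ gi q u, IsFormalSolution (base 𝕜 (targetOpens φ)) d (gMat 𝕜 r hφ) gi
      (connSeries r A hφ 𝕜) q u := by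
  obtain ⟨gi, hgi, hr⟩ := exists_gMat_inv (𝕜 := 𝕜) r hφ
  have hα : ∀ i, liftD (base 𝕜 (targetOpens φ)).d0 (connSeries r A hφ 𝕜 i) = 0 := fun i => by
    rw [← AmbBase.D_zero, connSeries, base_D_tay, ← map_zero (tay (liesOver_connOpens A))]
    have hr := SmoothFun.rep_mk _ (contDiffOn_connComp (𝕜 := 𝕜) r A hφ i)
    exact congrArg _ ((hr.ambD _).ext SmoothFun.rep_zero fun z hz =>
      apply_eq_zero_of_hasFDerivAt (hr.hasFDerivAt hz) fun s => congrArg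
        (fun w : Model n × ℝ => ((connForm r A (φ.symm w.1) w.2 (coordVec φ w.1 i) : ℝ) : 𝕜))
        (show (z + s • basisVec (idx0 n)).2 = z.2 by simp [basisVec]))
  obtain ⟨q, u, v, Gi, Γ, hs, hn, hv, hE, hS⟩ := exists_normalData (b := base 𝕜 (targetOpens φ))
    hd1 hd hα hgi (fun i j => (rep_gMat r hφ i j).ext (rep_gMat r hφ j i) fun p _ => by
      simp only [gComp, Matrix.of_apply]; rw [(r.signature _).symm])
    (fun i j => base_d0_eq_zero (F := fun y => gComp 𝕜 r φ y i j) (rep_gMat r hφ i j))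
    (fun i j => base_d0_eq_zero (F := fun y => (gComp 𝕜 r φ y)⁻¹ i j) (hr i j))
  exact ⟨gi, q, u, hs, Gi, Γ, v, hn, hv, hE, hS⟩

include hφ hψ in
lemma gComp_transform {y : Model n} (hy : y ∈ overlap φ ψ) (i j : Fin n) :
    gComp 𝕜 r φ y i j = ∑ k, ∑ l, (jacobian φ ψ y k i : 𝕜) * (jacobian φ ψ y l j : 𝕜) *
      gComp 𝕜 r ψ (transition φ ψ y) k l := by
  simp only [gComp, Matrix.of_apply]
  rw [form_transform₂ hφ hψ r.g hy]
  push_cast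
  rfl

include hφ hψ r in
lemma det_jacobian {y : Model n} (hy : y ∈ overlap φ ψ) : (jacobian φ ψ y).det ≠ 0 := by
  intro h0
  refine det_gComp (𝕜 := ℝ) r hφ hy.1 ?_
  have e : gComp ℝ r φ y = (jacobian φ ψ y).transpose * gComp ℝ r ψ (transition φ ψ y)
      * jacobian φ ψ y := by
    ext i j
    rw [gComp_transform r hφ hψ hy]
    simp only [Matrix.mul_apply, Matrix.transpose_apply, sum_mul, RCLike.ofReal_real_eq_id, id]
    exact sum_swap fun _ _ => by ring
  rw [e, Matrix.det_mul, h0, mul_zero]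

include hφ hψ in
lemma iteratedDeriv_connComp (m : ℕ) (i : Fin n) {y : Model n} (hy : y ∈ overlap φ ψ) (t : ℝ) :
    iteratedDeriv m (fun ρ => connComp 𝕜 r A φ i (t, y, ρ)) 0 = ∑ k, (jacobian φ ψ y k i : 𝕜) *
      iteratedDeriv m (fun ρ => connComp 𝕜 r A ψ k (t, transition φ ψ y, ρ)) 0 := by
  have e : (fun ρ => connComp 𝕜 r A φ i (t, y, ρ)) = fun ρ => ∑ k, (jacobian φ ψ y k i : 𝕜) *
      connComp 𝕜 r A ψ k (t, transition φ ψ y, ρ) := by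
    funext ρ
    simp only [connComp]
    rw [form_transform hφ hψ (fun x => connForm r A x ρ) hy i]
    push_cast
    rfl
  have hs : ∀ k, ContDiffAt ℝ ∞ (fun ρ => connComp 𝕜 r A ψ k (t, transition φ ψ y, ρ)) 0 := fun k => by
    have hmem : ((t, transition φ ψ y, 0) : Coord n) ∈ connOpens A ψ :=
      ⟨ψ.map_source hy.2, zero_mem_star (A.zero_mem _)⟩
    have h1 := (contDiffOn_connComp (𝕜 := 𝕜) r A hψ k).contDiffAt
      ((connOpens A ψ).isOpen.mem_nhds hmem)
    exact h1.comp (f := fun ρ : ℝ => ((t, transition φ ψ y, ρ) : Coord n)) 0 (by fun_prop)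
  have hk : (m : WithTop ℕ∞) ≤ ∞ := WithTop.coe_le_coe.mpr le_top
  rw [e, iteratedDeriv_fun_sum fun k _ => contDiffAt_const.mul ((hs k).of_le hk)]
  exact sum_congr rfl fun k _ => iteratedDeriv_const_mul _ ((hs k).of_le hk)

/-- Formal solutions transform as tensors. -/
theorem formalSolution_transform {d : 𝕜} (hd1 : d ≠ 1) (hd : ∀ m : ℕ, d ≠ 2 * m)
    {gi q u} (h : IsFormalSolution (base 𝕜 (targetOpens φ)) d (gMat 𝕜 r hφ) gi
      (connSeries r A hφ 𝕜) q u)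
    {gi' q' u'} (h' : IsFormalSolution (base 𝕜 (targetOpens ψ)) d (gMat 𝕜 r hψ) gi'
      (connSeries r A hψ 𝕜) q' u') {y : Model n} (hy : y ∈ overlap φ ψ) (m : ℕ) :
    (∀ i j, (coeff m (q i j)).rep (1, y) = ∑ k, ∑ l, (jacobian φ ψ y k i : 𝕜) *
      (jacobian φ ψ y l j : 𝕜) * (coeff m (q' k l)).rep (1, transition φ ψ y)) ∧
    (coeff m u).rep (1, y) = (coeff m u').rep (1, transition φ ψ y) := by
  have hχ := contDiffOn_transition hφ hψ
  have hm : ∀ y ∈ overlap φ ψ, transition φ ψ y ∈ targetOpens ψ := fun y hy => ψ.map_source hy.2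
  have hχ' : ContDiffOn ℝ ∞ (id : Model n → Model n) (overlap φ ψ) := contDiffOn_id
  have hm' : ∀ y ∈ overlap φ ψ, id y ∈ targetOpens φ := fun y hy => hy.1
  obtain ⟨Ji, hJ, -⟩ := exists_matrix_inverse (𝕜 := 𝕜) (GR := jacMat 𝕜 hχ)
    (G := fun p => (RCLike.ofRealAm (K := 𝕜)).toRingHom.mapMatrix (jacobian φ ψ p.2))
    (rep_jacMat hχ) fun p hp => by
      rw [← RingHom.map_det]
      exact fun h0 => det_jacobian r hφ hψ hp.2 (RCLike.ofReal_eq_zero.mp h0)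
  have hid : ∀ (x : Model n) (i k : Fin n),
      ((fderiv ℝ (id : Model n → Model n) x (EuclideanSpace.single i 1) k : ℝ) : 𝕜)
        = if k = i then 1 else 0 := fun x i k => by
    rw [fderiv_id]
    simp
  have hid₂ : ∀ (i j : Fin n) (c : Fin n → Fin n → 𝕜), ∑ k, ∑ l,
      (if k = i then (1 : 𝕜) else 0) * (if l = j then 1 else 0) * c k l = c i j := fun i j c => by
    simp
  have hJ1 : jacMat 𝕜 hχ' * 1 = 1 := by
    rw [mul_one]
    ext1 k i
    refine (rep_jacMat hχ' k i).ext (g := (1 : BaseMat n _) k i)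
      (G := fun _ => if k = i then 1 else 0) ?_ fun p _ => hid p.2 i k
    rw [Matrix.one_apply]
    split_ifs
    · exact SmoothFun.rep_one
    · exact SmoothFun.rep_zero
  have s1 := h.pull (isCoordChange hχ' hm' hJ1)
  have s2 := h'.pull (isCoordChange hχ hm hJ)
  have eg : (jacMat 𝕜 hχ').transpose * (gMat 𝕜 r hφ).map (basePull 𝕜 hχ' hm') * jacMat 𝕜 hχ'
      = (jacMat 𝕜 hχ).transpose * (gMat 𝕜 r hψ).map (basePull 𝕜 hχ hm) * jacMat 𝕜 hχ := by
    ext1 i j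
    refine (rep_pull_matrix hχ' hm' (rep_gMat r hφ) i j).ext
      (rep_pull_matrix hχ hm (rep_gMat r hψ) i j) fun w hw => ?_
    simp only [hid, id]
    refine Eq.trans ?_ (gComp_transform (𝕜 := 𝕜) r hφ hψ hw.2 i j)
    simp
  have eα : pullα (basePull 𝕜 hχ' hm' : SmoothFun 𝕜 (baseSet (targetOpens φ)) →+*
      SmoothFun 𝕜 (baseSet (overlap φ ψ))) (jacMat 𝕜 hχ')
      (connSeries r A hφ 𝕜) = pullα (basePull 𝕜 hχ hm : SmoothFun 𝕜 (baseSet (targetOpens ψ)) →+*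
      SmoothFun 𝕜 (baseSet (overlap φ ψ)))
      (jacMat 𝕜 hχ) (connSeries r A hψ 𝕜) := by
    funext i
    ext m
    refine (rep_coeff_pullα hχ' hm' _ m i fun k => rep_coeff_connSeries r A hφ m k).ext
      (rep_coeff_pullα hχ hm _ m i fun k => rep_coeff_connSeries r A hψ m k) fun w hw => ?_
    simp only [hid, ite_mul, one_mul, zero_mul, Finset.sum_ite_eq', Finset.mem_univ, if_true, id]
    rw [iteratedDeriv_connComp r A hφ hψ m i hw.2, mul_sum]
    exact sum_congr rfl fun k _ => by rw [jacobian]; simp only [Matrix.of_apply]; ring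
  rw [eg, eα] at s1
  obtain ⟨eq, eu⟩ := s2.unique hd1 hd s1
  have hy1 : ((1, y) : ℝ × Model n) ∈ baseSet (overlap φ ψ) := ⟨one_pos, hy⟩
  refine ⟨fun i j => ?_, ?_⟩
  · have e1 := rep_coeff_pullQ hχ' hm' q m i j
    rw [eq] at e1
    have := e1.eqOn (rep_coeff_pullQ hχ hm q' m i j) hy1
    simp only [hid, hid₂, id] at this
    exact this
  · have e1 := congrArg (coeff m) eu
    rw [PowerSeries.coeff_map, PowerSeries.coeff_map] at e1
    have r1 := (coeff m u).rep_rep.basePull hχ' hm'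
    have r2 := (coeff m u').rep_rep.basePull hχ hm
    exact (r1.eval hy1).symm.trans ((congrArg _ e1).trans (r2.eval hy1))

end Charts

end

section

/-! ### Tensor fields with prescribed Taylor coefficients -/

section Glue

variable {n : ℕ} {M : Type*} [TopologicalSpace M] [ChartedSpace (Model n) M]
  {𝕜 : Type*} [RCLike 𝕜] {φ ψ : Chart n M}

lemma contDiffOn_jacobian (hφ : φ ∈ charts n M) (hψ : ψ ∈ charts n M) (k i : Fin n) :
    ContDiffOn ℝ ∞ (fun y => jacobian φ ψ y k i) (overlap φ ψ) :=
  (EuclideanSpace.proj k : Model n →L[ℝ] ℝ).contDiff.comp_contDiffOn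
    (((contDiffOn_transition hφ hψ).fderiv_of_isOpen (overlap φ ψ).isOpen (by simp)).clm_apply
      contDiffOn_const)

lemma exists_borel_chart {F : Type*} [NormedAddCommGroup F] [NormedSpace ℝ F] [CompleteSpace F]
    {U K : Set (Model n)} (hU : IsOpen U) (hK : IsCompact K) (hKU : K ⊆ U) {η : Model n → ℝ}
    (hη : ContDiffOn ℝ ∞ η U) (hηK : ∀ y ∈ U, η y ≠ 0 → y ∈ K) {c : ℕ → Model n → F}
    (hc : ∀ m, ContDiffOn ℝ ∞ (c m) U) :
    ∃ H : Model n × ℝ → F, ContDiff ℝ ∞ H ∧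
      (∀ y ∈ U, ∀ m, iteratedDeriv m (fun ρ => H (y, ρ)) 0 = (m.factorial : ℝ) • η y • c m y) ∧
      ∀ y ∈ U, η y = 0 → ∀ ρ, H (y, ρ) = 0 := by
  classical
  set f : ℕ → Model n → F := fun m y => if y ∈ U then η y • c m y else 0 with hf
  have hf0 : ∀ m, ∀ y ∉ K, f m y = 0 := fun m y hy => by
    simp only [hf]
    split_ifs with h
    · rw [not_ne_iff.mp (mt (hηK y h) hy), zero_smul]
    · rfl
  have hs : ∀ m, ContDiff ℝ ∞ (f m) := fun m => contDiff_iff_contDiffAt.mpr fun y => by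
    by_cases hy : y ∈ U
    · exact ((hη.smul (hc m)).contDiffAt (hU.mem_nhds hy)).congr_of_eventuallyEq
        ((hU.eventually_mem hy).mono fun w hw => if_pos hw)
    · exact contDiffAt_const.congr_of_eventuallyEq ((hK.isClosed.isOpen_compl.eventually_mem
        fun h => hy (hKU h)).mono fun w hw => hf0 m w hw)
  obtain ⟨H, h1, h2, h3⟩ := exists_borel hs fun m => HasCompactSupport.intro hK (hf0 m)
  refine ⟨H, h1, fun y hy m => ?_, fun y hy h0 => h3 y fun m => ?_⟩
  · rw [h2, hf]; simp only [if_pos hy]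
  · simp [hf, h0]

lemma chartAt_mem_charts [IsManifold 𝓘(ℝ, Model n) ∞ M] (x : M) : chartAt (Model n) x ∈ charts n M :=
  IsManifold.chart_mem_maximalAtlas x

local notation "κ" => chartAt (Model n) (M := M)

variable [T2Space M] [SigmaCompactSpace M] [IsManifold 𝓘(ℝ, Model n) ∞ M]

lemma exists_chartPartition : ∃ (P : SmoothPartitionOfUnity M 𝓘(ℝ, Model n) M Set.univ)
    (K : M → Set (Model n)), ∀ x, tsupport (P x) ⊆ (κ x).source ∧ IsCompact (K x) ∧
      K x ⊆ (κ x).target ∧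
      ∀ y ∈ (κ x).target, P x ((κ x).symm y) ≠ 0 → y ∈ K x := by
  have h1 : ∀ x : M, ∃ ε > 0, Metric.closedBall (κ x x) ε ⊆
      (κ x).target := fun x =>
    Metric.nhds_basis_closedBall.mem_iff.mp ((κ x).open_target.mem_nhds
      (mem_chart_target _ x))
  choose ε hε hε' using h1
  obtain ⟨P, hP⟩ := SmoothPartitionOfUnity.exists_isSubordinate 𝓘(ℝ, Model n)
    (isClosed_univ (X := M)) (fun x => (κ x).source ∩
      κ x ⁻¹' Metric.ball (κ x x) (ε x))
    (fun x => (κ x).isOpen_inter_preimage Metric.isOpen_ball)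
    fun x _ => Set.mem_iUnion.mpr ⟨x, mem_chart_source _ x, Metric.mem_ball_self (hε x)⟩
  refine ⟨P, fun x => Metric.closedBall (κ x x) (ε x), fun x =>
    ⟨(hP x).trans Set.inter_subset_left, isCompact_closedBall _ _, hε' x, fun y hy h0 => ?_⟩⟩
  have := (hP x (subset_tsupport _ h0)).2
  rw [Set.mem_preimage, (κ x).right_inv hy] at this
  exact Metric.ball_subset_closedBall this

lemma contDiffOn_partition_sum (P : SmoothPartitionOfUnity M 𝓘(ℝ, Model n) M Set.univ)
    (hP : ∀ x, tsupport (P x) ⊆ (κ x).source) {T : M → Model n × ℝ → 𝕜}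
    (hT : ∀ x, ContDiffOn ℝ ∞ (T x) {w | w.1 ∈ overlap φ (κ x)})
    (h0 : ∀ x, ∀ y ∈ overlap φ (κ x), P x (φ.symm y) = 0 → ∀ ρ, T x (y, ρ) = 0) :
    ContDiffOn ℝ ∞ (fun w => ∑ x ∈ P.finsupport (φ.symm w.1), T x w) {w | w.1 ∈ φ.target} := by
  rintro ⟨y, ρ⟩ (hy : y ∈ φ.target)
  have hsrc : ∀ x ∈ P.fintsupport (φ.symm y), y ∈ overlap φ (κ x) := fun x hx =>
    ⟨hy, hP x ((P.mem_fintsupport_iff _ x).mp hx)⟩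
  have ev : ∀ᶠ w : Model n in nhds y, P.finsupport (φ.symm w) ⊆ P.fintsupport (φ.symm y) :=
    (φ.continuousAt_symm hy).eventually (P.eventually_finsupport_subset _)
  have ev2 : ∀ᶠ w : Model n in nhds y, ∀ x ∈ P.fintsupport (φ.symm y),
      w ∈ overlap φ (κ x) :=
    (Filter.eventually_all_finset _).mpr fun x hx => (overlap φ _).isOpen.eventually_mem (hsrc x hx)
  refine ContDiffAt.contDiffWithinAt (ContDiffAt.congr_of_eventuallyEq
    (f := fun w => ∑ x ∈ P.fintsupport (φ.symm y), T x w) (ContDiffAt.sum fun x hx =>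
      (hT x).contDiffAt (((overlap φ _).isOpen.preimage continuous_fst).mem_nhds (hsrc x hx))) ?_)
  filter_upwards [continuousAt_fst.eventually (ev.and ev2)] with w hw
  exact Finset.sum_subset hw.1 fun x hx hx' => h0 x w.1 (hw.2 x hx)
    (by simpa [P.mem_finsupport] using hx') w.2

/-- A compatible family of sequences of tensor fields and functions, given in charts, is the
sequence of Taylor coefficients of a family of tensor fields and of a family of functions. -/
theorem exists_tensor_of_coeffs (c : Chart n M → ℕ → Model n →
      Fin n → Fin n → 𝕜) (e : Chart n M → ℕ → Model n → 𝕜)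
    (hc : ∀ φ ∈ charts n M, ∀ m i j, ContDiffOn ℝ ∞ (fun y => c φ m y i j) φ.target)
    (he : ∀ φ ∈ charts n M, ∀ m, ContDiffOn ℝ ∞ (e φ m) φ.target)
    (hsymm : ∀ φ ∈ charts n M, ∀ y ∈ φ.target, ∀ m i j, c φ m y i j = c φ m y j i)
    (hct : ∀ φ ∈ charts n M, ∀ ψ ∈ charts n M, ∀ y ∈ overlap φ ψ, ∀ m i j, c φ m y i j =
      ∑ k, ∑ l, (jacobian φ ψ y k i : 𝕜) * (jacobian φ ψ y l j : 𝕜) * c ψ m (transition φ ψ y) k l)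
    (het : ∀ φ ∈ charts n M, ∀ ψ ∈ charts n M, ∀ y ∈ overlap φ ψ, ∀ m,
      e φ m y = e ψ m (transition φ ψ y)) :
    ∃ (Q : ∀ x : M, ℝ → Tan n x →ₗ[ℝ] Tan n x →ₗ[ℝ] 𝕜) (U : M → ℝ → 𝕜),
      (∀ x ρ v w, Q x ρ v w = Q x ρ w v) ∧ ∀ φ ∈ charts n M,
        (∀ i j, ContDiffOn ℝ ∞ (fun w : Model n × ℝ =>
          Q (φ.symm w.1) w.2 (coordVec φ w.1 i) (coordVec φ w.1 j)) {w | w.1 ∈ φ.target}) ∧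
        ContDiffOn ℝ ∞ (fun w : Model n × ℝ => U (φ.symm w.1) w.2) {w | w.1 ∈ φ.target} ∧
        ∀ y ∈ φ.target, ∀ m, (∀ i j, iteratedDeriv m (fun ρ =>
            Q (φ.symm y) ρ (coordVec φ y i) (coordVec φ y j)) 0 = m.factorial * c φ m y i j) ∧
          iteratedDeriv m (U (φ.symm y)) 0 = m.factorial * e φ m y := by
  obtain ⟨P, K, hPK⟩ := exists_chartPartition (n := n) (M := M)
  have hch : ∀ x : M, κ x ∈ charts n M := chartAt_mem_charts
  have hB := fun x : M => exists_borel_chart (F := (Fin n → Fin n → 𝕜) × 𝕜)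
    (κ x).open_target (hPK x).2.1 (hPK x).2.2.1
    (η := fun y => P x ((κ x).symm y))
    (contMDiffOn_iff_contDiffOn.mp ((P x).contMDiff.comp_contMDiffOn
      (contMDiffOn_chart_symm (hch x)))) (hPK x).2.2.2
    (c := fun m y => (c (κ x) m y, e (κ x) m y))
    fun m => (contDiffOn_pi.mpr fun i => contDiffOn_pi.mpr fun j => hc _ (hch x) m i j).prodMk
      (he _ (hch x) m)
  choose H hH hHd hH0 using hB
  set S : M → Fin n → Fin n → Model n × ℝ → 𝕜 := fun x k l w => 2⁻¹ * ((H x w).1 k l + (H x w).1 l k)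
    with hS
  have hSs : ∀ x k l, ContDiff ℝ ∞ (S x k l) := fun x k l =>
    contDiff_const.mul ((contDiff_pi.mp (contDiff_pi.mp (contDiff_fst.comp (hH x)) k) l).add
      (contDiff_pi.mp (contDiff_pi.mp (contDiff_fst.comp (hH x)) l) k))
  have hSsymm : ∀ x k l w, S x k l w = S x l k w := fun x k l w => by simp only [hS]; ring
  have hslice : ∀ {F : Type _} [NormedAddCommGroup F] [NormedSpace ℝ F] {f : Model n × ℝ → F},
      ContDiff ℝ ∞ f → ∀ y m, ContDiffAt ℝ (m : ℕ) (fun ρ => f (y, ρ)) 0 := fun hf y m =>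
    ((hf.of_le (m := (_ : ℕ)) (WithTop.coe_le_coe.mpr le_top)).comp
      (contDiff_prodMk_right y)).contDiffAt
  have hder : ∀ x, ∀ y ∈ (κ x).target, ∀ m, (∀ k l,
      iteratedDeriv m (fun ρ => S x k l (y, ρ)) 0 = m.factorial *
        (P x ((κ x).symm y) * c (κ x) m y k l)) ∧
      iteratedDeriv m (fun ρ => (H x (y, ρ)).2) 0 = m.factorial *
        (P x ((κ x).symm y) * e (κ x) m y) := fun x y hy m => by
    have key : ∀ L : ((Fin n → Fin n → 𝕜) × 𝕜) →L[ℝ] 𝕜, iteratedDeriv m (fun ρ => L (H x (y, ρ))) 0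
        = m.factorial * (P x ((κ x).symm y) *
          L (c (κ x) m y, e (κ x) m y)) := fun L => by
      have h1 := L.iteratedFDeriv_comp_left (hslice (hH x) y m) (le_refl _)
      have h2 := congrArg (fun T => T fun _ => (1 : ℝ)) h1
      have h3 : iteratedDeriv m (fun ρ => L (H x (y, ρ))) 0
        = L (iteratedDeriv m (fun ρ => H x (y, ρ)) 0) := h2
      rw [h3, hHd x y hy m, map_smul, map_smul, RCLike.real_smul_eq_coe_mul,
        RCLike.real_smul_eq_coe_mul]
      push_cast
      rfl
    refine ⟨fun k l => ?_, key (ContinuousLinearMap.snd ℝ _ _)⟩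
    have h1 := key ((2⁻¹ : ℝ) • (((ContinuousLinearMap.proj l).comp
      ((ContinuousLinearMap.proj k).comp (ContinuousLinearMap.fst ℝ (Fin n → Fin n → 𝕜) 𝕜))) +
      ((ContinuousLinearMap.proj k).comp ((ContinuousLinearMap.proj l).comp
        (ContinuousLinearMap.fst ℝ (Fin n → Fin n → 𝕜) 𝕜)))))
    have h2 : ∀ a b : 𝕜, (2⁻¹ : ℝ) • (a + b) = 2⁻¹ * (a + b) := fun a b => by
      rw [RCLike.real_smul_eq_coe_mul]; push_cast; rfl
    simp only [ContinuousLinearMap.smul_apply, ContinuousLinearMap.add_apply,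
      ContinuousLinearMap.comp_apply, ContinuousLinearMap.coe_fst', ContinuousLinearMap.proj_apply,
      h2, hsymm _ (hch x) y hy m l k] at h1
    rw [h1]
    ring
  set B : ∀ x x' : M, ℝ → Tan n x' →ₗ[ℝ] Tan n x' →ₗ[ℝ] 𝕜 := fun x x' ρ => ∑ k, ∑ l,
    LinearMap.mk₂ ℝ (fun v w => S x k l (κ x x', ρ) *
      (dchart (κ x) x' v k : 𝕜) * (dchart (κ x) x' w l : 𝕜))
      (fun _ _ _ => by rw [map_add, PiLp.add_apply]; push_cast; ring)
      (fun _ _ _ => by rw [map_smul, PiLp.smul_apply, smul_eq_mul,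
        RCLike.real_smul_eq_coe_mul]; push_cast; ring)
      (fun _ _ _ => by rw [map_add, PiLp.add_apply]; push_cast; ring)
      (fun _ _ _ => by rw [map_smul, PiLp.smul_apply, smul_eq_mul,
        RCLike.real_smul_eq_coe_mul]; push_cast; ring)
  have hBv : ∀ x x' ρ v w, B x x' ρ v w = ∑ k, ∑ l, S x k l (κ x x', ρ) *
      (dchart (κ x) x' v k : 𝕜) * (dchart (κ x) x' w l : 𝕜) := by
    intro x x' ρ v w
    simp only [B, LinearMap.sum_apply, LinearMap.mk₂_apply]
  have hBc : ∀ φ ∈ charts n M, ∀ x, ∀ y ∈ overlap φ (κ x), ∀ ρ i j,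
      B x (φ.symm y) ρ (coordVec φ y i) (coordVec φ y j) = ∑ k, ∑ l,
        (jacobian φ (κ x) y k i : 𝕜) * (jacobian φ (κ x) y l j : 𝕜) *
        S x k l (transition φ (κ x) y, ρ) := by
    intro φ hφ x y hy ρ i j
    rw [hBv]
    refine sum_congr₂ fun k l => ?_
    rw [dchart_apply_coordVec hφ (hch x) hy, dchart_apply_coordVec hφ (hch x) hy, transition]
    ring
  have hov : ∀ (φ : Chart n M) y, y ∈ φ.target →
      ∀ x ∈ P.finsupport (φ.symm y), y ∈ overlap φ (κ x) :=
    fun φ y hy x hx => ⟨hy, (hPK x).1 (subset_tsupport _ ((P.mem_finsupport _).mp hx))⟩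
  have hback : ∀ (φ : Chart n M) x y, y ∈ overlap φ (κ x) →
      transition φ (κ x) y ∈ (κ x).target ∧
      (κ x).symm (transition φ (κ x) y) = φ.symm y :=
    fun φ x y hy => ⟨(κ x).map_source hy.2, (κ x).left_inv hy.2⟩
  have hS0 : ∀ (φ : Chart n M) x, ∀ y ∈ overlap φ (κ x),
      P x (φ.symm y) = 0 → ∀ ρ, H x (transition φ (κ x) y, ρ) = 0 := by
    intro φ x y hy h0 ρ
    exact hH0 x _ (hback φ x y hy).1 (by rw [(hback φ x y hy).2]; exact h0) ρ
  have htr : ∀ φ ∈ charts n M, ∀ x, ContDiffOn ℝ ∞ (fun w : Model n × ℝ =>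
      (transition φ (κ x) w.1, w.2)) {w | w.1 ∈ overlap φ (κ x)} :=
    fun φ hφ x => ((contDiffOn_transition hφ (hch x)).comp contDiffOn_fst fun _ h => h).prodMk
      contDiffOn_snd
  have hone : ∀ x : M, ∑ x' ∈ P.finsupport x, ((P x' x : ℝ) : 𝕜) = 1 := fun x => by
    rw [← map_sum (algebraMap ℝ 𝕜), P.sum_finsupport x (Set.mem_univ x), map_one]
  refine ⟨fun x ρ => ∑ x' ∈ P.finsupport x, B x' x ρ,
    fun x ρ => ∑ x' ∈ P.finsupport x, (H x' (κ x' x, ρ)).2,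
    fun x ρ v w => ?_, fun φ hφ => ⟨fun i j => ?_, ?_, fun y hy m => ⟨fun i j => ?_, ?_⟩⟩⟩
  · simp only [LinearMap.sum_apply]
    refine sum_congr rfl fun x' _ => ?_
    rw [hBv, hBv, sum_comm]
    exact sum_congr₂ fun k l => by
      rw [hSsymm x' l k]; ring
  · simp only [LinearMap.sum_apply]
    refine contDiffOn_partition_sum P (fun x => (hPK x).1) (φ := φ)
      (T := fun x w => B x (φ.symm w.1) w.2 (coordVec φ w.1 i) (coordVec φ w.1 j)) (fun x => ?_)
      fun x y hy h0 ρ => ?_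
    · have hj : ∀ k i, ContDiffOn ℝ ∞ (fun w : Model n × ℝ =>
          (jacobian φ (κ x) w.1 k i : 𝕜))
          {w | w.1 ∈ overlap φ (κ x)} := fun k i =>
        (RCLike.ofRealCLM (K := 𝕜)).contDiff.comp_contDiffOn
          ((contDiffOn_jacobian hφ (hch x) k i).comp contDiffOn_fst fun _ h => h)
      exact (ContDiffOn.sum fun k _ => ContDiffOn.sum fun l _ => ((hj k i).mul (hj l j)).mul
        ((hSs x k l).comp_contDiffOn (htr φ hφ x))).congr fun w hw => hBc φ hφ x w.1 hw w.2 i j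
    · rw [hBc φ hφ x y hy]
      simp [hS, hS0 φ x y hy h0]
  · refine contDiffOn_partition_sum P (fun x => (hPK x).1) (φ := φ)
      (T := fun x w => (H x (transition φ (κ x) w.1, w.2)).2)
      (fun x => (contDiff_snd.comp (hH x)).comp_contDiffOn (htr φ hφ x))
      fun x y hy h0 ρ => by rw [hS0 φ x y hy h0]; rfl
  · have e1 : (fun ρ => (∑ x' ∈ P.finsupport (φ.symm y), B x' (φ.symm y) ρ) (coordVec φ y i)
        (coordVec φ y j)) = fun ρ => ∑ x ∈ P.finsupport (φ.symm y), ∑ k, ∑ l,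
        ((jacobian φ (κ x) y k i : 𝕜) *
          (jacobian φ (κ x) y l j : 𝕜)) *
        S x k l (transition φ (κ x) y, ρ) := by
      funext ρ
      simp only [LinearMap.sum_apply]
      exact sum_congr rfl fun x hx => hBc φ hφ x y (hov φ y hy x hx) ρ i j
    rw [e1, iteratedDeriv_fun_sum fun x _ => ContDiffAt.sum fun k _ => ContDiffAt.sum fun l _ =>
      contDiffAt_const.mul (hslice (hSs x k l) _ m), ← mul_one (_ * c φ m y i j),
      ← hone (φ.symm y), mul_sum]
    refine sum_congr rfl fun x hx => ?_
    have hy' := hov φ y hy x hx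
    rw [hct φ hφ _ (hch x) y hy', iteratedDeriv_fun_sum fun k _ => ContDiffAt.sum fun l _ =>
      contDiffAt_const.mul (hslice (hSs x k l) _ m), mul_sum, sum_mul]
    refine sum_congr rfl fun k _ => ?_
    rw [iteratedDeriv_fun_sum fun l _ => contDiffAt_const.mul (hslice (hSs x k l) _ m),
      mul_sum, sum_mul]
    refine sum_congr rfl fun l _ => ?_
    rw [iteratedDeriv_const_mul _ (hslice (hSs x k l) _ m),
      ((hder x _ (hback φ x y hy').1 m).1 k l), (hback φ x y hy').2]
    ring
  · refine (iteratedDeriv_fun_sum (f := fun x ρ => (H x (κ x (φ.symm y), ρ)).2)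
      fun x _ => hslice (contDiff_snd.comp (hH x)) _ m).trans ?_
    rw [← mul_one (_ * e φ m y), ← hone (φ.symm y), mul_sum]
    refine sum_congr rfl fun x hx => ?_
    have hy' := hov φ y hy x hx
    rw [het φ hφ _ (hch x) y hy']
    have := (hder x _ (hback φ x y hy').1 m).2
    rw [(hback φ x y hy').2] at this
    refine Eq.trans this ?_
    ring

end Glue

end

section

/-! ### The metric in Weyl-normal form -/

section Nondegenerate

variable {𝕜 : Type*} [RCLike 𝕜] {ι V : Type*} [Fintype ι] [DecidableEq ι] [AddCommGroup V]
  [Module ℝ V]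

lemma det_ne_zero_of_basis (B : V →ₗ[ℝ] V →ₗ[ℝ] 𝕜) (b b' : Module.Basis ι ℝ V)
    (h : (Matrix.of fun i j => B (b i) (b j)).det ≠ 0) :
    (Matrix.of fun i j => B (b' i) (b' j)).det ≠ 0 := by
  have e : (Matrix.of fun i j => B (b i) (b j)) = ((b'.toMatrix b).map (algebraMap ℝ 𝕜)).transpose *
      (Matrix.of fun i j => B (b' i) (b' j)) * (b'.toMatrix b).map (algebraMap ℝ 𝕜) := by
    ext i j
    rw [Matrix.of_apply, ← b'.sum_toMatrix_smul_self b i, ← b'.sum_toMatrix_smul_self b j]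
    simp only [map_sum, LinearMap.sum_apply, map_smul, LinearMap.smul_apply, Matrix.mul_apply,
      Matrix.transpose_apply, Matrix.map_apply, Matrix.of_apply, sum_mul,
      RCLike.real_smul_eq_coe_mul, mul_sum]
    exact sum_congr₂ fun k l => by
      simp only [RCLike.algebraMap_eq_ofReal]; ring
  intro h0
  rw [e, Matrix.det_mul, Matrix.det_mul, h0, mul_zero, zero_mul] at h
  exact h rfl

/-- Nondegeneracy of a bilinear form with values in `𝕜`. -/
def Nondeg (ι : Type*) [Fintype ι] [DecidableEq ι] (B : V →ₗ[ℝ] V →ₗ[ℝ] 𝕜) : Prop :=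
  ∃ b : Module.Basis ι ℝ V, (Matrix.of fun i j => B (b i) (b j)).det ≠ 0

lemma nondeg_iff (B : V →ₗ[ℝ] V →ₗ[ℝ] 𝕜) (b : Module.Basis ι ℝ V) :
    Nondeg ι B ↔ (Matrix.of fun i j => B (b i) (b j)).det ≠ 0 :=
  ⟨fun ⟨b', h⟩ => det_ne_zero_of_basis B b' b h, fun h => ⟨b, h⟩⟩

lemma Nondeg.of_homothety {W : Type*} [AddCommGroup W] [Module ℝ W] {B : V →ₗ[ℝ] V →ₗ[ℝ] 𝕜}
    {B' : W →ₗ[ℝ] W →ₗ[ℝ] 𝕜} (e : V ≃ₗ[ℝ] W) {c : 𝕜} (hc : c ≠ 0)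
    (h : ∀ v w, B' (e v) (e w) = c * B v w) (hB : Nondeg ι B) : Nondeg ι B' := by
  obtain ⟨b, hb⟩ := hB
  refine ⟨b.map e, ?_⟩
  have : (Matrix.of fun i j => B' (b.map e i) (b.map e j)) = c • Matrix.of fun i j => B (b i) (b j) := by
    ext i j; simp [h]
  rw [this, Matrix.det_smul]
  exact mul_ne_zero (pow_ne_zero _ hc) hb

end Nondegenerate

section Metric

variable {n : ℕ} {M : Type*} [TopologicalSpace M] [ChartedSpace (Model n) M] {p q : ℕ}
  {𝕜 : Type*} [RCLike 𝕜] (r : WeylRep n M p q) (A : Acceleration n M)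
  (Q : ∀ x : M, ℝ → Tan n x →ₗ[ℝ] Tan n x →ₗ[ℝ] 𝕜)
  {φ : Chart n M}

/-- The metric `2ρ dt² + 2t dt dρ + t² (Q + 2 𝔸 dρ)`, where `𝔸 = a + ∫_0^ρ ϕ dρ`. -/
def ambMetric : AmbForm 𝕜 n M := fun z => LinearMap.mk₂ ℝ
  (fun v w => ((2 * z.2.2 * v.1 * w.1 + z.1 * (v.1 * w.2.2 + w.1 * v.2.2) +
    z.1 ^ 2 * (connForm r A z.2.1 z.2.2 v.2.1 * w.2.2 + connForm r A z.2.1 z.2.2 w.2.1 * v.2.2) : ℝ)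
      : 𝕜) + (z.1 : 𝕜) ^ 2 * Q z.2.1 z.2.2 v.2.1 w.2.1)
  (fun _ _ _ => by
    simp only [Prod.fst_add, Prod.snd_add, map_add, LinearMap.add_apply]; push_cast; ring)
  (fun _ _ _ => by
    simp only [Prod.smul_fst, Prod.smul_snd, map_smul, LinearMap.smul_apply, smul_eq_mul,
      RCLike.real_smul_eq_coe_mul]
    push_cast; ring)
  (fun _ _ _ => by simp only [Prod.fst_add, Prod.snd_add, map_add]; push_cast; ring)
  (fun _ _ _ => by
    simp only [Prod.smul_fst, Prod.smul_snd, map_smul, smul_eq_mul, RCLike.real_smul_eq_coe_mul]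
    push_cast; ring)

lemma ambMetric_apply (z : ℝ × M × ℝ) (v w : AmbTan n z) : ambMetric r A Q z v w =
    ((2 * z.2.2 * v.1 * w.1 + z.1 * (v.1 * w.2.2 + w.1 * v.2.2) +
      z.1 ^ 2 * (connForm r A z.2.1 z.2.2 v.2.1 * w.2.2 + connForm r A z.2.1 z.2.2 w.2.1 * v.2.2) : ℝ)
      : 𝕜) + (z.1 : 𝕜) ^ 2 * Q z.2.1 z.2.2 v.2.1 w.2.1 := rfl

/-- The components of `Q`. -/
def qComp (φ : Chart n M) (i j : Fin n) (z : Coord n) : 𝕜 :=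
  Q (φ.symm z.2.1) z.2.2 (coordVec φ z.2.1 i) (coordVec φ z.2.1 j)

/-- The components of `ambMetric`. -/
def ambEntry (φ : Chart n M) (z : Coord n) : Idx n → Idx n → 𝕜
  | Sum.inl _, Sum.inl _ => 2 * (z.2.2 : 𝕜)
  | Sum.inl _, Sum.inr (Sum.inl _) => 0
  | Sum.inl _, Sum.inr (Sum.inr _) => (z.1 : 𝕜)
  | Sum.inr (Sum.inl _), Sum.inl _ => 0
  | Sum.inr (Sum.inl i), Sum.inr (Sum.inl j) => (z.1 : 𝕜) ^ 2 * qComp Q φ i j z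
  | Sum.inr (Sum.inl i), Sum.inr (Sum.inr _) => (z.1 : 𝕜) ^ 2 * connComp 𝕜 r A φ i z
  | Sum.inr (Sum.inr _), Sum.inl _ => (z.1 : 𝕜)
  | Sum.inr (Sum.inr _), Sum.inr (Sum.inl j) => (z.1 : 𝕜) ^ 2 * connComp 𝕜 r A φ j z
  | Sum.inr (Sum.inr _), Sum.inr (Sum.inr _) => 0

lemma comps_ambMetric (z : Coord n) (I J : Idx n) :
    comps φ (ambMetric r A Q) z I J = ambEntry r A Q φ z I J := by
  have key : ∀ (x : M) (t ρ τ τ' σ σ' : ℝ) (v w : Tan n x) (α β γ : 𝕜),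
      (connForm r A x ρ v : 𝕜) = α → (connForm r A x ρ w : 𝕜) = β → Q x ρ v w = γ →
      ambMetric r A Q (t, x, ρ) (τ, v, σ) (τ', w, σ') = 2 * (ρ : 𝕜) * τ * τ' + t * (τ * σ' + τ' * σ) +
        (t : 𝕜) ^ 2 * (α * σ' + β * σ + γ) := by
    rintro x t ρ τ τ' σ σ' v w _ _ _ rfl rfl rfl
    rw [ambMetric_apply]
    push_cast
    ring
  have c0 : ((connForm r A (φ.symm z.2.1) z.2.2 0 : ℝ) : 𝕜) = 0 := by simp
  have q0 : ∀ v, Q (φ.symm z.2.1) z.2.2 0 v = 0 := fun v => by simp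
  have q1 : ∀ v, Q (φ.symm z.2.1) z.2.2 v 0 = 0 := fun v => by simp
  rcases I with _ | i | _ <;> rcases J with _ | j | _
  · exact (key _ _ _ _ _ _ _ _ _ _ _ _ c0 c0 (q0 0)).trans (by simp [ambEntry])
  · exact (key _ _ _ _ _ _ _ _ _ _ _ _ c0 rfl (q0 _)).trans (by simp [ambEntry])
  · exact (key _ _ _ _ _ _ _ _ _ _ _ _ c0 c0 (q0 0)).trans (by simp [ambEntry])
  · exact (key _ _ _ _ _ _ _ _ _ _ _ _ rfl c0 (q1 _)).trans (by simp [ambEntry])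
  · exact (key _ _ _ _ _ _ _ _ _ _ _ _ rfl rfl rfl).trans (by simp [ambEntry, qComp])
  · exact (key _ _ _ _ _ _ _ _ _ _ _ _ rfl c0 (q1 _)).trans (by simp [ambEntry, connComp])
  · exact (key _ _ _ _ _ _ _ _ _ _ _ _ c0 c0 (q0 0)).trans (by simp [ambEntry])
  · exact (key _ _ _ _ _ _ _ _ _ _ _ _ c0 rfl (q0 _)).trans (by simp [ambEntry, connComp])
  · exact (key _ _ _ _ _ _ _ _ _ _ _ _ c0 c0 (q0 0)).trans (by simp [ambEntry])

/-- The points where the metric `ambMetric` and the function `U` are nondegenerate. -/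
def goodSet (U : M → ℝ → 𝕜) : Set (M × ℝ) :=
  {w | w ∈ star A.dom ∧ Nondeg (Idx n) (ambMetric r A Q (1, w)) ∧ U w.1 w.2 ≠ 0}

/-- The domain of the metric. -/
def ambDom (U : M → ℝ → 𝕜) : Set (ℝ × M × ℝ) := {z | 0 < z.1 ∧ z.2 ∈ star (goodSet r A Q U)}

lemma nondeg_ambMetric {t : ℝ} (ht : 0 < t) {w : M × ℝ}
    (h : Nondeg (Idx n) (ambMetric r A Q (1, w))) : Nondeg (Idx n) (ambMetric r A Q (t, w)) := by
  refine h.of_homothety (W := AmbTan n (t, w)) (((LinearEquiv.smulOfNeZero ℝ ℝ t ht.ne')).prodCongr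
    (LinearEquiv.refl ℝ (Tan n w.1 × ℝ))) (c := (t : 𝕜) ^ 2)
    (pow_ne_zero 2 (RCLike.ofReal_ne_zero.mpr ht.ne')) fun v w => ?_
  rw [ambMetric_apply, ambMetric_apply]
  simp only [LinearEquiv.prodCongr_apply, LinearEquiv.refl_apply, LinearEquiv.smulOfNeZero_apply,
    smul_eq_mul]
  push_cast
  ring

variable {Q} {U : M → ℝ → 𝕜}
  (hQs : ∀ x ρ v w, Q x ρ v w = Q x ρ w v)
  (hQ : ∀ φ ∈ charts n M, ∀ i j, ContDiffOn ℝ ∞ (fun w : Model n × ℝ =>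
    Q (φ.symm w.1) w.2 (coordVec φ w.1 i) (coordVec φ w.1 j)) {w | w.1 ∈ φ.target})
  (hU : ∀ φ ∈ charts n M, ContDiffOn ℝ ∞ (fun w : Model n × ℝ => U (φ.symm w.1) w.2)
    {w | w.1 ∈ φ.target})
  (hQ0 : ∀ x v w, Q x 0 v w = (r.g x v w : 𝕜)) (hU0 : ∀ x, U x 0 = 1)

include hQ in
lemma contDiffOn_comps_ambMetric (hφ : φ ∈ charts n M) (I J : Idx n) :
    ContDiffOn ℝ ∞ (fun z => comps φ (ambMetric r A Q) z I J) (connOpens A φ) := by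
  have hof : ContDiff ℝ ∞ (RCLike.ofReal : ℝ → 𝕜) := (RCLike.ofRealCLM (K := 𝕜)).contDiff
  have ht : ContDiffOn ℝ ∞ (fun z : Coord n => (z.1 : 𝕜)) (connOpens A φ) :=
    (hof.comp contDiff_fst).contDiffOn
  have hc := contDiffOn_connComp (𝕜 := 𝕜) r A hφ
  simp only [comps_ambMetric]
  rcases I with _ | i | _ <;> rcases J with _ | j | _ <;> simp only [ambEntry]
  · exact contDiffOn_const.mul (hof.comp (contDiff_snd.comp contDiff_snd)).contDiffOn
  · exact contDiffOn_const
  · exact ht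
  · exact contDiffOn_const
  · exact (ht.pow 2).mul ((hQ φ hφ i j).comp contDiffOn_snd fun _ h => h.1)
  · exact (ht.pow 2).mul (hc i)
  · exact ht
  · exact (ht.pow 2).mul (hc j)
  · exact contDiffOn_const

include hQ hU in
lemma isOpen_goodSet [IsManifold 𝓘(ℝ, Model n) ∞ M] : IsOpen (goodSet r A Q U) := by
  rw [isOpen_iff_eventually]
  rintro ⟨x, ρ⟩ ⟨hst, hnd, hu⟩
  set φ := chartAt (Model n) x
  have hφ : φ ∈ charts n M := chartAt_mem_charts x
  have hx : x ∈ φ.source := mem_chart_source _ x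
  have hpt : ∀ x' ∈ φ.source, ∀ ρ' : ℝ, ambPoint φ (1, φ x', ρ') = (1, x', ρ') := fun x' h ρ' => by
    rw [ambPoint, φ.left_inv h]
  have hcong : ∀ {z z' : ℝ × M × ℝ}, z = z' → (Nondeg (Idx n) (ambMetric r A Q z) ↔
      Nondeg (Idx n) (ambMetric r A Q z')) := by rintro _ _ rfl; rfl
  have hdet : ∀ x' ∈ φ.source, ∀ ρ' : ℝ, Nondeg (Idx n) (ambMetric r A Q (1, x', ρ')) ↔
      (comps φ (ambMetric r A Q) (1, φ x', ρ')).det ≠ 0 := fun x' h ρ' => by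
    rw [← hcong (hpt x' h ρ'), nondeg_iff _ (ambBasis hφ (z := (1, φ x', ρ')) (φ.map_source h))]
    simp only [ambBasis_apply]
    rfl
  have hcφ : ContinuousAt (fun w : M × ℝ => (φ w.1, w.2)) (x, ρ) :=
    ((φ.continuousAt hx).comp continuousAt_fst).prodMk continuousAt_snd
  have hmem : ((1, φ x, ρ) : Coord n) ∈ connOpens A φ :=
    ⟨φ.map_source hx, by rw [φ.left_inv hx]; exact hst⟩
  have hcd : ContinuousAt (fun w : M × ℝ => (comps φ (ambMetric r A Q) (1, φ w.1, w.2)).det)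
      (x, ρ) := by
    have h1 : ContinuousAt (fun z => (comps φ (ambMetric r A Q) z).det) (1, φ x, ρ) := by
      have : ContinuousAt (fun z => comps φ (ambMetric r A Q) z) (1, φ x, ρ) :=
        continuousAt_pi.mpr fun I => continuousAt_pi.mpr fun J =>
          (contDiffOn_comps_ambMetric r A hQ hφ I J).continuousOn.continuousAt
            ((connOpens A φ).isOpen.mem_nhds hmem)
      exact (continuous_id.matrix_det.continuousAt).comp this
    exact ContinuousAt.comp (f := fun w : M × ℝ => ((1, φ w.1, w.2) : Coord n)) h1
      (continuousAt_const.prodMk hcφ)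
  have hcu : ContinuousAt (fun w : M × ℝ => U (φ.symm (φ w.1)) w.2) (x, ρ) :=
    ContinuousAt.comp (f := fun w : M × ℝ => (φ w.1, w.2)) ((hU φ hφ).continuousOn.continuousAt
      ((φ.open_target.preimage continuous_fst).mem_nhds (φ.map_source hx))) hcφ
  filter_upwards [(isOpen_star A.isOpen_dom).eventually_mem hst,
    (φ.open_source.preimage continuous_fst).eventually_mem hx,
    hcd.eventually_ne ((hdet x hx ρ).mp hnd),
    hcu.eventually_ne (by simpa [φ.left_inv hx] using hu)] with w h1 h2 h3 h4
  exact ⟨h1, (hdet w.1 h2 w.2).mpr h3, by rwa [φ.left_inv h2] at h4⟩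

include hQ0 hU0 in
lemma zero_mem_goodSet [IsManifold 𝓘(ℝ, Model n) ∞ M] (x : M) : (x, (0 : ℝ)) ∈ goodSet r A Q U := by
  refine ⟨zero_mem_star (A.zero_mem x), ?_, by simp [hU0]⟩
  obtain ⟨φ, hφ, y, hy, rfl⟩ : ∃ φ ∈ charts n M, ∃ y ∈ φ.target, φ.symm y = x :=
    ⟨chartAt _ x, chartAt_mem_charts x, chartAt _ x x, mem_chart_target _ x,
      (chartAt _ x).left_inv (mem_chart_source _ x)⟩
  refine (nondeg_iff _ (ambBasis hφ (z := (1, y, 0)) hy)).mpr ?_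
  simp only [ambBasis_apply]
  intro h0
  obtain ⟨c, hc, e⟩ := Matrix.exists_mulVec_eq_zero_iff.mpr
    (show (comps φ (ambMetric r A Q) (1, y, 0)).det = 0 from h0)
  have e' : ∀ I, ∑ J, ambEntry r A Q φ (1, y, 0) I J * c J = 0 := fun I => by
    have := congrFun e I
    simpa only [Matrix.mulVec, dotProduct, comps_ambMetric, Pi.zero_apply] using this
  simp only [Fintype.sum_sum_type, Finset.univ_unique, Finset.sum_singleton] at e'
  have c1 : c (idxInf n) = 0 := by simpa [ambEntry] using e' (idx0 n)
  have c2 : (fun j => c (idxM j)) = 0 := by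
    by_contra hne
    refine det_gComp (𝕜 := 𝕜) r hφ hy (Matrix.exists_mulVec_eq_zero_iff.mp ⟨_, hne, ?_⟩)
    funext i
    have := e' (idxM i)
    simpa [ambEntry, qComp, hQ0, c1, Matrix.mulVec, dotProduct, gComp] using this
  have c3 : c (idx0 n) = 0 := by
    have := e' (idxInf n)
    simpa [ambEntry, fun j => congrFun c2 j] using this
  refine hc (funext fun I => ?_)
  rcases I with _ | i | _
  · exact c3
  · exact congrFun c2 i
  · exact c1

lemma chartDomain_ambDom_subset {z : Coord n} (hz : z ∈ chartDomain φ (ambDom r A Q U)) :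
    z ∈ connOpens A φ := ⟨hz.1, (star_subset hz.2.2).1⟩

lemma det_comps_ambMetric (hφ : φ ∈ charts n M) {z : Coord n}
    (hz : z ∈ chartDomain φ (ambDom r A Q U)) : (comps φ (ambMetric r A Q) z).det ≠ 0 := by
  have := (nondeg_iff _ (ambBasis hφ hz.1)).mp (nondeg_ambMetric r A Q hz.2.1 (star_subset hz.2.2).2.1)
  simp only [ambBasis_apply] at this
  exact this

include hQ hU hQ0 hU0 in
lemma isAmbientDomain_ambDom [IsManifold 𝓘(ℝ, Model n) ∞ M] :
    IsAmbientDomain (ambDom r A Q U) where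
  isOpen := (isOpen_lt continuous_const continuous_fst).inter
    ((isOpen_star (isOpen_goodSet r A hQ hU)).preimage continuous_snd)
  pos _ hz := hz.1
  zero_mem _ ht x := ⟨ht, zero_mem_star (zero_mem_goodSet r A hQ0 hU0 x)⟩
  dilatation _ hs _ hz := ⟨mul_pos hs hz.1, hz.2⟩

lemma connForm_zero (x : M) : connForm r A x 0 = r.a x := by simp [connForm]

include hQ0 in
lemma isWeylNormal_ambMetric : IsWeylNormal r A (ambDom r A Q U) (ambMetric r A Q) := by
  have hz0 : ∀ (I : Idx n) (z : Coord n), pd I (fun _ => (0 : 𝕜)) z = 0 := fun I z => by simp [pd]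
  have acc : ∀ φ ∈ charts n M, ∀ z ∈ chartDomain φ (ambDom r A Q U), ∀ I,
      accelLow (comps φ (ambMetric r A Q)) I z =
        pd (idxInf n) (fun w => ambEntry r A Q φ w (idxInf n) I) z := fun φ hφ z hz I => by
    rw [accelLow_eq (det_comps_ambMetric r A hφ hz)]
    simp only [comps_ambMetric]
    rw [show (fun w => ambEntry r A Q φ w (idxInf n) (idxInf n)) = fun _ => 0 from rfl, hz0, mul_zero,
      sub_zero]
  refine ⟨fun t ht x => ?_, fun z hz => star_subset (star_subset hz.2).1, fun φ hφ z hz => ?_,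
    fun φ hφ z hz => ?_, fun φ hφ z hz i => ?_, fun t ht x τ τ' σ σ' v v' => ?_⟩
  · have := ordConnected_star (goodSet r A Q U) x
    simpa only [ambDom, Set.mem_ofPred_eq, ht, true_and] using this
  · rw [acc φ hφ z hz]
    refine mul_eq_zero_of_right _ (apply_eq_zero_of_hasFDerivAt (DifferentiableAt.hasFDerivAt ?_)
      fun s => ?_)
    · exact ((RCLike.ofRealCLM (K := 𝕜)).differentiable.comp differentiable_fst).differentiableAt
    · simp [ambEntry, basisVec]
  · rw [acc φ hφ z hz]
    exact hz0 _ _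
  · rw [acc φ hφ z hz]
    have hc := chartDomain_ambDom_subset r A hz
    obtain ⟨t, y, ρ⟩ := z
    have hd := ((contDiffOn_connComp (𝕜 := 𝕜) r A hφ i).contDiffAt
      ((connOpens A φ).isOpen.mem_nhds hc)).differentiableAt (by simp)
    have hd' : DifferentiableAt ℝ (fun w => ambEntry r A Q φ w (idxInf n) (idxM i)) (t, y, ρ) :=
      (((RCLike.ofRealCLM (K := 𝕜)).differentiable.comp differentiable_fst).differentiableAt.pow 2).mul hd
    rw [← deriv_comp_rho hd']
    have h1 := ((RCLike.ofRealCLM (K := 𝕜)).hasFDerivAt.comp_hasDerivAt ρ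
      (hasDerivAt_connForm r A hφ (w := (y, ρ)) hc i)).const_mul ((t : 𝕜) ^ 2)
    refine h1.deriv.trans ?_
    push_cast
    rfl
  · rw [ambMetric_apply]
    simp only [hQ0, connForm_zero]
    rw [← RCLike.ofReal_pow, ← RCLike.ofReal_mul, ← RCLike.ofReal_add]
    congr 1
    field_simp
    ring

end Metric

end

section

/-! ### Existence in formal dimension `d` -/

section Taylor

variable {n : ℕ} {𝕜 : Type*} [RCLike 𝕜] {V : Opens (Model n)} {Ω : Opens (Coord n)}

lemma tay_eq_of_iteratedDeriv (h : LiesOver V Ω) {f : SmoothFun 𝕜 Ω} {F : Coord n → 𝕜} (hf : f.Rep F)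
    {P : (SmoothFun 𝕜 (baseSet V))⟦X⟧} (h0 : liftD (base 𝕜 V).d0 P = 0)
    (hc : ∀ t, ∀ y ∈ V, ∀ m, iteratedDeriv m (fun ρ => F (t, y, ρ)) 0
      = m.factorial * (coeff m P).rep (1, y)) : tay h f = P := by
  ext m
  refine (rep_coeff_tay h hf m).ext (SmoothFun.rep_rep _) fun p hp => ?_
  have h1 : (base 𝕜 V).d0 (coeff m P) = 0 := by rw [← coeff_liftD, h0, map_zero]
  rw [hc p.1 p.2 hp.2 m, show (coeff m P).rep p = _ from rep_eq_of_d0_eq_zero h1 hp.1 hp.2, ← mul_assoc,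
    inv_mul_cancel₀ (Nat.cast_ne_zero.mpr m.factorial_ne_zero), one_mul]

lemma contDiff_rho : ContDiff ℝ ∞ fun z : Coord n => (z.2.2 : 𝕜) :=
  (RCLike.ofRealCLM (K := 𝕜)).contDiff.comp (contDiff_snd.comp contDiff_snd)

lemma tay_rho (h : LiesOver V Ω) {f : SmoothFun 𝕜 Ω} (hf : f.Rep fun z => (z.2.2 : 𝕜)) :
    tay h f = X := by
  have h1 : derivX 𝕜 _ (tay h f - X) = 0 := by
    rw [map_sub, ← AmbBase.D_inf (base 𝕜 V), base_D_tay, AmbBase.D_inf, derivX_X,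
      ← map_one (tay h), ← map_sub, ← map_zero (tay h)]
    refine congrArg _ (sub_eq_zero.mpr ((hf.ambD _).ext SmoothFun.rep_one fun z _ => ?_))
    obtain ⟨t, y, ρ⟩ := z
    rw [← deriv_comp_rho (contDiff_rho.differentiable (by simp)).differentiableAt]
    exact (RCLike.ofRealCLM (K := 𝕜)).hasDerivAt.deriv.trans (by simp)
  have h2 := eq_C_of_derivX_eq_zero h1
  have h3 : constantCoeff (tay h f) = 0 :=
    (rep_constantCoeff_tay h hf).ext SmoothFun.rep_zero fun _ _ => by simp
  rw [map_sub, h3, constantCoeff_X, sub_zero, map_zero] at h2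
  exact sub_eq_zero.mp h2

end Taylor

section Existence

variable {n : ℕ} {M : Type*} [TopologicalSpace M] [ChartedSpace (Model n) M] {p q : ℕ}
  {𝕜 : Type*} [RCLike 𝕜] (r : WeylRep n M p q) (A : Acceleration n M)
  {φ : Chart n M} {Q : ∀ x : M, ℝ → Tan n x →ₗ[ℝ] Tan n x →ₗ[ℝ] 𝕜}
  {U : M → ℝ → 𝕜}

/-- Curvature of a metric whose Taylor coefficients are those of a formal solution. -/
lemma ricciFlat_of_formalSolution (hφ : φ ∈ charts n M) {D : Set (ℝ × M × ℝ)} (hD : IsAmbientDomain D)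
    (hDc : ∀ z ∈ chartDomain φ D, z ∈ connOpens A φ)
    (hs : ∀ z v w, ambMetric r A Q z v w = ambMetric r A Q z w v)
    (hQ : ∀ i j, ContDiffOn ℝ ∞ (qComp Q φ i j) (chartDomain φ D))
    (hU : ContDiffOn ℝ ∞ (fun z : Coord n => U (φ.symm z.2.1) z.2.2) (chartDomain φ D))
    (hG : ∀ I J, ContDiffOn ℝ ∞ (fun z => comps φ (ambMetric r A Q) z I J) (chartDomain φ D))
    (hdet : ∀ z ∈ chartDomain φ D, (comps φ (ambMetric r A Q) z).det ≠ 0)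
    (hU0 : ∀ z ∈ chartDomain φ D, U (φ.symm z.2.1) z.2.2 ≠ 0) {d : 𝕜} {gi qq u}
    (h : IsFormalSolution (base 𝕜 (targetOpens φ)) d (gMat 𝕜 r hφ) gi (connSeries r A hφ 𝕜) qq u)
    (hq : ∀ y ∈ φ.target, ∀ m i j, iteratedDeriv m (fun ρ =>
      Q (φ.symm y) ρ (coordVec φ y i) (coordVec φ y j)) 0
        = m.factorial * (coeff m (qq i j)).rep (1, y))
    (hu : ∀ y ∈ φ.target, ∀ m, iteratedDeriv m (U (φ.symm y)) 0 = m.factorial * (coeff m u).rep (1, y)) :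
    (∀ I J, ∀ w ∈ baseSet (targetOpens φ), VanishesToInfiniteOrder
      (formalRicci d (comps φ (ambMetric r A Q)) (fun z => z.1 * U (φ.symm z.2.1) z.2.2) I J)
        (w.1, w.2, 0)) ∧
    ∀ w ∈ baseSet (targetOpens φ), VanishesToInfiniteOrder
      (formalRicciFlat d (comps φ (ambMetric r A Q)) (fun z => z.1 * U (φ.symm z.2.1) z.2.2))
        (w.1, w.2, 0) := by
  have hL : LiesOver (targetOpens φ) (chartOpens φ hD.isOpen) := fun w hw =>
    ⟨hw.2, hD.zero_mem w.1 hw.1 _⟩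
  set Ω := chartOpens φ hD.isOpen
  set T := ambT 𝕜 Ω
  have rT : T.Rep fun z => (z.1 : 𝕜) := rep_ambT
  set ρR : SmoothFun 𝕜 Ω := SmoothFun.mk _ contDiff_rho.contDiffOn
  have rρ : ρR.Rep fun z => (z.2.2 : 𝕜) := SmoothFun.rep_mk _ _
  set qR : Fin n → Fin n → SmoothFun 𝕜 Ω := fun i j => SmoothFun.mk _ (hQ i j)
  have rq : ∀ i j, (qR i j).Rep (qComp Q φ i j) := fun i j => SmoothFun.rep_mk _ _
  set αR : Fin n → SmoothFun 𝕜 Ω := fun i => SmoothFun.mk (connComp 𝕜 r A φ i)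
    ((contDiffOn_connComp r A hφ i).mono hDc)
  have rα : ∀ i, (αR i).Rep (connComp 𝕜 r A φ i) := fun i => SmoothFun.rep_mk _ _
  set uR : SmoothFun 𝕜 Ω := SmoothFun.mk _ hU
  have ru : uR.Rep fun z => U (φ.symm z.2.1) z.2.2 := SmoothFun.rep_mk _ _
  have tq : ∀ i j, tay hL (qR i j) = qq i j := fun i j =>
    tay_eq_of_iteratedDeriv hL (rq i j) (h.seed.d0 i j) fun t y hy m => hq y hy m i j
  have tu : tay hL uR = u := tay_eq_of_iteratedDeriv hL ru h.seed.d0_u fun t y hy m => hu y hy m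
  have tα : ∀ i, tay hL (αR i) = connSeries r A hφ 𝕜 i := fun i => by
    ext m
    exact (rep_coeff_tay hL (rα i) m).ext (rep_coeff_connSeries r A hφ m i) fun _ _ => rfl
  set GR : AmbMat n (SmoothFun 𝕜 Ω) := Matrix.of fun I J => SmoothFun.mk _ (hG I J)
  have rG : ∀ I J, (GR I J).Rep fun z => comps φ (ambMetric r A Q) z I J := fun I J =>
    SmoothFun.rep_mk (Ω := Ω) (fun z => comps φ (ambMetric r A Q) z I J) (hG I J)
  have rF : (T * uR).Rep fun z => z.1 * U (φ.symm z.2.1) z.2.2 := rT.mul ru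
  obtain ⟨Gi, Γ, v, hinv, hlc, hv, hR, hS⟩ := exists_taylor_curvature hL rG
    (fun z _ I J => hs _ _ _) hdet rF fun z hz =>
      mul_ne_zero (RCLike.ofReal_ne_zero.mpr (hD.pos _ hz.2).ne') (hU0 z hz)
  have eG : ∀ {I J} {x : SmoothFun 𝕜 Ω}, x.Rep (fun z => ambEntry r A Q φ z I J) → GR I J = x :=
    fun {I J x} hx => (rG I J).ext hx fun z _ => comps_ambMetric r A Q z I J
  have hnorm : GR.map (tay hL) = (base 𝕜 (targetOpens φ)).normalG (2 * X) 0 qq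
      (connSeries r A hφ 𝕜) := by
    have r2 : (2 * ρR).Rep fun z => 2 * (z.2.2 : 𝕜) := by
      rw [two_mul]
      exact (rρ.add rρ).congr fun z _ => (two_mul _).symm
    ext1 I J
    rw [Matrix.map_apply]
    rcases I with _ | i | _ <;> rcases J with _ | j | _
    · rw [eG r2, map_mul, map_ofNat, tay_rho hL rρ]; rfl
    · rw [eG SmoothFun.rep_zero, map_zero, AmbBase.normalG_0M, Pi.zero_apply, mul_zero]
    · rw [eG rT, tay_ambT]; rfl
    · rw [eG SmoothFun.rep_zero, map_zero, AmbBase.normalG_M0, Pi.zero_apply, mul_zero]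
    · rw [eG ((rT.pow 2).mul (rq i j)), map_mul, map_pow, tay_ambT, tq]; rfl
    · rw [eG ((rT.pow 2).mul (rα i)), map_mul, map_pow, tay_ambT, tα]; rfl
    · rw [eG rT, tay_ambT]; rfl
    · rw [eG ((rT.pow 2).mul (rα j)), map_mul, map_pow, tay_ambT, tα]; rfl
    · rw [eG SmoothFun.rep_zero, map_zero]; rfl
  rw [map_mul, tay_ambT, tu] at hv hR hS
  rw [hnorm] at hinv hlc
  obtain ⟨Gi', Γ', v', hn, hv', hE, hF⟩ := h.flat
  obtain rfl : Γ' = Γ := hn.lc.unique (isUnit_two_of_field 𝕜) hn.inv hlc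
  obtain rfl : Gi' = Gi := by
    rw [← one_mul Gi, ← hn.inv', mul_assoc, hinv, mul_one]
  obtain rfl : v' = v := by
    rw [← one_mul v, ← hv', mul_comm _ v', mul_assoc, hv, mul_one]
  exact ⟨fun I J => (hR d I J).mp (hE I J), (hS d).mp hF⟩

variable [T2Space M] [SigmaCompactSpace M] [IsManifold 𝓘(ℝ, Model n) ∞ M]

theorem exists_formalAmbient {d : 𝕜} (hd1 : d ≠ 1) (hd : ∀ m : ℕ, d ≠ 2 * m) :
    ∃ (D : Set (ℝ × M × ℝ)) (G : AmbForm 𝕜 n M) (f : ℝ × M × ℝ → 𝕜),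
      IsFormalWeylAmbient r d D G f ∧ IsWeylNormal r A D G := by
  classical
  choose gi qq u hs using fun (φ : Chart n M) (hφ : φ ∈ charts n M) =>
    exists_formalSolution (𝕜 := 𝕜) r A hφ hd1 hd
  have hrep : ∀ (φ : Chart n M)
      (x : SmoothFun 𝕜 (baseSet (targetOpens φ))), ContDiffOn ℝ ∞ (fun y => x.rep (1, y)) φ.target :=
    fun φ x => x.contDiffOn_rep.comp (contDiff_prodMk_right 1).contDiffOn fun y hy => ⟨one_pos, hy⟩
  obtain ⟨Q, U, hQs, hQU⟩ := exists_tensor_of_coeffs (n := n) (M := M) (𝕜 := 𝕜)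
    (fun φ m y i j => if hφ : φ ∈ charts n M then (coeff m (qq φ hφ i j)).rep (1, y) else 0)
    (fun φ m y => if hφ : φ ∈ charts n M then (coeff m (u φ hφ)).rep (1, y) else 0)
    (fun φ hφ m i j => by simp only [dif_pos hφ]; exact hrep φ _)
    (fun φ hφ m => by simp only [dif_pos hφ]; exact hrep φ _)
    (fun φ hφ y hy m i j => by simp only [dif_pos hφ]; rw [(hs φ hφ).seed.symm])
    (fun φ hφ ψ hψ y hy m i j => by
      simp only [dif_pos hφ, dif_pos hψ]
      exact (formalSolution_transform r A hφ hψ hd1 hd (hs φ hφ) (hs ψ hψ) hy m).1 i j)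
    (fun φ hφ ψ hψ y hy m => by
      simp only [dif_pos hφ, dif_pos hψ]
      exact (formalSolution_transform r A hφ hψ hd1 hd (hs φ hφ) (hs ψ hψ) hy m).2)
  have hQ := fun φ hφ => (hQU φ hφ).1
  have hU := fun φ hφ => (hQU φ hφ).2.1
  have hq : ∀ φ (hφ : φ ∈ charts n M), ∀ y ∈ φ.target, ∀ m i j, iteratedDeriv m (fun ρ =>
      Q (φ.symm y) ρ (coordVec φ y i) (coordVec φ y j)) 0
        = m.factorial * (coeff m (qq φ hφ i j)).rep (1, y) := fun φ hφ y hy m i j => by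
    rw [((hQU φ hφ).2.2 y hy m).1 i j, dif_pos hφ]
  have hu : ∀ φ (hφ : φ ∈ charts n M), ∀ y ∈ φ.target, ∀ m, iteratedDeriv m (U (φ.symm y)) 0
      = m.factorial * (coeff m (u φ hφ)).rep (1, y) := fun φ hφ y hy m => by
    rw [((hQU φ hφ).2.2 y hy m).2, dif_pos hφ]
  have hx : ∀ x : M, ∃ φ ∈ charts n M, ∃ y ∈ φ.target, φ.symm y = x := fun x =>
    ⟨chartAt _ x, chartAt_mem_charts x, chartAt _ x x, mem_chart_target _ x,
      (chartAt _ x).left_inv (mem_chart_source _ x)⟩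
  have hQ0 : ∀ x v w, Q x 0 v w = (r.g x v w : 𝕜) := fun x v w => by
    obtain ⟨φ, hφ, y, hy, rfl⟩ := hx x
    have e : Q (φ.symm y) 0 = (r.g (φ.symm y)).compr₂ (RCLike.ofRealAm (K := 𝕜)).toLinearMap := by
      refine LinearMap.ext_basis (coordBasis hφ hy) (coordBasis hφ hy) fun i j => ?_
      rw [coordBasis_apply, coordBasis_apply]
      have h1 := hq φ hφ y hy 0 i j
      rw [iteratedDeriv_zero, coeff_zero_eq_constantCoeff_apply, (hs φ hφ).seed.cc,
        Nat.factorial_zero, Nat.cast_one, one_mul] at h1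
      exact h1.trans ((SmoothFun.rep_rep _).eqOn (rep_gMat r hφ i j) ⟨one_pos, hy⟩)
    rw [e]; rfl
  have hU0 : ∀ x, U x 0 = 1 := fun x => by
    obtain ⟨φ, hφ, y, hy, rfl⟩ := hx x
    have h1 := hu φ hφ y hy 0
    rw [iteratedDeriv_zero, coeff_zero_eq_constantCoeff_apply, (hs φ hφ).seed.cc_u,
      Nat.factorial_zero, Nat.cast_one, one_mul] at h1
    exact h1.trans ((SmoothFun.rep_rep _).eqOn SmoothFun.rep_one ⟨one_pos, hy⟩)
  have hD := isAmbientDomain_ambDom r A hQ hU hQ0 hU0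
  have hN := isWeylNormal_ambMetric (U := U) r A hQ0
  have hsymm : ∀ z v w, ambMetric r A Q z v w = ambMetric r A Q z w v := fun z v w => by
    rw [ambMetric_apply, ambMetric_apply, hQs _ _ v.2.1]
    congr 2
    ring
  have hG : ∀ φ ∈ charts n M, ∀ I J, ContDiffOn ℝ ∞ (fun z => comps φ (ambMetric r A Q) z I J)
      (chartDomain φ (ambDom r A Q U)) := fun φ hφ I J =>
    (contDiffOn_comps_ambMetric r A hQ hφ I J).mono fun z hz => chartDomain_ambDom_subset r A hz
  have hUc : ∀ φ ∈ charts n M, ContDiffOn ℝ ∞ (fun z : Coord n => U (φ.symm z.2.1) z.2.2)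
      (chartDomain φ (ambDom r A Q U)) := fun φ hφ =>
    (hU φ hφ).comp contDiffOn_snd fun z hz => hz.1
  have hflat := fun φ hφ => ricciFlat_of_formalSolution r A hφ hD
    (fun z hz => chartDomain_ambDom_subset r A hz) hsymm
    (fun i j => (hQ φ hφ i j).comp contDiffOn_snd fun z hz => hz.1) (hUc φ hφ) (hG φ hφ)
    (fun z hz => det_comps_ambMetric r A hφ hz) (fun z hz => (star_subset hz.2.2).2.2) (hs φ hφ)
    (hq φ hφ) (hu φ hφ)
  refine ⟨ambDom r A Q U, ambMetric r A Q, fun z => z.1 * U z.2.1 z.2.2, ?_, hN⟩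
  exact
  { domain := hD
    tautological := fun t ht x τ τ' v v' => by rw [hN.initial t ht]; simp
    tautological_flat := fun t _ x => by simp [hU0]
    smooth := hG
    smooth_flat := fun φ hφ =>
      ((RCLike.ofRealCLM (K := 𝕜)).contDiff.comp contDiff_fst).contDiffOn.mul (hUc φ hφ)
    symm := fun z _ => hsymm z
    nondegenerate := fun φ hφ z hz => det_comps_ambMetric r A hφ hz
    nondegenerate_flat := fun z hz =>
      mul_ne_zero (RCLike.ofReal_ne_zero.mpr hz.1.ne') (star_subset hz.2).2.2
    homogeneous := fun s hs t x ρ _ τ τ' σ σ' v v' => by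
      rw [ambMetric_apply, ambMetric_apply]
      push_cast
      ring
    homogeneous_flat := fun s hs z _ => by push_cast; ring
    ricciFlat := fun φ hφ t ht y hy I J => (hflat φ hφ).1 I J (t, y) ⟨ht, hy⟩
    ricciFlat_flat := fun φ hφ t ht y hy => (hflat φ hφ).2 (t, y) ⟨ht, hy⟩ }

end Existence

end

section

open LinearMap.BilinMap (toQuadraticMap toQuadraticMap_apply)

/-! ### The signature of the ambient metric -/

section Signature

variable {V : Type*} [AddCommGroup V] [Module ℝ V] [FiniteDimensional ℝ V]

lemma finrank_le_sigPos {W : Type*} [AddCommGroup W] [Module ℝ W] {Q : QuadraticForm ℝ V}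
    (L : W →ₗ[ℝ] V) (hL : ∀ w, w ≠ 0 → 0 < Q (L w)) : Module.finrank ℝ W ≤ sigPos Q := by
  have hi : Function.Injective L := by
    rw [injective_iff_map_eq_zero]
    intro w hw
    by_contra h
    simpa [hw] using hL w h
  rw [← LinearMap.finrank_range_of_inj hi]
  refine le_sigPos_of_posDef Q ?_
  rintro ⟨_, w, rfl⟩ hw
  exact hL w fun h => hw (by simp [h])

variable {T : Type*} [TopologicalSpace T] {B : T → V →ₗ[ℝ] V →ₗ[ℝ] ℝ}

lemma eventually_sigPos_le (hB : ∀ v w, Continuous fun s => B s v w) (s₀ : T) :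
    ∀ᶠ s in nhds s₀, sigPos (toQuadraticMap (B s₀)) ≤
      sigPos (toQuadraticMap (B s)) := by
  obtain ⟨W, hW, hpos⟩ := exists_finrank_eq_sigPos_and_posDef
    (toQuadraticMap (B s₀))
  set b := Module.finBasis ℝ W
  set L : (Fin (Module.finrank ℝ W) → ℝ) →ₗ[ℝ] V := W.subtype ∘ₗ b.equivFun.symm.toLinearMap
  have hF : Continuous fun z : T × (Fin (Module.finrank ℝ W) → ℝ) => B z.1 (L z.2) (L z.2) := by
    have e : ∀ z : T × (Fin (Module.finrank ℝ W) → ℝ), B z.1 (L z.2) (L z.2)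
        = ∑ j, ∑ i, z.2 j * (z.2 i * B z.1 (b i) (b j)) := fun z => by
      simp [L, Module.Basis.equivFun_symm_apply, mul_sum]
    simp only [e]
    exact continuous_finsetSum _ fun j _ => continuous_finsetSum _ fun i _ =>
      ((continuous_apply j).comp continuous_snd).mul (((continuous_apply i).comp continuous_snd).mul
        ((hB (b i) (b j)).comp continuous_fst))
  have hev : ∀ᶠ s in nhds s₀, ∀ c ∈ Metric.sphere (0 : Fin (Module.finrank ℝ W) → ℝ) 1,
      0 < B s (L c) (L c) := by
    refine (isCompact_sphere _ _).eventually_forall_of_forall_eventually fun c hc => ?_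
    refine hF.continuousAt.eventually (lt_mem_nhds ?_)
    refine hpos (b.equivFun.symm c) fun h => ?_
    rw [LinearEquiv.map_eq_zero_iff] at h
    simp [h] at hc
  filter_upwards [hev] with s hs
  rw [← hW, ← Module.finrank_fin_fun ℝ (n := Module.finrank ℝ W)]
  refine finrank_le_sigPos L fun c hc => ?_
  have h1 := hs (‖c‖⁻¹ • c) (by simp [norm_smul, hc])
  have h2 : 0 < ‖c‖⁻¹ * (‖c‖⁻¹ * B s (L c) (L c)) := by simpa using h1
  have h3 := inv_pos.mpr (norm_pos_iff.mpr hc)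
  exact pos_of_mul_pos_right (pos_of_mul_pos_right h2 h3.le) h3.le

lemma sigPos_add_sigNeg {B : V →ₗ[ℝ] V →ₗ[ℝ] ℝ} (hs : ∀ v w, B v w = B w v)
    (hnd : ∀ v, (∀ w, B v w = 0) → v = 0) :
    sigPos (toQuadraticMap B) + sigNeg (toQuadraticMap B)
      = Module.finrank ℝ V := by
  rw [← QuadraticForm.sigPos_add_sigNeg_add_radical (Q := toQuadraticMap B),
    left_eq_add, Submodule.finrank_eq_zero, Submodule.eq_bot_iff]
  rintro v ⟨-, hv⟩
  refine hnd v fun w => ?_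
  have h1 : QuadraticMap.polar (toQuadraticMap B) v w = 0 :=
    congrArg (fun T => T w) hv
  rw [LinearMap.BilinMap.polar_toQuadraticMap, hs w v] at h1
  linarith

lemma HasSignature.of_family [PreconnectedSpace T] (hB : ∀ v w, Continuous fun s => B s v w)
    (hs : ∀ s v w, B s v w = B s w v) (hnd : ∀ s v, (∀ w, B s v w = 0) → v = 0) {p q : ℕ} {s₀ : T}
    (h : HasSignature (B s₀) p q) (s : T) : HasSignature (B s) p q := by
  have hn : ∀ s, toQuadraticMap (-B s) = -toQuadraticMap (B s) :=
    fun s => by ext v; simp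
  have hsum := fun s => sigPos_add_sigNeg (hs s) (hnd s)
  have hloc : IsLocallyConstant fun s => sigPos (toQuadraticMap (B s)) := by
    rw [IsLocallyConstant.iff_eventually_eq]
    intro s₁
    filter_upwards [eventually_sigPos_le hB s₁, eventually_sigPos_le (B := fun s => -B s)
      (fun v w => (hB v w).neg) s₁] with s h1 h2
    rw [hn, hn, sigPos_neg, sigPos_neg] at h2
    have := hsum s
    have := hsum s₁
    omega
  have e := hloc.apply_eq_of_preconnectedSpace s s₀
  have := hsum s
  have := hsum s₀
  have h1 := h.pos
  have h2 := h.neg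
  exact ⟨hs s, h.finrank_eq, by omega, by omega⟩

end Signature

section Ambient

variable {n : ℕ} {M : Type*} [TopologicalSpace M] [ChartedSpace (Model n) M] {p q : ℕ}
  {r : WeylRep n M p q} {A : Acceleration n M}

lemma hasSignature_initial {x : M} {t : ℝ} (ht : 0 < t)
    {B : (ℝ × Tan n x × ℝ) →ₗ[ℝ] (ℝ × Tan n x × ℝ) →ₗ[ℝ] ℝ}
    (h : ∀ v w, B v w = t ^ 2 * r.g x v.2.1 w.2.1 +
      t ^ 2 * ((t⁻¹ * v.1 + r.a x v.2.1) * w.2.2 + (t⁻¹ * w.1 + r.a x w.2.1) * v.2.2)) :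
    HasSignature B (p + 1) (q + 1) := by
  have hfr : Module.finrank ℝ (ℝ × Tan n x × ℝ) = (p + 1) + (q + 1) := by
    rw [Module.finrank_prod, Module.finrank_prod, Module.finrank_self, (r.signature x).finrank_eq]
    ring
  set g := toQuadraticMap (r.g x)
  have hlift : ∀ (W : Submodule ℝ (Tan n x)) (ε : ℝ), ∃ L : (ℝ × W) →ₗ[ℝ] (ℝ × Tan n x × ℝ),
      ∀ w, B (L w) (L w) = t ^ 2 * (g w.2 + 2 * ε * w.1 ^ 2) := fun W ε => by
    refine ⟨((t • (LinearMap.fst ℝ ℝ W - r.a x ∘ₗ W.subtype ∘ₗ LinearMap.snd ℝ ℝ W))).prod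
      ((W.subtype ∘ₗ LinearMap.snd ℝ ℝ W).prod (ε • LinearMap.fst ℝ ℝ W)), fun w => ?_⟩
    rw [h]
    simp only [LinearMap.prod_apply, Function.prod_apply, LinearMap.smul_apply, LinearMap.sub_apply,
      LinearMap.comp_apply, LinearMap.fst_apply, LinearMap.snd_apply, Submodule.subtype_apply,
      smul_eq_mul, g, toQuadraticMap_apply]
    field_simp
    ring
  have hge : ∀ (ε : ℝ) (W : Submodule ℝ (Tan n x)), ε ^ 2 = 1 → (∀ w : W, w ≠ 0 → 0 < ε * g w) →
      Module.finrank ℝ W + 1 ≤ sigPos (ε • toQuadraticMap B) := by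
    intro ε W hε hW
    obtain ⟨L, hL⟩ := hlift W ε
    have e : Module.finrank ℝ (ℝ × W) = Module.finrank ℝ W + 1 := by
      rw [Module.finrank_prod, Module.finrank_self, add_comm]
    rw [← e]
    refine finrank_le_sigPos L fun w hw => ?_
    rw [smul_apply, toQuadraticMap_apply, hL, smul_eq_mul]
    have e2 : ε * (t ^ 2 * (g w.2 + 2 * ε * w.1 ^ 2)) = t ^ 2 * (ε * g w.2 + 2 * w.1 ^ 2) := by
      linear_combination 2 * t ^ 2 * w.1 ^ 2 * hε
    rw [e2]
    refine mul_pos (by positivity) ?_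
    rcases eq_or_ne w.2 0 with h0 | h0
    · have h1 : w.1 ≠ 0 := fun h1 => hw (Prod.ext h1 h0)
      rw [h0]
      simp only [ZeroMemClass.coe_zero, map_zero, mul_zero, zero_add]
      positivity
    · have := hW w.2 h0
      positivity
  obtain ⟨W, hW, hWp⟩ := exists_finrank_eq_sigPos_and_posDef g
  obtain ⟨W', hW', hWn⟩ := exists_finrank_eq_sigNeg_and_negDef g
  have h1 := hge 1 W (by norm_num) fun w hw => by rw [one_mul]; exact hWp w hw
  have h2 := hge (-1) W' (by norm_num) fun w hw => by rw [neg_one_mul]; exact hWn w hw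
  rw [one_smul, hW, (r.signature x).pos] at h1
  rw [show (-1 : ℝ) • toQuadraticMap B = -toQuadraticMap B by
    ext v; simp, sigPos_neg, hW', (r.signature x).neg] at h2
  have h3 := QuadraticForm.sigPos_add_sigNeg_add_radical (Q := toQuadraticMap B)
  refine ⟨fun v w => ?_, hfr, by omega, by omega⟩
  rw [h, h, (r.signature x).symm]
  ring

variable [IsManifold 𝓘(ℝ, Model n) ∞ M]

theorem IsFormalWeylAmbient.hasSignature {d : ℝ} {D : Set (ℝ × M × ℝ)} {G : AmbForm ℝ n M}
    {f : ℝ × M × ℝ → ℝ} (h : IsFormalWeylAmbient r d D G f) (hN : IsWeylNormal r A D G)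
    {z : ℝ × M × ℝ} (hz : z ∈ D) : HasSignature (G z) (p + 1) (q + 1) := by
  obtain ⟨t, x, ρ⟩ := z
  have ht : 0 < t := h.domain.pos _ hz
  have hmem : ∀ s : unitInterval, (t, x, (s : ℝ) * ρ) ∈ D := fun s => by
    have h1 := (hN.interval t ht x).uIcc_subset (h.domain.zero_mem t ht x) hz
    refine h1 ?_
    rw [← segment_eq_uIcc]
    exact ⟨1 - s, s, by linarith [s.2.2], s.2.1, by ring, by simp⟩
  set B : unitInterval → (ℝ × Tan n x × ℝ) →ₗ[ℝ] (ℝ × Tan n x × ℝ) →ₗ[ℝ] ℝ := fun s =>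
    G (t, x, (s : ℝ) * ρ)
  obtain ⟨φ, hφ, y, hy, hxy⟩ : ∃ φ ∈ charts n M, ∃ y ∈ φ.target, φ.symm y = x :=
    ⟨chartAt _ x, chartAt_mem_charts x, chartAt _ x x, mem_chart_target _ x,
      (chartAt _ x).left_inv (mem_chart_source _ x)⟩
  subst hxy
  have hcd : ∀ s : unitInterval, ((t, y, (s : ℝ) * ρ) : Coord n) ∈ chartDomain φ D := fun s =>
    ⟨hy, hmem s⟩
  set b : Module.Basis (Idx n) ℝ (ℝ × Tan n (φ.symm y) × ℝ) := ambBasis hφ (z := (t, y, 0)) hy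
  have hb : ∀ s I J, B s (b I) (b J) = comps φ G (t, y, (s : ℝ) * ρ) I J := fun s I J => by
    simp only [b]
    rw [show ambBasis hφ (z := (t, y, 0)) hy = ambBasis hφ (z := (t, y, (s : ℝ) * ρ)) hy from rfl]
    exact congrArg₂ (fun v w => G (ambPoint φ (t, y, (s : ℝ) * ρ)) v w)
      (ambBasis_apply hφ hy I) (ambBasis_apply hφ hy J)
  have hcont : ∀ v w, Continuous fun s => B s v w := fun v w => by
    have e : ∀ s, B s v w = ∑ I, ∑ J, b.repr v I * (b.repr w J * B s (b I) (b J)) := fun s => by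
      conv_lhs => rw [← b.sum_repr v, ← b.sum_repr w]
      simp only [map_sum, LinearMap.sum_apply, map_smul, LinearMap.smul_apply, smul_eq_mul,
        mul_sum]
      exact sum_swap fun _ _ => by ring
    simp only [e, hb]
    refine continuous_finsetSum _ fun I _ => continuous_finsetSum _ fun J _ =>
      continuous_const.mul (continuous_const.mul ?_)
    exact (h.smooth φ hφ I J).continuousOn.comp_continuous (by fun_prop) hcd
  have hnd : ∀ s v, (∀ w, B s v w = 0) → v = 0 := fun s v hv => by
    have hdet := h.nondegenerate φ hφ _ (hcd s)
    by_contra hne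
    refine hdet (Matrix.exists_vecMul_eq_zero_iff.mp ⟨b.equivFun v, by simpa using hne, ?_⟩)
    funext J
    have h1 := hv (b J)
    conv_lhs at h1 => rw [← b.sum_repr v]
    simp only [map_sum, LinearMap.sum_apply, map_smul, LinearMap.smul_apply, smul_eq_mul, hb] at h1
    exact h1
  have h0 : HasSignature (B 0) (p + 1) (q + 1) := by
    have h1 : ∀ ρ' : ℝ, ρ' = 0 → HasSignature (G (t, φ.symm y, ρ')) (p + 1) (q + 1) := by
      rintro _ rfl
      refine hasSignature_initial (r := r) ht fun v w => ?_
      simpa only [RCLike.ofReal_real_eq_id, id] using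
        hN.initial t ht _ v.1 w.1 v.2.2 w.2.2 v.2.1 w.2.1
    exact h1 _ (zero_mul ρ)
  have := h0.of_family hcont (fun s => h.symm _ (hmem s)) hnd 1
  have h1 : ∀ ρ' : ℝ, ρ' = ρ → HasSignature (G (t, φ.symm y, ρ')) (p + 1) (q + 1) →
      HasSignature (G (t, φ.symm y, ρ)) (p + 1) (q + 1) := by rintro _ rfl h; exact h
  exact h1 _ (one_mul ρ) this

theorem IsFormalWeylAmbient.isWeylAmbient {D : Set (ℝ × M × ℝ)} {G : AmbForm ℝ n M}
    {f : ℝ × M × ℝ → ℝ} (h : IsFormalWeylAmbient r (n : ℝ) D G f) (hN : IsWeylNormal r A D G) :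
    IsWeylAmbient r D G where
  domain := h.domain
  tautological := h.tautological
  smooth := h.smooth
  signature _ hz := h.hasSignature hN hz
  homogeneous := h.homogeneous
  ricciFlat φ hφ t ht y hy I J := by
    have := h.ricciFlat φ hφ t ht y hy I J
    rwa [formalRicci_natCast] at this

end Ambient

end

end WeylAmbient

end

theorem mainTheorem1 {n p q : ℕ} {M : Type*} [TopologicalSpace M] [T2Space M] [SigmaCompactSpace M]
    [ChartedSpace (WeylAmbient.Model n) M]
    [IsManifold (modelWithCornersSelf ℝ (WeylAmbient.Model n)) ((⊤ : ℕ∞) : WithTop ℕ∞) M]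
    (r : WeylAmbient.WeylRep n M p q) (A : WeylAmbient.Acceleration n M) :
    -- the dimension `n` of `M` itself, when it is odd and at least `3`
    (Odd n → 3 ≤ n →
      (∃ (D : Set (ℝ × M × ℝ)) (G : WeylAmbient.AmbForm ℝ n M),
        WeylAmbient.IsWeylAmbient r D G ∧ WeylAmbient.IsWeylNormal r A D G) ∧
      (∀ (D₁ D₂ : Set (ℝ × M × ℝ)) (G₁ G₂ : WeylAmbient.AmbForm ℝ n M),
        WeylAmbient.IsWeylAmbient r D₁ G₁ → WeylAmbient.IsWeylNormal r A D₁ G₁ →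
        WeylAmbient.IsWeylAmbient r D₂ G₂ → WeylAmbient.IsWeylNormal r A D₂ G₂ →
        WeylAmbient.AgreeToInfiniteOrder G₁ G₂)) ∧
    -- a formal real or complex dimension `d`, with `M` of any dimension
    (∀ (𝕜 : Type) [RCLike 𝕜] (d : 𝕜), d ≠ 1 → (∀ m : ℕ, d ≠ 2 * m) →
      (∃ (D : Set (ℝ × M × ℝ)) (G : WeylAmbient.AmbForm 𝕜 n M) (f : ℝ × M × ℝ → 𝕜),
        WeylAmbient.IsFormalWeylAmbient r d D G f ∧ WeylAmbient.IsWeylNormal r A D G) ∧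
      (∀ (D₁ D₂ : Set (ℝ × M × ℝ)) (G₁ G₂ : WeylAmbient.AmbForm 𝕜 n M) (f₁ f₂ : ℝ × M × ℝ → 𝕜),
        WeylAmbient.IsFormalWeylAmbient r d D₁ G₁ f₁ → WeylAmbient.IsWeylNormal r A D₁ G₁ →
        WeylAmbient.IsFormalWeylAmbient r d D₂ G₂ f₂ → WeylAmbient.IsWeylNormal r A D₂ G₂ →
        WeylAmbient.AgreeToInfiniteOrder G₁ G₂ ∧
          WeylAmbient.AgreeToInfiniteOrderFlat (n := n) f₁ f₂)) := by
  refine ⟨fun hn hn3 => ⟨?_, fun D₁ D₂ G₁ G₂ h₁ hN₁ h₂ hN₂ =>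
    WeylAmbient.agree_of_ambient hn hn3 h₁ hN₁ h₂ hN₂⟩, fun 𝕜 _ d hd1 hd =>
    ⟨WeylAmbient.exists_formalAmbient r A hd1 hd, fun D₁ D₂ G₁ G₂ f₁ f₂ h₁ hN₁ h₂ hN₂ =>
      WeylAmbient.agree_of_formal hd1 hd h₁ hN₁ h₂ hN₂⟩⟩
  obtain ⟨D, G, f, h, hN⟩ := WeylAmbient.exists_formalAmbient r A (d := (n : ℝ))
    (by exact_mod_cast (by omega : n ≠ 1)) fun m hm => by
      obtain ⟨k, rfl⟩ := hn
      have : 2 * k + 1 = 2 * m := by exact_mod_cast hm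
      omega
  exact ⟨D, G, h.isWeylAmbient hN, hN⟩
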